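/- **Notation.** All function spaces below are spaces of complex-valued functions or functionals. $\mathcal S_{1/2}(\mathbf R^n)$ is the Gelfand–Shilov space of all $f\in C^\infty(\mathbf R^n)$ such that, for some $h>0$, $\sup_{x,\alpha,\beta}\frac{|x^\beta\partial^\alpha f(x)|}{h^{|\alpha|+|\beta|}(\alpha!\,\beta!)^{1/2}}<\infty$ (with the inductive limit topology in $h$), and $\mathcal S_{1/2}'(\mathbf R^n)$ is its dual. For a fixed window $\Phi\in\mathcal S_{1/2}(\mathbf R^n)\setminus\{0\}$ let $$V_\Phi f(x,\xi)=(2\pi)^{-n/2}\langle f,\overline{\Phi(\cdot-x)}\,e^{-i\langle\cdot,\xi\rangle}\rangle ,\qquad f\in\mathcal S_{1/2}'(\mathbf R^n).$$ $\mathscr P_E(\mathbf R^{m})$ is the set of all $0<\omega\in L^\infty_{loc}(\mathbf R^m)$ for which there are $0<v\in L^\infty_{loc}(\mathbf R^m)$ and $C>0$ with $\omega(x+y)\le C\omega(x)v(y)$ for all $x,y$. For $p\in(0,\infty]$ and $\omega\in\mathscr P_E(\mathbf R^{2n})$, the modulation space $M^p_{(\omega)}(\mathbf R^n)$ consists of all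 $f\in\mathcal S_{1/2}'(\mathbf R^n)$ with $\|f\|_{M^p_{(\omega)}}=\|V_\Phi f\cdot\omega\|_{L^p(\mathbf R^{2n})}<\infty$. The conjugate exponent is $p'=\infty$ if $p\le1$, $p'=p/(p-1)$ if $1<p<\infty$, and $p'=1$ if $p=\infty$. For $K,L\in\mathcal S_{1/2}(\mathbf R^{2d})$ let $(K\circ L)(x,z)=\int_{\mathbf R^d}K(x,y)L(y,z)\,dy$. For $K,L,C\in\mathcal S_{1/2}'(\mathbf R^{2d})$ we say that $K\circ L$ is defined and equal to $C$ if for every $\varphi\in\mathcal S_{1/2}(\mathbf R^d)$ with $\|\varphi\|_{L^2}=1$ and all $f,g\in\mathcal S_{1/2}(\mathbf R^d)$, with $\varphi_{y,\eta}(t)=e^{i\langle t,\eta\rangle}\varphi(t-y)$, $$\langle C,g\otimes f\rangle=(2\pi)^{-d}\iint_{\mathbf R^{2d}}\langle K,g\otimes\varphi_{y,\eta}\rangle\,\langle L,\overline{\varphi_{y,\eta}}\otimes f\rangle\,dy\,d\eta$$ with absolutely convergent integral (that is, the operators with kernels $K$ and $L$ can be composed, and the composition has kernel $C$). **Proposition.**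 Let $N\ge3$ be odd, let $p\in(0,\infty]$, and let $\omega_j\in\mathscr P_E(\mathbf R^{4d})$, $j=0,1,\dots,N$, be such that $$\inf_{x_j,\xi_j\in\mathbf R^d}\Big(\omega_0(x_0,x_N,\xi_0,-\xi_N)\prod_{j=1}^N\omega_j(x_{j-1},x_j,\xi_{j-1},-\xi_j)\Big)>0 .$$ Then the following is true. (1) If $p_1=p_N=p$, $p_j=\max(1,p)$ when $j\in[3,N-2]$ is odd, and $p_j=p'$ when $j$ is even, then the map $$(K_1,\dots,K_N)\mapsto K_1\circ\cdots\circ K_N\qquad(*)$$ from $\mathcal S_{1/2}(\mathbf R^{2d})\times\cdots\times\mathcal S_{1/2}(\mathbf R^{2d})$ to $\mathcal S_{1/2}(\mathbf R^{2d})$ extends uniquely to a continuous, multilinear and associative map from $M^{p_1}_{(\omega_1)}(\mathbf R^{2d})\times\cdots\times M^{p_N}_{(\omega_N)}(\mathbf R^{2d})$ to $M^{p}_{(1/\omega_0)}(\mathbf R^{2d})$, and there is a constant $C$ such that $$\|K_1\circ\cdots\circ K_N\|_{M^p_{(1/\omega_0)}}\le C\prod_{j=1}^N\|K_j\|_{M^{p_j}_{(\omega_j)}},\qquad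 K_j\in M^{p_j}_{(\omega_j)}(\mathbf R^{2d}),\ j=1,\dots,N.$$ (2) If $p_j=p$ when $j$ is even and $p_j=p'$ when $j$ is odd, then the map $(*)$ extends uniquely to a continuous, multilinear and associative map from $M^{p_1}_{(\omega_1)}(\mathbf R^{2d})\times\cdots\times M^{p_N}_{(\omega_N)}(\mathbf R^{2d})$ to $M^{p'}_{(1/\omega_0)}(\mathbf R^{2d})$. Here *continuous* means: (a) continuous with respect to the (quasi-)norms, and (b) if the factors with $p_j<\infty$ are fixed in $\mathcal S_{1/2}(\mathbf R^{2d})$, and each factor with $p_j=\infty$ runs through a sequence that is bounded in $M^{\infty}_{(\omega_j)}$ and converges in $\mathcal S_{1/2}'$ to an element of $M^\infty_{(\omega_j)}$, then the values of the map converge in $\mathcal S_{1/2}'$ to its value at the limits. (Condition (b) is void if all $p_j<\infty$.) *Uniquely* means that there is exactly one map, multilinear or not, that agrees with $(*)$ on $\mathcal S_{1/2}(\mathbf R^{2d})^N$ and is continuous in this sense. *Associative* means that for all $K_j\in M^{p_j}_{(\omega_j)}(\mathbf R^{2d})$ there are $C_{k,l}\in\mathcal S_{1/2}'(\mathbf R^{2d})$,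 $1\le k\le l\le N$, (the subproducts $K_k\circ\cdots\circ K_l$) such that $C_{j,j}=K_j$, $C_{1,N}=K_1\circ\cdots\circ K_N$ is the value of the extended map, and $C_{k,m}\circ C_{m+1,l}$ is defined and equal to $C_{k,l}$ whenever $1\le k\le m<l\le N$. -/

import Mathlib

open MeasureTheory Filter Topology
open scoped ENNReal NNReal ComplexConjugate

noncomputable section

/-! ### Gelfand-Shilov space of order `1/2` and its dual -/

section GelfandShilov

variable {V : Type*} [NormedAddCommGroup V] [InnerProductSpace ℝ V]

section TestFunctions

open scoped Nat ContDiff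

/-- `f` has Gelfand-Shilov norm of order `1/2` and parameter `h` at most `B`:
`|x|^m |D^n f(x)| ≤ B h^(m+n) (m!)^(1/2) (n!)^(1/2)` for all `m`, `n`, `x`. In coordinates, replacing
`|x|^m |D^n f(x)|` and `m! n!` by `|x^β ∂^α f(x)|` and `α! β!` (all multi-indices) only changes `h`
by a dimensional factor, so it leads to the same space with the same topology. -/
def GSBound (h B : ℝ) (f : V → ℂ) : Prop :=
  ∀ (m n : ℕ) (x : V),
    ‖x‖ ^ m * ‖iteratedFDeriv ℝ n f x‖ ≤ B * h ^ (m + n) * √((m ! : ℝ) * (n ! : ℝ))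

/-- Membership in the Gelfand-Shilov space `S_{1/2}(V)`: smooth, with finite norm for some `h`. -/
def MemGS (f : V → ℂ) : Prop :=
  ContDiff ℝ ∞ f ∧ ∃ h B : ℝ, 0 < h ∧ GSBound h B f

theorem GSBound.nonneg {h B : ℝ} {f : V → ℂ} (hf : GSBound h B f) : 0 ≤ B := by
  have := hf 0 0 0
  simp only [pow_zero, one_mul, add_zero, mul_one, Nat.factorial_zero, Nat.cast_one,
    Real.sqrt_one] at this
  exact (norm_nonneg _).trans this

theorem GSBound.mono {h h' B : ℝ} {f : V → ℂ} (hf : GSBound h B f) (h0 : 0 < h) (hh : h ≤ h') :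
    GSBound h' B f := by
  intro m n x
  refine (hf m n x).trans ?_
  have := hf.nonneg
  gcongr

theorem MemGS.add {f g : V → ℂ} (hf : MemGS f) (hg : MemGS g) : MemGS (f + g) := by
  obtain ⟨hf, h₁, B₁, h1, b1⟩ := hf
  obtain ⟨hg, h₂, B₂, h2, b2⟩ := hg
  refine ⟨hf.add hg, max h₁ h₂, B₁ + B₂, lt_max_of_lt_left h1, fun m n x => ?_⟩
  have e := iteratedFDeriv_add_apply (𝕜 := ℝ) (i := n) (x := x)
    (hf.contDiffAt.of_le (by exact_mod_cast le_top)) (hg.contDiffAt.of_le (by exact_mod_cast le_top))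
  have b1' := b1.mono h1 (le_max_left h₁ h₂) m n x
  have b2' := b2.mono h2 (le_max_right h₁ h₂) m n x
  rw [e]
  calc ‖x‖ ^ m * ‖iteratedFDeriv ℝ n f x + iteratedFDeriv ℝ n g x‖
      ≤ ‖x‖ ^ m * (‖iteratedFDeriv ℝ n f x‖ + ‖iteratedFDeriv ℝ n g x‖) := by
        gcongr; exact norm_add_le _ _
    _ ≤ _ := by linarith

theorem MemGS.const_smul {f : V → ℂ} (hf : MemGS f) (c : ℂ) : MemGS (c • f) := by
  obtain ⟨hf, h, B, h1, b⟩ := hf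
  refine ⟨hf.const_smul c, h, ‖c‖ * B, h1, fun m n x => ?_⟩
  have e := iteratedFDeriv_const_smul_apply (𝕜 := ℝ) (i := n) (x := x) (a := c)
    (hf.contDiffAt.of_le (by exact_mod_cast le_top))
  rw [e, norm_smul]
  have := mul_le_mul_of_nonneg_left (b m n x) (norm_nonneg c)
  linarith

theorem MemGS.zero : MemGS (0 : V → ℂ) :=
  ⟨contDiff_const, 1, 0, one_pos, fun m n x => by simp⟩

/-- A smooth function whose derivatives grow at most geometrically multiplies `S_{1/2}`. -/
theorem MemGS.mul_of_bound {f e : V → ℂ} (hf : MemGS f) (he : ContDiff ℝ ∞ e) (r : ℝ)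
    (hb : ∀ n x, ‖iteratedFDeriv ℝ n e x‖ ≤ r ^ n) : MemGS (fun x => e x * f x) := by
  obtain ⟨hf, h, B, h1, b⟩ := hf
  have hB := b.nonneg
  set k := max h 1 with hk
  have hk1 : 1 ≤ k := le_max_right _ _
  have b' := b.mono h1 (le_max_left h 1)
  refine ⟨he.mul hf, 2 * k, B * √(Real.exp (r ^ 2)), by positivity, fun m n x => ?_⟩
  have key := norm_iteratedFDeriv_mul_le (𝕜 := ℝ) (A := ℂ) he hf x (n := n)
    (by exact_mod_cast le_top)
  have hri : ∀ i : ℕ, r ^ i ≤ √(Real.exp (r ^ 2)) * √(i ! : ℝ) := by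
    intro i
    rw [← Real.sqrt_mul (Real.exp_pos _).le]
    apply Real.le_sqrt_of_sq_le
    have := Real.pow_div_factorial_le_exp (r ^ 2) (by positivity) i
    rw [div_le_iff₀ (by positivity)] at this
    calc (r ^ i) ^ 2 = (r ^ 2) ^ i := by ring
      _ ≤ _ := this
  have hterm : ∀ i ∈ Finset.range (n + 1),
      ‖x‖ ^ m * ((n.choose i : ℝ) * ‖iteratedFDeriv ℝ i e x‖ * ‖iteratedFDeriv ℝ (n - i) f x‖)
        ≤ (n.choose i : ℝ) * (B * √(Real.exp (r ^ 2)) * k ^ (m + n) * √((m ! : ℝ) * (n ! : ℝ))) := by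
    intro i hi
    have hin : i ≤ n := Nat.lt_succ_iff.mp (Finset.mem_range.mp hi)
    have h2 := b' m (n - i) x
    have hfac : (i ! : ℝ) * ((n - i)! : ℝ) ≤ (n ! : ℝ) := by
      have := Nat.le_of_dvd (Nat.factorial_pos _) (Nat.factorial_mul_factorial_dvd_factorial hin)
      exact_mod_cast this
    calc ‖x‖ ^ m * ((n.choose i : ℝ) * ‖iteratedFDeriv ℝ i e x‖ * ‖iteratedFDeriv ℝ (n - i) f x‖)
        = (n.choose i : ℝ) * (‖iteratedFDeriv ℝ i e x‖ *
            (‖x‖ ^ m * ‖iteratedFDeriv ℝ (n - i) f x‖)) := by ring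
      _ ≤ (n.choose i : ℝ) * ((√(Real.exp (r ^ 2)) * √(i ! : ℝ)) *
            (B * k ^ (m + (n - i)) * √((m ! : ℝ) * ((n - i)! : ℝ)))) := by
          gcongr
          exact (hb i x).trans (hri i)
      _ = (n.choose i : ℝ) * (B * √(Real.exp (r ^ 2)) * k ^ (m + (n - i)) *
            √((m ! : ℝ) * ((i ! : ℝ) * ((n - i)! : ℝ)))) := by
          rw [Real.sqrt_mul (by positivity), Real.sqrt_mul (by positivity),
            Real.sqrt_mul (by positivity)]
          ring
      _ ≤ _ := by
          gcongr
          omega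
  calc ‖x‖ ^ m * ‖iteratedFDeriv ℝ n (fun x => e x * f x) x‖
      ≤ ‖x‖ ^ m * ∑ i ∈ Finset.range (n + 1),
          (n.choose i : ℝ) * ‖iteratedFDeriv ℝ i e x‖ * ‖iteratedFDeriv ℝ (n - i) f x‖ := by
        gcongr
    _ ≤ ∑ i ∈ Finset.range (n + 1),
          (n.choose i : ℝ) * (B * √(Real.exp (r ^ 2)) * k ^ (m + n) * √((m ! : ℝ) * (n ! : ℝ))) := by
        rw [Finset.mul_sum]
        exact Finset.sum_le_sum hterm
    _ = 2 ^ n * (B * √(Real.exp (r ^ 2)) * k ^ (m + n) * √((m ! : ℝ) * (n ! : ℝ))) := by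
        rw [← Finset.sum_mul]
        congr 1
        exact_mod_cast Nat.sum_range_choose n
    _ ≤ 2 ^ (m + n) * (B * √(Real.exp (r ^ 2)) * k ^ (m + n) * √((m ! : ℝ) * (n ! : ℝ))) := by
        gcongr
        · norm_num
        · omega
    _ = _ := by rw [mul_pow]; ring

theorem norm_iteratedFDeriv_character_le (ξ : V) (n : ℕ) (x : V) :
    ‖iteratedFDeriv ℝ n (fun t : V => Complex.exp (Complex.I * ((inner ℝ t ξ : ℝ) : ℂ))) x‖
      ≤ ‖ξ‖ ^ n := by
  have hg : ContDiff ℝ ∞ (fun s : ℝ => Complex.exp (Complex.I * (s : ℂ))) :=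
    (contDiff_const.mul Complex.ofRealCLM.contDiff).cexp
  have e : (fun t : V => Complex.exp (Complex.I * ((inner ℝ t ξ : ℝ) : ℂ)))
      = (fun s : ℝ => Complex.exp (Complex.I * (s : ℂ))) ∘ (innerSL ℝ ξ) := by
    funext t
    simp [real_inner_comm]
  have hd : ∀ n : ℕ, iteratedDeriv n (fun s : ℝ => Complex.exp (Complex.I * (s : ℂ)))
      = fun s : ℝ => Complex.I ^ n * Complex.exp (Complex.I * (s : ℂ)) := by
    intro n
    induction n with
    | zero => simp
    | succ k ih =>
      rw [iteratedDeriv_succ, ih]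
      funext s
      have h1 : HasDerivAt (fun s : ℝ => Complex.I * (s : ℂ)) (Complex.I * 1) s :=
        (Complex.ofRealCLM.hasDerivAt (x := s)).const_mul Complex.I
      have := (h1.cexp.const_mul (Complex.I ^ k)).deriv
      rw [this]
      ring
  rw [e, ContinuousLinearMap.iteratedFDeriv_comp_right (innerSL ℝ ξ) hg x
    (by exact_mod_cast le_top)]
  refine (ContinuousMultilinearMap.norm_compContinuousLinearMap_le _ _).trans ?_
  rw [norm_iteratedFDeriv_eq_norm_iteratedDeriv, hd]
  simp [Complex.norm_exp]

theorem MemGS.comp_sub {f : V → ℂ} (hf : MemGS f) (a : V) : MemGS (fun t => f (t - a)) := by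
  obtain ⟨hf, h, B, h1, b⟩ := hf
  have hB := b.nonneg
  set k := max h 1 with hk
  have hk1 : 1 ≤ k := le_max_right _ _
  have b' := b.mono h1 (le_max_left h 1)
  refine ⟨hf.comp (contDiff_id.sub contDiff_const), 2 * k, B * (1 + √(Real.exp (‖a‖ ^ 2))),
    by positivity, fun m n x => ?_⟩
  rw [iteratedFDeriv_comp_sub]
  have ha : ‖a‖ ^ m ≤ √(Real.exp (‖a‖ ^ 2)) * √(m ! : ℝ) := by
    rw [← Real.sqrt_mul (Real.exp_pos _).le]
    apply Real.le_sqrt_of_sq_le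
    have := Real.pow_div_factorial_le_exp (‖a‖ ^ 2) (by positivity) m
    rw [div_le_iff₀ (by positivity)] at this
    calc (‖a‖ ^ m) ^ 2 = (‖a‖ ^ 2) ^ m := by ring
      _ ≤ _ := this
  have hx : ‖x‖ ^ m ≤ 2 ^ m * (‖x - a‖ ^ m + ‖a‖ ^ m) := by
    have h0 : ‖x‖ ≤ ‖x - a‖ + ‖a‖ := by simpa using norm_add_le (x - a) a
    calc ‖x‖ ^ m ≤ (‖x - a‖ + ‖a‖) ^ m := by gcongr
      _ ≤ 2 ^ (m - 1) * (‖x - a‖ ^ m + ‖a‖ ^ m) := add_pow_le (norm_nonneg _) (norm_nonneg _) m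
      _ ≤ _ := by
        gcongr
        · norm_num
        · omega
  have c1 := b' m n (x - a)
  have c2 : ‖a‖ ^ m * ‖iteratedFDeriv ℝ n f (x - a)‖
      ≤ B * √(Real.exp (‖a‖ ^ 2)) * k ^ (m + n) * √((m ! : ℝ) * (n ! : ℝ)) := by
    have c3 := b' 0 n (x - a)
    simp only [pow_zero, one_mul, zero_add, Nat.factorial_zero, Nat.cast_one] at c3
    calc ‖a‖ ^ m * ‖iteratedFDeriv ℝ n f (x - a)‖
        ≤ (√(Real.exp (‖a‖ ^ 2)) * √(m ! : ℝ)) * (B * k ^ n * √(n ! : ℝ)) := by gcongr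
      _ = B * √(Real.exp (‖a‖ ^ 2)) * k ^ n * √((m ! : ℝ) * (n ! : ℝ)) := by
          rw [Real.sqrt_mul (by positivity) (n ! : ℝ)]
          ring
      _ ≤ _ := by
          gcongr
          omega
  calc ‖x‖ ^ m * ‖iteratedFDeriv ℝ n f (x - a)‖
      ≤ 2 ^ m * (‖x - a‖ ^ m + ‖a‖ ^ m) * ‖iteratedFDeriv ℝ n f (x - a)‖ := by gcongr
    _ = 2 ^ m * (‖x - a‖ ^ m * ‖iteratedFDeriv ℝ n f (x - a)‖
          + ‖a‖ ^ m * ‖iteratedFDeriv ℝ n f (x - a)‖) := by ring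
    _ ≤ 2 ^ m * (B * k ^ (m + n) * √((m ! : ℝ) * (n ! : ℝ))
          + B * √(Real.exp (‖a‖ ^ 2)) * k ^ (m + n) * √((m ! : ℝ) * (n ! : ℝ))) := by gcongr
    _ ≤ 2 ^ (m + n) * (B * k ^ (m + n) * √((m ! : ℝ) * (n ! : ℝ))
          + B * √(Real.exp (‖a‖ ^ 2)) * k ^ (m + n) * √((m ! : ℝ) * (n ! : ℝ))) := by
        gcongr
        · norm_num
        · omega
    _ = _ := by rw [mul_pow]; ring

theorem MemGS.conj {f : V → ℂ} (hf : MemGS f) : MemGS (fun t => conj (f t)) := by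
  obtain ⟨hf, h, B, h1, b⟩ := hf
  refine ⟨Complex.conjCLE.contDiff.comp hf, h, B, h1, fun m n x => ?_⟩
  have := LinearIsometryEquiv.norm_iteratedFDeriv_comp_left (𝕜 := ℝ) Complex.conjLIE f x n
  exact (congrArg (fun s => ‖x‖ ^ m * s) this).le.trans (b m n x)

end TestFunctions

variable (V) in
/-- The Gelfand-Shilov space `S_{1/2}(V)`. -/
def GelfandShilov : Submodule ℂ (V → ℂ) where
  carrier := {f | MemGS f}
  add_mem' := MemGS.add
  zero_mem' := MemGS.zero
  smul_mem' c _ hf := hf.const_smul c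

variable (V) in
/-- The dual `S_{1/2}'(V)` (linear, not antilinear, functionals). `S_{1/2}` is the inductive limit of
the spaces with parameter `h`, so continuity means boundedness on each of these spaces. -/
def GSDist : Submodule ℂ (GelfandShilov V →ₗ[ℂ] ℂ) where
  carrier := {u | ∀ h : ℝ, 0 < h → ∃ C : ℝ, ∀ (f : GelfandShilov V) (B : ℝ),
    GSBound h B (f : V → ℂ) → ‖u f‖ ≤ C * B}
  add_mem' := by
    intro u v hu hv h h0
    obtain ⟨C, hC⟩ := hu h h0
    obtain ⟨D, hD⟩ := hv h h0
    refine ⟨C + D, fun f B hf => ?_⟩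
    have := norm_add_le (u f) (v f)
    have h1 := hC f B hf
    have h2 := hD f B hf
    rw [LinearMap.add_apply]
    linarith
  zero_mem' := fun h _ => ⟨0, fun f B _ => by simp⟩
  smul_mem' := by
    intro c u hu h h0
    obtain ⟨C, hC⟩ := hu h h0
    refine ⟨‖c‖ * C, fun f B hf => ?_⟩
    rw [LinearMap.smul_apply, norm_smul, mul_assoc]
    exact mul_le_mul_of_nonneg_left (hC f B hf) (norm_nonneg c)

/-- The time-frequency shift `t ↦ e^{i⟨t,ξ⟩} φ(t - x)`. -/
def tfShift (x ξ : V) (φ : GelfandShilov V) : GelfandShilov V :=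
  ⟨fun t => Complex.exp (Complex.I * ((inner ℝ t ξ : ℝ) : ℂ)) * (φ : V → ℂ) (t - x),
    (MemGS.comp_sub φ.2 x).mul_of_bound
      ((contDiff_const.mul (Complex.ofRealCLM.contDiff.comp
        (contDiff_id.inner ℝ contDiff_const))).cexp) ‖ξ‖
      (norm_iteratedFDeriv_character_le ξ)⟩

/-- The complex conjugate of a test function. -/
def gsConj (φ : GelfandShilov V) : GelfandShilov V :=
  ⟨fun t => conj ((φ : V → ℂ) t), MemGS.conj φ.2⟩

/-- The short-time Fourier transform
`V_φ u (x, ξ) = 𝓕(u · conj(φ(· - x)))(ξ) = (2π)^{-n/2} ⟨u, e^{-i⟨·,ξ⟩} conj(φ(· - x))⟩`,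
where `n = dim V`. -/
def stft (φ : GelfandShilov V) (u : GSDist V) (z : V × V) : ℂ :=
  (((2 * Real.pi) ^ (-(Module.finrank ℝ V : ℝ) / 2) : ℝ) : ℂ) * u.1 (gsConj (tfShift z.1 z.2 φ))

/-- `u_k → u` in `S_{1/2}'`. -/
def GSDistTendsto (u : ℕ → GSDist V) (v : GSDist V) : Prop :=
  ∀ f : GelfandShilov V, Tendsto (fun k => (u k).1 f) atTop (𝓝 (v.1 f))

/-- The distribution `u` is given by integration against the function `f`. -/
def IsGivenBy [FiniteDimensional ℝ V] [MeasurableSpace V] [BorelSpace V]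
    (u : GSDist V) (f : V → ℂ) : Prop :=
  ∀ g : GelfandShilov V, Integrable (fun x => f x * (g : V → ℂ) x) ∧
    u.1 g = ∫ x, f x * (g : V → ℂ) x

end GelfandShilov

/-! ### Weights and modulation spaces -/

/-- The class `𝒫_E` of moderate weights: positive, in `L^∞_loc`, and
`ω(x + y) ≤ C ω(x) v(y)` for some positive `v` in `L^∞_loc`. -/
structure IsModerateWeight {E : Type*} [AddGroup E] [TopologicalSpace E] [MeasureSpace E]
    (ω : E → ℝ) : Prop where
  pos : ∀ x, 0 < ω x
  locBdd : ∀ s : Set E, IsCompact s → MemLp ω ∞ (volume.restrict s)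
  moderate : ∃ v : E → ℝ, (∀ x, 0 < v x) ∧
    (∀ s : Set E, IsCompact s → MemLp v ∞ (volume.restrict s)) ∧
    ∃ C : ℝ, 0 < C ∧ ∀ x y, ω (x + y) ≤ C * ω x * v y

section Modulation

variable {V : Type*} [NormedAddCommGroup V] [InnerProductSpace ℝ V] [FiniteDimensional ℝ V]
  [MeasurableSpace V] [BorelSpace V]

/-- The (quasi-)norm of `M^p_{(ω)} = M^{p,p}_{(ω)}` with window `φ`, for `0 < p ≤ ∞`:
the `L^p` (quasi-)norm of `V_φ u · ω` over phase space. -/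
def modNorm (φ : GelfandShilov V) (p : ℝ≥0∞) (ω : V × V → ℝ) (u : GSDist V) : ℝ≥0∞ :=
  eLpNorm (fun z => stft φ u z * (ω z : ℂ)) p volume

/-- The modulation space `M^p_{(ω)}(V)`, as a set of distributions. -/
def modSpace (φ : GelfandShilov V) (p : ℝ≥0∞) (ω : V × V → ℝ) : Set (GSDist V) :=
  {u | modNorm φ p ω u < ∞}

end Modulation

/-! ### Kernels on `ℝ^{2d}` and their compositions -/

/-- `ℝ^d`. -/
abbrev Rd (d : ℕ) : Type := EuclideanSpace ℝ (Fin d)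

/-- `ℝ^{2d} = ℝ^d × ℝ^d` with its Euclidean structure. -/
abbrev R2d (d : ℕ) : Type := WithLp 2 (Rd d × Rd d)

/-- The point `(x, y)` of `ℝ^{2d}`. -/
abbrev pt {d : ℕ} (x y : Rd d) : R2d d := WithLp.toLp 2 (x, y)

/-- Composition of two kernel functions: `(K ∘ L)(x, z) = ∫ K(x, y) L(y, z) dy`. -/
def kernelComp {d : ℕ} (K L : R2d d → ℂ) : R2d d → ℂ :=
  fun w => ∫ y : Rd d, K (pt w.fst y) * L (pt y w.snd)

/-- The composition `K_1 ∘ (K_2 ∘ (⋯ ∘ K_N))` of a non-empty list of kernel functions. -/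
def kernelCompList {d : ℕ} : List (R2d d → ℂ) → (R2d d → ℂ)
  | [] => 0
  | [K] => K
  | K :: L :: l => kernelComp K (kernelCompList (L :: l))

section Tensor

open scoped Nat ContDiff

theorem norm_iteratedFDeriv_comp_le_of_norm_le_one {V W : Type*} [NormedAddCommGroup V]
    [NormedSpace ℝ V] [NormedAddCommGroup W] [NormedSpace ℝ W] {f : W → ℂ} (hf : ContDiff ℝ ∞ f)
    (L : V →L[ℝ] W) (hL : ‖L‖ ≤ 1) (n : ℕ) (x : V) :
    ‖iteratedFDeriv ℝ n (fun x => f (L x)) x‖ ≤ ‖iteratedFDeriv ℝ n f (L x)‖ := by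
  have := ContinuousLinearMap.iteratedFDeriv_comp_right L hf x (i := n) (by exact_mod_cast le_top)
  have e : (fun x => f (L x)) = f ∘ L := rfl
  rw [e, this]
  refine (ContinuousMultilinearMap.norm_compContinuousLinearMap_le _ _).trans ?_
  refine mul_le_of_le_one_right (norm_nonneg _) ?_
  simpa using pow_le_one₀ (norm_nonneg L) hL

theorem MemGS.tensor {d : ℕ} {f g : Rd d → ℂ} (hf : MemGS f) (hg : MemGS g) :
    MemGS (fun w : R2d d => f w.fst * g w.snd) := by
  obtain ⟨hf, h₁, B₁, h1, b1⟩ := hf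
  obtain ⟨hg, h₂, B₂, h2, b2⟩ := hg
  have hB1 := b1.nonneg
  have hB2 := b2.nonneg
  set k := max (max h₁ h₂) 1 with hk
  have hk1 : 1 ≤ k := le_max_right _ _
  have b1 := b1.mono h1 ((le_max_left h₁ h₂).trans (le_max_left _ 1))
  have b2 := b2.mono h2 ((le_max_right h₁ h₂).trans (le_max_left _ 1))
  rw [← hk] at b1 b2
  let P : R2d d →L[ℝ] Rd d := WithLp.fstL 2 ℝ (Rd d) (Rd d)
  let Q : R2d d →L[ℝ] Rd d := WithLp.sndL 2 ℝ (Rd d) (Rd d)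
  have nP : ∀ w : R2d d, ‖w.fst‖ ≤ ‖w‖ := fun w => by
    rw [WithLp.prod_norm_eq_of_L2]
    exact Real.le_sqrt_of_sq_le (by nlinarith [sq_nonneg ‖w.snd‖])
  have nQ : ∀ w : R2d d, ‖w.snd‖ ≤ ‖w‖ := fun w => by
    rw [WithLp.prod_norm_eq_of_L2]
    exact Real.le_sqrt_of_sq_le (by nlinarith [sq_nonneg ‖w.fst‖])
  have hP : ‖P‖ ≤ 1 := P.opNorm_le_bound zero_le_one fun w => by
    rw [one_mul]; exact nP w
  have hQ : ‖Q‖ ≤ 1 := Q.opNorm_le_bound zero_le_one fun w => by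
    rw [one_mul]; exact nQ w
  have cP : ContDiff ℝ ∞ (fun w : R2d d => f w.fst) := hf.comp P.contDiff
  have cQ : ContDiff ℝ ∞ (fun w : R2d d => g w.snd) := hg.comp Q.contDiff
  refine ⟨cP.mul cQ, 4 * k, 2 * (B₁ * B₂), by positivity, fun m n w => ?_⟩
  have key := norm_iteratedFDeriv_mul_le (𝕜 := ℝ) (A := ℂ) cP cQ w (n := n)
    (by exact_mod_cast le_top)
  have hw : ‖w‖ ^ m ≤ 2 ^ m * (‖w.fst‖ ^ m + ‖w.snd‖ ^ m) := by
    have h0 : ‖w‖ ≤ ‖w.fst‖ + ‖w.snd‖ := by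
      rw [WithLp.prod_norm_eq_of_L2]
      refine Real.sqrt_le_iff.mpr ⟨by positivity, ?_⟩
      nlinarith [mul_nonneg (norm_nonneg w.fst) (norm_nonneg w.snd)]
    calc ‖w‖ ^ m ≤ (‖w.fst‖ + ‖w.snd‖) ^ m := by gcongr
      _ ≤ 2 ^ (m - 1) * (‖w.fst‖ ^ m + ‖w.snd‖ ^ m) :=
        add_pow_le (norm_nonneg _) (norm_nonneg _) m
      _ ≤ _ := by
        gcongr
        · norm_num
        · omega
  have hterm : ∀ i ∈ Finset.range (n + 1),
      ‖w‖ ^ m * ((n.choose i : ℝ) * ‖iteratedFDeriv ℝ i (fun w : R2d d => f w.fst) w‖ *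
          ‖iteratedFDeriv ℝ (n - i) (fun w : R2d d => g w.snd) w‖)
        ≤ (n.choose i : ℝ) * (2 ^ m * (2 * (B₁ * B₂) * k ^ (m + n) *
            √((m ! : ℝ) * (n ! : ℝ)))) := by
    intro i hi
    have hin : i ≤ n := Nat.lt_succ_iff.mp (Finset.mem_range.mp hi)
    have hfac : (i ! : ℝ) * ((n - i)! : ℝ) ≤ (n ! : ℝ) := by
      have := Nat.le_of_dvd (Nat.factorial_pos _) (Nat.factorial_mul_factorial_dvd_factorial hin)
      exact_mod_cast this
    have hs : √(i ! : ℝ) * √((n - i)! : ℝ) ≤ √(n ! : ℝ) := by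
      rw [← Real.sqrt_mul (by positivity)]
      exact Real.sqrt_le_sqrt hfac
    have a1 : ‖iteratedFDeriv ℝ i (fun w : R2d d => f w.fst) w‖ ≤ ‖iteratedFDeriv ℝ i f w.fst‖ :=
      norm_iteratedFDeriv_comp_le_of_norm_le_one hf P hP i w
    have a2 : ‖iteratedFDeriv ℝ (n - i) (fun w : R2d d => g w.snd) w‖
        ≤ ‖iteratedFDeriv ℝ (n - i) g w.snd‖ :=
      norm_iteratedFDeriv_comp_le_of_norm_le_one hg Q hQ (n - i) w
    have u0 := b1 0 i w.fst
    have um := b1 m i w.fst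
    have v0 := b2 0 (n - i) w.snd
    have vm := b2 m (n - i) w.snd
    simp only [pow_zero, one_mul, zero_add, Nat.factorial_zero, Nat.cast_one] at u0 v0
    rw [Real.sqrt_mul (by positivity)] at um vm
    have hkk : k ^ (m + i) * k ^ (n - i) = k ^ (m + n) := by
      rw [← pow_add]; congr 1; omega
    have hkk' : k ^ i * k ^ (m + (n - i)) = k ^ (m + n) := by
      rw [← pow_add]; congr 1; omega
    have t1 : (‖w.fst‖ ^ m * ‖iteratedFDeriv ℝ i f w.fst‖) * ‖iteratedFDeriv ℝ (n - i) g w.snd‖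
        ≤ B₁ * B₂ * k ^ (m + n) * (√(m ! : ℝ) * √(n ! : ℝ)) := by
      calc _ ≤ (B₁ * k ^ (m + i) * (√(m ! : ℝ) * √(i ! : ℝ))) *
            (B₂ * k ^ (n - i) * √((n - i)! : ℝ)) := by gcongr
        _ = B₁ * B₂ * (k ^ (m + i) * k ^ (n - i)) *
            (√(m ! : ℝ) * (√(i ! : ℝ) * √((n - i)! : ℝ))) := by ring
        _ ≤ _ := by rw [hkk]; gcongr
    have t2 : ‖iteratedFDeriv ℝ i f w.fst‖ * (‖w.snd‖ ^ m * ‖iteratedFDeriv ℝ (n - i) g w.snd‖)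
        ≤ B₁ * B₂ * k ^ (m + n) * (√(m ! : ℝ) * √(n ! : ℝ)) := by
      calc _ ≤ (B₁ * k ^ i * √(i ! : ℝ)) *
            (B₂ * k ^ (m + (n - i)) * (√(m ! : ℝ) * √((n - i)! : ℝ))) := by gcongr
        _ = B₁ * B₂ * (k ^ i * k ^ (m + (n - i))) *
            (√(m ! : ℝ) * (√(i ! : ℝ) * √((n - i)! : ℝ))) := by ring
        _ ≤ _ := by rw [hkk']; gcongr
    calc _ ≤ (2 ^ m * (‖w.fst‖ ^ m + ‖w.snd‖ ^ m)) * ((n.choose i : ℝ) *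
            ‖iteratedFDeriv ℝ i f w.fst‖ * ‖iteratedFDeriv ℝ (n - i) g w.snd‖) := by gcongr
      _ = (n.choose i : ℝ) * (2 ^ m *
            ((‖w.fst‖ ^ m * ‖iteratedFDeriv ℝ i f w.fst‖) * ‖iteratedFDeriv ℝ (n - i) g w.snd‖ +
            ‖iteratedFDeriv ℝ i f w.fst‖ *
              (‖w.snd‖ ^ m * ‖iteratedFDeriv ℝ (n - i) g w.snd‖))) := by ring
      _ ≤ (n.choose i : ℝ) * (2 ^ m * (B₁ * B₂ * k ^ (m + n) * (√(m ! : ℝ) * √(n ! : ℝ)) +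
            B₁ * B₂ * k ^ (m + n) * (√(m ! : ℝ) * √(n ! : ℝ)))) := by gcongr
      _ = _ := by rw [Real.sqrt_mul (by positivity) (n ! : ℝ)]; ring
  calc ‖w‖ ^ m * ‖iteratedFDeriv ℝ n (fun w : R2d d => f w.fst * g w.snd) w‖
      ≤ ‖w‖ ^ m * ∑ i ∈ Finset.range (n + 1),
          (n.choose i : ℝ) * ‖iteratedFDeriv ℝ i (fun w : R2d d => f w.fst) w‖ *
          ‖iteratedFDeriv ℝ (n - i) (fun w : R2d d => g w.snd) w‖ := by
        gcongr
    _ ≤ ∑ i ∈ Finset.range (n + 1), (n.choose i : ℝ) * (2 ^ m * (2 * (B₁ * B₂) * k ^ (m + n) *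
            √((m ! : ℝ) * (n ! : ℝ)))) := by
        rw [Finset.mul_sum]
        exact Finset.sum_le_sum hterm
    _ = 2 ^ (m + n) * (2 * (B₁ * B₂) * k ^ (m + n) * √((m ! : ℝ) * (n ! : ℝ))) := by
        rw [← Finset.sum_mul, pow_add]
        have : (∑ i ∈ Finset.range (n + 1), (n.choose i : ℝ)) = 2 ^ n := by
          exact_mod_cast Nat.sum_range_choose n
        rw [this]; ring
    _ ≤ 4 ^ (m + n) * (2 * (B₁ * B₂) * k ^ (m + n) * √((m ! : ℝ) * (n ! : ℝ))) := by
        gcongr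
        norm_num
    _ = _ := by rw [mul_pow]; ring

end Tensor

/-- The tensor product `(f ⊗ g)(x, y) = f(x) g(y)`. -/
def gsTensor {d : ℕ} (f g : GelfandShilov (Rd d)) : GelfandShilov (R2d d) :=
  ⟨fun w => (f : Rd d → ℂ) w.fst * (g : Rd d → ℂ) w.snd, MemGS.tensor f.2 g.2⟩

/-- `C = K ∘ L` for distribution kernels `K`, `L`, `C` in `S_{1/2}'(ℝ^{2d})`.

Let `T_K : S_{1/2}(ℝ^d) → S_{1/2}'(ℝ^d)` be the operator with kernel `K`, so that
`⟨T_K f, g⟩ = ⟨K, g ⊗ f⟩`. The composition `T_K ∘ T_L` makes sense, with kernel `C`, if inserting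
between `T_K` and `T_L` the resolution of the identity
`Id = (2π)^{-d} ∬ π(y,η)φ ⊗ conj(π(y,η)φ) dy dη`, `π(y,η)φ(t) = e^{i⟨t,η⟩} φ(t - y)`,
gives absolutely convergent integrals equal to `⟨C, g ⊗ f⟩`, for all test functions `f`, `g` and
every window `φ` in `S_{1/2}(ℝ^d)` with `‖φ‖_{L²} = 1`. -/
def IsKernelComp {d : ℕ} (K L C : GSDist (R2d d)) : Prop :=
  ∀ φ : GelfandShilov (Rd d), (∫ t, ‖(φ : Rd d → ℂ) t‖ ^ 2) = 1 →
  ∀ f g : GelfandShilov (Rd d),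
    Integrable (fun z : Rd d × Rd d =>
      K.1 (gsTensor g (tfShift z.1 z.2 φ)) * L.1 (gsTensor (gsConj (tfShift z.1 z.2 φ)) f)) ∧
    C.1 (gsTensor g f) = (((2 * Real.pi) ^ d)⁻¹ : ℝ) *
      ∫ z : Rd d × Rd d,
        K.1 (gsTensor g (tfShift z.1 z.2 φ)) * L.1 (gsTensor (gsConj (tfShift z.1 z.2 φ)) f)

/-! ### Extensions of `(K_1, …, K_N) ↦ K_1 ∘ ⋯ ∘ K_N` to modulation spaces

In this part `j : Fin N` stands for the index `j + 1 ∈ {1, …, N}`. -/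

/-- The conjugate exponent of `p ∈ (0, ∞]`: `∞` if `p ≤ 1`, `1` if `p = ∞`, else `p / (p - 1)`. -/
def conjExp (p : ℝ≥0∞) : ℝ≥0∞ :=
  if p ≤ 1 then ∞ else if p = ∞ then 1 else p / (p - 1)

/-- The weight `(x_{j-1}, ξ_{j-1}), (x_j, ξ_j) ↦ ω(x_{j-1}, x_j, ξ_{j-1}, -ξ_j)`. -/
def kernelWeight {d : ℕ} (ω : R2d d × R2d d → ℝ) (X Y : Rd d × Rd d) : ℝ :=
  ω (pt X.1 Y.1, pt X.2 (-Y.2))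

section Extension

variable {d N : ℕ}

/-- `T` agrees with the composition of kernels when every factor is in `S_{1/2}(ℝ^{2d})`, and this
composition is then in `S_{1/2}(ℝ^{2d})`. -/
def ExtendsKernelComp {M : Fin N → Set (GSDist (R2d d))} {M₀ : Set (GSDist (R2d d))}
    (T : (∀ j, M j) → M₀) : Prop :=
  ∀ (u : ∀ j, M j) (K : Fin N → GelfandShilov (R2d d)),
    (∀ j, IsGivenBy (u j : GSDist (R2d d)) (K j : R2d d → ℂ)) →
    MemGS (kernelCompList (List.ofFn fun j => (K j : R2d d → ℂ))) ∧
    IsGivenBy (T u : GSDist (R2d d)) (kernelCompList (List.ofFn fun j => (K j : R2d d → ℂ)))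

/-- Norm continuity of a map
`M^{q_1}_{(ω_1)} × ⋯ × M^{q_N}_{(ω_N)} → M^{r}_{(ω₀)}`. -/
def IsNormContinuous (Φ : GelfandShilov (R2d d)) (q : Fin N → ℝ≥0∞)
    (ω : Fin N → R2d d × R2d d → ℝ) (r : ℝ≥0∞) (ω₀ : R2d d × R2d d → ℝ)
    (T : (∀ j, modSpace Φ (q j) (ω j)) → modSpace Φ r ω₀) : Prop :=
  ∀ (U : ℕ → ∀ j, modSpace Φ (q j) (ω j)) (u : ∀ j, modSpace Φ (q j) (ω j)),
    (∀ j, Tendsto (fun k => modNorm Φ (q j) (ω j) ((U k j : GSDist (R2d d)) - u j)) atTop (𝓝 0)) →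
    Tendsto (fun k => modNorm Φ r ω₀ ((T (U k) : GSDist (R2d d)) - T u)) atTop (𝓝 0)

/-- Continuity in the factors of exponent `∞`, where `S_{1/2}` is not norm dense: with the factors
of finite exponent fixed in `S_{1/2}(ℝ^{2d})`, norm bounded sequences in the factors of exponent
`∞` which converge in `S_{1/2}'` are mapped to sequences which converge in `S_{1/2}'`. -/
def IsWeaklyContinuousAtInfty (Φ : GelfandShilov (R2d d)) (q : Fin N → ℝ≥0∞)
    (ω : Fin N → R2d d × R2d d → ℝ) (r : ℝ≥0∞) (ω₀ : R2d d × R2d d → ℝ)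
    (T : (∀ j, modSpace Φ (q j) (ω j)) → modSpace Φ r ω₀) : Prop :=
  ∀ (U : ℕ → ∀ j, modSpace Φ (q j) (ω j)) (u : ∀ j, modSpace Φ (q j) (ω j)),
    (∀ j, q j ≠ ∞ → (∀ k, U k j = u j) ∧
      ∃ K : GelfandShilov (R2d d), IsGivenBy (u j : GSDist (R2d d)) (K : R2d d → ℂ)) →
    (∀ j, q j = ∞ → (∃ B : ℝ≥0, ∀ k, modNorm Φ (q j) (ω j) (U k j) ≤ B) ∧
      GSDistTendsto (fun k => (U k j : GSDist (R2d d))) (u j)) →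
    GSDistTendsto (fun k => (T (U k) : GSDist (R2d d))) (T u)

/-- `T` is a continuous extension of the composition of kernels to
`M^{q_1}_{(ω_1)} × ⋯ × M^{q_N}_{(ω_N)} → M^{r}_{(ω₀)}`. -/
structure IsContinuousExtension (Φ : GelfandShilov (R2d d)) (q : Fin N → ℝ≥0∞)
    (ω : Fin N → R2d d × R2d d → ℝ) (r : ℝ≥0∞) (ω₀ : R2d d × R2d d → ℝ)
    (T : (∀ j, modSpace Φ (q j) (ω j)) → modSpace Φ r ω₀) : Prop where
  extend : ExtendsKernelComp T
  norm_continuous : IsNormContinuous Φ q ω r ω₀ T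
  weakly_continuous : IsWeaklyContinuousAtInfty Φ q ω r ω₀ T

/-- Linearity in each factor. -/
def IsMultilinear {M : Fin N → Set (GSDist (R2d d))} {M₀ : Set (GSDist (R2d d))}
    (T : (∀ j, M j) → M₀) : Prop :=
  ∀ (u : ∀ j, M j) (j : Fin N) (a b c : M j) (s t : ℂ),
    (c : GSDist (R2d d)) = s • (a : GSDist (R2d d)) + t • (b : GSDist (R2d d)) →
    (T (Function.update u j c) : GSDist (R2d d)) =
      s • (T (Function.update u j a) : GSDist (R2d d)) +
      t • (T (Function.update u j b) : GSDist (R2d d))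

/-- Associativity: all subproducts `C k l = K_k ∘ ⋯ ∘ K_l` are defined as distributions, `C k l` is
the composition of `C k m` and `C (m+1) l` whenever `k ≤ m < l`, and the full product is
`T(K_1, …, K_N)`. (Here `k`, `m`, `l` run over `{0, …, N - 1}`.) -/
def IsAssociative {M : Fin N → Set (GSDist (R2d d))} {M₀ : Set (GSDist (R2d d))}
    (T : (∀ j, M j) → M₀) : Prop :=
  ∀ u : ∀ j, M j, ∃ C : ℕ → ℕ → GSDist (R2d d),
    (∀ j : Fin N, C j j = u j) ∧ C 0 (N - 1) = T u ∧
    ∀ k m l : ℕ, k ≤ m → m < l → l < N → IsKernelComp (C k m) (C (m + 1) l) (C k l)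

end Extension

end

/-!
Fix a window `φ ∈ S_{1/2}(ℝ^d)` of `L²` norm one. A kernel `K ∈ S_{1/2}'(ℝ^{2d})` is determined by
its matrix `⟨K, conj(φ_X) ⊗ φ_Y⟩` with respect to the time-frequency shifts of `φ`, where `X`, `Y`
are points of the phase space `ℝ^d × ℝ^d` (`tfMatrix`, `kerSynth`, `tfMatrix_expansion`). Up to the
coordinates `phaseMap` this matrix is the short-time Fourier transform of `K` with window
`φ ⊗ conj φ`, so that modulation norms are weighted `L^q` norms of matrices (`IsMatrixWeight`).
By the resolution of the identity, composition of kernels is multiplication of matrices, that is,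
the formation of iterated integrals over phase space (`chain`), and a matrix belongs to a
distribution if it is reproduced on both sides by the Gram matrix of the shifts of `φ`.

The estimates rest on two facts. Firstly, short-time Fourier transforms satisfy a Gaussian
reproducing inequality, hence the least majorant of `V_φ u` which varies at most like `e^{s|z - w|}`
has weighted `L^q` norm bounded by that of `V_φ u`, for every `q ∈ (0, ∞]`
(`exists_eLpNorm_sharp_le`); this needs weights with Lipschitz continuous logarithm, and every
moderate weight is equivalent to one of these (`IsModerateWeight.exists_isLogLip`). For such slowly
varying functions the `L^q` norm with `q < 1` dominates the `L^1` norm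
(`exists_eLpNorm_max_one_le`). Secondly, for exponents whose values `max(1, q_j)` alternate
between conjugate exponents, Hölder's inequality, applied in turn to the intermediate variables,
bounds the `L^r` norm of the iterated integral by the product of the norms of the factors
(`exists_eLpNorm_uncurry_lchain_le`). The lower bound for the product of the weights along closed
paths passes through the iterated integral (`mul_lchain_le`), which gives the weighted estimate
`IsWeightChain.exists_wNorm_lchain_le`.

The estimate holds for the slowly varying majorants. It makes their full iterated integral finite
somewhere, and slow variation then makes all partial iterated integrals finite everywhere
(`IsWeightChain.isMajorant`). So Fubini's theorem and dominated convergence apply: the products of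
matrices are associative and linear in each factor, the partial products are matrices of
distributions (`IsCompositionSetup.tfMatrix_subProduct`) which compose as required
(`isKernelComp_kerSynth`), and bounded convergence in the factors of exponent `∞` gives convergence
of the product. Norm continuity follows from multilinearity and the estimate.

For uniqueness, truncating the matrix of `u` to bounded sets approximates `u` by elements of
`S_{1/2}`, in norm if the exponent is finite and boundedly in `S_{1/2}'` in all cases
(`IsMatrixWeight.exists_approx`). Weak continuity handles the factors of exponent `∞` while the
other ones are test functions; norm continuity then handles the other ones.
-/

noncomputable section

/-! ### Gaussian and exponential bounds -/

section Bounds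

open scoped Nat

theorem sqrt_factorial_two_mul_le (k : ℕ) : √((2 * k)! : ℝ) ≤ 2 ^ k * (k ! : ℝ) := by
  apply Real.sqrt_le_iff.mpr ⟨by positivity, ?_⟩
  have h : (2 * k)! ≤ 4 ^ k * (k ! * k !) := by
    have h1 := Nat.add_choose_mul_factorial_mul_factorial k k
    have h2 : (k + k).choose k ≤ 4 ^ k := by
      rw [← two_mul]
      have := Nat.choose_le_two_pow (2 * k) k
      rw [pow_mul] at this
      exact this
    rw [two_mul, ← h1, mul_assoc]
    exact Nat.mul_le_mul_right _ h2
  have h' : ((2 * k)! : ℝ) ≤ 4 ^ k * (k ! * k !) := by exact_mod_cast h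
  calc ((2 * k)! : ℝ) ≤ 4 ^ k * (k ! * k !) := h'
    _ = (2 ^ k * (k ! : ℝ)) ^ 2 := by
      rw [mul_pow, ← pow_mul, mul_comm k 2, pow_mul]; norm_num; ring

/-- Moment bounds of order `1/2` amount to Gaussian decay. -/
theorem gauss_of_moments {a y h B : ℝ} (ha : 0 ≤ a) (hh : 0 < h)
    (H : ∀ m : ℕ, y ^ m * a ≤ B * h ^ m * √(m ! : ℝ)) :
    a ≤ 2 * B * Real.exp (-((4 * h ^ 2)⁻¹ * y ^ 2)) := by
  have hB : 0 ≤ B := by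
    have := H 0
    simp only [pow_zero, one_mul, mul_one, Nat.factorial_zero, Nat.cast_one, Real.sqrt_one] at this
    exact ha.trans this
  set ρ := (4 * h ^ 2)⁻¹ with hρ
  have e1 : HasSum (fun k : ℕ => (ρ * y ^ 2) ^ k / (k ! : ℝ) * a) (Real.exp (ρ * y ^ 2) * a) := by
    have := NormedSpace.expSeries_div_hasSum_exp (𝔸 := ℝ) (ρ * y ^ 2)
    rw [← Real.exp_eq_exp_ℝ] at this
    exact this.mul_right a
  have e2 : HasSum (fun k : ℕ => B * (1 / 2 : ℝ) ^ k) (B * 2) := by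
    exact hasSum_geometric_two.mul_left B
  have e3 : Real.exp (ρ * y ^ 2) * a ≤ B * 2 := by
    refine hasSum_le (fun k => ?_) e1 e2
    have h1 := H (2 * k)
    have h2 := sqrt_factorial_two_mul_le k
    have h3 : y ^ (2 * k) * a ≤ B * h ^ (2 * k) * (2 ^ k * (k ! : ℝ)) :=
      h1.trans (by gcongr)
    have hk : (0 : ℝ) < k ! := by positivity
    calc (ρ * y ^ 2) ^ k / (k ! : ℝ) * a = ρ ^ k / (k ! : ℝ) * (y ^ (2 * k) * a) := by
          rw [mul_pow, pow_mul]; ring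
      _ ≤ ρ ^ k / (k ! : ℝ) * (B * h ^ (2 * k) * (2 ^ k * (k ! : ℝ))) := by gcongr
      _ = B * (ρ * h ^ 2 * 2) ^ k := by
          rw [mul_pow, mul_pow, pow_mul]; field_simp
      _ = B * (1 / 2 : ℝ) ^ k := by
          congr 2
          rw [hρ]; field_simp; norm_num
  rw [Real.exp_neg]
  have := Real.exp_pos (ρ * y ^ 2)
  rw [← div_eq_mul_inv, le_div_iff₀ this]
  linarith

/-- The converse of `gauss_of_moments`, for the Gaussian `exp (δ y ^ 2)`. -/
theorem pow_le_sqrt_factorial {H : ℝ} (hH : 0 < H) (y : ℝ) (m : ℕ) :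
    y ^ m ≤ H ^ m * √(m ! : ℝ) * Real.exp ((2 * H ^ 2)⁻¹ * y ^ 2) := by
  have h1 := Real.pow_div_factorial_le_exp ((y / H) ^ 2) (by positivity) m
  rw [div_le_iff₀ (by positivity)] at h1
  have h2 : (y / H) ^ m ≤ √(m ! : ℝ) * Real.exp ((2 * H ^ 2)⁻¹ * y ^ 2) := by
    apply le_of_sq_le_sq _ (by positivity)
    rw [mul_pow, Real.sq_sqrt (by positivity), ← Real.exp_nat_mul]
    calc ((y / H) ^ m) ^ 2 = ((y / H) ^ 2) ^ m := by rw [← pow_mul, ← pow_mul, mul_comm]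
      _ ≤ _ := h1
      _ = _ := by
        rw [mul_comm]
        congr 2
        field_simp
        norm_num
  calc y ^ m = H ^ m * (y / H) ^ m := by rw [div_pow]; field_simp
    _ ≤ H ^ m * (√(m ! : ℝ) * Real.exp ((2 * H ^ 2)⁻¹ * y ^ 2)) := by gcongr
    _ = _ := by ring

theorem exp_sub_sq_le {r : ℝ} (hr : 0 < r) (s x : ℝ) :
    Real.exp (s * x) * Real.exp (-(r * x ^ 2)) ≤ Real.exp (s ^ 2 / (4 * r)) := by
  rw [← Real.exp_add]
  apply Real.exp_le_exp.mpr
  rw [le_div_iff₀ (by positivity)]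
  nlinarith [sq_nonneg (s - 2 * r * x)]

theorem exp_neg_sq_le {r : ℝ} (hr : 0 < r) (s x : ℝ) :
    Real.exp (-(r * x ^ 2)) ≤ Real.exp (s ^ 2 / (4 * r)) * Real.exp (-(s * x)) := by
  have := exp_sub_sq_le hr s x
  rw [Real.exp_neg (s * x), ← div_eq_mul_inv, le_div_iff₀ (Real.exp_pos _)]
  linarith

section Integrable

variable {E : Type*} [NormedAddCommGroup E] [NormedSpace ℝ E] [FiniteDimensional ℝ E]
  [MeasurableSpace E] [BorelSpace E] (μ : Measure E) [μ.IsAddHaarMeasure]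

theorem integrable_exp_neg_norm {s : ℝ} (hs : 0 < s) :
    Integrable (fun z : E => Real.exp (-(s * ‖z‖))) μ := by
  set N := Module.finrank ℝ E + 1 with hN
  have h1 : Integrable (fun z : E => (1 + ‖z‖) ^ (-(N : ℝ))) μ :=
    integrable_one_add_norm (by rw [hN]; push_cast; linarith)
  refine (h1.const_mul ((N ! : ℝ) / s ^ N * Real.exp s)).mono'
    (by apply Measurable.aestronglyMeasurable; fun_prop) (Eventually.of_forall fun z => ?_)
  rw [Real.norm_of_nonneg (Real.exp_pos _).le]
  have h2 := Real.pow_div_factorial_le_exp (s * (1 + ‖z‖)) (by positivity) N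
  have hz : 0 < 1 + ‖z‖ := by positivity
  rw [Real.rpow_neg hz.le, Real.rpow_natCast, Real.exp_neg, div_mul_eq_mul_div,
    ← div_eq_mul_inv, div_div, le_div_iff₀ (by positivity), inv_mul_le_iff₀ (Real.exp_pos _),
    ← mul_assoc, mul_comm (Real.exp _), mul_assoc, ← Real.exp_add]
  rw [div_le_iff₀ (by positivity), mul_pow] at h2
  calc s ^ N * (1 + ‖z‖) ^ N ≤ _ := h2
    _ = _ := by ring_nf

theorem integrable_exp_neg_norm_sq {r : ℝ} (hr : 0 < r) :
    Integrable (fun z : E => Real.exp (-(r * ‖z‖ ^ 2))) μ := by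
  refine ((integrable_exp_neg_norm μ one_pos).const_mul (Real.exp (1 ^ 2 / (4 * r)))).mono'
    (by apply Measurable.aestronglyMeasurable; fun_prop) (Eventually.of_forall fun z => ?_)
  rw [Real.norm_of_nonneg (Real.exp_pos _).le]
  exact exp_neg_sq_le hr 1 _

end Integrable

end Bounds

/-! ### The short-time Fourier transform of test functions -/

section Analysis

open scoped Nat ContDiff FourierTransform

variable {V : Type*} [NormedAddCommGroup V] [InnerProductSpace ℝ V]

theorem GSBound.norm_iteratedFDeriv_le {h B : ℝ} {f : V → ℂ} (hf : GSBound h B f) (hh : 0 < h)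
    (n : ℕ) (x : V) : ‖iteratedFDeriv ℝ n f x‖
      ≤ 2 * (B * h ^ n * √(n ! : ℝ)) * Real.exp (-((4 * h ^ 2)⁻¹ * ‖x‖ ^ 2)) := by
  refine gauss_of_moments (norm_nonneg _) hh fun m => (hf m n x).trans_eq ?_
  rw [pow_add, Real.sqrt_mul (by positivity)]
  ring

theorem GSBound.norm_le {h B : ℝ} {f : V → ℂ} (hf : GSBound h B f) (hh : 0 < h) (x : V) :
    ‖f x‖ ≤ 2 * B * Real.exp (-((4 * h ^ 2)⁻¹ * ‖x‖ ^ 2)) := by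
  simpa using hf.norm_iteratedFDeriv_le hh 0 x

theorem gs_contDiff (F : GelfandShilov V) : ContDiff ℝ ∞ (F : V → ℂ) := F.2.1

theorem gs_continuous (F : GelfandShilov V) : Continuous (F : V → ℂ) :=
  (gs_contDiff F).continuous

theorem gs_exists_bound (F : GelfandShilov V) :
    ∃ h B : ℝ, 1 ≤ h ∧ 0 ≤ B ∧ GSBound h B (F : V → ℂ) := by
  obtain ⟨_, h, B, h0, hb⟩ := F.2
  exact ⟨max h 1, B, le_max_right _ _, hb.nonneg, hb.mono h0 (le_max_left _ _)⟩

theorem gs_exists_gauss (F : GelfandShilov V) :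
    ∃ C r : ℝ, 0 < r ∧ 0 ≤ C ∧ ∀ x, ‖(F : V → ℂ) x‖ ≤ C * Real.exp (-(r * ‖x‖ ^ 2)) := by
  obtain ⟨h, B, h1, hB, hb⟩ := (gs_exists_bound F)
  exact ⟨2 * B, (4 * h ^ 2)⁻¹, by positivity, by positivity, hb.norm_le (by linarith)⟩

@[simp] theorem tfShift_apply (x ξ : V) (ϕ : GelfandShilov V) (t : V) :
    (tfShift x ξ ϕ : V → ℂ) t
      = Complex.exp (Complex.I * ((inner ℝ t ξ : ℝ) : ℂ)) * (ϕ : V → ℂ) (t - x) := rfl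

@[simp] theorem gsConj_apply (ϕ : GelfandShilov V) (t : V) :
    (gsConj ϕ : V → ℂ) t = conj ((ϕ : V → ℂ) t) := rfl

theorem norm_character (s : ℝ) : ‖Complex.exp (Complex.I * (s : ℂ))‖ = 1 := by
  rw [mul_comm]; exact Complex.norm_exp_ofReal_mul_I s

theorem norm_tfShift (x ξ : V) (ϕ : GelfandShilov V) (t : V) :
    ‖(tfShift x ξ ϕ : V → ℂ) t‖ = ‖(ϕ : V → ℂ) (t - x)‖ := by
  rw [tfShift_apply, norm_mul, norm_character, one_mul]

theorem continuous_tfShift_uncurry (Ψ : GelfandShilov V) :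
    Continuous (fun p : (V × V) × V => (tfShift p.1.1 p.1.2 Ψ : V → ℂ) p.2) := by
  have := (gs_continuous Ψ)
  simp only [tfShift_apply]
  fun_prop

theorem norm_iteratedFDeriv_mul_shift_le {Ψ F : V → ℂ} {h B₀ B : ℝ} (hΨc : ContDiff ℝ ∞ Ψ)
    (hFc : ContDiff ℝ ∞ F) (hh : 0 < h)
    (hΨ : GSBound h B₀ Ψ) (hF : GSBound h B F) (n : ℕ) (x t : V) :
    ‖iteratedFDeriv ℝ n (fun t => F t * Ψ (t - x)) t‖
      ≤ 2 * B * B₀ * (2 * h) ^ n * √(n ! : ℝ) * Real.exp (-((4 * h ^ 2)⁻¹ * ‖t‖ ^ 2)) := by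
  have hB := hF.nonneg
  have hB₀ := hΨ.nonneg
  have cs : ContDiff ℝ ∞ (fun t => Ψ (t - x)) := hΨc.comp (contDiff_id.sub contDiff_const)
  refine (norm_iteratedFDeriv_mul_le (𝕜 := ℝ) (A := ℂ) hFc cs t (n := n)
    (by exact_mod_cast le_top)).trans ?_
  have hterm : ∀ i ∈ Finset.range (n + 1), (n.choose i : ℝ) * ‖iteratedFDeriv ℝ i F t‖ *
      ‖iteratedFDeriv ℝ (n - i) (fun t => Ψ (t - x)) t‖ ≤ (n.choose i : ℝ) *
      (2 * B * B₀ * h ^ n * √(n ! : ℝ) * Real.exp (-((4 * h ^ 2)⁻¹ * ‖t‖ ^ 2))) := by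
    intro i hi
    have hin : i ≤ n := Nat.lt_succ_iff.mp (Finset.mem_range.mp hi)
    rw [iteratedFDeriv_comp_sub]
    have h1 := hF.norm_iteratedFDeriv_le hh i t
    have h2 := hΨ 0 (n - i) (t - x)
    simp only [pow_zero, one_mul, zero_add, Nat.factorial_zero, Nat.cast_one] at h2
    have hfac : (i ! : ℝ) * ((n - i)! : ℝ) ≤ (n ! : ℝ) := by
      have := Nat.le_of_dvd (Nat.factorial_pos _) (Nat.factorial_mul_factorial_dvd_factorial hin)
      exact_mod_cast this
    have hs : √(i ! : ℝ) * √((n - i)! : ℝ) ≤ √(n ! : ℝ) := by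
      rw [← Real.sqrt_mul (by positivity)]
      exact Real.sqrt_le_sqrt hfac
    rw [mul_assoc]
    refine mul_le_mul_of_nonneg_left ?_ (by positivity)
    calc _ ≤ (2 * (B * h ^ i * √(i ! : ℝ)) * Real.exp (-((4 * h ^ 2)⁻¹ * ‖t‖ ^ 2))) *
          (B₀ * h ^ (n - i) * √((n - i)! : ℝ)) := by gcongr
      _ = 2 * B * B₀ * (h ^ i * h ^ (n - i)) * (√(i ! : ℝ) * √((n - i)! : ℝ)) *
          Real.exp (-((4 * h ^ 2)⁻¹ * ‖t‖ ^ 2)) := by ring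
      _ ≤ _ := by
        rw [← pow_add, Nat.add_sub_cancel' hin]
        gcongr
  refine (Finset.sum_le_sum hterm).trans_eq ?_
  rw [← Finset.sum_mul]
  have : (∑ i ∈ Finset.range (n + 1), (n.choose i : ℝ)) = 2 ^ n := by
    exact_mod_cast Nat.sum_range_choose n
  rw [this, mul_pow]
  ring

variable [FiniteDimensional ℝ V] [MeasurableSpace V] [BorelSpace V]

instance isAddHaarMeasure_volume_prod {W : Type*} [NormedAddCommGroup W]
    [InnerProductSpace ℝ W] [FiniteDimensional ℝ W] [MeasurableSpace W] [BorelSpace W] :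
    (volume : Measure (V × W)).IsAddHaarMeasure :=
  inferInstanceAs (((volume : Measure V).prod (volume : Measure W)).IsAddHaarMeasure)

theorem gs_integrable (F : GelfandShilov V) : Integrable (F : V → ℂ) := by
  obtain ⟨C, r, hr, -, hb⟩ := (gs_exists_gauss F)
  exact ((integrable_exp_neg_norm_sq volume hr).const_mul C).mono'
    (gs_continuous F).aestronglyMeasurable (Eventually.of_forall hb)

theorem gs_integrable_mul (F G : GelfandShilov V) :
    Integrable (fun t => (F : V → ℂ) t * (G : V → ℂ) t) := by
  obtain ⟨C, r, hr, hC, hb⟩ := (gs_exists_gauss G)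
  refine ((gs_integrable F)).mul_bdd (c := C) (gs_continuous G).aestronglyMeasurable
    (Eventually.of_forall fun t => (hb t).trans ?_)
  refine mul_le_of_le_one_right hC (Real.exp_le_one_iff.mpr ?_)
  simp only [Left.neg_nonpos_iff]; positivity

/-- The analysis transform `∫ F · π(z)Ψ`, `π(x, ξ)Ψ(t) = e^{i⟨t,ξ⟩} Ψ(t - x)`. The pairing is
bilinear, so this is the short-time Fourier transform of `F` with window `conj Ψ`, up to a factor
and a reflection of the frequency. -/
def ana (Ψ F : GelfandShilov V) (z : V × V) : ℂ :=
  ∫ t, (F : V → ℂ) t * (tfShift z.1 z.2 Ψ : V → ℂ) t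

theorem ana_add (Ψ F G : GelfandShilov V) (z : V × V) :
    ana Ψ (F + G) z = ana Ψ F z + ana Ψ G z := by
  unfold ana
  rw [← integral_add (gs_integrable_mul F _) (gs_integrable_mul G _)]
  simp only [Submodule.coe_add, Pi.add_apply, add_mul]

theorem ana_smul (Ψ F : GelfandShilov V) (c : ℂ) (z : V × V) :
    ana Ψ (c • F) z = c * ana Ψ F z := by
  unfold ana
  rw [← integral_const_mul]
  simp only [Submodule.coe_smul, Pi.smul_apply, smul_eq_mul, mul_assoc]

theorem stronglyMeasurable_ana (Ψ F : GelfandShilov V) : StronglyMeasurable (ana Ψ F) := by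
  have h : StronglyMeasurable (fun p : (V × V) × V =>
      (F : V → ℂ) p.2 * (tfShift p.1.1 p.1.2 Ψ : V → ℂ) p.2) :=
    (((gs_continuous F).comp continuous_snd).mul (continuous_tfShift_uncurry Ψ)).stronglyMeasurable
  exact h.integral_prod_right

/-- Covariance of the analysis transform under time-frequency shifts. -/
theorem ana_tfShift (Ψ F : GelfandShilov V) (w z : V × V) :
    ana Ψ (gsConj (tfShift w.1 w.2 F)) z
      = Complex.exp (Complex.I * ((inner ℝ w.1 (z.2 - w.2) : ℝ) : ℂ)) *
        ana Ψ (gsConj F) (z - w) := by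
  unfold ana
  rw [← integral_const_mul, ← integral_add_right_eq_self _ w.1]
  congr 1
  funext t
  simp only [gsConj_apply, tfShift_apply, map_mul, add_sub_cancel_right, ← Complex.exp_conj,
    Complex.conj_I, Complex.conj_ofReal, Prod.fst_sub, Prod.snd_sub]
  have e : t + w.1 - z.1 = t - (z.1 - w.1) := by abel
  rw [e]
  have : Complex.exp (-Complex.I * ((inner ℝ (t + w.1) w.2 : ℝ) : ℂ)) *
      Complex.exp (Complex.I * ((inner ℝ (t + w.1) z.2 : ℝ) : ℂ)) =
      Complex.exp (Complex.I * ((inner ℝ w.1 (z.2 - w.2) : ℝ) : ℂ)) *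
      Complex.exp (Complex.I * ((inner ℝ t (z.2 - w.2) : ℝ) : ℂ)) := by
    rw [← Complex.exp_add, ← Complex.exp_add]
    congr 1
    simp only [inner_add_left, inner_sub_right]
    push_cast
    ring
  linear_combination (conj ((F : V → ℂ) t) * (Ψ : V → ℂ) (t - (z.1 - w.1))) * this

/-- The analysis transform is a Fourier transform, in the normalization of Mathlib. -/
theorem ana_eq_fourier (Ψ F : GelfandShilov V) (x ξ : V) :
    ana Ψ F (x, ξ)
      = 𝓕 (fun t => (F : V → ℂ) t * (Ψ : V → ℂ) (t - x)) (-((2 * Real.pi)⁻¹ • ξ)) := by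
  rw [Real.fourier_eq']
  unfold ana
  congr 1
  funext t
  simp only [tfShift_apply, inner_neg_right, inner_smul_right, smul_eq_mul]
  have : Complex.exp (Complex.I * ((inner ℝ t ξ : ℝ) : ℂ)) =
      Complex.exp (((-2 * Real.pi * -((2 * Real.pi)⁻¹ * inner ℝ t ξ) : ℝ) : ℂ) * Complex.I) := by
    congr 1
    have hpi := Real.pi_ne_zero
    have e : -2 * Real.pi * -((2 * Real.pi)⁻¹ * inner ℝ t ξ) = inner ℝ t ξ := by field_simp
    rw [e, mul_comm]
  rw [this]
  ring

/-- The analysis transform of a test function has Gaussian decay, uniformly on the unit ball of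
each of the spaces whose inductive limit is `S_{1/2}`. -/
theorem exists_ana_le (Ψ : GelfandShilov V) {h : ℝ} (hh : 0 < h) :
    ∃ C r : ℝ, 0 < r ∧ 0 ≤ C ∧ ∀ (F : GelfandShilov V) (B : ℝ), GSBound h B (F : V → ℂ) →
      ∀ z, ‖ana Ψ F z‖ ≤ C * B * Real.exp (-(r * ‖z‖ ^ 2)) := by
  obtain ⟨h₀, B₀, h1, hB₀, hΨ'⟩ := (gs_exists_bound Ψ)
  set k := max h h₀ with hk
  have hk0 : 0 < k := lt_of_lt_of_le hh (le_max_left _ _)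
  have hk1 : 1 ≤ k := h1.trans (le_max_right _ _)
  have hΨ : GSBound k B₀ (Ψ : V → ℂ) := hΨ'.mono (by linarith) (le_max_right _ _)
  set σ := (4 * k ^ 2)⁻¹ with hσ
  have hσ0 : 0 < σ := by positivity
  set I₁ := ∫ t : V, Real.exp (-(σ / 2 * ‖t‖ ^ 2)) with hI₁
  set I₂ := ∫ t : V, Real.exp (-(σ * ‖t‖ ^ 2)) with hI₂
  have hI₁0 : 0 ≤ I₁ := integral_nonneg fun _ => (Real.exp_pos _).le
  have hI₂0 : 0 ≤ I₂ := integral_nonneg fun _ => (Real.exp_pos _).le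
  set s := (4 * (8 * k) ^ 2)⁻¹ * ((2 * Real.pi)⁻¹) ^ 2 with hs
  have hs0 : 0 < s := by positivity
  refine ⟨4 * B₀ * I₁ + 4 * B₀ * I₂, min (σ / 4) s, lt_min (by positivity) hs0, by positivity,
    fun F B hF' z => ?_⟩
  have hF : GSBound k B (F : V → ℂ) := hF'.mono hh (le_max_left _ _)
  have hB := hF.nonneg
  obtain ⟨x, ξ⟩ := z
  have bx : ‖ana Ψ F (x, ξ)‖ ≤ 4 * B₀ * I₁ * B * Real.exp (-(σ / 4 * ‖x‖ ^ 2)) := by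
    have e : 4 * B₀ * I₁ * B * Real.exp (-(σ / 4 * ‖x‖ ^ 2)) =
        ∫ t : V, (4 * B₀ * B * Real.exp (-(σ / 4 * ‖x‖ ^ 2))) *
          Real.exp (-(σ / 2 * ‖t‖ ^ 2)) := by
      rw [integral_const_mul]; ring
    rw [e]
    refine norm_integral_le_of_norm_le
      ((integrable_exp_neg_norm_sq volume (by positivity)).const_mul _)
      (Eventually.of_forall fun t => ?_)
    rw [norm_mul, norm_tfShift]
    have h1 := hF.norm_le hk0 t
    have h2 := hΨ.norm_le hk0 (t - x)
    calc _ ≤ (2 * B * Real.exp (-(σ * ‖t‖ ^ 2))) * (2 * B₀ * Real.exp (-(σ * ‖t - x‖ ^ 2))) := by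
          gcongr
      _ = 4 * B₀ * B * Real.exp (-(σ * ‖t‖ ^ 2) + -(σ * ‖t - x‖ ^ 2)) := by
          rw [Real.exp_add]; ring
      _ ≤ 4 * B₀ * B * Real.exp (-(σ / 4 * ‖x‖ ^ 2) + -(σ / 2 * ‖t‖ ^ 2)) := by
          gcongr 4 * B₀ * B * ?_
          apply Real.exp_le_exp.mpr
          have hx : ‖x‖ ≤ ‖t‖ + ‖t - x‖ := by
            have := norm_sub_le t (t - x)
            simpa using this
          have hx2 : ‖x‖ ^ 2 ≤ 2 * ‖t‖ ^ 2 + 2 * ‖t - x‖ ^ 2 := by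
            nlinarith [sq_nonneg (‖t‖ - ‖t - x‖), norm_nonneg x]
          nlinarith [sq_nonneg ‖t - x‖]
      _ = _ := by rw [Real.exp_add]; ring
  have bξ : ‖ana Ψ F (x, ξ)‖ ≤ 4 * B₀ * I₂ * B * Real.exp (-(s * ‖ξ‖ ^ 2)) := by
    rw [ana_eq_fourier]
    set g : V → ℂ := fun t => (F : V → ℂ) t * (Ψ : V → ℂ) (t - x) with hg
    have gc : ContDiff ℝ ∞ g :=
      (gs_contDiff F).mul ((gs_contDiff Ψ).comp (contDiff_id.sub contDiff_const))
    have gb := fun n t => norm_iteratedFDeriv_mul_shift_le (gs_contDiff Ψ) (gs_contDiff F) hk0 hΨ hF n x t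
    have gi : ∀ n, Integrable (fun t => ‖iteratedFDeriv ℝ n g t‖) := fun n =>
      ((integrable_exp_neg_norm_sq volume hσ0).const_mul
        (2 * B * B₀ * (2 * k) ^ n * √(n ! : ℝ))).mono'
        (gc.continuous_iteratedFDeriv (by exact_mod_cast le_top)).norm.aestronglyMeasurable
        (Eventually.of_forall fun t => by rw [norm_norm]; exact gb n t)
    have gI : ∀ n, ∫ t, ‖iteratedFDeriv ℝ n g t‖ ≤ 2 * B * B₀ * (2 * k) ^ n * √(n ! : ℝ) * I₂ := by
      intro n
      rw [hI₂, ← integral_const_mul]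
      exact integral_mono (gi n) ((integrable_exp_neg_norm_sq volume hσ0).const_mul _) (gb n)
    set w := -((2 * Real.pi)⁻¹ • ξ) with hw
    have key : ∀ n : ℕ, ‖w‖ ^ n * ‖𝓕 g w‖ ≤ (2 * B * B₀ * I₂) * (8 * k) ^ n * √(n ! : ℝ) := by
      intro n
      have h0 := Real.pow_mul_norm_iteratedFDeriv_fourier_le (K := 0) (N := ⊤) gc
        (fun k n hk _ => by
          have : k = 0 := by simpa using hk
          subst this
          simpa using gi n) (k := 0) (n := n) le_rfl (by exact_mod_cast le_top) w
      simp only [norm_iteratedFDeriv_zero, pow_zero, one_mul, Nat.cast_zero, mul_zero,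
        zero_add, Finset.range_one, Finset.singleton_product, Finset.sum_map,
        Function.Embedding.coeFn_mk] at h0
      refine h0.trans ?_
      have h1 : ∑ j ∈ Finset.range (n + 1), ∫ t, ‖iteratedFDeriv ℝ j g t‖
          ≤ (n + 1) * (2 * B * B₀ * (2 * k) ^ n * √(n ! : ℝ) * I₂) := by
        have : ∀ j ∈ Finset.range (n + 1), ∫ t, ‖iteratedFDeriv ℝ j g t‖
            ≤ 2 * B * B₀ * (2 * k) ^ n * √(n ! : ℝ) * I₂ := by
          intro j hj
          have hjn : j ≤ n := Nat.lt_succ_iff.mp (Finset.mem_range.mp hj)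
          refine (gI j).trans ?_
          gcongr
          linarith
        refine (Finset.sum_le_sum this).trans_eq ?_
        rw [Finset.sum_const, Finset.card_range, nsmul_eq_mul]
        push_cast; ring
      have h2 : ((n : ℝ) + 1) ≤ 2 ^ n := by
        exact_mod_cast Nat.lt_two_pow_self (n := n)
      calc _ ≤ 2 ^ n * (2 ^ n * (2 * B * B₀ * (2 * k) ^ n * √(n ! : ℝ) * I₂)) := by
            gcongr
            exact h1.trans (by gcongr)
        _ = _ := by
            have : (8 : ℝ) = 2 * 2 * 2 := by norm_num
            rw [this]; simp only [mul_pow]; ring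
    refine (gauss_of_moments (norm_nonneg _) (by positivity) key).trans_eq ?_
    have hwn : ‖w‖ = (2 * Real.pi)⁻¹ * ‖ξ‖ := by
      rw [hw, norm_neg, norm_smul, Real.norm_of_nonneg (by positivity)]
    have e : (4 * (8 * k) ^ 2)⁻¹ * ((2 * Real.pi)⁻¹ * ‖ξ‖) ^ 2 = s * ‖ξ‖ ^ 2 := by
      rw [hs]; ring
    rw [hwn, e]
    ring
  rw [Prod.norm_mk]
  rcases le_total ‖x‖ ‖ξ‖ with hle | hle
  · rw [max_eq_right hle]
    refine bξ.trans ?_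
    gcongr
    · linarith [mul_nonneg (mul_nonneg (by norm_num : (0:ℝ) ≤ 4) hB₀) hI₁0]
    · exact min_le_right _ _
  · rw [max_eq_left hle]
    refine bx.trans ?_
    gcongr
    · linarith [mul_nonneg (mul_nonneg (by norm_num : (0:ℝ) ≤ 4) hB₀) hI₂0]
    · exact min_le_left _ _

theorem exists_ana_gauss (Ψ F : GelfandShilov V) :
    ∃ C r : ℝ, 0 < r ∧ 0 ≤ C ∧ ∀ z, ‖ana Ψ F z‖ ≤ C * Real.exp (-(r * ‖z‖ ^ 2)) := by
  obtain ⟨h, B, h1, hB, hb⟩ := (gs_exists_bound F)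
  obtain ⟨C, r, hr, hC, H⟩ := exists_ana_le Ψ (h := h) (by linarith)
  exact ⟨C * B, r, hr, by positivity, H F B hb⟩

theorem integrable_ana (Ψ F : GelfandShilov V) : Integrable (ana Ψ F) := by
  obtain ⟨C, r, hr, -, hb⟩ := exists_ana_gauss Ψ F
  exact ((integrable_exp_neg_norm_sq volume hr).const_mul C).mono'
    (stronglyMeasurable_ana Ψ F).aestronglyMeasurable (Eventually.of_forall hb)

end Analysis

/-! ### Synthesis of test functions from time-frequency shifts -/

section Synthesis

open scoped Nat ContDiff FourierTransform

variable {V : Type*} [NormedAddCommGroup V] [InnerProductSpace ℝ V]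

/-- Time-frequency shifts grow subcritically: the parameter `h` can be chosen such that the norm of
`π(z)Ψ` grows as slowly as `exp (δ |z|^2)`. -/
theorem exists_gsBound_tfShift (Ψ : GelfandShilov V) {δ : ℝ} (hδ : 0 < δ) :
    ∃ h B : ℝ, 1 ≤ h ∧ 0 ≤ B ∧ ∀ z : V × V,
      GSBound h (B * Real.exp (δ * ‖z‖ ^ 2)) (tfShift z.1 z.2 Ψ : V → ℂ) := by
  obtain ⟨h₀, B₀, h1, hB₀, hΨ'⟩ := gs_exists_bound Ψ
  set H := √(δ⁻¹) with hH
  have hH0 : 0 < H := by positivity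
  have hHδ : (2 * H ^ 2)⁻¹ = δ / 2 := by
    rw [hH, Real.sq_sqrt (by positivity)]; field_simp
  set k := max h₀ H with hk
  have hk1 : 1 ≤ k := h1.trans (le_max_left _ _)
  have hHk : H ≤ k := le_max_right _ _
  have hΨ : GSBound k B₀ (Ψ : V → ℂ) := hΨ'.mono (by linarith) (le_max_left _ _)
  refine ⟨4 * k, 2 * B₀, by linarith, by positivity, fun z m n t => ?_⟩
  obtain ⟨x, ξ⟩ := z
  set e : V → ℂ := fun t => Complex.exp (Complex.I * ((inner ℝ t ξ : ℝ) : ℂ)) with he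
  have ec : ContDiff ℝ ∞ e := (contDiff_const.mul (Complex.ofRealCLM.contDiff.comp
        (contDiff_id.inner ℝ contDiff_const))).cexp
  have cs : ContDiff ℝ ∞ (fun t => (Ψ : V → ℂ) (t - x)) :=
    (gs_contDiff Ψ).comp (contDiff_id.sub contDiff_const)
  have key := norm_iteratedFDeriv_mul_le (𝕜 := ℝ) (A := ℂ) ec cs t (n := n)
    (by exact_mod_cast le_top)
  set X := Real.exp (δ / 2 * ‖x‖ ^ 2) with hX
  set Y := Real.exp (δ / 2 * ‖ξ‖ ^ 2) with hY
  have hX1 : 1 ≤ X := Real.one_le_exp (by positivity)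
  have hxm : ‖x‖ ^ m ≤ k ^ m * √(m ! : ℝ) * X := by
    refine (pow_le_sqrt_factorial hH0 ‖x‖ m).trans ?_
    rw [hHδ]
    gcongr
  have hξi : ∀ i : ℕ, ‖ξ‖ ^ i ≤ k ^ i * √(i ! : ℝ) * Y := by
    intro i
    refine (pow_le_sqrt_factorial hH0 ‖ξ‖ i).trans ?_
    rw [hHδ]
    gcongr
  have ht : ‖t‖ ^ m ≤ 2 ^ m * (‖t - x‖ ^ m + ‖x‖ ^ m) := by
    have h0 : ‖t‖ ≤ ‖t - x‖ + ‖x‖ := by simpa using norm_add_le (t - x) x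
    calc ‖t‖ ^ m ≤ (‖t - x‖ + ‖x‖) ^ m := by gcongr
      _ ≤ 2 ^ (m - 1) * (‖t - x‖ ^ m + ‖x‖ ^ m) := add_pow_le (norm_nonneg _) (norm_nonneg _) m
      _ ≤ _ := by
        gcongr
        · norm_num
        · omega
  have hbase : ∀ j, ‖t‖ ^ m * ‖iteratedFDeriv ℝ j (Ψ : V → ℂ) (t - x)‖ ≤
      2 ^ m * (2 * B₀ * k ^ (m + j) * (√(m ! : ℝ) * √(j ! : ℝ)) * X) := by
    intro j
    have c1 := hΨ m j (t - x)
    have c2 := hΨ 0 j (t - x)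
    rw [Real.sqrt_mul (by positivity)] at c1
    simp only [pow_zero, one_mul, zero_add, Nat.factorial_zero, Nat.cast_one] at c2
    calc _ ≤ (2 ^ m * (‖t - x‖ ^ m + ‖x‖ ^ m)) * ‖iteratedFDeriv ℝ j (Ψ : V → ℂ) (t - x)‖ := by
          gcongr
      _ = 2 ^ m * (‖t - x‖ ^ m * ‖iteratedFDeriv ℝ j (Ψ : V → ℂ) (t - x)‖ +
          ‖x‖ ^ m * ‖iteratedFDeriv ℝ j (Ψ : V → ℂ) (t - x)‖) := by ring
      _ ≤ 2 ^ m * (B₀ * k ^ (m + j) * (√(m ! : ℝ) * √(j ! : ℝ)) * X +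
          (k ^ m * √(m ! : ℝ) * X) * (B₀ * k ^ j * √(j ! : ℝ))) := by
          refine mul_le_mul_of_nonneg_left (add_le_add
            (c1.trans (le_mul_of_one_le_right (by positivity) hX1))
            (mul_le_mul hxm c2 (norm_nonneg _) (by positivity))) (by positivity)
      _ = _ := by rw [pow_add]; ring
  have hterm : ∀ i ∈ Finset.range (n + 1), ‖t‖ ^ m * ((n.choose i : ℝ) * ‖iteratedFDeriv ℝ i e t‖ *
      ‖iteratedFDeriv ℝ (n - i) (fun t => (Ψ : V → ℂ) (t - x)) t‖) ≤ (n.choose i : ℝ) *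
      (2 ^ m * (2 * B₀ * k ^ (m + n) * √((m ! : ℝ) * (n ! : ℝ)) * (X * Y))) := by
    intro i hi
    have hin : i ≤ n := Nat.lt_succ_iff.mp (Finset.mem_range.mp hi)
    rw [iteratedFDeriv_comp_sub]
    have hfac : (i ! : ℝ) * ((n - i)! : ℝ) ≤ (n ! : ℝ) := by
      have := Nat.le_of_dvd (Nat.factorial_pos _) (Nat.factorial_mul_factorial_dvd_factorial hin)
      exact_mod_cast this
    have hs : √(i ! : ℝ) * √((n - i)! : ℝ) ≤ √(n ! : ℝ) := by
      rw [← Real.sqrt_mul (by positivity)]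
      exact Real.sqrt_le_sqrt hfac
    calc _ = (n.choose i : ℝ) * (‖iteratedFDeriv ℝ i e t‖ *
          (‖t‖ ^ m * ‖iteratedFDeriv ℝ (n - i) (Ψ : V → ℂ) (t - x)‖)) := by ring
      _ ≤ (n.choose i : ℝ) * ((k ^ i * √(i ! : ℝ) * Y) *
          (2 ^ m * (2 * B₀ * k ^ (m + (n - i)) * (√(m ! : ℝ) * √((n - i)! : ℝ)) * X))) := by
          refine mul_le_mul_of_nonneg_left (mul_le_mul
            ((norm_iteratedFDeriv_character_le ξ i t).trans (hξi i)) (hbase _) (by positivity)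
            (by positivity)) (by positivity)
      _ = (n.choose i : ℝ) * (2 ^ m * (2 * B₀ * (k ^ i * k ^ (m + (n - i))) *
          (√(m ! : ℝ) * (√(i ! : ℝ) * √((n - i)! : ℝ))) * (X * Y))) := by ring
      _ ≤ _ := by
          have : k ^ i * k ^ (m + (n - i)) = k ^ (m + n) := by
            rw [← pow_add]; congr 1; omega
          rw [this, Real.sqrt_mul (by positivity)]
          gcongr
  have hXY : X * Y ≤ Real.exp (δ * ‖(x, ξ)‖ ^ 2) := by
    rw [hX, hY, ← Real.exp_add]
    apply Real.exp_le_exp.mpr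
    have h1 : ‖x‖ ^ 2 ≤ ‖(x, ξ)‖ ^ 2 := by gcongr; exact le_max_left _ _
    have h2 : ‖ξ‖ ^ 2 ≤ ‖(x, ξ)‖ ^ 2 := by gcongr; exact le_max_right _ _
    nlinarith
  calc ‖t‖ ^ m * ‖iteratedFDeriv ℝ n (tfShift x ξ Ψ : V → ℂ) t‖
      ≤ ‖t‖ ^ m * ∑ i ∈ Finset.range (n + 1), (n.choose i : ℝ) * ‖iteratedFDeriv ℝ i e t‖ *
      ‖iteratedFDeriv ℝ (n - i) (fun t => (Ψ : V → ℂ) (t - x)) t‖ :=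
        mul_le_mul_of_nonneg_left key (by positivity)
    _ ≤ ∑ i ∈ Finset.range (n + 1), (n.choose i : ℝ) *
      (2 ^ m * (2 * B₀ * k ^ (m + n) * √((m ! : ℝ) * (n ! : ℝ)) * (X * Y))) := by
        rw [Finset.mul_sum]
        exact Finset.sum_le_sum hterm
    _ = 2 ^ (m + n) * (2 * B₀ * k ^ (m + n) * √((m ! : ℝ) * (n ! : ℝ)) * (X * Y)) := by
        rw [← Finset.sum_mul, pow_add]
        have : (∑ i ∈ Finset.range (n + 1), (n.choose i : ℝ)) = 2 ^ n := by
          exact_mod_cast Nat.sum_range_choose n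
        rw [this]; ring
    _ ≤ 4 ^ (m + n) * (2 * B₀ * k ^ (m + n) * √((m ! : ℝ) * (n ! : ℝ)) *
        Real.exp (δ * ‖(x, ξ)‖ ^ 2)) := by
        gcongr
        norm_num
    _ = _ := by rw [mul_pow]; ring

theorem GSBound.conj {h B : ℝ} {f : V → ℂ} (hb : GSBound h B f) :
    GSBound h B (fun t => conj (f t)) := fun m n x => by
  have := LinearIsometryEquiv.norm_iteratedFDeriv_comp_left (𝕜 := ℝ) Complex.conjLIE f x n
  exact (congrArg (fun s => ‖x‖ ^ m * s) this).le.trans (hb m n x)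

/-- Superpositions of a smooth family of test functions are test functions, with bounds. -/
theorem contDiff_gsBound_integral {Z : Type*} [NormedAddCommGroup Z] [NormedSpace ℝ Z]
    [FiniteDimensional ℝ Z] [FiniteDimensional ℝ V]
    [MeasurableSpace Z] [BorelSpace Z] (μ : Measure Z) {G : Z × V → ℂ} (hG : ContDiff ℝ ∞ G)
    {b : Z → ℝ} {h : ℝ} (hb : ∀ z, GSBound h (b z) (fun x => G (z, x))) {A : Z → ℂ}
    (hA : AEStronglyMeasurable A μ) (hint : Integrable (fun z => ‖A z‖ * b z) μ) :
    ContDiff ℝ ∞ (fun x => ∫ z, A z * G (z, x) ∂μ) ∧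
      GSBound h (∫ z, ‖A z‖ * b z ∂μ) (fun x => ∫ z, A z * G (z, x) ∂μ) := by
  set g : Z → V → ℂ := fun z x => G (z, x) with hg
  have gc : ∀ z, ContDiff ℝ ∞ (g z) := fun z => hG.comp (contDiff_prodMk_right z)
  have cont : ∀ n : ℕ, Continuous (fun p : Z × V => iteratedFDeriv ℝ n (g p.1) p.2) := by
    intro n
    have e : (fun p : Z × V => iteratedFDeriv ℝ n (g p.1) p.2) = fun p =>
        ContinuousMultilinearMap.compContinuousLinearMapL (fun _ : Fin n => .inr ℝ Z V)
          (iteratedFDeriv ℝ n G p) := by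
      funext p
      have h1 : g p.1 = (fun q : Z × V => G (q + (p.1, 0))) ∘ (ContinuousLinearMap.inr ℝ Z V) := by
        funext x
        simp [hg]
      have h2 : ContDiff ℝ ∞ (fun q : Z × V => G (q + (p.1, 0))) :=
        hG.comp (contDiff_id.add contDiff_const)
      rw [h1, ContinuousLinearMap.iteratedFDeriv_comp_right _ h2 _ (by exact_mod_cast le_top),
        iteratedFDeriv_comp_add_right]
      simp
    rw [e]
    exact (ContinuousLinearMap.continuous _).comp
      (hG.continuous_iteratedFDeriv (by exact_mod_cast le_top))
  set c : ℕ → ℝ := fun n => h ^ n * √(n ! : ℝ) with hc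
  have gb : ∀ n z x, ‖iteratedFDeriv ℝ n (g z) x‖ ≤ b z * c n := by
    intro n z x
    have := hb z 0 n x
    simp only [pow_zero, one_mul, zero_add, Nat.factorial_zero, Nat.cast_one] at this
    rw [hc, ← mul_assoc]; exact this
  have meas : ∀ n x, AEStronglyMeasurable (fun z => A z • iteratedFDeriv ℝ n (g z) x) μ :=
    fun n x => hA.smul (((cont n).comp (Continuous.prodMk_left x)).aestronglyMeasurable)
  have bd : ∀ n z x, ‖A z • iteratedFDeriv ℝ n (g z) x‖ ≤ ‖A z‖ * b z * c n := by
    intro n z x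
    rw [norm_smul, mul_assoc]
    exact mul_le_mul_of_nonneg_left (gb n z x) (norm_nonneg _)
  have int : ∀ n x, Integrable (fun z => A z • iteratedFDeriv ℝ n (g z) x) μ := fun n x =>
    (hint.mul_const (c n)).mono' (meas n x) (Eventually.of_forall fun z => bd n z x)
  set p : V → FormalMultilinearSeries ℝ V ℂ := fun x n =>
    ∫ z, A z • iteratedFDeriv ℝ n (g z) x ∂μ with hp
  have der : ∀ (n : ℕ) x, HasFDerivAt (fun y => p y n) (p x (n + 1)).curryLeft x := by
    intro n x
    let L : ContinuousMultilinearMap ℝ (fun _ : Fin (n + 1) => V) ℂ →L[ℝ]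
        (V →L[ℝ] ContinuousMultilinearMap ℝ (fun _ : Fin n => V) ℂ) :=
      ((continuousMultilinearCurryLeftEquiv ℝ (fun _ : Fin (n + 1) => V)
        ℂ).toContinuousLinearEquiv : _ →L[ℝ] _)
    have e : (p x (n + 1)).curryLeft
        = ∫ z, L (A z • iteratedFDeriv ℝ (n + 1) (g z) x) ∂μ := by
      have h1 : (p x (n + 1)).curryLeft = L (p x (n + 1)) := rfl
      have h2 := ContinuousLinearMap.integral_comp_comm (𝕜 := ℝ) (Fₗ := V →L[ℝ] ContinuousMultilinearMap ℝ (fun _ : Fin n => V) ℂ) L (int (n + 1) x)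
      rw [h1, h2]
    rw [e]
    refine hasFDerivAt_integral_of_dominated_of_fderiv_le (s := Set.univ)
      (F := fun y z => A z • iteratedFDeriv ℝ n (g z) y)
      (F' := fun y z => L (A z • iteratedFDeriv ℝ (n + 1) (g z) y))
      (bound := fun z => ‖A z‖ * b z * c (n + 1)) univ_mem
      (Eventually.of_forall fun y => meas n y) (int n x) ?_ ?_ (hint.mul_const _) ?_
    · exact L.continuous.comp_aestronglyMeasurable (meas (n + 1) x)
    · refine Eventually.of_forall fun z y _ => ?_
      refine (ContinuousMultilinearMap.curryLeft_norm
        (A z • iteratedFDeriv ℝ (n + 1) (g z) y)).le.trans ?_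
      exact bd (n + 1) z y
    · refine Eventually.of_forall fun z y _ => ?_
      have h1 := ((gc z).ftaylorSeries (n := ∞)).fderiv n (by exact_mod_cast WithTop.coe_lt_top n) y
      exact h1.const_smul (A z)
  have ft : HasFTaylorSeriesUpTo ∞ (fun x => ∫ z, A z * G (z, x) ∂μ) p := by
    refine ⟨fun x => ?_, fun n _ x => der n x, fun n _ => ?_⟩
    · have := ((continuousMultilinearCurryFin0 ℝ V
        ℂ).toContinuousLinearEquiv.toContinuousLinearMap).integral_comp_comm (int 0 x)
      refine this.symm.trans ?_
      congr 1
    · exact continuous_iff_continuousAt.mpr fun x => (der n x).continuousAt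
  refine ⟨ft.contDiff, fun m n x => ?_⟩
  rw [← ft.eq_iteratedFDeriv (m := n) (by exact_mod_cast le_top) x]
  rw [show ‖x‖ ^ m * ‖p x n‖ = ‖((‖x‖ ^ m : ℝ)) • p x n‖ by
    rw [norm_smul, Real.norm_of_nonneg (by positivity)], hp, ← integral_smul, mul_assoc,
    ← integral_mul_const]
  refine norm_integral_le_of_norm_le (hint.mul_const _) (Eventually.of_forall fun z => ?_)
  rw [norm_smul, norm_smul, Real.norm_of_nonneg (by positivity)]
  have := hb z m n x
  calc _ = ‖A z‖ * (‖x‖ ^ m * ‖iteratedFDeriv ℝ n (g z) x‖) := by ring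
    _ ≤ ‖A z‖ * (b z * h ^ (m + n) * √((m ! : ℝ) * (n ! : ℝ))) := by gcongr
    _ = _ := by ring

theorem contDiff_tfShift_uncurry (Ψ : GelfandShilov V) :
    ContDiff ℝ ∞ (fun p : (V × V) × V => (tfShift p.1.1 p.1.2 Ψ : V → ℂ) p.2) := by
  have h1 : ContDiff ℝ ∞ (fun p : (V × V) × V => (Ψ : V → ℂ) (p.2 - p.1.1)) :=
    (gs_contDiff Ψ).comp (by fun_prop)
  have h2 : ContDiff ℝ ∞ (fun p : (V × V) × V => ((inner ℝ p.2 p.1.2 : ℝ) : ℂ)) :=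
    Complex.ofRealCLM.contDiff.comp (ContDiff.inner ℝ (by fun_prop) (by fun_prop))
  exact ((contDiff_const.mul h2).cexp).mul h1

theorem gs_exists_norm_le (Ψ : GelfandShilov V) :
    ∃ C : ℝ, 0 ≤ C ∧ ∀ t, ‖(Ψ : V → ℂ) t‖ ≤ C := by
  obtain ⟨C, r, hr, hC, hb⟩ := gs_exists_gauss Ψ
  refine ⟨C, hC, fun t => (hb t).trans (mul_le_of_le_one_right hC (Real.exp_le_one_iff.mpr ?_))⟩
  simp only [Left.neg_nonpos_iff]; positivity

variable [FiniteDimensional ℝ V] [MeasurableSpace V] [BorelSpace V]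

/-- Synthesis: superpositions of time-frequency shifts, and of their conjugates, with coefficients
of Gaussian decay are test functions. -/
theorem exists_gsBound_synth (Ψ : GelfandShilov V) {δ : ℝ} (hδ : 0 < δ) :
    ∃ h C : ℝ, 0 < h ∧ 0 ≤ C ∧ ∀ A : V × V → ℂ, AEStronglyMeasurable A →
      Integrable (fun z => ‖A z‖ * Real.exp (δ * ‖z‖ ^ 2)) →
      (ContDiff ℝ ∞ (fun t => ∫ z, A z * (tfShift z.1 z.2 Ψ : V → ℂ) t) ∧
        GSBound h (C * ∫ z, ‖A z‖ * Real.exp (δ * ‖z‖ ^ 2))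
          (fun t => ∫ z, A z * (tfShift z.1 z.2 Ψ : V → ℂ) t)) ∧
      (ContDiff ℝ ∞ (fun t => ∫ z, A z * (gsConj (tfShift z.1 z.2 Ψ) : V → ℂ) t) ∧
        GSBound h (C * ∫ z, ‖A z‖ * Real.exp (δ * ‖z‖ ^ 2))
          (fun t => ∫ z, A z * (gsConj (tfShift z.1 z.2 Ψ) : V → ℂ) t)) := by
  obtain ⟨h, B, h1, hB, hb⟩ := exists_gsBound_tfShift Ψ hδ
  refine ⟨h, B, by linarith, hB, fun A hA hint => ?_⟩
  have e : B * ∫ z, ‖A z‖ * Real.exp (δ * ‖z‖ ^ 2)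
      = ∫ z, ‖A z‖ * (B * Real.exp (δ * ‖z‖ ^ 2)) := by
    rw [← integral_const_mul]; congr 1; funext z; ring
  have hint' : Integrable (fun z => ‖A z‖ * (B * Real.exp (δ * ‖z‖ ^ 2))) :=
    (hint.const_mul B).congr (Eventually.of_forall fun z => by ring)
  rw [e]
  exact ⟨contDiff_gsBound_integral volume (contDiff_tfShift_uncurry Ψ) hb hA hint',
    contDiff_gsBound_integral volume
      (G := fun p : (V × V) × V => conj ((tfShift p.1.1 p.1.2 Ψ : V → ℂ) p.2))
      (Complex.conjCLE.contDiff.comp (contDiff_tfShift_uncurry Ψ)) (fun z => (hb z).conj) hA hint'⟩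

/-- The constant `(2π)^n ‖Ψ‖_{L²}^2` in the resolution of the identity. -/
def windowConst (Ψ : GelfandShilov V) : ℝ :=
  (2 * Real.pi) ^ Module.finrank ℝ V * ∫ t, ‖(Ψ : V → ℂ) t‖ ^ 2

theorem integrable_norm_sq (Ψ : GelfandShilov V) : Integrable (fun t => ‖(Ψ : V → ℂ) t‖ ^ 2) := by
  have := (gs_integrable_mul Ψ (gsConj Ψ)).norm
  refine this.congr (Eventually.of_forall fun t => ?_)
  simp [sq]

theorem windowConst_pos {Ψ : GelfandShilov V} (hΨ : Ψ ≠ 0) : 0 < windowConst Ψ := by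
  refine mul_pos (by positivity) ?_
  obtain ⟨t, ht⟩ : ∃ t, (Ψ : V → ℂ) t ≠ 0 := by
    by_contra! h
    exact hΨ (Subtype.ext (funext h))
  rw [integral_pos_iff_support_of_nonneg (fun t => by positivity) (integrable_norm_sq Ψ)]
  refine IsOpen.measure_pos volume ?_ ⟨t, by simpa using ht⟩
  exact ((gs_continuous Ψ).norm.pow 2).isOpen_support

/-- Resolution of the identity, for test functions and pointwise. It is Fourier inversion in the
frequency variable, followed by integration in the position variable. -/
theorem ana_inversion (Ψ F : GelfandShilov V) (s : V) :
    ∫ z, ana Ψ F z * (gsConj (tfShift z.1 z.2 Ψ) : V → ℂ) s = windowConst Ψ * (F : V → ℂ) s := by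
  obtain ⟨M, hM, hMb⟩ := gs_exists_norm_le Ψ
  have hint : Integrable (fun z => ana Ψ F z * (gsConj (tfShift z.1 z.2 Ψ) : V → ℂ) s) := by
    refine (integrable_ana Ψ F).mul_bdd (c := M) ?_ (Eventually.of_forall fun z => ?_)
    · have := (continuous_tfShift_uncurry Ψ).comp (Continuous.prodMk_left s)
      exact (Complex.continuous_conj.comp this).aestronglyMeasurable
    · rw [gsConj_apply, RCLike.norm_conj, norm_tfShift]
      exact hMb _
  rw [Measure.volume_eq_prod, integral_prod _ hint]
  have inner : ∀ x, ∫ ξ, ana Ψ F (x, ξ) * (gsConj (tfShift x ξ Ψ) : V → ℂ) s =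
      ((2 * Real.pi) ^ Module.finrank ℝ V : ℝ) * (F : V → ℂ) s * (‖(Ψ : V → ℂ) (s - x)‖ ^ 2 : ℝ) := by
    intro x
    set g : V → ℂ := fun t => (F : V → ℂ) t * (Ψ : V → ℂ) (t - x) with hg
    have hpi : (2 * Real.pi) ≠ 0 := by positivity
    have h𝓕 : ∀ η, 𝓕 g η = ana Ψ F (x, -((2 * Real.pi) • η)) := by
      intro η
      rw [ana_eq_fourier, smul_neg, neg_neg, smul_smul, inv_mul_cancel₀ hpi, one_smul]
    have gcont : Continuous g :=
      (gs_continuous F).mul ((gs_continuous Ψ).comp (continuous_id.sub continuous_const))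
    have gint : Integrable g := by
      refine (gs_integrable F).mul_bdd (c := M) ?_ (Eventually.of_forall fun t => hMb _)
      exact ((gs_continuous Ψ).comp (continuous_id.sub continuous_const)).aestronglyMeasurable
    have 𝓕int : Integrable (𝓕 g) := by
      obtain ⟨C, r, hr, hC, hb⟩ := exists_ana_gauss Ψ F
      refine ((integrable_exp_neg_norm_sq (volume : Measure V)
        (r := r * (2 * Real.pi) ^ 2) (by positivity)).const_mul C).mono' ?_
        (Eventually.of_forall fun η => ?_)
      · rw [funext h𝓕]
        exact ((stronglyMeasurable_ana Ψ F).comp_measurable (by fun_prop)).aestronglyMeasurable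
      · rw [h𝓕]
        refine (hb _).trans ?_
        gcongr C * Real.exp (-?_)
        have : ‖(2 * Real.pi) • η‖ ≤ ‖(x, -((2 * Real.pi) • η))‖ := by
          rw [Prod.norm_mk, norm_neg]; exact le_max_right _ _
        rw [norm_smul, Real.norm_of_nonneg (by positivity)] at this
        calc _ = r * (2 * Real.pi * ‖η‖) ^ 2 := by ring
          _ ≤ _ := by gcongr
    have inv : ∫ η, Complex.exp (((2 * Real.pi * inner ℝ η s : ℝ) : ℂ) * Complex.I) • 𝓕 g η
        = g s := by
      rw [← Real.fourierInv_eq', gcont.fourierInv_fourier_eq gint 𝓕int]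
    have e : ∀ ξ, ana Ψ F (x, ξ) * (gsConj (tfShift x ξ Ψ) : V → ℂ) s =
        (fun η => (Complex.exp (((2 * Real.pi * inner ℝ η s : ℝ) : ℂ) * Complex.I) • 𝓕 g η) *
          conj ((Ψ : V → ℂ) (s - x))) ((-(2 * Real.pi)⁻¹) • ξ) := by
      intro ξ
      simp only [ana_eq_fourier, gsConj_apply, tfShift_apply, map_mul, ← Complex.exp_conj,
        Complex.conj_I, Complex.conj_ofReal, smul_eq_mul, neg_smul]
      have : Complex.exp (-Complex.I * ((inner ℝ s ξ : ℝ) : ℂ)) =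
          Complex.exp (((2 * Real.pi * inner ℝ (-((2 * Real.pi)⁻¹ • ξ)) s : ℝ) : ℂ) *
            Complex.I) := by
        congr 1
        have e : 2 * Real.pi * inner ℝ (-((2 * Real.pi)⁻¹ • ξ)) s = - inner ℝ s ξ := by
          rw [inner_neg_left, real_inner_smul_left, real_inner_comm]
          field_simp
        rw [e]; push_cast; ring
      rw [this]; ring
    rw [funext e, Measure.integral_comp_smul volume (fun η =>
      (Complex.exp (((2 * Real.pi * inner ℝ η s : ℝ) : ℂ) * Complex.I) • 𝓕 g η) *
        conj ((Ψ : V → ℂ) (s - x))), integral_mul_const, inv]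
    have c : |((-(2 * Real.pi)⁻¹) ^ Module.finrank ℝ V)⁻¹| = (2 * Real.pi) ^ Module.finrank ℝ V := by
      rw [abs_inv, abs_pow, abs_neg, abs_of_pos (by positivity), inv_pow, inv_inv]
    rw [c, hg]
    simp only [Complex.real_smul]
    have : (Ψ : V → ℂ) (s - x) * conj ((Ψ : V → ℂ) (s - x)) = (‖(Ψ : V → ℂ) (s - x)‖ ^ 2 : ℝ) := by
      rw [Complex.mul_conj, Complex.normSq_eq_norm_sq]
    linear_combination (((2 * Real.pi) ^ Module.finrank ℝ V : ℝ) : ℂ) * (F : V → ℂ) s * this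
  simp only [inner]
  rw [integral_const_mul, integral_complex_ofReal,
    integral_sub_left_eq_self (fun x => ‖(Ψ : V → ℂ) x‖ ^ 2) volume s, windowConst]
  push_cast
  ring

end Synthesis

/-! ### Expansion of Gelfand-Shilov distributions in time-frequency shifts -/

section Expansion

variable {V : Type*} [NormedAddCommGroup V] [InnerProductSpace ℝ V]

theorem gsDist_growth (u : GSDist V) (Φ : GelfandShilov V) {ε : ℝ} (hε : 0 < ε) :
    ∃ C : ℝ, 0 ≤ C ∧ ∀ z : V × V,
      ‖u.1 (gsConj (tfShift z.1 z.2 Φ))‖ ≤ C * Real.exp (ε * ‖z‖ ^ 2) := by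
  obtain ⟨h, B, h1, hB, hb⟩ := exists_gsBound_tfShift Φ hε
  obtain ⟨C, hC⟩ := u.2 h (by linarith)
  refine ⟨max C 0 * B, by positivity, fun z => ?_⟩
  refine (hC (gsConj (tfShift z.1 z.2 Φ)) _ (hb z).conj).trans ?_
  rw [mul_assoc]
  gcongr
  exact le_max_left _ _

variable [FiniteDimensional ℝ V] [MeasurableSpace V] [BorelSpace V]

theorem exists_ana_tfShift_le (Ψ Φ : GelfandShilov V) :
    ∃ C r : ℝ, 0 < r ∧ 0 ≤ C ∧ ∀ w z : V × V,
      ‖ana Ψ (gsConj (tfShift w.1 w.2 Φ)) z‖ ≤ C * Real.exp (-(r * ‖z - w‖ ^ 2)) := by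
  obtain ⟨C, r, hr, hC, hb⟩ := exists_ana_gauss Ψ (gsConj Φ)
  refine ⟨C, r, hr, hC, fun w z => ?_⟩
  rw [ana_tfShift, norm_mul, norm_character, one_mul]
  exact hb _

theorem stronglyMeasurable_ana_tfShift (Ψ Φ : GelfandShilov V) :
    StronglyMeasurable (fun p : (V × V) × (V × V) =>
      ana Ψ (gsConj (tfShift p.1.1 p.1.2 Φ)) p.2) := by
  simp only [ana_tfShift]
  refine StronglyMeasurable.mul ?_ ?_
  · refine Continuous.stronglyMeasurable ?_
    fun_prop
  · exact (stronglyMeasurable_ana Ψ (gsConj Φ)).comp_measurable (by fun_prop)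

theorem sq_norm_le_two_mul {E : Type*} [SeminormedAddCommGroup E] (z w : E) :
    ‖z‖ ^ 2 ≤ 2 * ‖w‖ ^ 2 + 2 * ‖z - w‖ ^ 2 := by
  have h : ‖z‖ ≤ ‖w‖ + ‖z - w‖ := by
    have := norm_add_le w (z - w)
    simpa using this
  nlinarith [sq_nonneg (‖w‖ - ‖z - w‖), norm_nonneg z]

theorem memLp_exp_neg_norm_sq {s : ℝ} (hs : 0 < s) :
    MemLp (fun z : V × V => Real.exp (-(s * ‖z‖ ^ 2))) 2 volume := by
  rw [memLp_two_iff_integrable_sq (by apply Measurable.aestronglyMeasurable; fun_prop)]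
  refine (integrable_exp_neg_norm_sq (volume : Measure (V × V)) (r := 2 * s)
    (by positivity)).congr (Eventually.of_forall fun z => ?_)
  change Real.exp _ = Real.exp _ ^ 2
  rw [← Real.exp_nat_mul]
  congr 1
  push_cast
  ring

theorem memLp_two_of_gauss {f : V × V → ℂ} {C ρ r : ℝ} {w : V × V} (hr : 0 ≤ r)
    (hrρ : 2 * r < ρ)
    (hf : AEStronglyMeasurable f) (hb : ∀ z, ‖f z‖ ≤ C * Real.exp (-(ρ * ‖z - w‖ ^ 2))) :
    MemLp (fun z => f z * (Real.exp (r * ‖z‖ ^ 2) : ℂ)) 2 volume := by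
  have hC : 0 ≤ C := by
    have := (norm_nonneg _).trans (hb w)
    simpa using this
  have h1 : MemLp (fun z : V × V => Real.exp (-((ρ - 2 * r) * ‖z - w‖ ^ 2))) 2 volume :=
    (memLp_exp_neg_norm_sq (V := V) (s := ρ - 2 * r) (by linarith)).comp_measurePreserving
      (measurePreserving_sub_right volume w)
  refine (h1.const_mul (C * Real.exp (2 * r * ‖w‖ ^ 2))).mono ?_ (Eventually.of_forall fun z => ?_)
  · exact hf.mul (by apply Continuous.aestronglyMeasurable; fun_prop)
  · rw [norm_mul, Complex.norm_real, Real.norm_of_nonneg (Real.exp_pos _).le,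
      Real.norm_of_nonneg (by positivity)]
    calc _ ≤ C * Real.exp (-(ρ * ‖z - w‖ ^ 2)) * Real.exp (r * ‖z‖ ^ 2) := by
          gcongr; exact hb z
      _ = C * Real.exp (-(ρ * ‖z - w‖ ^ 2) + r * ‖z‖ ^ 2) := by rw [Real.exp_add]; ring
      _ ≤ C * Real.exp (2 * r * ‖w‖ ^ 2 + -((ρ - 2 * r) * ‖z - w‖ ^ 2)) := by
          gcongr C * Real.exp ?_
          have := sq_norm_le_two_mul z w
          nlinarith
      _ = _ := by rw [Real.exp_add]; ring

theorem integral_norm_mul_le_lp_norm {f : V × V → ℂ} {g : V × V → ℝ} (hf : MemLp f 2 volume)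
    (hg : MemLp g 2 volume) :
    ∫ z, ‖f z‖ * g z ≤ ‖hf.toLp f‖ * ‖hg.toLp g‖ := by
  have h1 := real_inner_le_norm (hf.norm.toLp _) (hg.toLp g)
  have h2 : ‖hf.norm.toLp _‖ = ‖hf.toLp f‖ := by
    rw [Lp.norm_toLp, Lp.norm_toLp, eLpNorm_norm]
  rw [h2] at h1
  refine le_of_eq_of_le ?_ h1
  rw [L2.inner_def]
  refine integral_congr_ae ?_
  filter_upwards [hf.norm.coeFn_toLp, hg.coeFn_toLp] with z h1 h2
  rw [h1, h2]
  simp [mul_comm]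

/-- Each distribution is, on test functions whose analysis transform is square integrable against
`exp (2 r |z|^2)`, given by a weighted `L²` pairing on phase space. This is the Riesz theorem,
after a Hahn-Banach extension. -/
theorem exists_l2_rep {Ψ : GelfandShilov V} (hΨ : Ψ ≠ 0) (u : GSDist V) {r : ℝ} (hr : 0 < r) :
    ∃ H : V × V → ℂ, StronglyMeasurable H ∧ MemLp H 2 volume ∧ ∀ F : GelfandShilov V,
      MemLp (fun z => ana Ψ F z * (Real.exp (r * ‖z‖ ^ 2) : ℂ)) 2 volume →
      u.1 F = ∫ z, ana Ψ F z * (Real.exp (r * ‖z‖ ^ 2) : ℂ) * H z := by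
  obtain ⟨h, C, hh, hC, hsyn⟩ := exists_gsBound_synth Ψ (δ := r / 2) (by positivity)
  obtain ⟨K, hK⟩ := u.2 h hh
  set W := windowConst Ψ with hW
  have hW0 : 0 < W := windowConst_pos hΨ
  have hg : MemLp (fun z : V × V => Real.exp (-(r / 2 * ‖z‖ ^ 2))) 2 volume :=
    memLp_exp_neg_norm_sq (by positivity)
  set M := ‖hg.toLp _‖ with hM
  let D : Submodule ℂ (GelfandShilov V) :=
    { carrier := {F | MemLp (fun z => ana Ψ F z * (Real.exp (r * ‖z‖ ^ 2) : ℂ)) 2 volume}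
      add_mem' := by
        intro F G hF hG
        refine (MemLp.add hF hG).ae_eq (Eventually.of_forall fun z => ?_)
        simp only [Pi.add_apply, ana_add]; ring
      zero_mem' := by
        have : ∀ z, ana Ψ (0 : GelfandShilov V) z = 0 := fun z => by simp [ana]
        simp [this]
      smul_mem' := by
        intro c F hF
        refine (MemLp.const_mul hF c).ae_eq (Eventually.of_forall fun z => ?_)
        simp only [ana_smul]; ring }
  let J : D →ₗ[ℂ] Lp ℂ 2 (volume : Measure (V × V)) :=
    { toFun := fun F => MemLp.toLp _ F.2
      map_add' := by
        intro F G
        rw [← MemLp.toLp_add]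
        refine MemLp.toLp_congr _ _ (Eventually.of_forall fun z => ?_)
        simp only [Submodule.coe_add, Pi.add_apply, ana_add]; ring
      map_smul' := by
        intro c F
        rw [RingHom.id_apply, ← MemLp.toLp_const_smul]
        refine MemLp.toLp_congr _ _ (Eventually.of_forall fun z => ?_)
        simp only [Submodule.coe_smul, Pi.smul_apply, ana_smul, smul_eq_mul]; ring }
  have bd : ∀ F : D, GSBound h (W⁻¹ * (C * (‖J F‖ * M))) ((F : GelfandShilov V) : V → ℂ) := by
    intro F
    have e : ∀ z, ‖ana Ψ F z‖ * Real.exp (r / 2 * ‖z‖ ^ 2) =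
        ‖ana Ψ F z * (Real.exp (r * ‖z‖ ^ 2) : ℂ)‖ * Real.exp (-(r / 2 * ‖z‖ ^ 2)) := by
      intro z
      rw [norm_mul, Complex.norm_real, Real.norm_of_nonneg (Real.exp_pos _).le, mul_assoc,
        ← Real.exp_add]
      congr 2; ring
    have hint : Integrable (fun z => ‖ana Ψ F z‖ * Real.exp (r / 2 * ‖z‖ ^ 2)) := by
      simp only [e]
      exact MemLp.integrable_mul (p := 2) (q := 2) (MemLp.norm F.2) hg
    obtain ⟨-, -, h2⟩ := hsyn (ana Ψ F) (stronglyMeasurable_ana _ _).aestronglyMeasurable hint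
    simp only [ana_inversion] at h2
    have h3 : ∫ z, ‖ana Ψ F z‖ * Real.exp (r / 2 * ‖z‖ ^ 2) ≤ ‖J F‖ * M := by
      simp only [e]
      exact integral_norm_mul_le_lp_norm F.2 hg
    intro m n x
    have h4 := h2 m n x
    have e2 : (fun t => (W : ℂ) * ((F : GelfandShilov V) : V → ℂ) t)
        = (W : ℂ) • ((F : GelfandShilov V) : V → ℂ) := rfl
    rw [e2, iteratedFDeriv_const_smul_apply (a := (W : ℂ)) ((gs_contDiff _).contDiffAt.of_le
      (by exact_mod_cast le_top)), norm_smul, Complex.norm_real, Real.norm_of_nonneg hW0.le] at h4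
    have h5 : W * (‖x‖ ^ m * ‖iteratedFDeriv ℝ n ((F : GelfandShilov V) : V → ℂ) x‖) ≤
        C * (‖J F‖ * M) * h ^ (m + n) * √((m.factorial : ℝ) * (n.factorial : ℝ)) := by
      calc _ = _ := by ring
        _ ≤ _ := h4
        _ ≤ _ := by gcongr
    calc _ = W⁻¹ * (W * (‖x‖ ^ m * ‖iteratedFDeriv ℝ n ((F : GelfandShilov V) : V → ℂ) x‖)) := by
          field_simp
      _ ≤ W⁻¹ * (C * (‖J F‖ * M) * h ^ (m + n) *
          √((m.factorial : ℝ) * (n.factorial : ℝ))) := by gcongr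
      _ = _ := by ring
  have inj : Function.Injective J := by
    intro F G hFG
    rw [← sub_eq_zero]
    have hF : J (F - G) = 0 := by
      have h1 : F - G = F + (-1 : ℂ) • G := by module
      have h2 : J (F + (-1 : ℂ) • G) = J F + (-1 : ℂ) • J G :=
        (J.map_add _ _).trans (congrArg _ (J.map_smul _ _))
      rw [h1, h2, hFG]
      module
    revert hF
    generalize F - G = F
    intro hF
    have h0 := bd F
    rw [hF] at h0
    refine Subtype.ext (Subtype.ext (funext fun x => ?_))
    have := h0 0 0 x
    simpa using this
  let e := LinearEquiv.ofInjective J inj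
  let f₀ : LinearMap.range J →ₗ[ℂ] ℂ := (u.1.comp D.subtype).comp e.symm.toLinearMap
  have hf₀ : ∀ y : LinearMap.range J, ‖f₀ y‖ ≤ (max K 0 * (W⁻¹ * (C * M))) * ‖y‖ := by
    intro y
    obtain ⟨F, rfl⟩ := e.surjective y
    have h1 : f₀ (e F) = u.1 F := by simp [f₀]
    have h2 : ‖e F‖ = ‖J F‖ := rfl
    rw [h1, h2]
    refine (hK _ _ (bd F)).trans ?_
    calc _ ≤ max K 0 * (W⁻¹ * (C * (‖J F‖ * M))) := by
          gcongr; exact le_max_left _ _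
      _ = _ := by ring
  obtain ⟨L, hL, -⟩ := exists_extension_norm_eq (LinearMap.range J) (f₀.mkContinuous _ hf₀)
  set H₀ := (InnerProductSpace.toDual ℂ (Lp ℂ 2 (volume : Measure (V × V)))).symm L with hH₀
  refine ⟨fun z => conj (H₀ z), Complex.continuous_conj.comp_stronglyMeasurable
    (Lp.stronglyMeasurable H₀), (Lp.memLp H₀).star, fun F hF => ?_⟩
  have h1 : u.1 F = L (J ⟨F, hF⟩) := by
    have := hL (e ⟨F, hF⟩)
    have h2 : f₀ (e ⟨F, hF⟩) = u.1 F := by simp [f₀]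
    rw [← h2]
    exact this.symm
  rw [h1, ← InnerProductSpace.toDual_symm_apply, ← hH₀, L2.inner_def]
  refine integral_congr_ae ?_
  filter_upwards [hF.coeFn_toLp] with z hz
  have : (J ⟨F, hF⟩ : V × V → ℂ) z = ana Ψ F z * (Real.exp (r * ‖z‖ ^ 2) : ℂ) := hz
  rw [this]
  simp

/-- The values of a distribution at time-frequency shifts, as a measurable function. -/
theorem stronglyMeasurable_gsDist_tfShift (u : GSDist V) (Φ : GelfandShilov V) :
    StronglyMeasurable (fun z : V × V => u.1 (gsConj (tfShift z.1 z.2 Φ))) := by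
  by_cases hΦ : Φ = 0
  · subst hΦ
    have : ∀ z : V × V, gsConj (tfShift z.1 z.2 (0 : GelfandShilov V)) = 0 := fun z =>
      Subtype.ext (funext fun t => by simp)
    simp only [this, map_zero]
    exact stronglyMeasurable_const
  obtain ⟨C, ρ, hρ, hC, hb⟩ := exists_ana_tfShift_le Φ Φ
  obtain ⟨H, hHm, -, hH⟩ := exists_l2_rep hΦ u (r := ρ / 4) (by positivity)
  have e : ∀ z : V × V, u.1 (gsConj (tfShift z.1 z.2 Φ)) =
      ∫ w, ana Φ (gsConj (tfShift z.1 z.2 Φ)) w * (Real.exp (ρ / 4 * ‖w‖ ^ 2) : ℂ) * H w :=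
    fun z => hH _ (memLp_two_of_gauss (by positivity) (by linarith)
      (stronglyMeasurable_ana _ _).aestronglyMeasurable (hb z))
  simp only [e]
  refine StronglyMeasurable.integral_prod_right' (f := fun p : (V × V) × (V × V) =>
    ana Φ (gsConj (tfShift p.1.1 p.1.2 Φ)) p.2 * (Real.exp (ρ / 4 * ‖p.2‖ ^ 2) : ℂ) * H p.2) ?_
  refine ((stronglyMeasurable_ana_tfShift Φ Φ).mul ?_).mul (hHm.comp_measurable measurable_snd)
  apply Continuous.stronglyMeasurable
  fun_prop

/-- Parseval's formula on phase space, for the bilinear pairing. -/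
theorem ana_parseval (Ψ F G : GelfandShilov V) :
    Integrable (fun z : V × V => ana Ψ F z *
      ∫ t, (gsConj (tfShift z.1 z.2 Ψ) : V → ℂ) t * (G : V → ℂ) t) ∧
    ∫ z : V × V, ana Ψ F z * (∫ t, (gsConj (tfShift z.1 z.2 Ψ) : V → ℂ) t * (G : V → ℂ) t)
      = windowConst Ψ * ∫ t, (F : V → ℂ) t * (G : V → ℂ) t := by
  obtain ⟨M, hM, hMb⟩ := gs_exists_norm_le Ψ
  have cΨ : Continuous (fun p : (V × V) × V => (gsConj (tfShift p.1.1 p.1.2 Ψ) : V → ℂ) p.2) :=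
    Complex.continuous_conj.comp (continuous_tfShift_uncurry Ψ)
  have hint : Integrable (fun p : (V × V) × V =>
      ana Ψ F p.1 * ((gsConj (tfShift p.1.1 p.1.2 Ψ) : V → ℂ) p.2 * (G : V → ℂ) p.2)) := by
    have h1 : Integrable (fun p : (V × V) × V => (ana Ψ F p.1 * (G : V → ℂ) p.2) *
        (gsConj (tfShift p.1.1 p.1.2 Ψ) : V → ℂ) p.2) :=
      ((integrable_ana Ψ F).mul_prod (gs_integrable G)).mul_bdd (c := M) cΨ.aestronglyMeasurable
        (Eventually.of_forall fun p => by
          rw [gsConj_apply, RCLike.norm_conj, norm_tfShift]; exact hMb _)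
    exact h1.congr (Eventually.of_forall fun p => by ring)
  have h1 := hint.integral_prod_left
  have h2 := integral_integral_swap (f := fun (z : V × V) (t : V) =>
    ana Ψ F z * ((gsConj (tfShift z.1 z.2 Ψ) : V → ℂ) t * (G : V → ℂ) t)) hint
  simp only [integral_const_mul] at h1 h2
  refine ⟨h1, h2.trans ?_⟩
  rw [← integral_const_mul]
  congr 1
  funext t
  have := ana_inversion Ψ F t
  rw [← mul_assoc, ← this, ← integral_mul_const]
  congr 1
  funext z
  ring

/-- The expansion `(2π)^n ‖Ψ‖² u = ∫ ⟨u, conj (π(z)Ψ)⟩ π(z)Ψ dz` of a distribution. -/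
theorem gsDist_expansion (Ψ : GelfandShilov V) (u : GSDist V) (F : GelfandShilov V) :
    Integrable (fun z : V × V => u.1 (gsConj (tfShift z.1 z.2 Ψ)) * ana Ψ F z) ∧
    ∫ z : V × V, u.1 (gsConj (tfShift z.1 z.2 Ψ)) * ana Ψ F z = windowConst Ψ * u.1 F := by
  obtain ⟨C₁, ρ₁, hρ₁, hC₁, hb₁⟩ := exists_ana_gauss Ψ F
  constructor
  · obtain ⟨C, hC, hg⟩ := gsDist_growth u Ψ (ε := ρ₁ / 2) (by positivity)
    refine ((integrable_exp_neg_norm_sq (volume : Measure (V × V)) (r := ρ₁ / 2)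
      (by positivity)).const_mul (C * C₁)).mono'
      ((stronglyMeasurable_gsDist_tfShift u Ψ).mul (stronglyMeasurable_ana Ψ F)).aestronglyMeasurable
      (Eventually.of_forall fun z => ?_)
    rw [norm_mul]
    calc _ ≤ (C * Real.exp (ρ₁ / 2 * ‖z‖ ^ 2)) * (C₁ * Real.exp (-(ρ₁ * ‖z‖ ^ 2))) := by
          gcongr
          · exact hg z
          · exact hb₁ z
      _ = C * C₁ * (Real.exp (ρ₁ / 2 * ‖z‖ ^ 2) * Real.exp (-(ρ₁ * ‖z‖ ^ 2))) := by ring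
      _ = _ := by rw [← Real.exp_add]; congr 2; ring
  by_cases hΨ : Ψ = 0
  · subst hΨ
    have : ∀ z : V × V, ana 0 F z = 0 := fun z => by simp [ana]
    simp [this, windowConst]
  obtain ⟨C₂, ρ₂, hρ₂, hC₂, hb₂⟩ := exists_ana_tfShift_le Ψ Ψ
  set ρ := min ρ₁ ρ₂ with hρ
  have hρ0 : 0 < ρ := lt_min hρ₁ hρ₂
  set r := ρ / 8 with hr
  obtain ⟨H, hHm, hHL, hH⟩ := exists_l2_rep hΨ u (r := r) (by positivity)
  have hF : u.1 F = ∫ w, ana Ψ F w * (Real.exp (r * ‖w‖ ^ 2) : ℂ) * H w :=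
    hH F (memLp_two_of_gauss (w := 0) (ρ := ρ₁) (by positivity)
      (by have := min_le_left ρ₁ ρ₂; linarith)
      (stronglyMeasurable_ana _ _).aestronglyMeasurable (by simpa using hb₁))
  have hS : ∀ z : V × V, u.1 (gsConj (tfShift z.1 z.2 Ψ)) =
      ∫ w, ana Ψ (gsConj (tfShift z.1 z.2 Ψ)) w * (Real.exp (r * ‖w‖ ^ 2) : ℂ) * H w :=
    fun z => hH _ (memLp_two_of_gauss (ρ := ρ₂) (by positivity)
      (by have := min_le_right ρ₁ ρ₂; linarith)
      (stronglyMeasurable_ana _ _).aestronglyMeasurable (hb₂ z))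
  have hHi : Integrable (fun w => Real.exp (-(r * ‖w‖ ^ 2)) * ‖H w‖) :=
    MemLp.integrable_mul (p := 2) (q := 2) (memLp_exp_neg_norm_sq (by positivity)) hHL.norm
  have hint : Integrable (fun p : (V × V) × (V × V) =>
      ana Ψ F p.1 * (ana Ψ (gsConj (tfShift p.1.1 p.1.2 Ψ)) p.2 *
        (Real.exp (r * ‖p.2‖ ^ 2) : ℂ) * H p.2)) := by
    refine (((integrable_exp_neg_norm_sq (volume : Measure (V × V)) (r := ρ / 2)
      (by positivity)).const_mul (C₁ * C₂)).mul_prod hHi).mono' ?_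
      (Eventually.of_forall fun p => ?_)
    · refine StronglyMeasurable.aestronglyMeasurable ?_
      refine ((stronglyMeasurable_ana Ψ F).comp_measurable measurable_fst).mul
        (((stronglyMeasurable_ana_tfShift Ψ Ψ).mul ?_).mul (hHm.comp_measurable measurable_snd))
      apply Continuous.stronglyMeasurable
      fun_prop
    · obtain ⟨z, w⟩ := p
      simp only [norm_mul, Complex.norm_real, Real.norm_of_nonneg (Real.exp_pos _).le]
      have b1 : ‖ana Ψ F z‖ ≤ C₁ * Real.exp (-(ρ * ‖z‖ ^ 2)) := by
        refine (hb₁ z).trans ?_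
        gcongr
        exact min_le_left _ _
      have b2 : ‖ana Ψ (gsConj (tfShift z.1 z.2 Ψ)) w‖ ≤ C₂ * Real.exp (-(ρ * ‖w - z‖ ^ 2)) := by
        refine (hb₂ z w).trans ?_
        gcongr
        exact min_le_right _ _
      calc _ ≤ (C₁ * Real.exp (-(ρ * ‖z‖ ^ 2))) * ((C₂ * Real.exp (-(ρ * ‖w - z‖ ^ 2))) *
            Real.exp (r * ‖w‖ ^ 2) * ‖H w‖) := by gcongr
        _ = C₁ * C₂ * Real.exp (-(ρ * ‖z‖ ^ 2) + -(ρ * ‖w - z‖ ^ 2) + r * ‖w‖ ^ 2) * ‖H w‖ := by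
            rw [Real.exp_add, Real.exp_add]; ring
        _ ≤ C₁ * C₂ * Real.exp (-(ρ / 2 * ‖z‖ ^ 2) + -(r * ‖w‖ ^ 2)) * ‖H w‖ := by
            gcongr C₁ * C₂ * Real.exp ?_ * _
            have := sq_norm_le_two_mul w z
            nlinarith [sq_nonneg ‖w - z‖]
        _ = _ := by rw [Real.exp_add]; ring
  have swap := integral_integral_swap (f := fun (z w : V × V) => ana Ψ F z *
    (ana Ψ (gsConj (tfShift z.1 z.2 Ψ)) w * (Real.exp (r * ‖w‖ ^ 2) : ℂ) * H w)) hint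
  calc _ = ∫ z, ∫ w, ana Ψ F z *
        (ana Ψ (gsConj (tfShift z.1 z.2 Ψ)) w * (Real.exp (r * ‖w‖ ^ 2) : ℂ) * H w) := by
        congr 1
        funext z
        rw [hS z, integral_const_mul, mul_comm]
    _ = _ := swap
    _ = ∫ w, (windowConst Ψ : ℂ) * (ana Ψ F w * (Real.exp (r * ‖w‖ ^ 2) : ℂ) * H w) := by
        congr 1
        funext w
        have := (ana_parseval Ψ F (tfShift w.1 w.2 Ψ)).2
        change ∫ z, ana Ψ F z * ana Ψ (gsConj (tfShift z.1 z.2 Ψ)) w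
          = windowConst Ψ * ana Ψ F w at this
        rw [← mul_assoc, ← mul_assoc, ← this, ← integral_mul_const, ← integral_mul_const]
        congr 1
        funext z
        ring
    _ = _ := by rw [integral_const_mul, ← hF]

theorem integrable_exp_mul_gauss {E : Type*} [NormedAddCommGroup E] [NormedSpace ℝ E]
    [FiniteDimensional ℝ E] [MeasurableSpace E] [BorelSpace E] (μ : Measure E)
    [μ.IsAddHaarMeasure] (s : ℝ) {r : ℝ} (hr : 0 < r) :
    Integrable (fun z : E => Real.exp (s * ‖z‖) * Real.exp (-(r * ‖z‖ ^ 2))) μ := by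
  refine ((integrable_exp_neg_norm_sq μ (r := r / 2) (by positivity)).const_mul
    (Real.exp (s ^ 2 / (4 * (r / 2))))).mono'
    (by apply Measurable.aestronglyMeasurable; fun_prop) (Eventually.of_forall fun z => ?_)
  rw [Real.norm_of_nonneg (by positivity)]
  have := exp_sub_sq_le (r := r / 2) (by positivity) s ‖z‖
  calc _ = (Real.exp (s * ‖z‖) * Real.exp (-(r / 2 * ‖z‖ ^ 2))) *
        Real.exp (-(r / 2 * ‖z‖ ^ 2)) := by
        rw [mul_assoc, ← Real.exp_add (-(r / 2 * ‖z‖ ^ 2))]; congr 2; ring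
    _ ≤ _ := by gcongr

theorem integrable_mul_ana {H : V × V → ℂ} (hH : AEStronglyMeasurable H) {C s : ℝ}
    (hb : ∀ z, ‖H z‖ ≤ C * Real.exp (s * ‖z‖)) (Ψ F : GelfandShilov V) :
    Integrable (fun z => H z * ana Ψ F z) := by
  obtain ⟨C₁, r, hr, hC₁, hb₁⟩ := exists_ana_gauss Ψ F
  have hC : 0 ≤ C := by
    have := (norm_nonneg _).trans (hb 0)
    simpa using this
  refine ((integrable_exp_mul_gauss volume s hr).const_mul (C * C₁)).mono'
    (hH.mul (stronglyMeasurable_ana Ψ F).aestronglyMeasurable) (Eventually.of_forall fun z => ?_)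
  rw [norm_mul]
  calc _ ≤ (C * Real.exp (s * ‖z‖)) * (C₁ * Real.exp (-(r * ‖z‖ ^ 2))) := by
        gcongr
        · exact hb z
        · exact hb₁ z
    _ = _ := by ring

/-- Functions of exponential growth on phase space synthesize distributions. -/
theorem exists_gsDist_synth (Ψ : GelfandShilov V) {H : V × V → ℂ} (hH : AEStronglyMeasurable H)
    {C s : ℝ} (hb : ∀ z, ‖H z‖ ≤ C * Real.exp (s * ‖z‖)) :
    ∃ u : GSDist V, ∀ F, u.1 F = ∫ z, H z * ana Ψ F z := by
  have hC : 0 ≤ C := by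
    have := (norm_nonneg _).trans (hb 0)
    simpa using this
  let L : GelfandShilov V →ₗ[ℂ] ℂ :=
    { toFun := fun F => ∫ z, H z * ana Ψ F z
      map_add' := fun F G => by
        rw [← integral_add (integrable_mul_ana hH hb Ψ F) (integrable_mul_ana hH hb Ψ G)]
        simp only [ana_add, mul_add]
      map_smul' := fun c F => by
        rw [RingHom.id_apply, smul_eq_mul, ← integral_const_mul]
        congr 1
        funext z
        rw [ana_smul]; ring }
  refine ⟨⟨L, fun h hh => ?_⟩, fun F => rfl⟩
  obtain ⟨C₁, r, hr, hC₁, hb₁⟩ := exists_ana_le Ψ hh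
  refine ⟨∫ z : V × V, C * C₁ * (Real.exp (s * ‖z‖) * Real.exp (-(r * ‖z‖ ^ 2))),
    fun F B hF => ?_⟩
  have hB := hF.nonneg
  rw [← integral_mul_const]
  refine norm_integral_le_of_norm_le
    (((integrable_exp_mul_gauss volume s hr).const_mul _).mul_const _)
    (Eventually.of_forall fun z => ?_)
  rw [norm_mul]
  calc _ ≤ (C * Real.exp (s * ‖z‖)) * (C₁ * B * Real.exp (-(r * ‖z‖ ^ 2))) := by
        gcongr
        · exact hb z
        · exact hb₁ F B hF z
    _ = _ := by ring

end Expansion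

/-! ### Moderate weights -/

section Weights

/-- A positive weight whose logarithm is Lipschitz continuous with constant `c`. -/
structure IsLogLip {E : Type*} [NormedAddCommGroup E] (c : ℝ) (ω : E → ℝ) : Prop where
  nonneg : 0 ≤ c
  pos : ∀ x, 0 < ω x
  le_mul : ∀ x y, ω x ≤ ω y * Real.exp (c * ‖x - y‖)

variable {E : Type*} [NormedAddCommGroup E]

theorem IsLogLip.inv {c : ℝ} {ω : E → ℝ} (h : IsLogLip c ω) : IsLogLip c (fun x => (ω x)⁻¹) where
  nonneg := h.nonneg
  pos x := inv_pos.mpr (h.pos x)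
  le_mul x y := by
    have h1 := h.le_mul y x
    have hx := h.pos x
    have hy := h.pos y
    rw [norm_sub_rev] at h1
    rw [inv_mul_eq_div, le_div_iff₀ hy, inv_mul_le_iff₀ hx]
    exact h1

theorem IsLogLip.continuous {c : ℝ} {ω : E → ℝ} (h : IsLogLip c ω) : Continuous ω := by
  have hlog : LipschitzWith ⟨c, h.nonneg⟩ (fun x => Real.log (ω x)) := by
    refine LipschitzWith.of_le_add_mul _ fun x y => ?_
    have := Real.log_le_log (h.pos x) (h.le_mul x y)
    rw [Real.log_mul (h.pos y).ne' (Real.exp_pos _).ne', Real.log_exp] at this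
    rw [dist_eq_norm]
    exact this
  have e : ω = fun x => Real.exp (Real.log (ω x)) := funext fun x => (Real.exp_log (h.pos x)).symm
  rw [e]
  exact Real.continuous_exp.comp hlog.continuous

variable [NormedSpace ℝ E] [FiniteDimensional ℝ E] [MeasureSpace E] [BorelSpace E]
  [(volume : Measure E).IsAddHaarMeasure]

/-- A moderate weight grows at most exponentially under translations: near the origin the moderating
function may be replaced by a constant, because almost every decomposition `y = t + (y - t)` has
both terms in the set where it is essentially bounded. -/
theorem IsModerateWeight.exists_exp {ω : E → ℝ} (hω : IsModerateWeight ω) :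
    ∃ c K : ℝ, 0 ≤ c ∧ 1 ≤ K ∧ ∀ x y, ω (x + y) ≤ K * Real.exp (c * ‖y‖) * ω x := by
  obtain ⟨v, hv, hvb, C, hC, hmod⟩ := hω.moderate
  have hb := hvb (Metric.closedBall 0 1) (isCompact_closedBall _ _)
  set M := (eLpNorm v ∞ (volume.restrict (Metric.closedBall 0 1))).toReal with hM
  have hae : ∀ᵐ y, y ∈ Metric.closedBall (0 : E) 1 → v y ≤ M := by
    rw [← ae_restrict_iff' measurableSet_closedBall]
    have := ae_le_eLpNormEssSup (f := v) (μ := volume.restrict (Metric.closedBall 0 1))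
    filter_upwards [this] with y hy
    have h2 : eLpNorm v ∞ (volume.restrict (Metric.closedBall 0 1)) ≠ ∞ := hb.2.ne
    rw [eLpNorm_exponent_top] at h2 hM
    have h3 := ENNReal.toReal_mono h2 hy
    rw [← hM, toReal_enorm] at h3
    exact (le_abs_self _).trans h3
  have hsmall : ∀ y : E, ‖y‖ ≤ 1 / 2 → ∀ x, ω (x + y) ≤ (C * max M 1) ^ 2 * ω x := by
    intro y hy x
    have hae2 : ∀ᵐ s, y - s ∈ Metric.closedBall (0 : E) 1 → v (y - s) ≤ M :=
      (quasiMeasurePreserving_sub_left volume y).ae hae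
    have hpos : 0 < (volume : Measure E) (Metric.ball 0 (1 / 2)) :=
      Metric.measure_ball_pos _ _ (by norm_num)
    obtain ⟨s, hs, h1, h2⟩ : ∃ s ∈ Metric.ball (0 : E) (1 / 2),
        (s ∈ Metric.closedBall (0 : E) 1 → v s ≤ M) ∧
        (y - s ∈ Metric.closedBall (0 : E) 1 → v (y - s) ≤ M) := by
      by_contra! hcon
      have : ∀ᵐ s, s ∉ Metric.ball (0 : E) (1 / 2) := by
        filter_upwards [hae, hae2] with s h1 h2 hs
        obtain ⟨h3, h4⟩ := hcon s hs h1
        exact absurd (h2 h3) (not_le.mpr h4)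
      rw [ae_iff] at this
      simp only [not_not, Set.ofPred_mem_eq] at this
      exact hpos.ne' this
    have hs' : ‖s‖ < 1 / 2 := by simpa using hs
    have g1 : v s ≤ max M 1 := (h1 (by simp; linarith)).trans (le_max_left _ _)
    have g2 : v (y - s) ≤ max M 1 :=
      (h2 (by simpa using (norm_sub_le y s).trans (by linarith))).trans (le_max_left _ _)
    have m1 := hmod (x + s) (y - s)
    have m2 := hmod x s
    have e : x + s + (y - s) = x + y := by abel
    rw [e] at m1
    have hx := hω.pos x
    have hxs := hω.pos (x + s)
    have hvs := hv s
    have hvy := (hv (y - s)).le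
    calc ω (x + y) ≤ C * ω (x + s) * v (y - s) := m1
      _ ≤ C * (C * ω x * v s) * v (y - s) := by
          gcongr
      _ ≤ C * (C * ω x * max M 1) * max M 1 := by gcongr
      _ = _ := by ring
  set K := max ((C * max M 1) ^ 2) 1 with hK
  have hK1 : 1 ≤ K := le_max_right _ _
  have hn : ∀ (n : ℕ) (y : E), ‖y‖ ≤ 1 / 2 → ∀ x, ω (x + n • y) ≤ K ^ n * ω x := by
    intro n y hy
    induction n with
    | zero => simp
    | succ n ih =>
      intro x
      have h1 := hsmall y hy (x + n • y)
      have e : x + n • y + y = x + (n + 1) • y := by rw [succ_nsmul, add_assoc]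
      rw [e] at h1
      have := hω.pos (x + n • y)
      calc _ ≤ _ := h1
        _ ≤ K * (K ^ n * ω x) := by
          gcongr
          · exact le_max_left _ _
          · exact ih x
        _ = _ := by ring
  refine ⟨2 * Real.log K, K, mul_nonneg (by norm_num) (Real.log_nonneg hK1), hK1, fun x y => ?_⟩
  set n := ⌈2 * ‖y‖⌉₊ with hnd
  have hx := hω.pos x
  have hKn : K ^ n ≤ K * Real.exp (2 * Real.log K * ‖y‖) := by
    have h1 : (n : ℝ) ≤ 2 * ‖y‖ + 1 := (Nat.ceil_lt_add_one (by positivity)).le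
    calc K ^ n = Real.exp (Real.log K * n) := by
          rw [mul_comm, Real.exp_nat_mul, Real.exp_log (by linarith)]
      _ ≤ Real.exp (Real.log K + 2 * Real.log K * ‖y‖) := by
          apply Real.exp_le_exp.mpr
          nlinarith [Real.log_nonneg hK1]
      _ = _ := by rw [Real.exp_add, Real.exp_log (by linarith)]
  rcases Nat.eq_zero_or_pos n with h0 | h0
  · have : ‖y‖ ≤ 0 := by
      have := Nat.ceil_eq_zero.mp (hnd ▸ h0)
      linarith
    have hy : y = 0 := norm_le_zero_iff.mp this
    subst hy
    simp only [add_zero, norm_zero, mul_zero, Real.exp_zero, mul_one]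
    exact le_mul_of_one_le_left hx.le hK1
  · have hn0 : (0 : ℝ) < n := by exact_mod_cast h0
    have h2 : ‖(n : ℝ)⁻¹ • y‖ ≤ 1 / 2 := by
      rw [norm_smul, Real.norm_of_nonneg (by positivity), inv_mul_le_iff₀ hn0]
      have := Nat.le_ceil (2 * ‖y‖)
      rw [← hnd] at this
      linarith
    have h3 := hn n _ h2 x
    have e : n • ((n : ℝ)⁻¹ • y) = y := by
      rw [← Nat.cast_smul_eq_nsmul ℝ, smul_smul, mul_inv_cancel₀ hn0.ne', one_smul]
    rw [e] at h3
    exact h3.trans (by gcongr)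

/-- A moderate weight is equivalent to a weight whose logarithm is Lipschitz continuous. -/
theorem IsModerateWeight.exists_isLogLip {ω : E → ℝ} (hω : IsModerateWeight ω) :
    ∃ (ω' : E → ℝ) (c K : ℝ), IsLogLip c ω' ∧ 1 ≤ K ∧ (∀ x, ω' x ≤ ω x) ∧
      ∀ x, ω x ≤ K * ω' x := by
  obtain ⟨c, K, hc, hK, h⟩ := hω.exists_exp
  have hK0 : 0 < K := by linarith
  have hbdd : ∀ x, BddBelow (Set.range fun y => ω y * Real.exp (c * ‖x - y‖)) := fun x =>
    ⟨0, by rintro _ ⟨y, rfl⟩; exact mul_nonneg (hω.pos y).le (Real.exp_pos _).le⟩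
  have hlow : ∀ x, ω x / K ≤ ⨅ y, ω y * Real.exp (c * ‖x - y‖) := by
    intro x
    refine le_ciInf fun y => ?_
    rw [div_le_iff₀ hK0]
    have := h y (x - y)
    rw [add_sub_cancel] at this
    linarith
  refine ⟨fun x => ⨅ y, ω y * Real.exp (c * ‖x - y‖), c, K, ⟨hc, fun x => ?_, fun x z => ?_⟩, hK,
    fun x => ?_, fun x => ?_⟩
  · exact lt_of_lt_of_le (div_pos (hω.pos x) hK0) (hlow x)
  · rw [← div_le_iff₀ (Real.exp_pos _)]
    refine le_ciInf fun y => ?_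
    rw [div_le_iff₀ (Real.exp_pos _)]
    refine (ciInf_le (hbdd x) y).trans ?_
    rw [mul_assoc, ← Real.exp_add, ← mul_add]
    have := (hω.pos y).le
    have h3 : ‖x - y‖ ≤ ‖z - y‖ + ‖x - z‖ := by
      have := norm_add_le (z - y) (x - z)
      rwa [show z - y + (x - z) = x - y by abel] at this
    gcongr
  · have := ciInf_le (hbdd x) x
    simpa using this
  · have := hlow x
    rw [div_le_iff₀ hK0] at this
    linarith

end Weights

/-! ### Local estimates for functions with a Gaussian reproducing inequality -/

section LocalBounds

/-- The exponential function, with values in `[0, ∞]`. -/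
def ex (x : ℝ) : ℝ≥0∞ := ENNReal.ofReal (Real.exp x)

theorem ex_add (x y : ℝ) : ex (x + y) = ex x * ex y := by
  rw [ex, Real.exp_add, ENNReal.ofReal_mul (Real.exp_pos _).le]; rfl

theorem ex_mono {x y : ℝ} (h : x ≤ y) : ex x ≤ ex y :=
  ENNReal.ofReal_le_ofReal (Real.exp_le_exp.mpr h)

theorem ex_ne_top (x : ℝ) : ex x ≠ ∞ := ENNReal.ofReal_ne_top

theorem ex_ne_zero (x : ℝ) : ex x ≠ 0 := (ENNReal.ofReal_pos.mpr (Real.exp_pos _)).ne'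

@[simp] theorem ex_zero : ex 0 = 1 := by simp [ex]

theorem ex_rpow (x p : ℝ) : ex x ^ p = ex (p * x) := by
  rw [ex, ENNReal.ofReal_rpow_of_pos (Real.exp_pos _), ← Real.exp_mul, mul_comm]; rfl

theorem ex_neg_mul_ex (x : ℝ) : ex (-x) * ex x = 1 := by rw [← ex_add]; simp

theorem ex_neg_sq_le {r : ℝ} (hr : 0 < r) (s x : ℝ) :
    ex (-(r * x ^ 2)) ≤ ex (s ^ 2 / (4 * r)) * ex (-(s * x)) := by
  rw [← ex_add]
  refine ex_mono ?_
  have := exp_neg_sq_le hr s x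
  rw [← Real.exp_add] at this
  exact Real.exp_le_exp.mp this

@[fun_prop] theorem measurable_ex : Measurable ex :=
  ENNReal.measurable_ofReal.comp Real.measurable_exp

theorem continuous_ex : Continuous ex := ENNReal.continuous_ofReal.comp Real.continuous_exp

theorem lintegral_ex_lt_top {E : Type*} [MeasurableSpace E] {μ : Measure E} {f : E → ℝ} (hf : Integrable (fun z => Real.exp (f z)) μ) :
    ∫⁻ z, ex (f z) ∂μ < ∞ := by
  have := hf.lintegral_lt_top
  exact this

variable {E : Type*} [NormedAddCommGroup E]

/-- The maximal function `sup_w f(w) e^{-s|z-w|}`: the least majorant of `f` which varies by a factor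
of at most `e^{s|z-z'|}` between `z` and `z'`. -/
def sharp (s : ℝ) (f : E → ℝ≥0∞) (z : E) : ℝ≥0∞ := ⨆ w, f w * ex (-(s * ‖z - w‖))

theorem le_sharp (s : ℝ) (f : E → ℝ≥0∞) (z : E) : f z ≤ sharp s f z := by
  refine le_trans ?_ (le_iSup _ z)
  simp

theorem sharp_le {s : ℝ} (hs : 0 ≤ s) (f : E → ℝ≥0∞) (z z' : E) :
    sharp s f z ≤ ex (s * ‖z - z'‖) * sharp s f z' := by
  refine iSup_le fun w => ?_
  calc f w * ex (-(s * ‖z - w‖)) ≤ f w * (ex (s * ‖z - z'‖) * ex (-(s * ‖z' - w‖))) := by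
        rw [← ex_add]
        refine mul_le_mul_right (ex_mono ?_) _
        have h3 : ‖z' - w‖ ≤ ‖z - z'‖ + ‖z - w‖ := by
          have := norm_sub_le (z - w) (z - z')
          rw [show z - w - (z - z') = z' - w by abel] at this
          linarith
        nlinarith
    _ = ex (s * ‖z - z'‖) * (f w * ex (-(s * ‖z' - w‖))) := by ring
    _ ≤ _ := mul_le_mul_right (le_iSup (fun w => f w * ex (-(s * ‖z' - w‖))) w) _

variable [MeasurableSpace E] [BorelSpace E]

theorem measurable_sharp (s : ℝ) {f : E → ℝ≥0∞} (hf : ∀ z, f z ≠ ∞) : Measurable (sharp s f) := by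
  refine LowerSemicontinuous.measurable (lowerSemicontinuous_iSup fun w => ?_)
  refine Continuous.lowerSemicontinuous (ENNReal.continuous_const_mul (hf w) |>.comp ?_)
  exact continuous_ex.comp (by fun_prop)

variable [NormedSpace ℝ E] [FiniteDimensional ℝ E] (μ : Measure E) [μ.IsAddHaarMeasure]

theorem lintegral_ex_neg_norm {s : ℝ} (hs : 0 < s) : ∫⁻ z, ex (-(s * ‖z‖)) ∂μ < ∞ :=
  lintegral_ex_lt_top (integrable_exp_neg_norm μ hs)

theorem lintegral_ex_neg_norm_sq {r : ℝ} (hr : 0 < r) : ∫⁻ z, ex (-(r * ‖z‖ ^ 2)) ∂μ < ∞ :=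
  lintegral_ex_lt_top (integrable_exp_neg_norm_sq μ hr)

theorem lintegral_ex_mul_gauss (s : ℝ) {r : ℝ} (hr : 0 < r) :
    ∫⁻ z, ex (s * ‖z‖) * ex (-(r * ‖z‖ ^ 2)) ∂μ < ∞ := by
  simp only [← ex_add]
  refine lintegral_ex_lt_top ?_
  simp only [Real.exp_add]
  exact integrable_exp_mul_gauss μ s hr

/-- If `g` satisfies a Gaussian reproducing inequality, then its values are controlled by `p`-th means
for every `p > 0`. For `p ≥ 1` this is Hölder's inequality. For `p < 1` write `g = g^p g^(1-p)` and
absorb `g^(1-p)` into the Gaussian maximal function of `g`, which is finite by the growth assumption;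
the aperture `a` of the maximal function and the loss `1 + p` in the triangle inequality for squares
are such that `a (1 - p) < a / (1 + p)`. -/
theorem exists_local_bound {r : ℝ} (hr : 0 < r) {p : ℝ} (hp : 0 < p) {C₀ : ℝ≥0∞} (hC₀ : C₀ ≠ ∞)
    (t : ℝ) : ∃ C : ℝ≥0∞, C ≠ ∞ ∧ ∀ g : E → ℝ≥0∞, Measurable g →
      (∀ z, g z ≤ C₀ * ∫⁻ w, g w * ex (-(r * ‖z - w‖ ^ 2)) ∂μ) →
      (∀ ε > 0, ∃ K : ℝ≥0∞, K ≠ ∞ ∧ ∀ z, g z ≤ K * ex (ε * ‖z‖ ^ 2)) →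
      ∀ z, g z ^ p ≤ C * ∫⁻ w, g w ^ p * ex (-(t * ‖z - w‖)) ∂μ := by
  -- it suffices to have some Gaussian on the right-hand side
  suffices ∃ C : ℝ≥0∞, ∃ b : ℝ, C ≠ ∞ ∧ 0 < b ∧ ∀ g : E → ℝ≥0∞, Measurable g →
      (∀ z, g z ≤ C₀ * ∫⁻ w, g w * ex (-(r * ‖z - w‖ ^ 2)) ∂μ) →
      (∀ ε > 0, ∃ K : ℝ≥0∞, K ≠ ∞ ∧ ∀ z, g z ≤ K * ex (ε * ‖z‖ ^ 2)) →
      ∀ z, g z ^ p ≤ C * ∫⁻ w, g w ^ p * ex (-(b * ‖z - w‖ ^ 2)) ∂μ by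
    obtain ⟨C, b, hC, hb, H⟩ := this
    refine ⟨C * ex (t ^ 2 / (4 * b)), ENNReal.mul_ne_top hC (ex_ne_top _), fun g hg h1 h2 z => ?_⟩
    refine (H g hg h1 h2 z).trans ?_
    rw [mul_assoc, ← lintegral_const_mul' _ _ (ex_ne_top _)]
    gcongr C * ?_
    refine lintegral_mono fun w => ?_
    calc _ ≤ g w ^ p * (ex (t ^ 2 / (4 * b)) * ex (-(t * ‖z - w‖))) :=
          mul_le_mul_right (ex_neg_sq_le hb _ _) _
      _ = _ := by ring
  rcases lt_trichotomy p 1 with hp1 | hp1 | hp1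
  · set a := r * p / 2 with ha
    have ha0 : 0 < a := by positivity
    set b := a * (p ^ 2 / (1 + p)) with hb
    refine ⟨C₀, b, hC₀, by positivity, fun g hg h1 h2 z => ?_⟩
    set M := ⨆ w, g w * ex (-(a * ‖z - w‖ ^ 2)) with hM
    have hgM : ∀ w, g w ≤ M * ex (a * ‖z - w‖ ^ 2) := by
      intro w
      calc g w = g w * ex (-(a * ‖z - w‖ ^ 2)) * ex (a * ‖z - w‖ ^ 2) := by
            rw [mul_assoc, ex_neg_mul_ex, mul_one]
        _ ≤ _ := mul_le_mul_left (le_iSup (fun w => g w * ex (-(a * ‖z - w‖ ^ 2))) w) _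
    have hzM : g z ≤ M := by simpa using hgM z
    have hMtop : M ≠ ∞ := by
      obtain ⟨K, hK, hgK⟩ := h2 (a / 2) (by positivity)
      refine ne_top_of_le_ne_top (ENNReal.mul_ne_top hK (ex_ne_top (a * ‖z‖ ^ 2)))
        (iSup_le fun w => ?_)
      calc _ ≤ K * ex (a / 2 * ‖w‖ ^ 2) * ex (-(a * ‖z - w‖ ^ 2)) := mul_le_mul_left (hgK w) _
        _ ≤ _ := by
          rw [mul_assoc, ← ex_add]
          refine mul_le_mul_right (ex_mono ?_) _
          have := sq_norm_le_two_mul w z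
          rw [norm_sub_rev] at this
          nlinarith
    set I := C₀ * ∫⁻ w, g w ^ p * ex (-(b * ‖z - w‖ ^ 2)) ∂μ with hI
    have hMI : M ≤ M ^ (1 - p) * I := by
      refine iSup_le fun x => ?_
      calc g x * ex (-(a * ‖z - x‖ ^ 2))
          ≤ (C₀ * ∫⁻ w, g w * ex (-(r * ‖x - w‖ ^ 2)) ∂μ) * ex (-(a * ‖z - x‖ ^ 2)) :=
            mul_le_mul_left (h1 x) _
        _ = C₀ * ∫⁻ w, g w * ex (-(r * ‖x - w‖ ^ 2)) * ex (-(a * ‖z - x‖ ^ 2)) ∂μ := by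
            rw [lintegral_mul_const' _ _ (ex_ne_top _), mul_assoc]
        _ ≤ C₀ * ∫⁻ w, M ^ (1 - p) * (g w ^ p * ex (-(b * ‖z - w‖ ^ 2))) ∂μ := by
            gcongr C₀ * ?_
            refine lintegral_mono fun w => ?_
            have e1 : g w = g w ^ p * g w ^ (1 - p) := by
              rcases eq_or_ne (g w) 0 with h0 | h0
              · rw [h0, ENNReal.zero_rpow_of_pos hp, zero_mul]
              · rw [← ENNReal.rpow_add _ _ h0 (ne_top_of_le_ne_top
                  (ENNReal.mul_ne_top hMtop (ex_ne_top _)) (hgM w))]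
                simp
            have e2 : g w ^ (1 - p) ≤ M ^ (1 - p) * ex ((1 - p) * (a * ‖z - w‖ ^ 2)) := by
              rw [← ex_rpow, ← ENNReal.mul_rpow_of_nonneg _ _ (by linarith)]
              exact ENNReal.rpow_le_rpow (hgM w) (by linarith)
            have e3 : ex ((1 - p) * (a * ‖z - w‖ ^ 2)) * ex (-(r * ‖x - w‖ ^ 2)) *
                ex (-(a * ‖z - x‖ ^ 2)) ≤ ex (-(b * ‖z - w‖ ^ 2)) := by
              rw [← ex_add, ← ex_add]
              refine ex_mono ?_
              have h3 : ‖z - w‖ ≤ ‖z - x‖ + ‖x - w‖ := norm_sub_le_norm_sub_add_norm_sub _ _ _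
              have h4 : ‖z - w‖ ^ 2 ≤ (1 + p) * ‖z - x‖ ^ 2 + (1 + 1 / p) * ‖x - w‖ ^ 2 := by
                have h5 : 0 ≤ (p * ‖z - x‖ - ‖x - w‖) ^ 2 / p := by positivity
                have h6 : (p * ‖z - x‖ - ‖x - w‖) ^ 2 / p = p * ‖z - x‖ ^ 2
                    - 2 * ‖z - x‖ * ‖x - w‖ + 1 / p * ‖x - w‖ ^ 2 := by
                      field_simp; ring
                nlinarith [norm_nonneg (z - w)]
              have h7 : a / (1 + p) * ‖z - w‖ ^ 2 ≤ a * ‖z - x‖ ^ 2 + r * ‖x - w‖ ^ 2 := by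
                rw [div_mul_eq_mul_div, div_le_iff₀ (by positivity)]
                have e5 : a * (1 + 1 / p) = r * (1 + p) / 2 := by rw [ha]; field_simp; ring
                calc a * ‖z - w‖ ^ 2
                    ≤ a * ((1 + p) * ‖z - x‖ ^ 2 + (1 + 1 / p) * ‖x - w‖ ^ 2) := by gcongr
                  _ = a * (1 + p) * ‖z - x‖ ^ 2 + r * (1 + p) / 2 * ‖x - w‖ ^ 2 := by
                      rw [← e5]; ring
                  _ ≤ _ := by
                      have : 0 ≤ r * (1 + p) / 2 * ‖x - w‖ ^ 2 := by positivity
                      linarith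
              have h8 : (1 - p) * a + b = a / (1 + p) := by rw [hb]; field_simp; ring
              have h9 : (1 - p) * (a * ‖z - w‖ ^ 2) + b * ‖z - w‖ ^ 2 = a / (1 + p) * ‖z - w‖ ^ 2 := by
                rw [← h8]; ring
              linarith
            calc g w * ex (-(r * ‖x - w‖ ^ 2)) * ex (-(a * ‖z - x‖ ^ 2))
                = g w ^ p * g w ^ (1 - p) * ex (-(r * ‖x - w‖ ^ 2)) * ex (-(a * ‖z - x‖ ^ 2)) := by
                  rw [← e1]
              _ ≤ g w ^ p * (M ^ (1 - p) * ex ((1 - p) * (a * ‖z - w‖ ^ 2))) *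
                  ex (-(r * ‖x - w‖ ^ 2)) * ex (-(a * ‖z - x‖ ^ 2)) := by gcongr
              _ = M ^ (1 - p) * g w ^ p * (ex ((1 - p) * (a * ‖z - w‖ ^ 2)) *
                  ex (-(r * ‖x - w‖ ^ 2)) * ex (-(a * ‖z - x‖ ^ 2))) := by ring
              _ ≤ M ^ (1 - p) * g w ^ p * ex (-(b * ‖z - w‖ ^ 2)) := by gcongr
              _ = _ := by ring
        _ = _ := by
            rw [lintegral_const_mul' _ _ (ENNReal.rpow_ne_top_of_nonneg (by linarith) hMtop)]
            ring
    refine (ENNReal.rpow_le_rpow hzM hp.le).trans ?_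
    rcases eq_or_ne M 0 with h0 | h0
    · rw [h0, ENNReal.zero_rpow_of_pos hp]; exact zero_le
    · have e : M ^ p * M ^ (1 - p) = M := by
        rw [← ENNReal.rpow_add _ _ h0 hMtop]; simp
      have h3 : M ^ (1 - p) ≠ 0 := by
        simp [h0, hMtop]
      have h4 : M ^ (1 - p) ≠ ∞ := ENNReal.rpow_ne_top_of_nonneg (by linarith) hMtop
      rw [← ENNReal.mul_le_mul_iff_left h3 h4, e]
      rw [mul_comm] at hMI
      exact hMI
  · subst hp1
    refine ⟨C₀, r, hC₀, hr, fun g hg h1 h2 z => ?_⟩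
    simpa using h1 z
  · set q := p.conjExponent with hq
    have hpq : p.HolderConjugate q := Real.HolderConjugate.conjExponent hp1
    set I := ∫⁻ w : E, ex (-(r * ‖w‖ ^ 2)) ∂μ with hI
    have hIt : I < ∞ := lintegral_ex_neg_norm_sq μ hr
    refine ⟨C₀ ^ p * (I ^ (1 / q)) ^ p, r, ?_, hr, fun g hg h1 h2 z => ?_⟩
    · exact ENNReal.mul_ne_top (ENNReal.rpow_ne_top_of_nonneg hp.le hC₀)
        (ENNReal.rpow_ne_top_of_nonneg hp.le (ENNReal.rpow_ne_top_of_nonneg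
          (by have := hpq.symm.pos; positivity) hIt.ne))
    have hI' : ∫⁻ w, ex (-(r * ‖z - w‖ ^ 2)) ∂μ = I :=
      lintegral_sub_left_eq_self (fun w => ex (-(r * ‖w‖ ^ 2))) z
    have hq0 := hpq.symm.pos
    have hold := ENNReal.lintegral_mul_le_Lp_mul_Lq μ hpq
      (f := fun w => g w * ex (-(r / p * ‖z - w‖ ^ 2))) (g := fun w => ex (-(r / q * ‖z - w‖ ^ 2)))
      (by fun_prop) (by fun_prop)
    have e1 : ∀ w, (g w * ex (-(r / p * ‖z - w‖ ^ 2))) ^ p = g w ^ p * ex (-(r * ‖z - w‖ ^ 2)) := by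
      intro w
      rw [ENNReal.mul_rpow_of_nonneg _ _ hp.le, ex_rpow]
      congr 2
      field_simp
    have e2 : ∀ w, ex (-(r / q * ‖z - w‖ ^ 2)) ^ q = ex (-(r * ‖z - w‖ ^ 2)) := by
      intro w
      rw [ex_rpow]
      congr 1
      field_simp
    have e3 : ∀ w, g w * ex (-(r / p * ‖z - w‖ ^ 2)) * ex (-(r / q * ‖z - w‖ ^ 2))
        = g w * ex (-(r * ‖z - w‖ ^ 2)) := by
      intro w
      rw [mul_assoc, ← ex_add]
      congr 2
      have := hpq.inv_add_inv_eq_one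
      calc _ = -(r * (p⁻¹ + q⁻¹) * ‖z - w‖ ^ 2) := by ring
        _ = _ := by rw [this, mul_one]
    simp only [Pi.mul_apply, e1, e2, e3, hI'] at hold
    calc g z ^ p ≤ (C₀ * ((∫⁻ w, g w ^ p * ex (-(r * ‖z - w‖ ^ 2)) ∂μ) ^ (1 / p) * I ^ (1 / q))) ^ p :=
          ENNReal.rpow_le_rpow ((h1 z).trans (mul_le_mul_right hold _)) hp.le
      _ = _ := by
          rw [ENNReal.mul_rpow_of_nonneg _ _ hp.le, ENNReal.mul_rpow_of_nonneg _ _ hp.le,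
            ← ENNReal.rpow_mul, one_div_mul_cancel hp.ne', ENNReal.rpow_one]
          ring

end LocalBounds

/-! ### Maximal functions of short-time Fourier transforms -/

section Maximal

theorem IsLogLip.ofReal_le {E : Type*} [NormedAddCommGroup E] {c : ℝ} {ω : E → ℝ}
    (h : IsLogLip c ω) (x y : E) :
    ENNReal.ofReal (ω x) ≤ ENNReal.ofReal (ω y) * ex (c * ‖x - y‖) := by
  rw [ex, ← ENNReal.ofReal_mul (h.pos y).le]
  exact ENNReal.ofReal_le_ofReal (h.le_mul x y)

variable {V : Type*} [NormedAddCommGroup V] [InnerProductSpace ℝ V]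

/-- The absolute value of the short-time Fourier transform, without normalizing factor. -/
def absStft (Ψ : GelfandShilov V) (u : GSDist V) (z : V × V) : ℝ≥0∞ :=
  ‖u.1 (gsConj (tfShift z.1 z.2 Ψ))‖ₑ

theorem absStft_ne_top (Ψ : GelfandShilov V) (u : GSDist V) (z : V × V) :
    absStft Ψ u z ≠ ∞ := enorm_ne_top

/-- The constant `(2π)^{-n/2}` in the definition of the short-time Fourier transform. -/
theorem enorm_stft (Φ : GelfandShilov V) (u : GSDist V) (z : V × V) :
    ‖stft Φ u z‖ₑ = ENNReal.ofReal ((2 * Real.pi) ^ (-(Module.finrank ℝ V : ℝ) / 2)) *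
      absStft Φ u z := by
  rw [stft, enorm_mul, absStft, ← ofReal_norm (Complex.ofReal _), Complex.norm_real,
    Real.norm_of_nonneg (by positivity)]

variable [FiniteDimensional ℝ V] [MeasurableSpace V] [BorelSpace V]

theorem measurable_absStft (Ψ : GelfandShilov V) (u : GSDist V) : Measurable (absStft Ψ u) :=
  (stronglyMeasurable_gsDist_tfShift u Ψ).enorm

/-- Change of window: the short-time Fourier transforms with two windows are related by convolution
with a Gaussian, also in the presence of a weight. -/
theorem exists_absStft_le {c : ℝ} {ω : V × V → ℝ} (hω : IsLogLip c ω) (Ψ : GelfandShilov V)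
    {Φ : GelfandShilov V} (hΦ : Φ ≠ 0) :
    ∃ (C : ℝ≥0∞) (r : ℝ), C ≠ ∞ ∧ 0 < r ∧ ∀ (u : GSDist V) (z : V × V),
      absStft Ψ u z * ENNReal.ofReal (ω z) ≤
        C * ∫⁻ w, absStft Φ u w * ENNReal.ofReal (ω w) * ex (-(r * ‖z - w‖ ^ 2)) := by
  obtain ⟨K, ρ, hρ, hK, hb⟩ := exists_ana_tfShift_le Φ Ψ
  set W := windowConst Φ with hW
  have hW0 : 0 < W := windowConst_pos hΦ
  set A := ENNReal.ofReal W with hA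
  have hA0 : A ≠ 0 := (ENNReal.ofReal_pos.mpr hW0).ne'
  have hAt : A ≠ ∞ := ENNReal.ofReal_ne_top
  set L := ENNReal.ofReal K * ex (c ^ 2 / (4 * (ρ / 2))) with hL
  have hLt : L ≠ ∞ := ENNReal.mul_ne_top ENNReal.ofReal_ne_top (ex_ne_top _)
  refine ⟨A⁻¹ * L, ρ / 2, ENNReal.mul_ne_top (ENNReal.inv_ne_top.mpr hA0) hLt, by positivity,
    fun u z => ?_⟩
  have h1 := (gsDist_expansion Φ u (gsConj (tfShift z.1 z.2 Ψ))).2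
  have h2 : A * absStft Ψ u z ≤
      ∫⁻ w, absStft Φ u w * (ENNReal.ofReal K * ex (-(ρ * ‖w - z‖ ^ 2))) := by
    have e : A * absStft Ψ u z = ‖(W : ℂ) * u.1 (gsConj (tfShift z.1 z.2 Ψ))‖ₑ := by
      rw [enorm_mul, absStft, hA]
      congr 1
      rw [← ofReal_norm, Complex.norm_real, Real.norm_of_nonneg hW0.le]
    rw [e, ← h1]
    refine (enorm_integral_le_lintegral_enorm _).trans (lintegral_mono fun w => ?_)
    rw [enorm_mul]
    refine mul_le_mul_right ?_ _
    rw [← ofReal_norm, ex, ← ENNReal.ofReal_mul hK]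
    exact ENNReal.ofReal_le_ofReal (hb z w)
  calc absStft Ψ u z * ENNReal.ofReal (ω z)
      = A⁻¹ * (A * absStft Ψ u z) * ENNReal.ofReal (ω z) := by
        rw [← mul_assoc, ENNReal.inv_mul_cancel hA0 hAt, one_mul]
    _ ≤ A⁻¹ * (∫⁻ w, absStft Φ u w * (ENNReal.ofReal K * ex (-(ρ * ‖w - z‖ ^ 2)))) *
        ENNReal.ofReal (ω z) := by gcongr
    _ = A⁻¹ * ∫⁻ w, absStft Φ u w * (ENNReal.ofReal K * ex (-(ρ * ‖w - z‖ ^ 2))) *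
        ENNReal.ofReal (ω z) := by
        rw [lintegral_mul_const' _ _ ENNReal.ofReal_ne_top, mul_assoc]
    _ ≤ A⁻¹ * ∫⁻ w, L * (absStft Φ u w * ENNReal.ofReal (ω w) *
        ex (-(ρ / 2 * ‖z - w‖ ^ 2))) := by
        gcongr A⁻¹ * ?_
        refine lintegral_mono fun w => ?_
        have h3 : ex (-(ρ * ‖w - z‖ ^ 2)) * ex (c * ‖z - w‖) ≤
            ex (c ^ 2 / (4 * (ρ / 2))) * ex (-(ρ / 2 * ‖z - w‖ ^ 2)) := by
          rw [norm_sub_rev w z, ← ex_add, ← ex_add]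
          refine ex_mono ?_
          have := exp_sub_sq_le (r := ρ / 2) (by positivity) c ‖z - w‖
          rw [← Real.exp_add] at this
          have := Real.exp_le_exp.mp this
          linarith
        calc _ ≤ absStft Φ u w * (ENNReal.ofReal K * ex (-(ρ * ‖w - z‖ ^ 2))) *
              (ENNReal.ofReal (ω w) * ex (c * ‖z - w‖)) :=
              mul_le_mul_right (hω.ofReal_le z w) _
          _ = ENNReal.ofReal K * (absStft Φ u w * ENNReal.ofReal (ω w)) *
              (ex (-(ρ * ‖w - z‖ ^ 2)) * ex (c * ‖z - w‖)) := by ring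
          _ ≤ ENNReal.ofReal K * (absStft Φ u w * ENNReal.ofReal (ω w)) *
              (ex (c ^ 2 / (4 * (ρ / 2))) * ex (-(ρ / 2 * ‖z - w‖ ^ 2))) := by gcongr
          _ = _ := by rw [hL]; ring
    _ = _ := by rw [lintegral_const_mul' _ _ hLt]; ring

theorem eLpNorm_ennreal {E : Type*} [MeasurableSpace E] {μ : Measure E} (f : E → ℝ≥0∞)
    {q : ℝ≥0∞} (hq : q ≠ 0) (hq' : q ≠ ∞) :
    eLpNorm f q μ = (∫⁻ z, f z ^ q.toReal ∂μ) ^ (1 / q.toReal) := by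
  rw [eLpNorm_eq_lintegral_rpow_enorm_toReal hq hq']
  simp

theorem ae_le_eLpNorm_top {E : Type*} [MeasurableSpace E] {μ : Measure E} (f : E → ℝ≥0∞) :
    ∀ᵐ z ∂μ, f z ≤ eLpNorm f ∞ μ := by
  rw [eLpNorm_exponent_top]
  filter_upwards [ae_le_eLpNormEssSup (f := f) (μ := μ)] with z hz
  simpa using hz

/-- Weighted `L^q` quasi-norms of the maximal function of a short-time Fourier transform are
controlled by the weighted `L^q` quasi-norms of the short-time Fourier transform with any other
window, for all `0 < q ≤ ∞`. -/
theorem exists_eLpNorm_sharp_le {c : ℝ} {ω : V × V → ℝ} (hω : IsLogLip c ω) (Ψ : GelfandShilov V)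
    {Φ : GelfandShilov V} (hΦ : Φ ≠ 0) {q : ℝ≥0∞} (hq : q ≠ 0) {s : ℝ} (hs : c + 1 ≤ s) :
    ∃ C : ℝ≥0∞, C ≠ ∞ ∧ ∀ u : GSDist V,
      eLpNorm (fun z => sharp s (absStft Ψ u) z * ENNReal.ofReal (ω z)) q volume ≤
        C * eLpNorm (fun z => absStft Φ u z * ENNReal.ofReal (ω z)) q volume := by
  obtain ⟨C₁, r₁, hC₁, hr₁, h₁⟩ := exists_absStft_le hω Ψ hΦ
  have hsh : ∀ u z, sharp s (absStft Ψ u) z * ENNReal.ofReal (ω z) ≤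
      ⨆ w, (absStft Ψ u w * ENNReal.ofReal (ω w)) * ex (-(1 * ‖z - w‖)) := by
    intro u z
    rw [sharp, ENNReal.iSup_mul]
    refine iSup_mono fun w => ?_
    calc _ ≤ absStft Ψ u w * ex (-(s * ‖z - w‖)) *
          (ENNReal.ofReal (ω w) * ex (c * ‖z - w‖)) := mul_le_mul_right (hω.ofReal_le z w) _
      _ = absStft Ψ u w * ENNReal.ofReal (ω w) * (ex (-(s * ‖z - w‖) + c * ‖z - w‖)) := by
          rw [ex_add]; ring
      _ ≤ _ := by
          refine mul_le_mul_right (ex_mono ?_) _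
          nlinarith [norm_nonneg (z - w)]
  have hωm : Measurable fun z => ENNReal.ofReal (ω z) :=
    ENNReal.measurable_ofReal.comp hω.continuous.measurable
  rcases eq_or_ne q ∞ with rfl | hqt
  · refine ⟨C₁ * ∫⁻ w : V × V, ex (-(r₁ * ‖w‖ ^ 2)), ENNReal.mul_ne_top hC₁
      (lintegral_ex_neg_norm_sq _ hr₁).ne, fun u => ?_⟩
    set G : V × V → ℝ≥0∞ := fun z => absStft Φ u z * ENNReal.ofReal (ω z) with hG
    have hall : ∀ z, sharp s (absStft Ψ u) z * ENNReal.ofReal (ω z) ≤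
        C₁ * (∫⁻ w : V × V, ex (-(r₁ * ‖w‖ ^ 2))) * eLpNorm G ∞ volume := by
      intro z
      refine (hsh u z).trans (iSup_le fun w => ?_)
      calc _ ≤ absStft Ψ u w * ENNReal.ofReal (ω w) := by
            refine mul_le_of_le_one_right zero_le ?_
            rw [← ex_zero]
            refine ex_mono ?_
            simp
        _ ≤ _ := h₁ u w
        _ ≤ C₁ * ∫⁻ y, eLpNorm G ∞ volume * ex (-(r₁ * ‖w - y‖ ^ 2)) := by
            gcongr C₁ * ?_
            refine lintegral_mono_ae ?_
            filter_upwards [ae_le_eLpNorm_top (μ := volume) G] with y hy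
            gcongr
        _ = _ := by
            rw [lintegral_const_mul _ (by fun_prop),
              lintegral_sub_left_eq_self (fun y : V × V => ex (-(r₁ * ‖y‖ ^ 2))) w]
            ring
    rw [eLpNorm_exponent_top]
    refine eLpNormEssSup_le_of_ae_enorm_bound (Eventually.of_forall fun z => ?_)
    simpa using hall z
  set p := q.toReal with hp
  have hp0 : 0 < p := ENNReal.toReal_pos hq hqt
  obtain ⟨C₀, r₀, hC₀, hr₀, h₀⟩ := exists_absStft_le hω Φ hΦ
  obtain ⟨C, hC, hloc⟩ := exists_local_bound (volume : Measure (V × V)) hr₀ hp0 hC₀ p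
  set I := ∫⁻ y : V × V, ex (1 * ‖y‖) * ex (-(r₁ * ‖y‖ ^ 2)) with hI
  have hIt : I ≠ ∞ := (lintegral_ex_mul_gauss _ 1 hr₁).ne
  set J := ∫⁻ y : V × V, ex (-(p * ‖y‖)) with hJ
  have hJt : J ≠ ∞ := (lintegral_ex_neg_norm _ hp0).ne
  refine ⟨C₁ * I * C ^ (1 / p) * J ^ (1 / p), ?_, fun u => ?_⟩
  · exact ENNReal.mul_ne_top (ENNReal.mul_ne_top (ENNReal.mul_ne_top hC₁ hIt)
      (ENNReal.rpow_ne_top_of_nonneg (by positivity) hC))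
      (ENNReal.rpow_ne_top_of_nonneg (by positivity) hJt)
  set G : V × V → ℝ≥0∞ := fun z => absStft Φ u z * ENNReal.ofReal (ω z) with hG
  have hGm : Measurable G := (measurable_absStft Φ u).mul hωm
  have hgrow : ∀ ε > 0, ∃ K : ℝ≥0∞, K ≠ ∞ ∧ ∀ z, G z ≤ K * ex (ε * ‖z‖ ^ 2) := by
    intro ε hε
    obtain ⟨K, hK, hb⟩ := gsDist_growth u Φ (ε := ε / 2) (by positivity)
    refine ⟨ENNReal.ofReal K * (ENNReal.ofReal (ω 0) * ex (c ^ 2 / (4 * (ε / 2)))),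
      ENNReal.mul_ne_top ENNReal.ofReal_ne_top (ENNReal.mul_ne_top ENNReal.ofReal_ne_top
        (ex_ne_top _)), fun z => ?_⟩
    have h1 : absStft Φ u z ≤ ENNReal.ofReal K * ex (ε / 2 * ‖z‖ ^ 2) := by
      rw [absStft, ex, ← ENNReal.ofReal_mul hK, ← ofReal_norm]
      exact ENNReal.ofReal_le_ofReal (hb z)
    have h2 := hω.ofReal_le z 0
    rw [sub_zero] at h2
    calc G z ≤ (ENNReal.ofReal K * ex (ε / 2 * ‖z‖ ^ 2)) *
          (ENNReal.ofReal (ω 0) * ex (c * ‖z‖)) := mul_le_mul' h1 h2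
      _ = ENNReal.ofReal K * (ENNReal.ofReal (ω 0) * (ex (ε / 2 * ‖z‖ ^ 2 + c * ‖z‖))) := by
          rw [ex_add]; ring
      _ ≤ ENNReal.ofReal K * (ENNReal.ofReal (ω 0) *
          ex (c ^ 2 / (4 * (ε / 2)) + ε * ‖z‖ ^ 2)) := by
          gcongr _ * (_ * ?_)
          refine ex_mono ?_
          have := exp_sub_sq_le (r := ε / 2) (by positivity) c ‖z‖
          rw [← Real.exp_add] at this
          have := Real.exp_le_exp.mp this
          linarith
      _ = _ := by rw [ex_add]; ring
  have hl := hloc G hGm (h₀ u) hgrow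
  set N : V × V → ℝ≥0∞ := fun z => ∫⁻ w, G w ^ p * ex (-(p * ‖z - w‖)) with hN
  have hGN : ∀ z y, G y ≤ (C * N z) ^ (1 / p) * ex (1 * ‖z - y‖) := by
    intro z y
    have h1 : G y ^ p ≤ C * N z * ex (p * ‖z - y‖) := by
      refine (hl y).trans ?_
      rw [mul_assoc]
      gcongr C * ?_
      rw [hN, ← lintegral_mul_const' _ _ (ex_ne_top _)]
      refine lintegral_mono fun w => ?_
      rw [mul_assoc, ← ex_add]
      refine mul_le_mul_right (ex_mono ?_) _
      have := norm_sub_le_norm_sub_add_norm_sub z y w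
      nlinarith
    have h2 := ENNReal.rpow_le_rpow h1 (z := 1 / p) (by positivity)
    rw [← ENNReal.rpow_mul, mul_one_div_cancel hp0.ne', ENNReal.rpow_one,
      ENNReal.mul_rpow_of_nonneg _ _ (by positivity), ex_rpow] at h2
    convert h2 using 3
    field_simp
  have hpt : ∀ z, sharp s (absStft Ψ u) z * ENNReal.ofReal (ω z) ≤
      C₁ * I * (C * N z) ^ (1 / p) := by
    intro z
    refine (hsh u z).trans (iSup_le fun w => ?_)
    calc _ ≤ (C₁ * ∫⁻ y, G y * ex (-(r₁ * ‖w - y‖ ^ 2))) * ex (-(1 * ‖z - w‖)) :=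
          mul_le_mul_left (h₁ u w) _
      _ = C₁ * ∫⁻ y, G y * ex (-(r₁ * ‖w - y‖ ^ 2)) * ex (-(1 * ‖z - w‖)) := by
          rw [lintegral_mul_const' _ _ (ex_ne_top _), mul_assoc]
      _ ≤ C₁ * ∫⁻ y, (C * N z) ^ (1 / p) * (ex (1 * ‖w - y‖) * ex (-(r₁ * ‖w - y‖ ^ 2))) := by
          gcongr C₁ * ?_
          refine lintegral_mono fun y => ?_
          calc _ ≤ (C * N z) ^ (1 / p) * ex (1 * ‖z - y‖) * ex (-(r₁ * ‖w - y‖ ^ 2)) *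
                ex (-(1 * ‖z - w‖)) := by
                have := hGN z y
                gcongr
            _ = (C * N z) ^ (1 / p) * ((ex (1 * ‖z - y‖ + -(1 * ‖z - w‖))) *
                ex (-(r₁ * ‖w - y‖ ^ 2))) := by
                rw [ex_add]; ring
            _ ≤ _ := by
                gcongr _ * (?_ * _)
                refine ex_mono ?_
                have := norm_sub_le_norm_sub_add_norm_sub z w y
                linarith
      _ = _ := by
          rw [lintegral_const_mul _ (by fun_prop), lintegral_sub_left_eq_self
            (fun y : V × V => ex (1 * ‖y‖) * ex (-(r₁ * ‖y‖ ^ 2))) w]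
          ring
  have hNint : ∫⁻ z, N z = J * ∫⁻ w, G w ^ p := by
    rw [hN, lintegral_lintegral_swap]
    · rw [← lintegral_const_mul _ (by fun_prop)]
      congr 1
      funext w
      rw [lintegral_const_mul _ (by fun_prop),
        lintegral_sub_right_eq_self (fun y : V × V => ex (-(p * ‖y‖))) w, mul_comm]
    · exact Measurable.aemeasurable (by fun_prop)
  have hmono : eLpNorm (fun z => sharp s (absStft Ψ u) z * ENNReal.ofReal (ω z)) q volume ≤
      eLpNorm (fun z => C₁ * I * (C * N z) ^ (1 / p)) q volume := by
    refine eLpNorm_mono_enorm fun z => ?_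
    simpa using hpt z
  refine hmono.trans ?_
  rw [eLpNorm_ennreal _ hq hqt, eLpNorm_ennreal _ hq hqt, ← hp]
  have e : ∀ z, (C₁ * I * (C * N z) ^ (1 / p)) ^ p = (C₁ * I) ^ p * C * N z := by
    intro z
    rw [ENNReal.mul_rpow_of_nonneg _ _ hp0.le, ← ENNReal.rpow_mul, one_div_mul_cancel hp0.ne',
      ENNReal.rpow_one, mul_assoc]
  simp only [e]
  have ht : (C₁ * I) ^ p * C ≠ ∞ := ENNReal.mul_ne_top
    (ENNReal.rpow_ne_top_of_nonneg hp0.le (ENNReal.mul_ne_top hC₁ hIt)) hC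
  have hL : ((C₁ * I) ^ p) ^ (1 / p) = C₁ * I := by
    rw [← ENNReal.rpow_mul, mul_one_div_cancel hp0.ne', ENNReal.rpow_one]
  have hmul : ∀ a b : ℝ≥0∞, (a * b) ^ (1 / p) = a ^ (1 / p) * b ^ (1 / p) :=
    fun a b => ENNReal.mul_rpow_of_nonneg _ _ (by positivity)
  rw [lintegral_const_mul' _ _ ht, hNint, hmul, hmul _ C, hmul J, hL]
  exact le_of_eq (by ring)

theorem modNorm_eq (Φ : GelfandShilov V) (q : ℝ≥0∞) {ω : V × V → ℝ} (hω : ∀ z, 0 < ω z)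
    (u : GSDist V) : modNorm Φ q ω u =
      eLpNorm (fun z => ENNReal.ofReal ((2 * Real.pi) ^ (-(Module.finrank ℝ V : ℝ) / 2)) *
        (absStft Φ u z * ENNReal.ofReal (ω z))) q volume := by
  refine eLpNorm_congr_enorm_ae (Eventually.of_forall fun z => ?_)
  rw [enorm_mul, enorm_stft, ← ofReal_norm (Complex.ofReal _), Complex.norm_real,
    Real.norm_of_nonneg (hω z).le, enorm_eq_self, mul_assoc]

theorem eLpNorm_ennreal_const_mul {E : Type*} [MeasurableSpace E] {μ : Measure E} (f : E → ℝ≥0∞)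
    {C : ℝ≥0∞} (hC : C ≠ ∞) (q : ℝ≥0∞) :
    eLpNorm (fun z => C * f z) q μ = C * eLpNorm f q μ := by
  rcases eq_or_ne q 0 with rfl | hq
  · simp
  rcases eq_or_ne q ∞ with rfl | hqt
  · simp only [eLpNorm_exponent_top, eLpNormEssSup, enorm_eq_self]
    exact ENNReal.essSup_const_mul
  · rw [eLpNorm_ennreal _ hq hqt, eLpNorm_ennreal _ hq hqt]
    have hp := ENNReal.toReal_pos hq hqt
    simp only [ENNReal.mul_rpow_of_nonneg _ _ hp.le]
    rw [lintegral_const_mul' _ _ (ENNReal.rpow_ne_top_of_nonneg hp.le hC),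
      ENNReal.mul_rpow_of_nonneg _ _ (by positivity), ← ENNReal.rpow_mul,
      mul_one_div_cancel hp.ne', ENNReal.rpow_one]

end Maximal

/-! ### Integral operators between Lebesgue spaces -/

section Lebesgue

/-- A function which varies by at most a factor `e^{s |x - y|}` between `x` and `y`. -/
def IsSlow {E : Type*} [NormedAddCommGroup E] (s : ℝ) (F : E → ℝ≥0∞) : Prop :=
  ∀ x y, F x ≤ F y * ex (s * ‖x - y‖)

/-- For slowly varying functions, `ℓ^q`-like embeddings hold on a continuous space: the `L^1` norm
is controlled by the `L^q` quasi-norm when `q < 1`. -/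
theorem exists_eLpNorm_max_one_le {E : Type*} [NormedAddCommGroup E] [NormedSpace ℝ E]
    [FiniteDimensional ℝ E] [MeasurableSpace E] [BorelSpace E] (μ : Measure E)
    [μ.IsAddHaarMeasure] (s : ℝ) {q : ℝ≥0∞} (hq : q ≠ 0) :
    ∃ C : ℝ≥0∞, C ≠ ∞ ∧ ∀ F : E → ℝ≥0∞, Measurable F → IsSlow s F →
      eLpNorm F (max 1 q) μ ≤ C * eLpNorm F q μ := by
  rcases le_or_gt 1 q with h1 | h1
  · exact ⟨1, ENNReal.one_ne_top, fun F _ _ => by rw [max_eq_right h1, one_mul]⟩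
  have hqt : q ≠ ∞ := (h1.trans ENNReal.one_lt_top).ne
  set p := q.toReal with hp
  have hp0 : 0 < p := ENNReal.toReal_pos hq hqt
  have hp1 : p < 1 := by
    have := (ENNReal.toReal_lt_toReal hqt ENNReal.one_ne_top).mpr h1
    simpa using this
  set b := μ (Metric.ball (0 : E) 1) with hb
  have hb0 : b ≠ 0 := (Metric.measure_ball_pos μ 0 one_pos).ne'
  have hbt : b ≠ ∞ := measure_ball_lt_top.ne
  set D := b⁻¹ * ex (|s| * p) with hD
  have hDt : D ≠ ∞ := ENNReal.mul_ne_top (ENNReal.inv_ne_top.mpr hb0) (ex_ne_top _)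
  set t := (1 - p) / p with ht
  have ht0 : 0 ≤ t := div_nonneg (by linarith) hp0.le
  refine ⟨D ^ t, ENNReal.rpow_ne_top_of_nonneg ht0 hDt, fun F hF hs => ?_⟩
  rw [max_eq_left h1.le, eLpNorm_one_eq_lintegral_enorm, eLpNorm_ennreal F hq hqt, ← hp]
  simp only [enorm_eq_self]
  set A := ∫⁻ x, F x ^ p ∂μ with hA
  have hpt : ∀ x, F x ^ p ≤ D * A := by
    intro x
    have h2 : F x ^ p * b ≤ A * ex (|s| * p) := by
      calc F x ^ p * b = ∫⁻ _ in Metric.ball x 1, F x ^ p ∂μ := by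
            rw [setLIntegral_const, hb, Measure.addHaar_ball_center μ x]
        _ ≤ ∫⁻ y in Metric.ball x 1, F y ^ p * ex (|s| * p) ∂μ := by
            refine setLIntegral_mono' measurableSet_ball fun y hy => ?_
            rw [mul_comm |s|, ← ex_rpow, ← ENNReal.mul_rpow_of_nonneg _ _ hp0.le]
            refine ENNReal.rpow_le_rpow ((hs x y).trans (mul_le_mul_right (ex_mono ?_) _)) hp0.le
            rw [Metric.mem_ball', dist_eq_norm] at hy
            calc s * ‖x - y‖ ≤ |s| * ‖x - y‖ := by
                  gcongr; exact le_abs_self s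
              _ ≤ |s| * 1 := by gcongr
              _ = |s| := mul_one _
        _ ≤ ∫⁻ y, F y ^ p * ex (|s| * p) ∂μ := setLIntegral_le_lintegral _ _
        _ = _ := by rw [lintegral_mul_const' _ _ (ex_ne_top _)]
    calc F x ^ p = b⁻¹ * (F x ^ p * b) := by
          rw [mul_comm (F x ^ p), ← mul_assoc, ENNReal.inv_mul_cancel hb0 hbt, one_mul]
      _ ≤ b⁻¹ * (A * ex (|s| * p)) := by gcongr
      _ = _ := by rw [hD]; ring
  have hF1 : ∀ x, F x ≤ F x ^ p * (D * A) ^ t := by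
    intro x
    calc F x = F x ^ (p + p * t) := by
          rw [ht, mul_div_cancel₀ _ hp0.ne', add_sub_cancel, ENNReal.rpow_one]
      _ = F x ^ p * (F x ^ p) ^ t := by
          rw [ENNReal.rpow_add_of_nonneg _ _ hp0.le (by positivity), ENNReal.rpow_mul]
      _ ≤ _ := mul_le_mul_right (ENNReal.rpow_le_rpow (hpt x) ht0) _
  calc ∫⁻ x, F x ∂μ ≤ ∫⁻ x, F x ^ p * (D * A) ^ t ∂μ := lintegral_mono hF1
    _ = A * (D * A) ^ t := by rw [lintegral_mul_const _ (hF.pow_const p)]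
    _ = D ^ t * (A ^ (1 : ℝ) * A ^ t) := by
        rw [ENNReal.mul_rpow_of_nonneg _ _ ht0, ENNReal.rpow_one]; ring
    _ = D ^ t * A ^ (1 / p) := by
        rw [← ENNReal.rpow_add_of_nonneg _ _ zero_le_one ht0]
        congr 2
        rw [ht]; field_simp; ring

/-- Hölder's inequality for non-negative functions, endpoints included. -/
theorem lintegral_mul_le_eLpNorm_mul_eLpNorm {α : Type*} [MeasurableSpace α] {μ : Measure α}
    {f g : α → ℝ≥0∞} (hf : Measurable f) (hg : Measurable g) {e e' : ℝ≥0∞}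
    (h : ENNReal.HolderConjugate e e') :
    ∫⁻ x, f x * g x ∂μ ≤ eLpNorm f e μ * eLpNorm g e' μ := by
  have key : ∀ f g : α → ℝ≥0∞, Measurable f → ∫⁻ x, f x * g x ∂μ ≤ eLpNorm f 1 μ * eLpNorm g ∞ μ := by
    intro f g hf
    rw [eLpNorm_one_eq_lintegral_enorm, ← lintegral_mul_const _ hf.enorm]
    refine lintegral_mono_ae ?_
    filter_upwards [ae_le_eLpNorm_top (μ := μ) g] with x hx
    rw [enorm_eq_self]
    gcongr
  have e1 : 1 ≤ e := ENNReal.HolderConjugate.one_le e e'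
  have e1' : 1 ≤ e' := ENNReal.HolderConjugate.one_le e' e
  rcases eq_or_ne e ∞ with rfl | he
  · obtain rfl : e' = 1 := (ENNReal.HolderConjugate.eq_top_iff_eq_one ∞ e').mp rfl
    simp only [mul_comm (f _)]
    rw [mul_comm]
    exact key g f hg
  rcases eq_or_ne e' ∞ with rfl | he'
  · obtain rfl : e = 1 := (ENNReal.HolderConjugate.eq_top_iff_eq_one ∞ e).mp rfl
    exact key f g hf
  rw [eLpNorm_ennreal _ (zero_lt_one.trans_le e1).ne' he,
    eLpNorm_ennreal _ (zero_lt_one.trans_le e1').ne' he']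
  refine ENNReal.lintegral_mul_le_Lp_mul_Lq μ ?_ hf.aemeasurable hg.aemeasurable
  refine ENNReal.HolderConjugate.toReal_of_ne_top (p := e) (q := e') he he'

variable {α β : Type*} [MeasurableSpace α] [MeasurableSpace β]

theorem eLpNorm_const_mul_of_measurable {μ : Measure α} {f : α → ℝ≥0∞} {q : ℝ≥0∞}
    (hf : q ≠ ∞ → Measurable f) (C : ℝ≥0∞) :
    eLpNorm (fun z => C * f z) q μ = C * eLpNorm f q μ := by
  rcases eq_or_ne q 0 with rfl | hq
  · simp
  rcases eq_or_ne q ∞ with rfl | hqt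
  · simp only [eLpNorm_exponent_top, eLpNormEssSup, enorm_eq_self]
    exact ENNReal.essSup_const_mul
  · rw [eLpNorm_ennreal _ hq hqt, eLpNorm_ennreal _ hq hqt]
    have hp := ENNReal.toReal_pos hq hqt
    simp only [ENNReal.mul_rpow_of_nonneg _ _ hp.le]
    rw [lintegral_const_mul _ ((hf hqt).pow_const _),
      ENNReal.mul_rpow_of_nonneg _ _ (by positivity), ← ENNReal.rpow_mul,
      mul_one_div_cancel hp.ne', ENNReal.rpow_one]

theorem measurable_eLpNorm_slice {ν : Measure β} [SFinite ν] {F : α → β → ℝ≥0∞}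
    (hF : Measurable (Function.uncurry F)) {q : ℝ≥0∞} (hq : q ≠ ∞) :
    Measurable fun x => eLpNorm (F x) q ν := by
  rcases eq_or_ne q 0 with rfl | hq0
  · simp
  simp only [eLpNorm_ennreal _ hq0 hq]
  exact Measurable.pow_const (hF.pow_const _).lintegral_prod_right' _

theorem eLpNorm_eLpNorm_le {μ : Measure α} {ν : Measure β} [SFinite μ] [SFinite ν]
    {F : α → β → ℝ≥0∞} (hF : Measurable (Function.uncurry F)) {q : ℝ≥0∞} (hq : q ≠ 0) :
    eLpNorm (fun x => eLpNorm (F x) q ν) q μ ≤ eLpNorm (Function.uncurry F) q (μ.prod ν) := by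
  rcases eq_or_ne q ∞ with rfl | hqt
  · have h := Measure.ae_ae_of_ae_prod (ae_le_eLpNorm_top (μ := μ.prod ν) (Function.uncurry F))
    rw [eLpNorm_exponent_top]
    refine eLpNormEssSup_le_of_ae_enorm_bound ?_
    filter_upwards [h] with x hx
    rw [enorm_eq_self, eLpNorm_exponent_top]
    refine eLpNormEssSup_le_of_ae_enorm_bound ?_
    filter_upwards [hx] with y hy
    simpa using hy
  · have hp := ENNReal.toReal_pos hq hqt
    rw [eLpNorm_ennreal _ hq hqt, eLpNorm_ennreal _ hq hqt,
      lintegral_prod _ (hF.pow_const _).aemeasurable]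
    refine le_of_eq ?_
    congr 2
    funext x
    rw [eLpNorm_ennreal _ hq hqt, ← ENNReal.rpow_mul, one_div_mul_cancel hp.ne', ENNReal.rpow_one]
    rfl

theorem eLpNorm_mul_prod_le {μ : Measure α} {ν : Measure β} [SFinite μ] [SFinite ν]
    {f : α → ℝ≥0∞} {g : β → ℝ≥0∞} {q : ℝ≥0∞} (hq : q ≠ 0)
    (hf : q ≠ ∞ → Measurable f) (hg : q ≠ ∞ → Measurable g) :
    eLpNorm (fun z : α × β => f z.1 * g z.2) q (μ.prod ν) ≤ eLpNorm f q μ * eLpNorm g q ν := by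
  rcases eq_or_ne q ∞ with rfl | hqt
  · nth_rw 1 [eLpNorm_exponent_top]
    refine eLpNormEssSup_le_of_ae_enorm_bound ?_
    filter_upwards [Measure.quasiMeasurePreserving_fst.ae (ae_le_eLpNorm_top (μ := μ) f),
      Measure.quasiMeasurePreserving_snd.ae (ae_le_eLpNorm_top (μ := ν) g)] with z h1 h2
    rw [enorm_eq_self]
    exact mul_le_mul' h1 h2
  · have hp := ENNReal.toReal_pos hq hqt
    rw [eLpNorm_ennreal _ hq hqt, eLpNorm_ennreal _ hq hqt, eLpNorm_ennreal _ hq hqt,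
      ← ENNReal.mul_rpow_of_nonneg _ _ (by positivity)]
    simp only [ENNReal.mul_rpow_of_nonneg _ _ hp.le]
    rw [lintegral_prod_mul ((hf hqt).pow_const _).aemeasurable ((hg hqt).pow_const _).aemeasurable]

end Lebesgue

/-! ### Iterated integrals of non-negative kernels -/

section MajorantChain

variable {P : Type*} [MeasurableSpace P] (ν : Measure P)

/-- The iterated integral
`∫ ⋯ ∫ m_i(X, Z_1) m_{i+1}(Z_1, Z_2) ⋯ m_{i+n}(Z_n, Y) dν(Z_1) ⋯ dν(Z_n)` of non-negative kernels. -/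
def lchain (m : ℕ → P → P → ℝ≥0∞) : ℕ → ℕ → P → P → ℝ≥0∞
  | i, 0 => m i
  | i, n + 1 => fun X Y => ∫⁻ Z, m i X Z * lchain m (i + 1) n Z Y ∂ν

variable {ν}
variable {m : ℕ → P → P → ℝ≥0∞}

theorem lchain_zero (i : ℕ) : lchain ν m i 0 = m i := by simp [lchain]

theorem lchain_succ (i n : ℕ) (X Y : P) :
    lchain ν m i (n + 1) X Y = ∫⁻ Z, m i X Z * lchain ν m (i + 1) n Z Y ∂ν := by simp [lchain]

theorem measurable_lchain [SFinite ν] (hm : ∀ i, Measurable (Function.uncurry (m i))) (i n : ℕ) :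
    Measurable (Function.uncurry (lchain ν m i n)) := by
  induction n generalizing i with
  | zero => rw [lchain_zero]; exact hm i
  | succ n ih =>
    have h : Measurable fun q : (P × P) × P => m i q.1.1 q.2 * lchain ν m (i + 1) n q.2 q.1.2 :=
      ((hm i).comp (measurable_fst.fst.prodMk measurable_snd)).mul
        ((ih (i + 1)).comp (measurable_snd.prodMk measurable_fst.snd))
    have h' := h.lintegral_prod_right' (ν := ν)
    have e : Function.uncurry (lchain ν m i (n + 1)) = fun q : P × P =>
        ∫⁻ Z, m i q.1 Z * lchain ν m (i + 1) n Z q.2 ∂ν := by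
      funext q
      exact lchain_succ i n q.1 q.2
    rw [e]
    exact h'

theorem measurable_lchain_left [SFinite ν] (hm : ∀ i, Measurable (Function.uncurry (m i)))
    (i n : ℕ) (Y : P) : Measurable fun X => lchain ν m i n X Y :=
  (measurable_lchain hm i n).comp (measurable_id.prodMk measurable_const)

theorem measurable_lchain_right [SFinite ν] (hm : ∀ i, Measurable (Function.uncurry (m i)))
    (i n : ℕ) (X : P) : Measurable fun Y => lchain ν m i n X Y :=
  (measurable_lchain hm i n).comp (measurable_const.prodMk measurable_id)

theorem lchain_mono {m' : ℕ → P → P → ℝ≥0∞} {i n : ℕ}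
    (h : ∀ j ∈ Finset.Icc i (i + n), ∀ X Y, m j X Y ≤ m' j X Y) (X Y : P) :
    lchain ν m i n X Y ≤ lchain ν m' i n X Y := by
  induction n generalizing i X with
  | zero => simpa only [lchain_zero] using h i (by simp) X Y
  | succ n ih =>
    rw [lchain_succ, lchain_succ]
    refine lintegral_mono fun Z => mul_le_mul' (h i (by simp) X Z) (ih ?_ Z)
    intro j hj
    exact h j (by simp only [Finset.mem_Icc] at hj ⊢; omega)

theorem lchain_add [SFinite ν] (hm : ∀ i, Measurable (Function.uncurry (m i))) (i a b : ℕ)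
    (X Y : P) : lchain ν m i (a + b + 1) X Y =
      ∫⁻ Z, lchain ν m i a X Z * lchain ν m (i + a + 1) b Z Y ∂ν := by
  induction a generalizing i X with
  | zero => rw [zero_add, lchain_succ, lchain_zero, add_zero]
  | succ a ih =>
    have e : a + 1 + b + 1 = (a + b + 1) + 1 := by omega
    rw [e, lchain_succ]
    simp only [ih, lchain_succ]
    have e' : i + 1 + a + 1 = i + (a + 1) + 1 := by omega
    rw [e']
    have h1 : ∀ Z, m i X Z * ∫⁻ W, lchain ν m (i + 1) a Z W * lchain ν m (i + (a + 1) + 1) b W Y ∂ν =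
        ∫⁻ W, m i X Z * lchain ν m (i + 1) a Z W * lchain ν m (i + (a + 1) + 1) b W Y ∂ν := by
      intro Z
      simp only [mul_assoc]
      rw [lintegral_const_mul]
      exact (measurable_lchain_right hm _ _ _).mul (measurable_lchain_left hm _ _ _)
    have h2 : ∀ W, (∫⁻ Z, m i X Z * lchain ν m (i + 1) a Z W ∂ν) *
        lchain ν m (i + (a + 1) + 1) b W Y =
        ∫⁻ Z, m i X Z * lchain ν m (i + 1) a Z W * lchain ν m (i + (a + 1) + 1) b W Y ∂ν := by
      intro W
      rw [lintegral_mul_const]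
      exact ((hm i).comp (measurable_const.prodMk measurable_id)).mul
        (measurable_lchain_left hm _ _ _)
    simp only [h1, h2]
    refine lintegral_lintegral_swap (Measurable.aemeasurable ?_)
    have a1 : Measurable fun z : P × P => m i X z.1 :=
      (hm i).comp (measurable_const.prodMk measurable_fst)
    have a2 : Measurable fun z : P × P => lchain ν m (i + 1) a z.1 z.2 :=
      measurable_lchain hm _ _
    have a3 : Measurable fun z : P × P => lchain ν m (i + (a + 1) + 1) b z.2 Y :=
      (measurable_lchain_left hm _ _ Y).comp measurable_snd
    exact (a1.mul a2).mul a3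

/-- Weights can be distributed over the kernels along paths. -/
theorem mul_lchain_le [SFinite ν] (hm : ∀ i, Measurable (Function.uncurry (m i)))
    {w : ℕ → P → P → ℝ≥0∞}
    (hw0 : ∀ i X Y, w i X Y ≠ 0) (hwt : ∀ i X Y, w i X Y ≠ ∞) (i n : ℕ) (X Y : P) (a : ℝ≥0∞)
    (h : ∀ Z : ℕ → P, Z 0 = X → Z (n + 1) = Y →
      a ≤ ∏ j ∈ Finset.range (n + 1), w (i + j) (Z j) (Z (j + 1))) :
    a * lchain ν m i n X Y ≤ lchain ν (fun j X Y => w j X Y * m j X Y) i n X Y := by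
  induction n generalizing i X a with
  | zero =>
    rw [lchain_zero, lchain_zero]
    gcongr
    have := h (fun j => if j = 0 then X else Y) (by simp) (by simp)
    simpa using this
  | succ n ih =>
    rw [lchain_succ, lchain_succ, ← lintegral_const_mul]
    · refine lintegral_mono fun Z => ?_
      have key := ih (i + 1) Z (a / w i X Z) ?_
      · calc a * (m i X Z * lchain ν m (i + 1) n Z Y)
            = (w i X Z * m i X Z) * (a / w i X Z * lchain ν m (i + 1) n Z Y) := by
              have : w i X Z * (a / w i X Z) = a := ENNReal.mul_div_cancel (hw0 _ _ _) (hwt _ _ _)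
              calc _ = (w i X Z * (a / w i X Z)) * (m i X Z * lchain ν m (i + 1) n Z Y) := by
                    rw [this]
                _ = _ := by ring
          _ ≤ _ := by gcongr
      · intro Z' h0 h1
        refine ENNReal.div_le_of_le_mul ?_
        have := h (fun j => Nat.casesOn j X Z') rfl (by simpa using h1)
        rw [Finset.prod_range_succ'] at this
        simpa [h0, add_assoc, add_comm, add_left_comm] using this
    · exact ((hm i).comp (measurable_const.prodMk measurable_id)).mul
        (measurable_lchain_left hm _ _ _)

variable [SFinite ν]

/-- Alternating applications of Hölder's inequality. -/
theorem eLpNorm_lchain_le (hm : ∀ i, Measurable (Function.uncurry (m i))) {e : ℕ → ℝ≥0∞} (Y : P)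
    (i n : ℕ) (he : ∀ j, i ≤ j → j < i + n → ENNReal.HolderConjugate (e j) (e (j + 1)))
    (he0 : ∀ j, e j ≠ 0) :
    eLpNorm (fun X => lchain ν m i n X Y) (e i) ν ≤
      (∏ j ∈ Finset.range n, eLpNorm (Function.uncurry (m (i + j))) (e (i + j)) (ν.prod ν)) *
        eLpNorm (fun X => m (i + n) X Y) (e (i + n)) ν := by
  induction n generalizing i with
  | zero => simp [lchain_zero]
  | succ n ih =>
    have hstep : ∀ X, lchain ν m i (n + 1) X Y ≤
        eLpNorm (fun Z => lchain ν m (i + 1) n Z Y) (e (i + 1)) ν * eLpNorm (m i X) (e i) ν := by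
      intro X
      rw [lchain_succ, mul_comm]
      exact lintegral_mul_le_eLpNorm_mul_eLpNorm
        ((hm i).comp (measurable_const.prodMk measurable_id)) (measurable_lchain_left hm _ _ _)
        (he i le_rfl (by omega))
    calc _ ≤ eLpNorm (fun X => eLpNorm (fun Z => lchain ν m (i + 1) n Z Y) (e (i + 1)) ν *
          eLpNorm (m i X) (e i) ν) (e i) ν := by
          refine eLpNorm_mono_enorm fun X => ?_
          simpa using hstep X
      _ = eLpNorm (fun Z => lchain ν m (i + 1) n Z Y) (e (i + 1)) ν *
          eLpNorm (fun X => eLpNorm (m i X) (e i) ν) (e i) ν :=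
          eLpNorm_const_mul_of_measurable (fun h => measurable_eLpNorm_slice (hm i) h) _
      _ ≤ ((∏ j ∈ Finset.range n, eLpNorm (Function.uncurry (m (i + 1 + j))) (e (i + 1 + j))
          (ν.prod ν)) * eLpNorm (fun X => m (i + 1 + n) X Y) (e (i + 1 + n)) ν) *
          eLpNorm (Function.uncurry (m i)) (e i) (ν.prod ν) := by
          refine mul_le_mul' (ih (i + 1) fun j h1 h2 => he j (by omega) (by omega)) ?_
          exact eLpNorm_eLpNorm_le (hm i) (he0 i)
      _ = _ := by
          rw [Finset.prod_range_succ', show i + 1 + n = i + (n + 1) by omega]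
          simp only [add_zero, show ∀ j, i + 1 + j = i + (j + 1) by intro j; omega]
          ring

end MajorantChain

section SlowChain

/-- Slow variation in both arguments of a kernel. -/
def IsSlowKernel {P : Type*} [NormedAddCommGroup P] (s : ℝ) (F : P → P → ℝ≥0∞) : Prop :=
  ∀ X X' Y Y', F X Y ≤ F X' Y' * ex (s * (‖X - X'‖ + ‖Y - Y'‖))

theorem IsSlowKernel.isSlow_left {P : Type*} [NormedAddCommGroup P] {s : ℝ}
    {F : P → P → ℝ≥0∞} (h : IsSlowKernel s F) (Y : P) :
    IsSlow s fun X => F X Y := fun X X' => by simpa using h X X' Y Y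

theorem IsSlowKernel.isSlow_right {P : Type*} [NormedAddCommGroup P] {s : ℝ}
    {F : P → P → ℝ≥0∞} (h : IsSlowKernel s F) (X : P) :
    IsSlow s (F X) := fun Y Y' => by simpa using h X X Y Y'

theorem IsSlowKernel.isSlow_uncurry {P : Type*} [NormedAddCommGroup P] {s : ℝ}
    {F : P → P → ℝ≥0∞} (h : IsSlowKernel s F)
    (hs : 0 ≤ s) : IsSlow (2 * s) (Function.uncurry F) := by
  rintro ⟨X, Y⟩ ⟨X', Y'⟩
  refine (h X X' Y Y').trans (mul_le_mul_right (ex_mono ?_) _)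
  have h1 : ‖X - X'‖ ≤ ‖(X, Y) - (X', Y')‖ := norm_fst_le ((X, Y) - (X', Y'))
  have h2 : ‖Y - Y'‖ ≤ ‖(X, Y) - (X', Y')‖ := norm_snd_le ((X, Y) - (X', Y'))
  nlinarith

theorem IsSlowKernel.ne_top {P : Type*} [NormedAddCommGroup P] {s : ℝ} {F : P → P → ℝ≥0∞} (h : IsSlowKernel s F) {X₀ Y₀ : P}
    (h0 : F X₀ Y₀ ≠ ∞) (X Y : P) : F X Y ≠ ∞ :=
  ((h X X₀ Y Y₀).trans_lt (ENNReal.mul_lt_top h0.lt_top (ex_ne_top _).lt_top)).ne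

theorem isSlowKernel_lchain {P : Type*} [NormedAddCommGroup P]
    [MeasurableSpace P] {ν : Measure P} {m : ℕ → P → P → ℝ≥0∞} {s : ℝ} (hms : ∀ i, IsSlowKernel s (m i)) (i n : ℕ) :
    IsSlowKernel s (lchain ν m i n) := by
  induction n generalizing i with
  | zero => rw [lchain_zero]; exact hms i
  | succ n ih =>
    intro X X' Y Y'
    rw [lchain_succ, lchain_succ, ← lintegral_mul_const' _ _ (ex_ne_top _)]
    refine lintegral_mono fun Z => ?_
    calc _ ≤ (m i X' Z * ex (s * (‖X - X'‖ + ‖Z - Z‖))) *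
          (lchain ν m (i + 1) n Z Y' * ex (s * (‖Z - Z‖ + ‖Y - Y'‖))) :=
          mul_le_mul' (hms i X X' Z Z) (ih (i + 1) Z Z Y Y')
      _ = _ := by
          rw [sub_self, norm_zero, add_zero, zero_add, mul_add s, ex_add]; ring

variable {P : Type*} [NormedAddCommGroup P] [NormedSpace ℝ P] [FiniteDimensional ℝ P]
  [MeasurableSpace P] [BorelSpace P] {ν : Measure P} [ν.IsAddHaarMeasure]
  {m : ℕ → P → P → ℝ≥0∞}

/-- The estimate behind the composition theorems: kernels which vary slowly, are in `L^{q_j}`, with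
`max(1, q_j)` alternating between conjugate exponents, and with the first and last exponents both
equal to `q`, compose to a kernel in `L^q`. -/
theorem exists_eLpNorm_uncurry_lchain_le (ν : Measure P) [ν.IsAddHaarMeasure] {s : ℝ} (hs : 0 ≤ s)
    {q : ℕ → ℝ≥0∞} (hq : ∀ j, q j ≠ 0) (n : ℕ)
    (he : ∀ j, j ≤ n → ENNReal.HolderConjugate (max 1 (q j)) (max 1 (q (j + 1))))
    (hq' : q (n + 1) = q 0) :
    ∃ C : ℝ≥0∞, C ≠ ∞ ∧ ∀ m : ℕ → P → P → ℝ≥0∞, (∀ i, Measurable (Function.uncurry (m i))) →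
      (∀ i, IsSlowKernel s (m i)) →
      eLpNorm (Function.uncurry (lchain ν m 0 (n + 1))) (q 0) (ν.prod ν) ≤
        C * ∏ j ∈ Finset.range (n + 2), eLpNorm (Function.uncurry (m j)) (q j) (ν.prod ν) := by
  have : (ν.prod ν).IsAddHaarMeasure := inferInstance
  choose C₁ hC₁ h₁ using fun j => exists_eLpNorm_max_one_le (ν.prod ν) (2 * s) (hq j)
  obtain ⟨C₀, hC₀, h₀⟩ := exists_eLpNorm_max_one_le ν s (hq 0)
  refine ⟨C₀ * C₀ * ∏ j ∈ Finset.range n, C₁ (j + 1), ?_, fun m hm hms => ?_⟩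
  · exact ENNReal.mul_ne_top (ENNReal.mul_ne_top hC₀ hC₀) (ENNReal.prod_ne_top fun j _ => hC₁ _)
  set e : ℕ → ℝ≥0∞ := fun j => max 1 (q j) with hedef
  have he0 : ∀ j, e j ≠ 0 := fun j => (zero_lt_one.trans_le (le_max_left _ _)).ne'
  set M := ∏ j ∈ Finset.range n, eLpNorm (Function.uncurry (m (1 + j))) (e (1 + j)) (ν.prod ν)
  have hmid : M ≤ (∏ j ∈ Finset.range n, C₁ (j + 1)) *
      ∏ j ∈ Finset.range n, eLpNorm (Function.uncurry (m (j + 1))) (q (j + 1)) (ν.prod ν) := by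
    rw [← Finset.prod_mul_distrib]
    refine Finset.prod_le_prod' fun j _ => ?_
    rw [add_comm 1 j]
    exact h₁ (j + 1) _ (hm _) ((hms _).isSlow_uncurry hs)
  have hpt : ∀ z : P × P, Function.uncurry (lchain ν m 0 (n + 1)) z ≤
      (C₀ * C₀ * M) * (eLpNorm (m 0 z.1) (q 0) ν * eLpNorm (fun X => m (n + 1) X z.2) (q 0) ν) := by
    rintro ⟨X, Y⟩
    have a1 : lchain ν m 0 (n + 1) X Y ≤
        eLpNorm (m 0 X) (e 0) ν * eLpNorm (fun Z => lchain ν m 1 n Z Y) (e 1) ν := by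
      rw [lchain_succ]
      exact lintegral_mul_le_eLpNorm_mul_eLpNorm
        ((hm 0).comp (measurable_const.prodMk measurable_id)) (measurable_lchain_left hm _ _ _)
        (he 0 (by omega))
    have a2 := eLpNorm_lchain_le (ν := ν) hm (e := e) Y 1 n
      (fun j h1 h2 => he j (by omega)) he0
    have a3 : eLpNorm (m 0 X) (e 0) ν ≤ C₀ * eLpNorm (m 0 X) (q 0) ν :=
      h₀ _ ((hm 0).comp (measurable_const.prodMk measurable_id)) ((hms 0).isSlow_right X)
    have a4 : eLpNorm (fun X => m (n + 1) X Y) (e (n + 1)) ν ≤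
        C₀ * eLpNorm (fun X => m (n + 1) X Y) (q 0) ν := by
      simp only [hedef, hq']
      exact h₀ _ ((hm _).comp (measurable_id.prodMk measurable_const)) ((hms _).isSlow_left Y)
    rw [add_comm 1 n] at a2
    calc lchain ν m 0 (n + 1) X Y ≤ _ := a1
      _ ≤ (C₀ * eLpNorm (m 0 X) (q 0) ν) *
          (M * (C₀ * eLpNorm (fun X => m (n + 1) X Y) (q 0) ν)) :=
          mul_le_mul' a3 (a2.trans (mul_le_mul_right a4 _))
      _ = _ := by ring
  have hswap : eLpNorm (fun Y => eLpNorm (fun X => m (n + 1) X Y) (q 0) ν) (q 0) ν ≤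
      eLpNorm (Function.uncurry (m (n + 1))) (q (n + 1)) (ν.prod ν) := by
    rw [hq']
    have hm' : Measurable (Function.uncurry fun Y X => m (n + 1) X Y) :=
      (hm (n + 1)).comp measurable_swap
    have e : (Function.uncurry fun Y X => m (n + 1) X Y) =
        Function.uncurry (m (n + 1)) ∘ Prod.swap := rfl
    refine (eLpNorm_eLpNorm_le (μ := ν) (ν := ν) hm' (hq 0)).trans (le_of_eq ?_)
    rw [e, eLpNorm_comp_measurePreserving (hm (n + 1)).aestronglyMeasurable
      Measure.measurePreserving_swap]
  have hmeas1 : q 0 ≠ ∞ → Measurable fun X => eLpNorm (m 0 X) (q 0) ν :=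
    fun h => measurable_eLpNorm_slice (hm 0) h
  have hmeas2 : q 0 ≠ ∞ → Measurable fun Y => eLpNorm (fun X => m (n + 1) X Y) (q 0) ν :=
    fun h => measurable_eLpNorm_slice (F := fun Y X => m (n + 1) X Y)
      ((hm (n + 1)).comp measurable_swap) h
  calc _ ≤ eLpNorm (fun z : P × P => (C₀ * C₀ * M) * (eLpNorm (m 0 z.1) (q 0) ν *
        eLpNorm (fun X => m (n + 1) X z.2) (q 0) ν)) (q 0) (ν.prod ν) := by
        refine eLpNorm_mono_enorm fun z => ?_
        simpa only [enorm_eq_self] using hpt z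
    _ = (C₀ * C₀ * M) * eLpNorm (fun z : P × P => eLpNorm (m 0 z.1) (q 0) ν *
        eLpNorm (fun X => m (n + 1) X z.2) (q 0) ν) (q 0) (ν.prod ν) :=
        eLpNorm_const_mul_of_measurable
          (fun h => ((hmeas1 h).comp measurable_fst).mul ((hmeas2 h).comp measurable_snd)) _
    _ ≤ (C₀ * C₀ * M) * (eLpNorm (fun X => eLpNorm (m 0 X) (q 0) ν) (q 0) ν *
        eLpNorm (fun Y => eLpNorm (fun X => m (n + 1) X Y) (q 0) ν) (q 0) ν) := by
        gcongr
        exact eLpNorm_mul_prod_le (f := fun X => eLpNorm (m 0 X) (q 0) ν)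
          (g := fun Y => eLpNorm (fun X => m (n + 1) X Y) (q 0) ν) (hq 0) hmeas1 hmeas2
    _ ≤ (C₀ * C₀ * ((∏ j ∈ Finset.range n, C₁ (j + 1)) *
        ∏ j ∈ Finset.range n, eLpNorm (Function.uncurry (m (j + 1))) (q (j + 1)) (ν.prod ν))) *
        (eLpNorm (Function.uncurry (m 0)) (q 0) (ν.prod ν) *
          eLpNorm (Function.uncurry (m (n + 1))) (q (n + 1)) (ν.prod ν)) :=
        mul_le_mul' (mul_le_mul_right hmid _) (mul_le_mul' (eLpNorm_eLpNorm_le (hm 0) (hq 0)) hswap)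
    _ = _ := by
        rw [Finset.prod_range_succ, Finset.prod_range_succ']
        ring

end SlowChain

/-- If an iterated integral of positive, slowly varying kernels is finite, then so are all partial
ones. -/
theorem lchain_ne_top {P : Type*} [NormedAddCommGroup P] [MeasurableSpace P] {ν : Measure P}
    [SFinite ν] [NeZero ν] {m : ℕ → P → P → ℝ≥0∞} {s : ℝ} (hm : ∀ i, Measurable (Function.uncurry (m i)))
    (hms : ∀ i, IsSlowKernel s (m i)) {N : ℕ} (hpos : ∀ i ≤ N, ∀ X Y, m i X Y ≠ 0) {X₀ Y₀ : P}
    (h : lchain ν m 0 N X₀ Y₀ ≠ ∞) {i n : ℕ} (hin : i + n ≤ N) (X Y : P) :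
    lchain ν m i n X Y ≠ ∞ := by
  have hsl := fun i n => isSlowKernel_lchain (ν := ν) hms i n
  have key : ∀ {f : P → ℝ≥0∞}, AEMeasurable f ν → ∫⁻ Z, f Z ∂ν ≠ ∞ → ∃ Z, f Z ≠ ∞ := by
    intro f hf hfi
    obtain ⟨Z, hZ⟩ := (ae_lt_top' hf hfi).exists
    exact ⟨Z, hZ.ne⟩
  have hprefix : ∀ k, k ≤ N → ∃ X Y, lchain ν m k (N - k) X Y ≠ ∞ := by
    intro k
    induction k with
    | zero => exact fun _ => ⟨X₀, Y₀, h⟩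
    | succ k ih =>
      intro hk
      obtain ⟨X, Y, hXY⟩ := ih (by omega)
      rw [show N - k = (N - (k + 1)) + 1 by omega, lchain_succ] at hXY
      obtain ⟨Z, hZ⟩ := key (((hm k).comp (measurable_const.prodMk measurable_id)).mul
        (measurable_lchain_left hm _ _ _)).aemeasurable hXY
      refine ⟨Z, Y, fun h' => hZ ?_⟩
      change m k X Z * lchain ν m (k + 1) (N - (k + 1)) Z Y = ∞
      rw [h', ENNReal.mul_top (hpos k (by omega) X Z)]
  have hsuffix : ∀ l, l ≤ N - i → ∃ X Y, lchain ν m i (N - i - l) X Y ≠ ∞ := by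
    intro l
    induction l with
    | zero => exact fun _ => hprefix i (by omega)
    | succ l ih =>
      intro hl
      obtain ⟨X, Y, hXY⟩ := ih (by omega)
      rw [show N - i - l = (N - i - (l + 1)) + 0 + 1 by omega,
        lchain_add hm i (N - i - (l + 1)) 0 X Y] at hXY
      obtain ⟨Z, hZ⟩ := key ((measurable_lchain_right hm _ _ _).mul
        (measurable_lchain_left hm _ _ _)).aemeasurable hXY
      refine ⟨X, Z, fun h' => hZ ?_⟩
      change lchain ν m i (N - i - (l + 1)) X Z * lchain ν m (i + (N - i - (l + 1)) + 1) 0 Z Y = ∞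
      rw [h', lchain_zero, ENNReal.top_mul (hpos _ (by omega) Z Y)]
  obtain ⟨X', Y', h'⟩ := hsuffix (N - i - n) (by omega)
  rw [show N - i - (N - i - n) = n by omega] at h'
  exact (hsl i n).ne_top h' X Y

/-! ### Iterated integrals of dominated complex kernels -/

section Fubini

variable {α β : Type*} [MeasurableSpace α] [MeasurableSpace β] {μ : Measure α} {ν : Measure β}
  [SFinite ν] {f : α → ℂ} {b : α → β → ℂ} {g : β → ℂ}

theorem integrable_mul_mul (hf : AEStronglyMeasurable f μ)
    (hb : AEStronglyMeasurable (Function.uncurry b) (μ.prod ν)) (hg : AEStronglyMeasurable g ν)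
    (h : ∫⁻ x, ∫⁻ y, ‖f x‖ₑ * (‖b x y‖ₑ * ‖g y‖ₑ) ∂ν ∂μ ≠ ∞) :
    Integrable (fun z : α × β => f z.1 * b z.1 z.2 * g z.2) (μ.prod ν) := by
  have hm : AEStronglyMeasurable (fun z : α × β => f z.1 * b z.1 z.2 * g z.2) (μ.prod ν) :=
    ((hf.comp_fst).mul hb).mul hg.comp_snd
  refine ⟨hm, ?_⟩
  rw [hasFiniteIntegral_iff_enorm, lintegral_prod _ hm.enorm]
  refine lt_of_le_of_lt (le_of_eq ?_) h.lt_top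
  simp only [enorm_mul, mul_assoc]

/-- Associativity of the composition of integral kernels: a form of Fubini's theorem. -/
theorem integral_mul_integral_assoc [SFinite μ] (hf : AEStronglyMeasurable f μ)
    (hb : AEStronglyMeasurable (Function.uncurry b) (μ.prod ν)) (hg : AEStronglyMeasurable g ν)
    (h : ∫⁻ x, ∫⁻ y, ‖f x‖ₑ * (‖b x y‖ₑ * ‖g y‖ₑ) ∂ν ∂μ ≠ ∞) :
    ∫ x, f x * ∫ y, b x y * g y ∂ν ∂μ = ∫ y, (∫ x, f x * b x y ∂μ) * g y ∂ν := by
  have hi := integrable_mul_mul hf hb hg h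
  have e1 : ∀ x, f x * ∫ y, b x y * g y ∂ν = ∫ y, f x * b x y * g y ∂ν := fun x => by
    simp only [mul_assoc]; rw [integral_const_mul]
  have e2 : ∀ y, (∫ x, f x * b x y ∂μ) * g y = ∫ x, f x * b x y * g y ∂μ := fun y => by
    rw [integral_mul_const]
  simp only [e1, e2]
  exact integral_integral_swap hi

end Fubini

section Chain

variable {P : Type*} [MeasurableSpace P] (ν : Measure P)

/-- The iterated integral
`∫ ⋯ ∫ k_i(X, Z_1) k_{i+1}(Z_1, Z_2) ⋯ k_{i+n}(Z_n, Y) dν(Z_1) ⋯ dν(Z_n)`. -/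
def chain (k : ℕ → P → P → ℂ) : ℕ → ℕ → P → P → ℂ
  | i, 0 => k i
  | i, n + 1 => fun X Y => ∫ Z, k i X Z * chain k (i + 1) n Z Y ∂ν

/-- Slowly varying non-negative kernels `m_0, …, m_N` all of whose iterated integrals are finite. -/
structure IsMajorant {P : Type*} [NormedAddCommGroup P] [MeasurableSpace P] (ν : Measure P)
    (s : ℝ) (N : ℕ) (m : ℕ → P → P → ℝ≥0∞) : Prop where
  measurable : ∀ i, Measurable (Function.uncurry (m i))
  slow : ∀ i, IsSlowKernel s (m i)
  ne_top : ∀ i n, i + n ≤ N → ∀ X Y, lchain ν m i n X Y ≠ ∞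

variable {ν} {k : ℕ → P → P → ℂ} {m : ℕ → P → P → ℝ≥0∞}

theorem chain_zero (i : ℕ) : chain ν k i 0 = k i := by simp [chain]

theorem chain_succ (i n : ℕ) (X Y : P) :
    chain ν k i (n + 1) X Y = ∫ Z, k i X Z * chain ν k (i + 1) n Z Y ∂ν := by simp [chain]

theorem chain_congr {k' : ℕ → P → P → ℂ} {i n : ℕ} (h : ∀ j, i ≤ j → j ≤ i + n → k j = k' j) :
    chain ν k i n = chain ν k' i n := by
  induction n generalizing i with
  | zero => rw [chain_zero, chain_zero]; exact h i le_rfl (by omega)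
  | succ n ih =>
    funext X Y
    rw [chain_succ, chain_succ, h i le_rfl (by omega), ih fun j h1 h2 => h j (by omega) (by omega)]

theorem stronglyMeasurable_chain [SFinite ν]
    (hk : ∀ i, StronglyMeasurable (Function.uncurry (k i))) (i n : ℕ) :
    StronglyMeasurable (Function.uncurry (chain ν k i n)) := by
  induction n generalizing i with
  | zero => rw [chain_zero]; exact hk i
  | succ n ih =>
    have h : StronglyMeasurable fun q : (P × P) × P =>
        k i q.1.1 q.2 * chain ν k (i + 1) n q.2 q.1.2 :=
      ((hk i).comp_measurable (measurable_fst.fst.prodMk measurable_snd)).mul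
        ((ih (i + 1)).comp_measurable (measurable_snd.prodMk measurable_fst.snd))
    have h' := h.integral_prod_right' (ν := ν)
    have e : Function.uncurry (chain ν k i (n + 1)) = fun q : P × P =>
        ∫ Z, k i q.1 Z * chain ν k (i + 1) n Z q.2 ∂ν := by
      funext q
      exact chain_succ i n q.1 q.2
    rw [e]
    exact h'

theorem stronglyMeasurable_left {f : P → P → ℂ} (hf : StronglyMeasurable (Function.uncurry f))
    (Y : P) : StronglyMeasurable fun X => f X Y :=
  hf.comp_measurable (measurable_id.prodMk measurable_const)

theorem stronglyMeasurable_right {f : P → P → ℂ} (hf : StronglyMeasurable (Function.uncurry f))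
    (X : P) : StronglyMeasurable (f X) :=
  hf.comp_measurable (measurable_const.prodMk measurable_id)

theorem enorm_chain_le (hkm : ∀ i X Y, ‖k i X Y‖ₑ ≤ m i X Y) (i n : ℕ) (X Y : P) :
    ‖chain ν k i n X Y‖ₑ ≤ lchain ν m i n X Y := by
  induction n generalizing i X with
  | zero => rw [chain_zero, lchain_zero]; exact hkm i X Y
  | succ n ih =>
    rw [chain_succ, lchain_succ]
    refine (enorm_integral_le_lintegral_enorm _).trans (lintegral_mono fun Z => ?_)
    rw [enorm_mul]
    exact mul_le_mul' (hkm i X Z) (ih (i + 1) Z)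

end Chain

section DominatedChain

variable {P : Type*} [NormedAddCommGroup P] [MeasurableSpace P] {ν : Measure P} [SFinite ν]
  {s : ℝ} {N : ℕ} {k : ℕ → P → P → ℂ} {m : ℕ → P → P → ℝ≥0∞}

theorem integrable_chain_mul (hM : IsMajorant ν s N m)
    (hk : ∀ i, StronglyMeasurable (Function.uncurry (k i)))
    (hkm : ∀ i X Y, ‖k i X Y‖ₑ ≤ m i X Y) {i a b : ℕ} (h : i + (a + b + 1) ≤ N) (X Y : P) :
    Integrable (fun Z => chain ν k i a X Z * chain ν k (i + a + 1) b Z Y) ν := by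
  refine ⟨((stronglyMeasurable_right (stronglyMeasurable_chain hk _ _) X).mul
    (stronglyMeasurable_left (stronglyMeasurable_chain hk _ _) Y)).aestronglyMeasurable, ?_⟩
  rw [hasFiniteIntegral_iff_enorm]
  refine lt_of_le_of_lt ?_ (hM.ne_top i (a + b + 1) h X Y).lt_top
  rw [lchain_add hM.measurable]
  refine lintegral_mono fun Z => ?_
  rw [enorm_mul]
  exact mul_le_mul' (enorm_chain_le hkm _ _ _ _) (enorm_chain_le hkm _ _ _ _)

theorem integrable_chain_step (hM : IsMajorant ν s N m)
    (hk : ∀ i, StronglyMeasurable (Function.uncurry (k i)))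
    (hkm : ∀ i X Y, ‖k i X Y‖ₑ ≤ m i X Y) {i n : ℕ} (h : i + (n + 1) ≤ N) (X Y : P) :
    Integrable (fun Z => k i X Z * chain ν k (i + 1) n Z Y) ν := by
  have := integrable_chain_mul hM hk hkm (i := i) (a := 0) (b := n) (by omega) X Y
  simpa only [chain_zero, add_zero] using this

theorem chain_add (hM : IsMajorant ν s N m)
    (hk : ∀ i, StronglyMeasurable (Function.uncurry (k i)))
    (hkm : ∀ i X Y, ‖k i X Y‖ₑ ≤ m i X Y) {i a b : ℕ} (h : i + (a + b + 1) ≤ N) (X Y : P) :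
    chain ν k i (a + b + 1) X Y =
      ∫ Z, chain ν k i a X Z * chain ν k (i + a + 1) b Z Y ∂ν := by
  induction a generalizing i X with
  | zero => rw [zero_add, chain_succ, chain_zero, add_zero]
  | succ a ih =>
    have e : a + 1 + b + 1 = (a + b + 1) + 1 := by omega
    rw [e, chain_succ]
    simp only [chain_succ]
    rw [← integral_mul_integral_assoc]
    · refine integral_congr_ae (Eventually.of_forall fun Z => ?_)
      simp only
      rw [← chain_succ, ih (i := i + 1) (by omega), show i + 1 + a + 1 = i + (a + 1) + 1 by omega]
    · exact (stronglyMeasurable_right (hk i) X).aestronglyMeasurable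
    · exact (stronglyMeasurable_chain hk _ _).aestronglyMeasurable
    · exact (stronglyMeasurable_left (stronglyMeasurable_chain hk _ _) Y).aestronglyMeasurable
    · refine ne_top_of_le_ne_top (hM.ne_top i (a + b + 1 + 1) (by omega) X Y) ?_
      rw [lchain_succ]
      refine lintegral_mono fun Z => ?_
      rw [lintegral_const_mul' _ _ enorm_ne_top, lchain_add hM.measurable,
        show i + 1 + a + 1 = i + (a + 1) + 1 by omega]
      refine mul_le_mul' (hkm _ _ _) (lintegral_mono fun W => ?_)
      exact mul_le_mul' (enorm_chain_le hkm _ _ _ _) (enorm_chain_le hkm _ _ _ _)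

/-- Linearity of iterated integrals in the kernel with index `j`. -/
theorem chain_linear {m₁ m₂ : ℕ → P → P → ℝ≥0∞} (hM₁ : IsMajorant ν s N m₁)
    (hM₂ : IsMajorant ν s N m₂) {k₁ k₂ : ℕ → P → P → ℂ}
    (hk₁ : ∀ i, StronglyMeasurable (Function.uncurry (k₁ i)))
    (hk₂ : ∀ i, StronglyMeasurable (Function.uncurry (k₂ i)))
    (hkm₁ : ∀ i X Y, ‖k₁ i X Y‖ₑ ≤ m₁ i X Y) (hkm₂ : ∀ i X Y, ‖k₂ i X Y‖ₑ ≤ m₂ i X Y)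
    {j : ℕ} (h₁ : ∀ l, l ≠ j → k l = k₁ l) (h₂ : ∀ l, l ≠ j → k l = k₂ l) {a b : ℂ}
    (hj : ∀ X Y, k j X Y = a * k₁ j X Y + b * k₂ j X Y) {i n : ℕ} (hin : i + n ≤ N)
    (hij : i ≤ j) (hjn : j ≤ i + n) (X Y : P) :
    chain ν k i n X Y = a * chain ν k₁ i n X Y + b * chain ν k₂ i n X Y := by
  induction n generalizing i X with
  | zero =>
    obtain rfl : j = i := by omega
    simp only [chain_zero, hj]
  | succ n ih =>
    rw [chain_succ, chain_succ, chain_succ, ← integral_const_mul, ← integral_const_mul,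
      ← integral_add ((integrable_chain_step hM₁ hk₁ hkm₁ hin X Y).const_mul a)
        ((integrable_chain_step hM₂ hk₂ hkm₂ hin X Y).const_mul b)]
    congr 1
    funext Z
    rcases eq_or_ne j i with rfl | hne
    · have e₁ : chain ν k (j + 1) n = chain ν k₁ (j + 1) n :=
        chain_congr fun l h _ => h₁ l (by omega)
      have e₂ : chain ν k (j + 1) n = chain ν k₂ (j + 1) n :=
        chain_congr fun l h _ => h₂ l (by omega)
      rw [← e₁, ← e₂, hj]
      ring
    · rw [ih (by omega) (by omega) (by omega), ← h₁ i (Ne.symm hne), ← h₂ i (Ne.symm hne)]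
      ring

/-- Dominated convergence for iterated integrals. -/
theorem tendsto_chain (hM : IsMajorant ν s N m) {κ : ℕ → ℕ → P → P → ℂ}
    (hκ : ∀ l i, StronglyMeasurable (Function.uncurry (κ l i)))
    (hκm : ∀ l i X Y, ‖κ l i X Y‖ₑ ≤ m i X Y)
    (hlim : ∀ i X Y, Tendsto (fun l => κ l i X Y) atTop (𝓝 (k i X Y))) {i n : ℕ}
    (hin : i + n ≤ N) (X Y : P) :
    Tendsto (fun l => chain ν (κ l) i n X Y) atTop (𝓝 (chain ν k i n X Y)) := by
  induction n generalizing i X with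
  | zero => simpa only [chain_zero] using hlim i X Y
  | succ n ih =>
    simp only [chain_succ]
    have hfin := hM.ne_top i (n + 1) hin X Y
    rw [lchain_succ] at hfin
    have hmeas : Measurable fun Z => m i X Z * lchain ν m (i + 1) n Z Y :=
      ((hM.measurable i).comp (measurable_const.prodMk measurable_id)).mul
        (measurable_lchain_left hM.measurable _ _ _)
    have hm0 : ∀ i X Y, i ≤ N → m i X Y ≠ ∞ := fun i X Y hi => by
      simpa only [lchain_zero] using hM.ne_top i 0 (by omega) X Y
    refine tendsto_integral_of_dominated_convergence
      (fun Z => (m i X Z * lchain ν m (i + 1) n Z Y).toReal) (fun l => ?_)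
      (integrable_toReal_of_lintegral_ne_top hmeas.aemeasurable hfin) (fun l => ?_) ?_
    · exact ((stronglyMeasurable_right (hκ l i) X).mul (stronglyMeasurable_left
        (stronglyMeasurable_chain (hκ l) _ _) Y)).aestronglyMeasurable
    · refine Eventually.of_forall fun Z => ?_
      rw [← toReal_enorm, enorm_mul]
      refine ENNReal.toReal_mono (ENNReal.mul_ne_top (hm0 i X Z (by omega))
        (hM.ne_top (i + 1) n (by omega) Z Y)) ?_
      exact mul_le_mul' (hκm _ _ _ _) (enorm_chain_le (hκm l) _ _ _ _)
    · refine Eventually.of_forall fun Z => ?_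
      exact (hlim i X Z).mul (ih (by omega) Z)

end DominatedChain

section Reproducing

/-- A measurable kernel with Gaussian decay off the diagonal. -/
structure IsGaussKernel {P : Type*} [NormedAddCommGroup P] [MeasurableSpace P]
    (R : P → P → ℂ) : Prop where
  meas : StronglyMeasurable (Function.uncurry R)
  bound : ∃ (A : ℝ≥0∞) (r : ℝ), A ≠ ∞ ∧ 0 < r ∧ ∀ X Y, ‖R X Y‖ₑ ≤ A * ex (-(r * ‖X - Y‖ ^ 2))

theorem IsGaussKernel.swap {P : Type*} [NormedAddCommGroup P] [MeasurableSpace P] {R : P → P → ℂ} (hR : IsGaussKernel R) :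
    IsGaussKernel fun X Y => R Y X := by
  obtain ⟨A, r, hA, hr, h⟩ := hR.bound
  refine ⟨hR.meas.comp_measurable measurable_swap, A, r, hA, hr, fun X Y => ?_⟩
  rw [norm_sub_rev]
  exact h Y X

variable {P : Type*} [NormedAddCommGroup P] [NormedSpace ℝ P] [FiniteDimensional ℝ P]
  [MeasurableSpace P] [BorelSpace P] {ν : Measure P} [ν.IsAddHaarMeasure]
  {s : ℝ} {N : ℕ} {k : ℕ → P → P → ℂ} {m : ℕ → P → P → ℝ≥0∞}

/-- Integration against a Gaussian kernel preserves slowly varying functions, up to a constant. -/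
theorem IsGaussKernel.exists_lintegral_le {R : P → P → ℂ} (hR : IsGaussKernel R) (ν : Measure P)
    [ν.IsAddHaarMeasure] (s : ℝ) :
    ∃ K : ℝ≥0∞, K ≠ ∞ ∧ ∀ M : P → ℝ≥0∞, IsSlow s M → ∀ X,
      ∫⁻ Z, ‖R X Z‖ₑ * M Z ∂ν ≤ K * M X := by
  obtain ⟨A, r, hA, hr, h⟩ := hR.bound
  set I := ∫⁻ Z, ex (s * ‖Z‖) * ex (-(r * ‖Z‖ ^ 2)) ∂ν with hI
  have hIt : I ≠ ∞ := (lintegral_ex_mul_gauss _ s hr).ne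
  refine ⟨A * I, ENNReal.mul_ne_top hA hIt, fun M hM X => ?_⟩
  calc _ ≤ ∫⁻ Z, (A * M X) * (ex (s * ‖X - Z‖) * ex (-(r * ‖X - Z‖ ^ 2))) ∂ν := by
        refine lintegral_mono fun Z => ?_
        have := hM Z X
        rw [norm_sub_rev] at this
        calc _ ≤ (A * ex (-(r * ‖X - Z‖ ^ 2))) * (M X * ex (s * ‖X - Z‖)) :=
              mul_le_mul' (h X Z) this
          _ = _ := by ring
    _ = A * M X * I := by
        rw [lintegral_const_mul _ (by fun_prop),
          lintegral_sub_left_eq_self (fun Z : P => ex (s * ‖Z‖) * ex (-(r * ‖Z‖ ^ 2))) X]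
    _ = _ := by ring

/-- `k` is reproduced by composition with `R` from the left. -/
def ReproducesLeft (ν : Measure P) (R k : P → P → ℂ) : Prop :=
  ∀ X Y, ∫ Z, R X Z * k Z Y ∂ν = k X Y

/-- `k` is reproduced by composition with `R` from the right. -/
def ReproducesRight (ν : Measure P) (R k : P → P → ℂ) : Prop :=
  ∀ X Y, ∫ Z, k X Z * R Z Y ∂ν = k X Y

variable {R : P → P → ℂ}

theorem reproducesLeft_chain (hR : IsGaussKernel R) (hM : IsMajorant ν s N m)
    (hk : ∀ i, StronglyMeasurable (Function.uncurry (k i)))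
    (hkm : ∀ i X Y, ‖k i X Y‖ₑ ≤ m i X Y) {i n : ℕ} (hin : i + n ≤ N)
    (h : ReproducesLeft ν R (k i)) : ReproducesLeft ν R (chain ν k i n) := by
  cases n with
  | zero => rwa [chain_zero]
  | succ n =>
    intro X Y
    simp only [chain_succ]
    rw [integral_mul_integral_assoc]
    · refine integral_congr_ae (Eventually.of_forall fun Z => ?_)
      simp only
      rw [h X Z]
    · exact (stronglyMeasurable_right hR.meas X).aestronglyMeasurable
    · exact (hk i).aestronglyMeasurable
    · exact (stronglyMeasurable_left (stronglyMeasurable_chain hk _ _) Y).aestronglyMeasurable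
    · obtain ⟨K, hK, hb⟩ := hR.exists_lintegral_le ν s
      have hsl := (isSlowKernel_lchain (ν := ν) hM.slow i (n + 1)).isSlow_left Y
      refine ne_top_of_le_ne_top (ENNReal.mul_ne_top hK (hM.ne_top i (n + 1) hin X Y))
        (le_trans (lintegral_mono fun Z => ?_) (hb _ hsl X))
      rw [lintegral_const_mul' _ _ enorm_ne_top, lchain_succ]
      refine mul_le_mul_right (lintegral_mono fun W => ?_) _
      exact mul_le_mul' (hkm _ _ _) (enorm_chain_le hkm _ _ _ _)

theorem reproducesRight_chain (hR : IsGaussKernel R) (hM : IsMajorant ν s N m)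
    (hk : ∀ i, StronglyMeasurable (Function.uncurry (k i)))
    (hkm : ∀ i X Y, ‖k i X Y‖ₑ ≤ m i X Y) {i n : ℕ} (hin : i + n ≤ N)
    (h : ReproducesRight ν R (k (i + n))) : ReproducesRight ν R (chain ν k i n) := by
  induction n generalizing i with
  | zero => rwa [chain_zero]
  | succ n ih =>
    intro X Y
    simp only [chain_succ]
    have ih' := ih (i := i + 1) (by omega) (by rwa [show i + 1 + n = i + (n + 1) by omega])
    rw [← integral_mul_integral_assoc]
    · refine integral_congr_ae (Eventually.of_forall fun Z => ?_)
      simp only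
      rw [ih' Z Y]
    · exact (stronglyMeasurable_right (hk i) X).aestronglyMeasurable
    · exact (stronglyMeasurable_chain hk _ _).aestronglyMeasurable
    · exact (stronglyMeasurable_left hR.meas Y).aestronglyMeasurable
    · obtain ⟨K, hK, hb⟩ := hR.swap.exists_lintegral_le ν s
      refine ne_top_of_le_ne_top (ENNReal.mul_ne_top hK (hM.ne_top i (n + 1) hin X Y)) ?_
      rw [lchain_succ, ← lintegral_const_mul' _ _ hK]
      refine lintegral_mono fun Z => ?_
      have hsl := (isSlowKernel_lchain (ν := ν) hM.slow (i + 1) n).isSlow_right Z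
      rw [lintegral_const_mul' _ _ enorm_ne_top]
      calc _ ≤ m i X Z * ∫⁻ W, ‖R W Y‖ₑ * lchain ν m (i + 1) n Z W ∂ν := by
            refine mul_le_mul' (hkm _ _ _) (lintegral_mono fun W => ?_)
            rw [mul_comm]
            exact mul_le_mul_right (enorm_chain_le hkm _ _ _ _) _
        _ ≤ m i X Z * (K * lchain ν m (i + 1) n Z Y) := mul_le_mul_right (hb _ hsl Y) _
        _ = _ := by ring

end Reproducing

/-! ### Phase space coordinates for kernels -/

section PhaseSpace

variable {d : ℕ}

/-- Lebesgue measure on the phase space `ℝ^d × ℝ^d`, divided by `(2π)^d`. With this normalization the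
time-frequency shifts of a window of norm one resolve the identity. -/
def phaseMeasure (d : ℕ) : Measure (Rd d × Rd d) := ENNReal.ofReal (((2 * Real.pi) ^ d)⁻¹) • volume

theorem phaseConst_pos (d : ℕ) : 0 < ((2 * Real.pi) ^ d)⁻¹ := by positivity

instance isAddHaarMeasure_phaseMeasure (d : ℕ) : (phaseMeasure d).IsAddHaarMeasure :=
  Measure.IsAddHaarMeasure.smul _ (ENNReal.ofReal_pos.mpr (phaseConst_pos d)).ne'
    ENNReal.ofReal_ne_top

theorem integral_phaseMeasure (f : Rd d × Rd d → ℂ) :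
    ∫ z, f z ∂(phaseMeasure d) = (((2 * Real.pi) ^ d)⁻¹ : ℝ) * ∫ z, f z := by
  rw [phaseMeasure, integral_smul_measure, ENNReal.toReal_ofReal (phaseConst_pos d).le]
  exact Complex.real_smul

theorem integrable_phaseMeasure {E : Type*} [NormedAddCommGroup E] {f : Rd d × Rd d → E} :
    Integrable f (phaseMeasure d) ↔ Integrable f :=
  integrable_smul_measure (ENNReal.ofReal_pos.mpr (phaseConst_pos d)).ne' ENNReal.ofReal_ne_top

theorem phaseMeasure_prod : (phaseMeasure d).prod (phaseMeasure d) =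
    ENNReal.ofReal ((((2 * Real.pi) ^ d)⁻¹) ^ 2) • volume := by
  rw [phaseMeasure, Measure.prod_smul_left, Measure.prod_smul_right, smul_smul,
    ← ENNReal.ofReal_mul (phaseConst_pos d).le, pow_two]
  rfl

/-- The identification `((x, ξ), (y, η)) ↦ ((x, y), (ξ, -η))` of pairs of points of the phase space
of `ℝ^d` with points of the phase space of `ℝ^{2d}`. -/
def phaseMap (q : (Rd d × Rd d) × (Rd d × Rd d)) : R2d d × R2d d :=
  (pt q.1.1 q.2.1, pt q.1.2 (-q.2.2))

/-- The inverse of `phaseMap`. -/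
def phaseMapInv (z : R2d d × R2d d) : (Rd d × Rd d) × (Rd d × Rd d) :=
  ((z.1.fst, z.2.fst), (z.1.snd, -z.2.snd))

theorem phaseMapInv_phaseMap (q : (Rd d × Rd d) × (Rd d × Rd d)) : phaseMapInv (phaseMap q) = q := by
  simp [phaseMapInv, phaseMap]

theorem phaseMap_phaseMapInv (z : R2d d × R2d d) : phaseMap (phaseMapInv z) = z := by
  simp only [phaseMapInv, phaseMap, neg_neg]
  rfl

theorem continuous_phaseMap : Continuous (phaseMap (d := d)) := by
  unfold phaseMap
  have h := WithLp.prod_continuous_toLp 2 (Rd d) (Rd d)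
  exact (h.comp (by fun_prop)).prodMk (h.comp (by fun_prop))

theorem continuous_phaseMapInv : Continuous (phaseMapInv (d := d)) := by
  unfold phaseMapInv
  have h := WithLp.prod_continuous_ofLp 2 (Rd d) (Rd d)
  have h1 : Continuous fun z : R2d d × R2d d => z.1.ofLp := h.comp continuous_fst
  have h2 : Continuous fun z : R2d d × R2d d => z.2.ofLp := h.comp continuous_snd
  exact (h1.fst.prodMk h2.fst).prodMk (h1.snd.prodMk h2.snd.neg)

theorem measurableEmbedding_phaseMap : MeasurableEmbedding (phaseMap (d := d)) :=
  (MeasurableEquiv.mk ⟨phaseMap, phaseMapInv, phaseMapInv_phaseMap, phaseMap_phaseMapInv⟩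
    continuous_phaseMap.measurable continuous_phaseMapInv.measurable).measurableEmbedding

theorem measurePreserving_phaseMap :
    MeasurePreserving (phaseMap (d := d)) volume volume := by
  have hneg : MeasurePreserving (fun q : Rd d × Rd d => (q.1, -q.2)) volume volume :=
    (MeasurePreserving.id _).prod (Measure.measurePreserving_neg (volume : Measure (Rd d)))
  have hto : MeasurePreserving (fun q : Rd d × Rd d => pt q.1 q.2) volume volume :=
    WithLp.volume_preserving_toLp (Rd d) (Rd d)
  have hsw : MeasurePreserving (fun q : Rd d × (Rd d × Rd d) => (q.2.1, (q.1, q.2.2)))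
      volume volume := by
    have h1 := (volume_preserving_prodAssoc (α₁ := Rd d) (β₁ := Rd d) (γ₁ := Rd d)).symm
    have h2 : MeasurePreserving (Prod.map (Prod.swap (α := Rd d) (β := Rd d)) (id : Rd d → Rd d))
        volume volume := Measure.measurePreserving_swap.prod (MeasurePreserving.id _)
    exact (volume_preserving_prodAssoc.comp h2).comp h1
  have hmid : MeasurePreserving (fun q : (Rd d × Rd d) × (Rd d × Rd d) =>
      ((q.1.1, q.2.1), (q.1.2, q.2.2))) volume volume := by
    have h1 := volume_preserving_prodAssoc (α₁ := Rd d) (β₁ := Rd d) (γ₁ := Rd d × Rd d)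
    have h2 : MeasurePreserving (Prod.map (id : Rd d → Rd d)
        fun q : Rd d × (Rd d × Rd d) => (q.2.1, (q.1, q.2.2))) volume volume :=
      (MeasurePreserving.id _).prod hsw
    exact ((volume_preserving_prodAssoc (α₁ := Rd d) (β₁ := Rd d) (γ₁ := Rd d × Rd d)).symm.comp
      h2).comp h1
  exact (hto.prod (hto.comp hneg)).comp hmid

theorem integral_comp_phaseMap (g : R2d d × R2d d → ℂ) :
    ∫ q, g (phaseMap q) ∂((phaseMeasure d).prod (phaseMeasure d)) =
      ((((2 * Real.pi) ^ d)⁻¹) ^ 2 : ℝ) * ∫ z, g z := by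
  rw [phaseMeasure_prod, integral_smul_measure,
    ENNReal.toReal_ofReal (by positivity), measurePreserving_phaseMap.integral_comp
      measurableEmbedding_phaseMap]
  exact Complex.real_smul

theorem integrable_comp_phaseMap {E : Type*} [NormedAddCommGroup E] {g : R2d d × R2d d → E} :
    Integrable (fun q => g (phaseMap q)) ((phaseMeasure d).prod (phaseMeasure d)) ↔
      Integrable g := by
  rw [phaseMeasure_prod, integrable_smul_measure (ENNReal.ofReal_pos.mpr (by positivity)).ne'
    ENNReal.ofReal_ne_top]
  exact measurePreserving_phaseMap.integrable_comp_emb measurableEmbedding_phaseMap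

theorem norm_pt_le (x y : Rd d) : ‖pt x y‖ ≤ ‖x‖ + ‖y‖ := by
  rw [WithLp.prod_norm_eq_of_L2]
  refine Real.sqrt_le_iff.mpr ⟨by positivity, ?_⟩
  change ‖x‖ ^ 2 + ‖y‖ ^ 2 ≤ _
  nlinarith [mul_nonneg (norm_nonneg x) (norm_nonneg y)]

theorem norm_phaseMap_sub_le (X X' Y Y' : Rd d × Rd d) :
    ‖phaseMap (X, Y) - phaseMap (X', Y')‖ ≤ ‖X - X'‖ + ‖Y - Y'‖ := by
  have e1 : pt X.1 Y.1 - pt X'.1 Y'.1 = pt (X.1 - X'.1) (Y.1 - Y'.1) := rfl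
  have e2 : pt X.2 (-Y.2) - pt X'.2 (-Y'.2) = pt (X.2 - X'.2) (-Y.2 - -Y'.2) := rfl
  have h1 : ‖X.1 - X'.1‖ ≤ ‖X - X'‖ := norm_fst_le (X - X')
  have h2 : ‖Y.1 - Y'.1‖ ≤ ‖Y - Y'‖ := norm_fst_le (Y - Y')
  have h3 : ‖X.2 - X'.2‖ ≤ ‖X - X'‖ := norm_snd_le (X - X')
  have h4 : ‖-Y.2 - -Y'.2‖ ≤ ‖Y - Y'‖ := by
    rw [← neg_sub', norm_neg]; exact norm_snd_le (Y - Y')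
  refine norm_prod_le_iff.mpr ⟨?_, ?_⟩
  · change ‖pt X.1 Y.1 - pt X'.1 Y'.1‖ ≤ _
    rw [e1]
    exact (norm_pt_le _ _).trans (add_le_add h1 h2)
  · change ‖pt X.2 (-Y.2) - pt X'.2 (-Y'.2)‖ ≤ _
    rw [e2]
    exact (norm_pt_le _ _).trans (add_le_add h3 h4)

theorem norm_phaseMap_le (q : (Rd d × Rd d) × (Rd d × Rd d)) :
    ‖phaseMap q‖ ≤ ‖q.1‖ + ‖q.2‖ := by
  have h := norm_phaseMap_sub_le q.1 0 q.2 0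
  have h0 : phaseMap ((0 : Rd d × Rd d), (0 : Rd d × Rd d)) = 0 := by
    simp [phaseMap]
  simpa [h0] using h

theorem norm_phaseMapInv_le (z : R2d d × R2d d) :
    ‖(phaseMapInv z).1‖ ≤ ‖z‖ ∧ ‖(phaseMapInv z).2‖ ≤ ‖z‖ := by
  have hf : ∀ w : R2d d, ‖w.fst‖ ≤ ‖w‖ := fun w => by
    rw [WithLp.prod_norm_eq_of_L2]
    exact Real.le_sqrt_of_sq_le (by nlinarith [sq_nonneg ‖w.snd‖])
  have hs : ∀ w : R2d d, ‖w.snd‖ ≤ ‖w‖ := fun w => by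
    rw [WithLp.prod_norm_eq_of_L2]
    exact Real.le_sqrt_of_sq_le (by nlinarith [sq_nonneg ‖w.fst‖])
  refine ⟨norm_prod_le_iff.mpr ⟨(hf z.1).trans (norm_fst_le z), (hf z.2).trans (norm_snd_le z)⟩,
    norm_prod_le_iff.mpr ⟨(hs z.1).trans (norm_fst_le z), ?_⟩⟩
  change ‖-z.2.snd‖ ≤ _
  rw [norm_neg]
  exact (hs z.2).trans (norm_snd_le z)

theorem integral_R2d_mul (f g : Rd d → ℂ) :
    ∫ w : R2d d, f w.fst * g w.snd = (∫ x, f x) * ∫ y, g y := by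
  have h := (WithLp.volume_preserving_toLp (Rd d) (Rd d)).integral_comp
    (MeasurableEquiv.toLp 2 (Rd d × Rd d)).measurableEmbedding (fun w : R2d d => f w.fst * g w.snd)
  rw [← h]
  exact integral_prod_mul f g

end PhaseSpace

/-! ### Matrices of kernels with respect to time-frequency shifts -/

section TFMatrix

variable {d : ℕ}

/-- The inner products of the time-frequency shifts of two windows. -/
def tfGram (φ ψ : GelfandShilov (Rd d)) (X Y : Rd d × Rd d) : ℂ :=
  ana ψ (gsConj (tfShift X.1 X.2 φ)) Y

theorem isGaussKernel_tfGram (φ ψ : GelfandShilov (Rd d)) : IsGaussKernel (tfGram φ ψ) := by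
  obtain ⟨C, r, hr, hC, h⟩ := exists_ana_tfShift_le ψ φ
  refine ⟨stronglyMeasurable_ana_tfShift ψ φ, ENNReal.ofReal C, r, ENNReal.ofReal_ne_top, hr,
    fun X Y => ?_⟩
  rw [ex, ← ENNReal.ofReal_mul hC, ← ofReal_norm, norm_sub_rev]
  exact ENNReal.ofReal_le_ofReal (h X Y)

theorem windowConst_of_norm_eq_one {φ : GelfandShilov (Rd d)}
    (hφ : ∫ t, ‖(φ : Rd d → ℂ) t‖ ^ 2 = 1) : windowConst φ = (2 * Real.pi) ^ d := by
  rw [windowConst, hφ, mul_one, finrank_euclideanSpace, Fintype.card_fin]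

/-- The resolution of the identity by the time-frequency shifts of `ψ`. -/
theorem integral_tfGram_mul_tfGram (φ φ' : GelfandShilov (Rd d)) {ψ : GelfandShilov (Rd d)}
    (hψ : ∫ t, ‖(ψ : Rd d → ℂ) t‖ ^ 2 = 1) (X Y : Rd d × Rd d) :
    ∫ Z, tfGram φ ψ X Z * tfGram ψ φ' Z Y ∂(phaseMeasure d) = tfGram φ φ' X Y := by
  have h := (ana_parseval ψ (gsConj (tfShift X.1 X.2 φ)) (tfShift Y.1 Y.2 φ')).2
  rw [windowConst_of_norm_eq_one hψ] at h
  rw [integral_phaseMeasure]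
  have h' : ∫ Z, tfGram φ ψ X Z * tfGram ψ φ' Z Y =
      ((2 * Real.pi) ^ d : ℝ) * tfGram φ φ' X Y := h
  rw [h', ← mul_assoc, ← Complex.ofReal_mul, inv_mul_cancel₀ (by positivity), Complex.ofReal_one,
    one_mul]

/-- The window on `ℝ^{2d}` adapted to kernels of operators. -/
def kerWindow (φ : GelfandShilov (Rd d)) : GelfandShilov (R2d d) := gsTensor φ (gsConj φ)

theorem gsConj_tfShift_kerWindow (φ : GelfandShilov (Rd d)) (X Y : Rd d × Rd d) :
    gsConj (tfShift (phaseMap (X, Y)).1 (phaseMap (X, Y)).2 (kerWindow φ)) =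
      gsTensor (gsConj (tfShift X.1 X.2 φ)) (tfShift Y.1 Y.2 φ) := by
  refine Subtype.ext (funext fun w => ?_)
  change conj (Complex.exp (Complex.I * ((inner ℝ w (pt X.2 (-Y.2)) : ℝ) : ℂ)) *
      ((φ : Rd d → ℂ) (w - pt X.1 Y.1).fst * conj ((φ : Rd d → ℂ) (w - pt X.1 Y.1).snd))) =
    conj (Complex.exp (Complex.I * ((inner ℝ w.fst X.2 : ℝ) : ℂ)) * (φ : Rd d → ℂ) (w.fst - X.1)) *
      (Complex.exp (Complex.I * ((inner ℝ w.snd Y.2 : ℝ) : ℂ)) * (φ : Rd d → ℂ) (w.snd - Y.1))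
  have e : (inner ℝ w (pt X.2 (-Y.2)) : ℝ) = inner ℝ w.fst X.2 - inner ℝ w.snd Y.2 := by
    rw [WithLp.prod_inner_apply]
    simp [inner_neg_right, sub_eq_add_neg]
  have e1 : (w - pt X.1 Y.1).fst = w.fst - X.1 := rfl
  have e2 : (w - pt X.1 Y.1).snd = w.snd - Y.1 := rfl
  rw [e, e1, e2]
  simp only [map_mul, ← Complex.exp_conj, Complex.conj_I, Complex.conj_ofReal, Complex.conj_conj,
    Complex.ofReal_sub, map_sub]
  have e3 : Complex.exp (-Complex.I * (((inner ℝ w.fst X.2 : ℝ) : ℂ) - ((inner ℝ w.snd Y.2 : ℝ) : ℂ))) =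
      Complex.exp (-Complex.I * ((inner ℝ w.fst X.2 : ℝ) : ℂ)) *
        Complex.exp (Complex.I * ((inner ℝ w.snd Y.2 : ℝ) : ℂ)) := by
    rw [← Complex.exp_add]; congr 1; ring
  rw [e3]
  ring

theorem tfShift_kerWindow (φ : GelfandShilov (Rd d)) (X Y : Rd d × Rd d) :
    tfShift (phaseMap (X, Y)).1 (phaseMap (X, Y)).2 (kerWindow φ) =
      gsTensor (tfShift X.1 X.2 φ) (gsConj (tfShift Y.1 Y.2 φ)) := by
  have h := congrArg gsConj (gsConj_tfShift_kerWindow φ X Y)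
  refine Subtype.ext (funext fun w => ?_)
  have h' := congrFun (congrArg Subtype.val h) w
  change conj (conj ((tfShift (phaseMap (X, Y)).1 (phaseMap (X, Y)).2 (kerWindow φ) :
    R2d d → ℂ) w)) = conj (conj ((tfShift X.1 X.2 φ : Rd d → ℂ) w.fst) *
      (tfShift Y.1 Y.2 φ : Rd d → ℂ) w.snd) at h'
  rw [Complex.conj_conj, map_mul, Complex.conj_conj] at h'
  exact h'

/-- The matrix of the operator with kernel `K` with respect to the time-frequency shifts of `φ`. -/
def tfMatrix (φ : GelfandShilov (Rd d)) (K : GSDist (R2d d)) (X Y : Rd d × Rd d) : ℂ :=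
  K.1 (gsTensor (gsConj (tfShift X.1 X.2 φ)) (tfShift Y.1 Y.2 φ))

theorem tfMatrix_eq (φ : GelfandShilov (Rd d)) (K : GSDist (R2d d)) (X Y : Rd d × Rd d) :
    tfMatrix φ K X Y =
      K.1 (gsConj (tfShift (phaseMap (X, Y)).1 (phaseMap (X, Y)).2 (kerWindow φ))) := by
  rw [tfMatrix, gsConj_tfShift_kerWindow]

theorem stronglyMeasurable_tfMatrix (φ : GelfandShilov (Rd d)) (K : GSDist (R2d d)) :
    StronglyMeasurable (Function.uncurry (tfMatrix φ K)) := by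
  have h := (stronglyMeasurable_gsDist_tfShift K (kerWindow φ)).comp_measurable
    (continuous_phaseMap (d := d)).measurable
  have e : Function.uncurry (tfMatrix φ K) = (fun z : R2d d × R2d d =>
      K.1 (gsConj (tfShift z.1 z.2 (kerWindow φ)))) ∘ phaseMap :=
    funext fun q => tfMatrix_eq φ K q.1 q.2
  rw [e]
  exact h

/-- The coefficients `⟨F, π(X)φ ⊗ conj(π(Y)φ)⟩` of a test function on `ℝ^{2d}`. -/
def anaKer (φ : GelfandShilov (Rd d)) (F : GelfandShilov (R2d d)) (X Y : Rd d × Rd d) : ℂ :=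
  ana (kerWindow φ) F (phaseMap (X, Y))

/-- The coefficients `⟨f, conj(π(Y)φ)⟩` of a test function on `ℝ^d`. -/
def anaConj (φ f : GelfandShilov (Rd d)) (Y : Rd d × Rd d) : ℂ :=
  ∫ t, (f : Rd d → ℂ) t * (gsConj (tfShift Y.1 Y.2 φ) : Rd d → ℂ) t

theorem anaKer_gsTensor (φ g f : GelfandShilov (Rd d)) (X Y : Rd d × Rd d) :
    anaKer φ (gsTensor g f) X Y = ana φ g X * anaConj φ f Y := by
  rw [anaKer, ana, tfShift_kerWindow, ana, anaConj, ← integral_R2d_mul]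
  refine integral_congr_ae (Eventually.of_forall fun w => ?_)
  change (g : Rd d → ℂ) w.fst * (f : Rd d → ℂ) w.snd * ((tfShift X.1 X.2 φ : Rd d → ℂ) w.fst *
    (gsConj (tfShift Y.1 Y.2 φ) : Rd d → ℂ) w.snd) = _
  simp only
  ring

theorem anaConj_tfShift (φ ψ : GelfandShilov (Rd d)) (Z Y : Rd d × Rd d) :
    anaConj φ (tfShift Z.1 Z.2 ψ) Y = tfGram φ ψ Y Z := by
  rw [anaConj, tfGram, ana]
  simp only [mul_comm]

theorem windowConst_kerWindow {φ : GelfandShilov (Rd d)}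
    (hφ : ∫ t, ‖(φ : Rd d → ℂ) t‖ ^ 2 = 1) :
    windowConst (kerWindow φ) = ((2 * Real.pi) ^ d) ^ 2 := by
  have h1 : ∫ w : R2d d, ‖(kerWindow φ : R2d d → ℂ) w‖ ^ 2 = 1 := by
    have h := integral_R2d_mul (fun t => ((‖(φ : Rd d → ℂ) t‖ ^ 2 : ℝ) : ℂ))
      (fun t => ((‖(φ : Rd d → ℂ) t‖ ^ 2 : ℝ) : ℂ))
    rw [integral_complex_ofReal, hφ, Complex.ofReal_one, one_mul] at h
    have e : ∀ w : R2d d, ((‖(φ : Rd d → ℂ) w.fst‖ ^ 2 : ℝ) : ℂ) *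
        ((‖(φ : Rd d → ℂ) w.snd‖ ^ 2 : ℝ) : ℂ) = ((‖(kerWindow φ : R2d d → ℂ) w‖ ^ 2 : ℝ) : ℂ) := by
      intro w
      rw [← Complex.ofReal_mul, ← mul_pow]
      change _ = ((‖(φ : Rd d → ℂ) w.fst * conj ((φ : Rd d → ℂ) w.snd)‖ ^ 2 : ℝ) : ℂ)
      rw [norm_mul, RCLike.norm_conj]
    simp only [e] at h
    rw [integral_complex_ofReal] at h
    exact_mod_cast h
  rw [windowConst, h1, mul_one, ← pow_mul]
  congr 1
  rw [(WithLp.linearEquiv 2 ℝ (Rd d × Rd d)).finrank_eq, Module.finrank_prod,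
    finrank_euclideanSpace, Fintype.card_fin]
  ring

/-- Every distribution on `ℝ^{2d}` is recovered from its matrix. -/
theorem tfMatrix_expansion {φ : GelfandShilov (Rd d)} (hφ : ∫ t, ‖(φ : Rd d → ℂ) t‖ ^ 2 = 1)
    (K : GSDist (R2d d)) (F : GelfandShilov (R2d d)) :
    Integrable (fun q : (Rd d × Rd d) × (Rd d × Rd d) => tfMatrix φ K q.1 q.2 * anaKer φ F q.1 q.2)
      ((phaseMeasure d).prod (phaseMeasure d)) ∧
    ∫ q : (Rd d × Rd d) × (Rd d × Rd d), tfMatrix φ K q.1 q.2 * anaKer φ F q.1 q.2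
      ∂((phaseMeasure d).prod (phaseMeasure d)) = K.1 F := by
  obtain ⟨h1, h2⟩ := gsDist_expansion (kerWindow φ) K F
  rw [windowConst_kerWindow hφ] at h2
  have e : (fun q : (Rd d × Rd d) × (Rd d × Rd d) => tfMatrix φ K q.1 q.2 * anaKer φ F q.1 q.2) =
      fun q => (fun z : R2d d × R2d d => K.1 (gsConj (tfShift z.1 z.2 (kerWindow φ))) *
        ana (kerWindow φ) F z) (phaseMap q) := by
    funext q
    rw [tfMatrix_eq]
    rfl
  rw [e]
  refine ⟨integrable_comp_phaseMap.mpr h1, ?_⟩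
  rw [integral_comp_phaseMap (fun z : R2d d × R2d d =>
    K.1 (gsConj (tfShift z.1 z.2 (kerWindow φ))) * ana (kerWindow φ) F z), h2, ← mul_assoc, ← Complex.ofReal_mul, ← mul_pow,
    inv_mul_cancel₀ (by positivity), one_pow, Complex.ofReal_one, one_mul]

end TFMatrix

/-! ### Kernels dominated by slowly varying functions -/

section Tame

variable {P : Type*} [NormedAddCommGroup P] [MeasurableSpace P]

/-- Finite, measurable, slowly varying non-negative kernels. -/
structure IsTame (s : ℝ) (M : P → P → ℝ≥0∞) : Prop where
  measurable : Measurable (Function.uncurry M)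
  slow : IsSlowKernel s M
  ne_top : ∀ X Y, M X Y ≠ ∞

/-- The complex kernel `c` is measurable and dominated by `M`. -/
structure IsDominatedBy (M : P → P → ℝ≥0∞) (c : P → P → ℂ) : Prop where
  meas : StronglyMeasurable (Function.uncurry c)
  le : ∀ X Y, ‖c X Y‖ₑ ≤ M X Y

/-- Integrability against all exponentials. -/
structure HasExpMoments (ν : Measure P) (a : P → ℂ) : Prop where
  meas : StronglyMeasurable a
  ne_top : ∀ s, ∫⁻ X, ‖a X‖ₑ * ex (s * ‖X‖) ∂ν ≠ ∞

variable {ν : Measure P} {s : ℝ} {M : P → P → ℝ≥0∞} {c : P → P → ℂ} {a b : P → ℂ}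

theorem IsTame.le_zero (hM : IsTame s M) (X Y : P) :
    M X Y ≤ M 0 0 * ex (s * ‖X‖) * ex (s * ‖Y‖) := by
  refine (hM.slow X 0 Y 0).trans (le_of_eq ?_)
  rw [sub_zero, sub_zero, mul_add, ex_add, mul_assoc]

theorem IsMajorant.isTame_lchain [SFinite ν] {N : ℕ} {m : ℕ → P → P → ℝ≥0∞}
    (h : IsMajorant ν s N m) {i n : ℕ} (hin : i + n ≤ N) : IsTame s (lchain ν m i n) :=
  ⟨measurable_lchain h.measurable i n, isSlowKernel_lchain h.slow i n, h.ne_top i n hin⟩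

theorem lintegral_lintegral_ne_top (hM : IsTame s M) (ha : HasExpMoments ν a)
    (hb : HasExpMoments ν b) :
    ∫⁻ X, ∫⁻ Y, ‖a X‖ₑ * (M X Y * ‖b Y‖ₑ) ∂ν ∂ν ≠ ∞ := by
  refine ne_top_of_le_ne_top (ENNReal.mul_ne_top (ENNReal.mul_ne_top (hM.ne_top 0 0) (ha.ne_top s))
    (hb.ne_top s)) ?_
  calc _ ≤ ∫⁻ X, ∫⁻ Y, (M 0 0 * (‖a X‖ₑ * ex (s * ‖X‖))) * (‖b Y‖ₑ * ex (s * ‖Y‖)) ∂ν ∂ν := by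
        refine lintegral_mono fun X => lintegral_mono fun Y => ?_
        calc _ ≤ ‖a X‖ₑ * (M 0 0 * ex (s * ‖X‖) * ex (s * ‖Y‖) * ‖b Y‖ₑ) := by
              have := hM.le_zero X Y
              gcongr
          _ = _ := by ring
    _ = ∫⁻ X, (M 0 0 * (‖a X‖ₑ * ex (s * ‖X‖))) * ∫⁻ Y, ‖b Y‖ₑ * ex (s * ‖Y‖) ∂ν ∂ν := by
        congr 1
        funext X
        rw [lintegral_const_mul' _ _ (ENNReal.mul_ne_top (hM.ne_top 0 0)
          (ENNReal.mul_ne_top enorm_ne_top (ex_ne_top _)))]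
    _ = _ := by
        rw [lintegral_mul_const' _ _ (hb.ne_top s), lintegral_const_mul' _ _ (hM.ne_top 0 0)]

theorem IsDominatedBy.lintegral_ne_top (hc : IsDominatedBy M c) (hM : IsTame s M)
    (ha : HasExpMoments ν a) (hb : HasExpMoments ν b) :
    ∫⁻ X, ∫⁻ Y, ‖a X‖ₑ * (‖c X Y‖ₑ * ‖b Y‖ₑ) ∂ν ∂ν ≠ ∞ :=
  ne_top_of_le_ne_top (lintegral_lintegral_ne_top hM ha hb)
    (lintegral_mono fun X => lintegral_mono fun Y =>
      mul_le_mul_right (mul_le_mul_left (hc.le X Y) _) _)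

/-- Associativity `a ∘ (c ∘ b) = (a ∘ c) ∘ b` for a dominated kernel between rapidly decreasing
functions. -/
theorem IsDominatedBy.assoc [SFinite ν] (hc : IsDominatedBy M c) (hM : IsTame s M)
    (ha : HasExpMoments ν a) (hb : HasExpMoments ν b) :
    ∫ X, a X * ∫ Y, c X Y * b Y ∂ν ∂ν = ∫ Y, (∫ X, a X * c X Y ∂ν) * b Y ∂ν :=
  integral_mul_integral_assoc ha.meas.aestronglyMeasurable hc.meas.aestronglyMeasurable
    hb.meas.aestronglyMeasurable (hc.lintegral_ne_top hM ha hb)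

variable {M₁ M₂ : P → P → ℝ≥0∞} {c₁ c₂ : P → P → ℂ}

/-- `(a ∘ c₁) ∘ (c₂ ∘ b) = a ∘ ((c₁ ∘ c₂) ∘ b)`, together with absolute convergence of the integral
on the left-hand side, also after replacing all factors by their majorants. -/
theorem integral_comp_comp [SFinite ν] (h₁ : IsTame s M₁) (h₂ : IsTame s M₂)
    (hM : IsTame s M) (hMM : ∀ X Y, ∫⁻ Z, M₁ X Z * M₂ Z Y ∂ν = M X Y)
    (hc₁ : IsDominatedBy M₁ c₁) (hc₂ : IsDominatedBy M₂ c₂) (ha : HasExpMoments ν a)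
    (hb : HasExpMoments ν b) :
    ∫⁻ Z, (∫⁻ X, ‖a X‖ₑ * M₁ X Z ∂ν) * (∫⁻ Y, M₂ Z Y * ‖b Y‖ₑ ∂ν) ∂ν ≠ ∞ ∧
    ∫ Z, (∫ X, a X * c₁ X Z ∂ν) * (∫ Y, c₂ Z Y * b Y ∂ν) ∂ν =
      ∫ X, a X * ∫ Y, (∫ Z, c₁ X Z * c₂ Z Y ∂ν) * b Y ∂ν ∂ν := by
  have hM₁l : ∀ Z, Measurable fun X => M₁ X Z := fun Z =>
    h₁.measurable.comp (measurable_id.prodMk measurable_const)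
  have hM₁r : ∀ X, Measurable fun Z => M₁ X Z := fun X =>
    h₁.measurable.comp (measurable_const.prodMk measurable_id)
  have hae : Measurable fun X => ‖a X‖ₑ := ha.meas.enorm
  have hbe : Measurable fun X => ‖b X‖ₑ := hb.meas.enorm
  have hB : Measurable fun Z => ∫⁻ Y, M₂ Z Y * ‖b Y‖ₑ ∂ν :=
    Measurable.lintegral_prod_right' (f := fun q : P × P => M₂ q.1 q.2 * ‖b q.2‖ₑ)
      (h₂.measurable.mul (hbe.comp measurable_snd))
  have eM : ∀ X, ∫⁻ Y, M X Y * ‖b Y‖ₑ ∂ν = ∫⁻ Z, M₁ X Z * ∫⁻ Y, M₂ Z Y * ‖b Y‖ₑ ∂ν ∂ν := by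
    intro X
    have e1 : ∀ Y, M X Y * ‖b Y‖ₑ = ∫⁻ Z, M₁ X Z * (M₂ Z Y * ‖b Y‖ₑ) ∂ν := fun Y => by
      rw [← hMM, ← lintegral_mul_const' _ _ enorm_ne_top]
      simp only [mul_assoc]
    have e2 : ∀ Z, M₁ X Z * ∫⁻ Y, M₂ Z Y * ‖b Y‖ₑ ∂ν = ∫⁻ Y, M₁ X Z * (M₂ Z Y * ‖b Y‖ₑ) ∂ν :=
      fun Z => (lintegral_const_mul' _ _ (h₁.ne_top X Z)).symm
    simp only [e1, e2]
    refine lintegral_lintegral_swap (Measurable.aemeasurable ?_)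
    exact ((hM₁r X).comp measurable_snd).mul
      ((h₂.measurable.comp measurable_swap).mul (hbe.comp measurable_fst))
  have hfin := lintegral_lintegral_ne_top hM ha hb
  have hfin' : ∫⁻ X, ‖a X‖ₑ * ∫⁻ Z, M₁ X Z * ∫⁻ Y, M₂ Z Y * ‖b Y‖ₑ ∂ν ∂ν ∂ν ≠ ∞ := by
    refine ne_top_of_le_ne_top hfin (le_of_eq ?_)
    congr 1
    funext X
    rw [← eM, lintegral_const_mul' _ _ enorm_ne_top]
  have hBc : StronglyMeasurable fun Z => ∫ Y, c₂ Z Y * b Y ∂ν :=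
    StronglyMeasurable.integral_prod_right' (f := fun q : P × P => c₂ q.1 q.2 * b q.2)
      (hc₂.meas.mul (hb.meas.comp_measurable measurable_snd))
  have hBe : ∀ Z, ‖∫ Y, c₂ Z Y * b Y ∂ν‖ₑ ≤ ∫⁻ Y, M₂ Z Y * ‖b Y‖ₑ ∂ν := fun Z => by
    refine (enorm_integral_le_lintegral_enorm _).trans (lintegral_mono fun Y => ?_)
    rw [enorm_mul]
    exact mul_le_mul_left (hc₂.le Z Y) _
  have hswap : ∫⁻ Z, (∫⁻ X, ‖a X‖ₑ * M₁ X Z ∂ν) * (∫⁻ Y, M₂ Z Y * ‖b Y‖ₑ ∂ν) ∂ν =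
      ∫⁻ X, ‖a X‖ₑ * ∫⁻ Z, M₁ X Z * ∫⁻ Y, M₂ Z Y * ‖b Y‖ₑ ∂ν ∂ν ∂ν := by
    have e1 : ∀ Z, (∫⁻ X, ‖a X‖ₑ * M₁ X Z ∂ν) * (∫⁻ Y, M₂ Z Y * ‖b Y‖ₑ ∂ν) =
        ∫⁻ X, ‖a X‖ₑ * (M₁ X Z * ∫⁻ Y, M₂ Z Y * ‖b Y‖ₑ ∂ν) ∂ν := fun Z => by
      have hm : Measurable fun X => ‖a X‖ₑ * M₁ X Z := hae.mul (hM₁l Z)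
      rw [← lintegral_mul_const _ hm]
      simp only [mul_assoc]
    have e2 : ∀ X, ‖a X‖ₑ * ∫⁻ Z, M₁ X Z * ∫⁻ Y, M₂ Z Y * ‖b Y‖ₑ ∂ν ∂ν =
        ∫⁻ Z, ‖a X‖ₑ * (M₁ X Z * ∫⁻ Y, M₂ Z Y * ‖b Y‖ₑ ∂ν) ∂ν := fun X =>
      (lintegral_const_mul' _ _ enorm_ne_top).symm
    simp only [e1, e2]
    refine lintegral_lintegral_swap (Measurable.aemeasurable ?_)
    exact (hae.comp measurable_snd).mul ((h₁.measurable.comp measurable_swap).mul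
      (hB.comp measurable_fst))
  refine ⟨by rw [hswap]; exact hfin', ?_⟩
  rw [← integral_mul_integral_assoc ha.meas.aestronglyMeasurable hc₁.meas.aestronglyMeasurable
    hBc.aestronglyMeasurable]
  · refine integral_congr_ae ?_
    -- For fixed `X` the inner associativity needs finiteness, which holds where `a X ≠ 0` matters.
    have hae_fin : ∀ᵐ X ∂ν, ‖a X‖ₑ * ∫⁻ Z, M₁ X Z * ∫⁻ Y, M₂ Z Y * ‖b Y‖ₑ ∂ν ∂ν < ∞ := by
      refine ae_lt_top ?_ hfin'
      exact hae.mul (Measurable.lintegral_prod_right'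
        (f := fun q : P × P => M₁ q.1 q.2 * ∫⁻ Y, M₂ q.2 Y * ‖b Y‖ₑ ∂ν)
        (h₁.measurable.mul (hB.comp measurable_snd)))
    filter_upwards [hae_fin] with X hX
    rcases eq_or_ne (a X) 0 with h0 | h0
    · simp [h0]
    · congr 1
      rw [integral_mul_integral_assoc (stronglyMeasurable_right hc₁.meas X).aestronglyMeasurable
        hc₂.meas.aestronglyMeasurable hb.meas.aestronglyMeasurable]
      have h1 : ∫⁻ Z, M₁ X Z * ∫⁻ Y, M₂ Z Y * ‖b Y‖ₑ ∂ν ∂ν ≠ ∞ := fun h => by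
        rw [h, ENNReal.mul_top (by simpa using h0)] at hX
        exact lt_irrefl _ hX
      refine ne_top_of_le_ne_top h1 (lintegral_mono fun Z => ?_)
      rw [lintegral_const_mul' _ _ enorm_ne_top]
      exact mul_le_mul' (hc₁.le _ _) (lintegral_mono fun Y => mul_le_mul_left (hc₂.le _ _) _)
  · refine ne_top_of_le_ne_top hfin' (lintegral_mono fun X => ?_)
    rw [lintegral_const_mul' _ _ enorm_ne_top]
    exact mul_le_mul_right (lintegral_mono fun Z => mul_le_mul' (hc₁.le _ _) (hBe Z)) _

end Tame

section Pairing

variable {P : Type*} [NormedAddCommGroup P] [NormedSpace ℝ P] [FiniteDimensional ℝ P]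
  [MeasurableSpace P] [BorelSpace P] {ν : Measure P} [ν.IsAddHaarMeasure] {s : ℝ}

theorem IsGaussKernel.hasExpMoments {R : P → P → ℂ} (hR : IsGaussKernel R) (X : P) :
    HasExpMoments ν (R X) := by
  refine ⟨stronglyMeasurable_right hR.meas X, fun s => ?_⟩
  obtain ⟨K, hK, h⟩ := hR.exists_lintegral_le ν |s|
  have hsl : IsSlow |s| fun X : P => ex (s * ‖X‖) := fun x y => by
    rw [← ex_add]
    refine ex_mono ?_
    have h1 := abs_norm_sub_norm_le x y
    have h2 : s * (‖x‖ - ‖y‖) ≤ |s| * |‖x‖ - ‖y‖| := by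
      rw [← abs_mul]; exact le_abs_self _
    have h3 := mul_le_mul_of_nonneg_left h1 (abs_nonneg s)
    linarith
  exact ne_top_of_le_ne_top (ENNReal.mul_ne_top hK (ex_ne_top _)) (h _ hsl X)

theorem hasExpMoments_of_gauss {a : P → ℂ} (ha : StronglyMeasurable a) {C r : ℝ} (hr : 0 < r)
    (hC : 0 ≤ C) (h : ∀ X, ‖a X‖ ≤ C * Real.exp (-(r * ‖X‖ ^ 2))) : HasExpMoments ν a := by
  refine ⟨ha, fun s => ?_⟩
  refine ne_top_of_le_ne_top (ENNReal.mul_ne_top (ENNReal.ofReal_ne_top (r := C))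
    (lintegral_ex_mul_gauss ν s hr).ne) ?_
  rw [← lintegral_const_mul' _ _ ENNReal.ofReal_ne_top]
  refine lintegral_mono fun X => ?_
  have : ‖a X‖ₑ ≤ ENNReal.ofReal C * ex (-(r * ‖X‖ ^ 2)) := by
    rw [ex, ← ENNReal.ofReal_mul hC, ← ofReal_norm]
    exact ENNReal.ofReal_le_ofReal (h X)
  calc _ ≤ (ENNReal.ofReal C * ex (-(r * ‖X‖ ^ 2))) * ex (s * ‖X‖) := mul_le_mul_left this _
    _ = _ := by ring

/-- The pairing `∫ u w` of functions dominated by slowly varying functions can be computed after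
transforming `u` by `Q` and `w` by `Q'`, if `Q ∘ Q'` reproduces `w`. -/
theorem integral_transform_mul_transform {Q Q' R : P → P → ℂ} (hQ : IsGaussKernel Q)
    (hQ' : IsGaussKernel Q') (hQQ : ∀ X Y, ∫ Z, Q X Z * Q' Z Y ∂ν = R X Y) {u w : P → ℂ}
    {U W : P → ℝ≥0∞} (hu : StronglyMeasurable u) (hw : StronglyMeasurable w)
    (hU : IsSlow s U) (hW : IsSlow s W) (huU : ∀ X, ‖u X‖ₑ ≤ U X)
    (hwW : ∀ X, ‖w X‖ₑ ≤ W X) (hWt : ∀ X, W X ≠ ∞) (hUW : ∫⁻ X, U X * W X ∂ν ≠ ∞)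
    (hR : ∀ X, ∫ Y, R X Y * w Y ∂ν = w X) :
    Integrable (fun Z => (∫ X, u X * Q X Z ∂ν) * ∫ Y, Q' Z Y * w Y ∂ν) ν ∧
    ∫ Z, (∫ X, u X * Q X Z ∂ν) * ∫ Y, Q' Z Y * w Y ∂ν ∂ν = ∫ X, u X * w X ∂ν := by
  obtain ⟨K₁, hK₁, h₁⟩ := hQ.swap.exists_lintegral_le ν s
  obtain ⟨K₂, hK₂, h₂⟩ := hQ'.exists_lintegral_le ν s
  obtain ⟨K₃, hK₃, h₃⟩ := hQ.exists_lintegral_le ν s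
  set v : P → ℂ := fun Z => ∫ Y, Q' Z Y * w Y ∂ν with hv
  have hvm : StronglyMeasurable v :=
    StronglyMeasurable.integral_prod_right' (f := fun q : P × P => Q' q.1 q.2 * w q.2)
      (hQ'.meas.mul (hw.comp_measurable measurable_snd))
  have hvb : ∀ Z, ‖v Z‖ₑ ≤ K₂ * W Z := fun Z => by
    refine (enorm_integral_le_lintegral_enorm _).trans (le_trans (lintegral_mono fun Y => ?_)
      (h₂ W hW Z))
    rw [enorm_mul]
    exact mul_le_mul_right (hwW Y) _
  have hum : StronglyMeasurable fun Z => ∫ X, u X * Q X Z ∂ν :=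
    StronglyMeasurable.integral_prod_right' (f := fun q : P × P => u q.2 * Q q.2 q.1)
      ((hu.comp_measurable measurable_snd).mul (hQ.meas.comp_measurable measurable_swap))
  have hub : ∀ Z, ‖∫ X, u X * Q X Z ∂ν‖ₑ ≤ K₁ * U Z := fun Z => by
    refine (enorm_integral_le_lintegral_enorm _).trans (le_trans (lintegral_mono fun X => ?_)
      (h₁ U hU Z))
    rw [enorm_mul, mul_comm]
    exact mul_le_mul_right (huU X) _
  refine ⟨⟨(hum.mul hvm).aestronglyMeasurable, ?_⟩, ?_⟩
  · rw [hasFiniteIntegral_iff_enorm]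
    refine lt_of_le_of_lt ?_ (ENNReal.mul_lt_top (ENNReal.mul_lt_top hK₁.lt_top hK₂.lt_top)
      hUW.lt_top)
    rw [← lintegral_const_mul' _ _ (ENNReal.mul_ne_top hK₁ hK₂)]
    refine lintegral_mono fun Z => ?_
    rw [enorm_mul]
    calc _ ≤ (K₁ * U Z) * (K₂ * W Z) := mul_le_mul' (hub Z) (hvb Z)
      _ = _ := by ring
  · have hcomp : ∀ X, ∫ Z, Q X Z * v Z ∂ν = w X := by
      intro X
      rw [hv, integral_mul_integral_assoc (stronglyMeasurable_right hQ.meas X).aestronglyMeasurable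
        hQ'.meas.aestronglyMeasurable hw.aestronglyMeasurable]
      · simp only [hQQ]
        exact hR X
      · have hsl : IsSlow s fun Z => K₂ * W Z := fun x y => by
          rw [mul_assoc]; exact mul_le_mul_right (hW x y) _
        refine ne_top_of_le_ne_top (ENNReal.mul_ne_top hK₃ (ENNReal.mul_ne_top hK₂ (hWt X)))
          (le_trans (lintegral_mono fun Z => ?_) (h₃ _ hsl X))
        rw [lintegral_const_mul' _ _ enorm_ne_top]
        refine mul_le_mul_right (le_trans (lintegral_mono fun Y => ?_) (h₂ W hW Z)) _
        exact mul_le_mul_right (hwW Y) _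
    rw [← integral_mul_integral_assoc hu.aestronglyMeasurable hQ.meas.aestronglyMeasurable
      hvm.aestronglyMeasurable]
    · simp only [hcomp]
    · have hsl : IsSlow s fun Z => K₂ * W Z := fun x y => by
        rw [mul_assoc]; exact mul_le_mul_right (hW x y) _
      refine ne_top_of_le_ne_top (ENNReal.mul_ne_top (ENNReal.mul_ne_top hK₃ hK₂) hUW) ?_
      rw [← lintegral_const_mul' _ _ (ENNReal.mul_ne_top hK₃ hK₂)]
      refine lintegral_mono fun X => ?_
      rw [lintegral_const_mul' _ _ enorm_ne_top]
      calc _ ≤ U X * ∫⁻ Z, ‖Q X Z‖ₑ * (K₂ * W Z) ∂ν :=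
            mul_le_mul' (huU X) (lintegral_mono fun Z => mul_le_mul_right (hvb Z) _)
        _ ≤ U X * (K₃ * (K₂ * W X)) := mul_le_mul_right (h₃ _ hsl X) _
        _ = _ := by ring

end Pairing

/-! ### Distributions with given matrices and their compositions -/

section KerSynth

variable {d : ℕ} {φ : GelfandShilov (Rd d)} {s : ℝ}
  {M : Rd d × Rd d → Rd d × Rd d → ℝ≥0∞} {c : Rd d × Rd d → Rd d × Rd d → ℂ}

theorem hasExpMoments_ana (φ g : GelfandShilov (Rd d)) :
    HasExpMoments (phaseMeasure d) (ana φ g) := by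
  obtain ⟨C, r, hr, hC, h⟩ := exists_ana_gauss φ g
  exact hasExpMoments_of_gauss (stronglyMeasurable_ana φ g) hr hC h

theorem anaConj_eq_conj (φ f : GelfandShilov (Rd d)) (Y : Rd d × Rd d) :
    anaConj φ f Y = conj (ana φ (gsConj f) Y) := by
  rw [anaConj, ana, ← integral_conj]
  refine integral_congr_ae (Eventually.of_forall fun t => ?_)
  simp only [gsConj_apply, map_mul, Complex.conj_conj]

theorem hasExpMoments_anaConj (φ f : GelfandShilov (Rd d)) :
    HasExpMoments (phaseMeasure d) (anaConj φ f) := by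
  have h := hasExpMoments_ana φ (gsConj f)
  have e : anaConj φ f = fun Y => conj (ana φ (gsConj f) Y) := funext (anaConj_eq_conj φ f)
  rw [e]
  refine ⟨Complex.continuous_conj.comp_stronglyMeasurable h.meas, fun s => ?_⟩
  simpa only [RCLike.enorm_conj] using h.ne_top s

variable (φ c) in
/-- The distribution with matrix `c`, that is, the functional
`F ↦ ∬ c(X, Y) ⟨F, π(X)φ ⊗ conj(π(Y)φ)⟩ dν(X) dν(Y)`, if this defines a distribution, and zero
otherwise. -/
def kerSynth : GSDist (R2d d) :=
  open Classical in
  if h : ∃ K : GSDist (R2d d), ∀ F, K.1 F = ∫ q : (Rd d × Rd d) × (Rd d × Rd d),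
    c q.1 q.2 * anaKer φ F q.1 q.2 ∂((phaseMeasure d).prod (phaseMeasure d))
  then h.choose else 0

theorem kerSynth_apply_of_exists (h : ∃ K : GSDist (R2d d), ∀ F,
    K.1 F = ∫ q : (Rd d × Rd d) × (Rd d × Rd d),
      c q.1 q.2 * anaKer φ F q.1 q.2 ∂((phaseMeasure d).prod (phaseMeasure d)))
    (F : GelfandShilov (R2d d)) :
    (kerSynth φ c).1 F = ∫ q : (Rd d × Rd d) × (Rd d × Rd d),
      c q.1 q.2 * anaKer φ F q.1 q.2 ∂((phaseMeasure d).prod (phaseMeasure d)) := by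
  rw [kerSynth, dif_pos h]
  exact h.choose_spec F

theorem IsDominatedBy.exists_bound (hc : IsDominatedBy M c) (hM : IsTame s M) :
    ∃ C : ℝ, ∀ z : R2d d × R2d d,
      ‖c (phaseMapInv z).1 (phaseMapInv z).2‖ ≤ C * Real.exp (2 * |s| * ‖z‖) := by
  refine ⟨(M 0 0).toReal, fun z => ?_⟩
  have h1 : ‖c (phaseMapInv z).1 (phaseMapInv z).2‖ₑ ≤ M 0 0 * ex (2 * |s| * ‖z‖) := by
    refine (hc.le _ _).trans ((hM.le_zero _ _).trans ?_)
    rw [mul_assoc, ← ex_add]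
    refine mul_le_mul_right (ex_mono ?_) _
    obtain ⟨h1, h2⟩ := norm_phaseMapInv_le z
    have h3 : ∀ x, 0 ≤ x → x ≤ ‖z‖ → s * x ≤ |s| * ‖z‖ := fun x hx hxz =>
      (mul_le_mul_of_nonneg_right (le_abs_self s) hx).trans
        (mul_le_mul_of_nonneg_left hxz (abs_nonneg s))
    have := h3 _ (norm_nonneg _) h1
    have := h3 _ (norm_nonneg _) h2
    linarith
  have h2 := ENNReal.toReal_mono (ENNReal.mul_ne_top (hM.ne_top 0 0) (ex_ne_top _)) h1
  rwa [toReal_enorm, ENNReal.toReal_mul, ex, ENNReal.toReal_ofReal (Real.exp_pos _).le] at h2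

theorem integrable_mul_anaKer (hc : IsDominatedBy M c) (hM : IsTame s M)
    (F : GelfandShilov (R2d d)) :
    Integrable (fun q : (Rd d × Rd d) × (Rd d × Rd d) => c q.1 q.2 * anaKer φ F q.1 q.2)
      ((phaseMeasure d).prod (phaseMeasure d)) := by
  obtain ⟨C, hC⟩ := hc.exists_bound hM
  have hH : AEStronglyMeasurable (fun z : R2d d × R2d d =>
      c (phaseMapInv z).1 (phaseMapInv z).2) volume :=
    (hc.meas.comp_measurable continuous_phaseMapInv.measurable).aestronglyMeasurable
  have h := integrable_comp_phaseMap.mpr (integrable_mul_ana hH hC (kerWindow φ) F)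
  simp only [phaseMapInv_phaseMap] at h
  exact h

theorem kerSynth_apply (hc : IsDominatedBy M c) (hM : IsTame s M) (F : GelfandShilov (R2d d)) :
    (kerSynth φ c).1 F = ∫ q : (Rd d × Rd d) × (Rd d × Rd d),
      c q.1 q.2 * anaKer φ F q.1 q.2 ∂((phaseMeasure d).prod (phaseMeasure d)) := by
  refine kerSynth_apply_of_exists ?_ F
  obtain ⟨C, hC⟩ := hc.exists_bound hM
  have hH : AEStronglyMeasurable (fun z : R2d d × R2d d =>
      c (phaseMapInv z).1 (phaseMapInv z).2) volume :=
    (hc.meas.comp_measurable continuous_phaseMapInv.measurable).aestronglyMeasurable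
  obtain ⟨u, hu⟩ := exists_gsDist_synth (kerWindow φ) hH hC
  refine ⟨(((((2 * Real.pi) ^ d)⁻¹) ^ 2 : ℝ) : ℂ) • u, fun F => ?_⟩
  have h := integral_comp_phaseMap fun z : R2d d × R2d d =>
    c (phaseMapInv z).1 (phaseMapInv z).2 * ana (kerWindow φ) F z
  simp only [phaseMapInv_phaseMap] at h
  change _ * u.1 F = _
  rw [hu]
  exact h.symm

theorem kerSynth_tfMatrix (hφ : ∫ t, ‖(φ : Rd d → ℂ) t‖ ^ 2 = 1) (K : GSDist (R2d d)) :
    kerSynth φ (tfMatrix φ K) = K := by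
  refine Subtype.ext (LinearMap.ext fun F => ?_)
  rw [kerSynth_apply_of_exists ⟨K, fun F => (tfMatrix_expansion hφ K F).2.symm⟩]
  exact (tfMatrix_expansion hφ K F).2

theorem kerSynth_gsTensor (hc : IsDominatedBy M c) (hM : IsTame s M)
    (g f : GelfandShilov (Rd d)) :
    (kerSynth φ c).1 (gsTensor g f) =
      ∫ X, ana φ g X * ∫ Y, c X Y * anaConj φ f Y ∂(phaseMeasure d) ∂(phaseMeasure d) := by
  have hi := integrable_mul_anaKer (φ := φ) hc hM (gsTensor g f)
  rw [kerSynth_apply hc hM, integral_prod _ hi]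
  refine integral_congr_ae (Eventually.of_forall fun X => ?_)
  simp only [anaKer_gsTensor]
  rw [← integral_const_mul]
  refine integral_congr_ae (Eventually.of_forall fun Y => ?_)
  simp only
  ring

theorem tfMatrix_kerSynth_eq (hc : IsDominatedBy M c) (hM : IsTame s M) (X Y : Rd d × Rd d) :
    tfMatrix φ (kerSynth φ c) X Y =
      ∫ Z, tfGram φ φ X Z * ∫ W, c Z W * tfGram φ φ W Y ∂(phaseMeasure d) ∂(phaseMeasure d) := by
  rw [tfMatrix, kerSynth_gsTensor hc hM]
  simp only [anaConj_tfShift]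
  rfl

theorem tfMatrix_kerSynth (hc : IsDominatedBy M c) (hM : IsTame s M)
    (hl : ReproducesLeft (phaseMeasure d) (tfGram φ φ) c)
    (hr : ReproducesRight (phaseMeasure d) (tfGram φ φ) c) :
    tfMatrix φ (kerSynth φ c) = c := by
  funext X Y
  rw [tfMatrix_kerSynth_eq hc hM]
  have h1 : ∀ Z, ∫ W, c Z W * tfGram φ φ W Y ∂(phaseMeasure d) = c Z Y := fun Z => hr Z Y
  simp only [h1]
  exact hl X Y

/-- Time-frequency matrices are reproduced by the Gram matrix of the time-frequency shifts. This is where the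
resolution of the identity enters. -/
theorem reproducesLeft_tfMatrix (hφ : ∫ t, ‖(φ : Rd d → ℂ) t‖ ^ 2 = 1) {K : GSDist (R2d d)}
    (hK : IsDominatedBy M (tfMatrix φ K)) (hM : IsTame s M) :
    ReproducesLeft (phaseMeasure d) (tfGram φ φ) (tfMatrix φ K) := by
  intro X Y
  set R := tfGram φ φ with hR
  have hG : IsGaussKernel R := isGaussKernel_tfGram φ φ
  have hK' : tfMatrix φ K = fun X Y =>
      ∫ Z, R X Z * ∫ W, tfMatrix φ K Z W * R W Y ∂(phaseMeasure d) ∂(phaseMeasure d) := by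
    funext X Y
    rw [← tfMatrix_kerSynth_eq hK hM, kerSynth_tfMatrix hφ]
  have hB : StronglyMeasurable fun Z => ∫ W, tfMatrix φ K Z W * R W Y ∂(phaseMeasure d) :=
    StronglyMeasurable.integral_prod_right'
      (f := fun q : (Rd d × Rd d) × (Rd d × Rd d) => tfMatrix φ K q.1 q.2 * R q.2 Y)
      (hK.meas.mul ((stronglyMeasurable_left hG.meas Y).comp_measurable measurable_snd))
  obtain ⟨K₁, hK₁, h₁⟩ := hG.exists_lintegral_le (phaseMeasure d) s
  obtain ⟨K₂, hK₂, h₂⟩ := hG.swap.exists_lintegral_le (phaseMeasure d) s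
  have hBb : ∀ Z, ‖∫ W, tfMatrix φ K Z W * R W Y ∂(phaseMeasure d)‖ₑ ≤ K₂ * M Z Y := by
    intro Z
    refine (enorm_integral_le_lintegral_enorm _).trans (le_trans (lintegral_mono fun W => ?_)
      (h₂ _ (hM.slow.isSlow_right Z) Y))
    rw [enorm_mul, mul_comm]
    exact mul_le_mul_right (hK.le Z W) _
  have hsl : IsSlow s fun Z => K₂ * M Z Y := fun x y => by
    rw [mul_assoc]; exact mul_le_mul_right (hM.slow.isSlow_left Y x y) _
  conv_lhs => rw [hK']
  conv_rhs => rw [hK']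
  rw [integral_mul_integral_assoc (stronglyMeasurable_right hG.meas X).aestronglyMeasurable
    hG.meas.aestronglyMeasurable hB.aestronglyMeasurable]
  · simp only [hR, integral_tfGram_mul_tfGram φ φ hφ]
  · refine ne_top_of_le_ne_top (ENNReal.mul_ne_top hK₁ (ENNReal.mul_ne_top hK₁
      (ENNReal.mul_ne_top hK₂ (hM.ne_top X Y)))) (le_trans (lintegral_mono fun Z => ?_)
      (h₁ (fun Z => K₁ * (K₂ * M Z Y)) (fun x y => by
        rw [mul_assoc]; exact mul_le_mul_right (hsl x y) _) X))
    rw [lintegral_const_mul' _ _ enorm_ne_top]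
    refine mul_le_mul_right (le_trans (lintegral_mono fun W => ?_) (h₁ _ hsl Z)) _
    exact mul_le_mul_right (hBb W) _

theorem reproducesRight_tfMatrix (hφ : ∫ t, ‖(φ : Rd d → ℂ) t‖ ^ 2 = 1) {K : GSDist (R2d d)}
    (hK : IsDominatedBy M (tfMatrix φ K)) (hM : IsTame s M) :
    ReproducesRight (phaseMeasure d) (tfGram φ φ) (tfMatrix φ K) := by
  intro X Y
  set R := tfGram φ φ with hR
  have hG : IsGaussKernel R := isGaussKernel_tfGram φ φ
  have hl : ∀ X Y, ∫ Z, R X Z * tfMatrix φ K Z Y ∂(phaseMeasure d) = tfMatrix φ K X Y :=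
    reproducesLeft_tfMatrix hφ hK hM
  have h1 : tfMatrix φ K X Y =
      ∫ Z, R X Z * ∫ W, tfMatrix φ K Z W * R W Y ∂(phaseMeasure d) ∂(phaseMeasure d) := by
    rw [← tfMatrix_kerSynth_eq hK hM, kerSynth_tfMatrix hφ]
  rw [h1, hK.assoc hM (hG.hasExpMoments X) (hG.swap.hasExpMoments Y)]
  simp only [hl]

/-- Distributions with dominated reproducing matrices are composed by composing the matrices. -/
theorem isKernelComp_kerSynth
    {M₁ M₂ : Rd d × Rd d → Rd d × Rd d → ℝ≥0∞} {c₁ c₂ : Rd d × Rd d → Rd d × Rd d → ℂ}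
    (h₁ : IsTame s M₁) (h₂ : IsTame s M₂) (hM : IsTame s M)
    (hMM : ∀ X Y, ∫⁻ Z, M₁ X Z * M₂ Z Y ∂(phaseMeasure d) = M X Y)
    (hc₁ : IsDominatedBy M₁ c₁) (hc₂ : IsDominatedBy M₂ c₂) (hc : IsDominatedBy M c)
    (hcc : ∀ X Y, c X Y = ∫ Z, c₁ X Z * c₂ Z Y ∂(phaseMeasure d))
    (hl : ReproducesLeft (phaseMeasure d) (tfGram φ φ) c₂) :
    IsKernelComp (kerSynth φ c₁) (kerSynth φ c₂) (kerSynth φ c) := by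
  intro ψ hψ f g
  have hag := hasExpMoments_ana φ g
  have hbf := hasExpMoments_anaConj φ f
  obtain ⟨hfin, hcomp⟩ := integral_comp_comp h₁ h₂ hM hMM hc₁ hc₂ hag hbf
  set u : Rd d × Rd d → ℂ := fun Z => ∫ X, ana φ g X * c₁ X Z ∂(phaseMeasure d) with hu
  set w : Rd d × Rd d → ℂ := fun Z => ∫ Y, c₂ Z Y * anaConj φ f Y ∂(phaseMeasure d) with hw
  have hgm := hag.meas
  have hfm := hbf.meas
  have hum : StronglyMeasurable u :=
    StronglyMeasurable.integral_prod_right'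
      (f := fun q : (Rd d × Rd d) × (Rd d × Rd d) => ana φ g q.2 * c₁ q.2 q.1)
      ((hgm.comp_measurable measurable_snd).mul (hc₁.meas.comp_measurable measurable_swap))
  have hwm : StronglyMeasurable w :=
    StronglyMeasurable.integral_prod_right'
      (f := fun q : (Rd d × Rd d) × (Rd d × Rd d) => c₂ q.1 q.2 * anaConj φ f q.2)
      (hc₂.meas.mul (hfm.comp_measurable measurable_snd))
  have hU : IsSlow s fun Z => ∫⁻ X, ‖ana φ g X‖ₑ * M₁ X Z ∂(phaseMeasure d) := fun Z Z' => by
    rw [← lintegral_mul_const' _ _ (ex_ne_top _)]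
    refine lintegral_mono fun X => ?_
    rw [mul_assoc]
    exact mul_le_mul_right (h₁.slow.isSlow_right X Z Z') _
  have hW : IsSlow s fun Z => ∫⁻ Y, M₂ Z Y * ‖anaConj φ f Y‖ₑ ∂(phaseMeasure d) := fun Z Z' => by
    rw [← lintegral_mul_const' _ _ (ex_ne_top _)]
    refine lintegral_mono fun Y => ?_
    rw [mul_right_comm]
    exact mul_le_mul_left (h₂.slow.isSlow_left Y Z Z') _
  have hWt : ∀ Z, ∫⁻ Y, M₂ Z Y * ‖anaConj φ f Y‖ₑ ∂(phaseMeasure d) ≠ ∞ := fun Z => by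
    refine ne_top_of_le_ne_top (ENNReal.mul_ne_top (ENNReal.mul_ne_top (h₂.ne_top 0 0)
      (ex_ne_top (s * ‖Z‖))) (hbf.ne_top s)) ?_
    rw [← lintegral_const_mul' _ _ (ENNReal.mul_ne_top (h₂.ne_top 0 0) (ex_ne_top _))]
    refine lintegral_mono fun Y => ?_
    calc _ ≤ (M₂ 0 0 * ex (s * ‖Z‖) * ex (s * ‖Y‖)) * ‖anaConj φ f Y‖ₑ :=
          mul_le_mul_left (h₂.le_zero Z Y) _
      _ = _ := by ring
  have huU : ∀ Z, ‖u Z‖ₑ ≤ ∫⁻ X, ‖ana φ g X‖ₑ * M₁ X Z ∂(phaseMeasure d) := fun Z => by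
    refine (enorm_integral_le_lintegral_enorm _).trans (lintegral_mono fun X => ?_)
    rw [enorm_mul]
    exact mul_le_mul_right (hc₁.le X Z) _
  have hwW : ∀ Z, ‖w Z‖ₑ ≤ ∫⁻ Y, M₂ Z Y * ‖anaConj φ f Y‖ₑ ∂(phaseMeasure d) := fun Z => by
    refine (enorm_integral_le_lintegral_enorm _).trans (lintegral_mono fun Y => ?_)
    rw [enorm_mul]
    exact mul_le_mul_left (hc₂.le Z Y) _
  have hR : ∀ X, ∫ Z, tfGram φ φ X Z * w Z ∂(phaseMeasure d) = w X := fun X => by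
    rw [hw, hc₂.assoc h₂ ((isGaussKernel_tfGram φ φ).hasExpMoments X) hbf]
    refine integral_congr_ae (Eventually.of_forall fun Y => ?_)
    simp only
    rw [hl X Y]
  have key := integral_transform_mul_transform (isGaussKernel_tfGram φ ψ)
    (isGaussKernel_tfGram ψ φ) (fun X Y => integral_tfGram_mul_tfGram φ φ hψ X Y) hum hwm hU hW
    huU hwW hWt hfin hR
  -- The two factors in the definition of the composition are transforms of `u` and `w`.
  have e1 : ∀ Z : Rd d × Rd d, (kerSynth φ c₁).1 (gsTensor g (tfShift Z.1 Z.2 ψ)) =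
      ∫ X, u X * tfGram φ ψ X Z ∂(phaseMeasure d) := fun Z => by
    rw [kerSynth_gsTensor hc₁ h₁]
    simp only [anaConj_tfShift]
    exact hc₁.assoc h₁ hag ((isGaussKernel_tfGram φ ψ).swap.hasExpMoments Z)
  have e2 : ∀ Z : Rd d × Rd d, (kerSynth φ c₂).1 (gsTensor (gsConj (tfShift Z.1 Z.2 ψ)) f) =
      ∫ Y, tfGram ψ φ Z Y * w Y ∂(phaseMeasure d) := fun Z => by
    rw [kerSynth_gsTensor hc₂ h₂]
    rfl
  simp only [e1, e2]
  refine ⟨integrable_phaseMeasure.mp key.1, ?_⟩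
  rw [← integral_phaseMeasure, key.2, hcomp, kerSynth_gsTensor hc hM]
  simp only [hcc]

end KerSynth

/-! ### Test functions on `ℝ^{2d}` and their matrices -/

section KerFun

theorem lintegral_lintegral_ne_top_of_le {α β : Type*} [MeasurableSpace α] [MeasurableSpace β]
    {μ : Measure α} {ν : Measure β} {f : α → β → ℝ≥0∞} {F : α → ℝ≥0∞} {G : α → β → ℝ≥0∞}
    {L : ℝ≥0∞} (h : ∀ x y, f x y ≤ F x * G x y) (hF : ∀ x, F x ≠ ∞)
    (hG : ∀ x, ∫⁻ y, G x y ∂ν ≤ L) (hL : L ≠ ∞) (hFi : ∫⁻ x, F x ∂μ ≠ ∞) :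
    ∫⁻ x, ∫⁻ y, f x y ∂ν ∂μ ≠ ∞ := by
  refine ne_top_of_le_ne_top (ENNReal.mul_ne_top hFi hL) ?_
  rw [← lintegral_mul_const' _ _ hL]
  refine lintegral_mono fun x => (lintegral_mono (h x)).trans ?_
  rw [lintegral_const_mul' _ _ (hF x)]
  exact mul_le_mul_right (hG x) _

variable {d : ℕ} {φ : GelfandShilov (Rd d)}
  {k l : Rd d × Rd d → Rd d × Rd d → ℂ}

/-- Measurable kernels with Gaussian decay in both variables. -/
structure IsRapid (k : Rd d × Rd d → Rd d × Rd d → ℂ) : Prop where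
  meas : StronglyMeasurable (Function.uncurry k)
  bound : ∃ (C : ℝ≥0∞) (r : ℝ), C ≠ ∞ ∧ 0 < r ∧ ∀ X Y,
    ‖k X Y‖ₑ ≤ C * (ex (-(r * ‖X‖ ^ 2)) * ex (-(r * ‖Y‖ ^ 2)))

theorem ex_neg_sq_le_one {r : ℝ} (hr : 0 < r) (x : ℝ) : ex (-(r * x ^ 2)) ≤ 1 := by
  rw [← ex_zero]
  exact ex_mono (neg_nonpos.mpr (by positivity))

theorem IsRapid.exists_tame (hk : IsRapid k) :
    ∃ M, IsTame 0 M ∧ IsDominatedBy M k := by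
  obtain ⟨C, r, hC, hr, h⟩ := hk.bound
  refine ⟨fun _ _ => C, ⟨measurable_const, fun X X' Y Y' => by simp, fun _ _ => hC⟩, hk.meas,
    fun X Y => (h X Y).trans ?_⟩
  exact mul_le_of_le_one_right zero_le (mul_le_one' (ex_neg_sq_le_one hr _) (ex_neg_sq_le_one hr _))

theorem IsRapid.comp (hk : IsRapid k) (hl : IsRapid l) :
    IsRapid fun X Y => ∫ Z, k X Z * l Z Y ∂(phaseMeasure d) := by
  obtain ⟨C, r, hC, hr, h⟩ := hk.bound
  obtain ⟨C', r', hC', hr', h'⟩ := hl.bound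
  refine ⟨?_, C * C' * ∫⁻ Z, ex (-(r * ‖Z‖ ^ 2)) ∂(phaseMeasure d), min r r',
    ENNReal.mul_ne_top (ENNReal.mul_ne_top hC hC') (lintegral_ex_neg_norm_sq _ hr).ne,
    lt_min hr hr', fun X Y => ?_⟩
  · have h : StronglyMeasurable fun q : ((Rd d × Rd d) × (Rd d × Rd d)) × (Rd d × Rd d) =>
        k q.1.1 q.2 * l q.2 q.1.2 :=
      (hk.meas.comp_measurable (measurable_fst.fst.prodMk measurable_snd)).mul
        (hl.meas.comp_measurable (measurable_snd.prodMk measurable_fst.snd))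
    exact h.integral_prod_right' (ν := phaseMeasure d)
  · have hX : ex (-(r * ‖X‖ ^ 2)) ≤ ex (-(min r r' * ‖X‖ ^ 2)) :=
      ex_mono (neg_le_neg (mul_le_mul_of_nonneg_right (min_le_left _ _) (by positivity)))
    have hY : ex (-(r' * ‖Y‖ ^ 2)) ≤ ex (-(min r r' * ‖Y‖ ^ 2)) :=
      ex_mono (neg_le_neg (mul_le_mul_of_nonneg_right (min_le_right _ _) (by positivity)))
    calc _ ≤ ∫⁻ Z, (C * C' * (ex (-(min r r' * ‖X‖ ^ 2)) * ex (-(min r r' * ‖Y‖ ^ 2)))) *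
          ex (-(r * ‖Z‖ ^ 2)) ∂(phaseMeasure d) := by
          refine (enorm_integral_le_lintegral_enorm _).trans (lintegral_mono fun Z => ?_)
          rw [enorm_mul]
          calc _ ≤ (C * (ex (-(r * ‖X‖ ^ 2)) * ex (-(r * ‖Z‖ ^ 2)))) *
                (C' * (ex (-(r' * ‖Z‖ ^ 2)) * ex (-(r' * ‖Y‖ ^ 2)))) :=
                mul_le_mul' (h X Z) (h' Z Y)
            _ ≤ (C * (ex (-(min r r' * ‖X‖ ^ 2)) * ex (-(r * ‖Z‖ ^ 2)))) *
                (C' * (1 * ex (-(min r r' * ‖Y‖ ^ 2)))) := by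
                gcongr
                exact ex_neg_sq_le_one hr' _
            _ = _ := by ring
      _ = _ := by
          rw [lintegral_const_mul _ (by fun_prop)]; ring

theorem IsRapid.chain {k : ℕ → Rd d × Rd d → Rd d × Rd d → ℂ} {i n : ℕ}
    (hk : ∀ j, i ≤ j → j ≤ i + n → IsRapid (k j)) : IsRapid (chain (phaseMeasure d) k i n) := by
  induction n generalizing i with
  | zero => rw [chain_zero]; exact hk i le_rfl (by omega)
  | succ n ih =>
    have e : _root_.chain (phaseMeasure d) k i (n + 1) = fun X Y =>
        ∫ Z, k i X Z * _root_.chain (phaseMeasure d) k (i + 1) n Z Y ∂(phaseMeasure d) :=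
      funext fun X => funext fun Y => chain_succ i n X Y
    rw [e]
    exact (hk i le_rfl (by omega)).comp (ih fun j h1 h2 => hk j (by omega) (by omega))

variable (φ k) in
/-- The function `(s, t) ↦ ∬ k(X, Y) π(X)φ(s) conj(π(Y)φ(t)) dν(X) dν(Y)`. -/
def kerFun (w : R2d d) : ℂ :=
  ∫ X, (tfShift X.1 X.2 φ : Rd d → ℂ) w.fst *
    ∫ Y, k X Y * (gsConj (tfShift Y.1 Y.2 φ) : Rd d → ℂ) w.snd ∂(phaseMeasure d) ∂(phaseMeasure d)

variable (φ) in
theorem exists_enorm_tfShift_le : ∃ D : ℝ≥0∞, D ≠ ∞ ∧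
    (∀ (X : Rd d × Rd d) t, ‖(tfShift X.1 X.2 φ : Rd d → ℂ) t‖ₑ ≤ D) ∧
    ∀ (X : Rd d × Rd d) t, ‖(gsConj (tfShift X.1 X.2 φ) : Rd d → ℂ) t‖ₑ ≤ D := by
  obtain ⟨C, hC, h⟩ := gs_exists_norm_le φ
  have h1 : ∀ (X : Rd d × Rd d) t, ‖(tfShift X.1 X.2 φ : Rd d → ℂ) t‖ₑ ≤ ENNReal.ofReal C :=
    fun X t => by
      rw [← ofReal_norm, norm_tfShift]
      exact ENNReal.ofReal_le_ofReal (h _)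
  refine ⟨ENNReal.ofReal C, ENNReal.ofReal_ne_top, h1, fun X t => ?_⟩
  rw [gsConj_apply, RCLike.enorm_conj]
  exact h1 X t

variable (φ) in
theorem stronglyMeasurable_tfShift_apply (t : Rd d) :
    StronglyMeasurable fun X : Rd d × Rd d => (tfShift X.1 X.2 φ : Rd d → ℂ) t :=
  ((continuous_tfShift_uncurry φ).comp (Continuous.prodMk_left t)).stronglyMeasurable

variable (φ) in
theorem stronglyMeasurable_gsConj_tfShift_apply (t : Rd d) :
    StronglyMeasurable fun X : Rd d × Rd d => (gsConj (tfShift X.1 X.2 φ) : Rd d → ℂ) t :=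
  Complex.continuous_conj.comp_stronglyMeasurable (stronglyMeasurable_tfShift_apply φ t)

variable (φ) in
theorem lintegral_enorm_gsConj_tfShift (X : Rd d × Rd d) :
    ∫⁻ t, ‖(gsConj (tfShift X.1 X.2 φ) : Rd d → ℂ) t‖ₑ = ∫⁻ t, ‖(φ : Rd d → ℂ) t‖ₑ := by
  rw [← lintegral_sub_right_eq_self (fun t => ‖(φ : Rd d → ℂ) t‖ₑ) X.1]
  refine lintegral_congr fun t => ?_
  rw [gsConj_apply, RCLike.enorm_conj, ← ofReal_norm, norm_tfShift, ofReal_norm]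

/-- Composition of kernel functions is multiplication of matrices. The resolution of the identity
turns the integral over the common variable into the Gram matrix, which is absorbed by `l`. -/
theorem kernelComp_kerFun (hφ : ∀ X Y, ∫ Z, tfGram φ φ X Z * l Z Y ∂(phaseMeasure d) = l X Y)
    (hk : IsRapid k) (hl : IsRapid l) :
    kernelComp (kerFun φ k) (kerFun φ l) =
      kerFun φ fun X Y => ∫ Z, k X Z * l Z Y ∂(phaseMeasure d) := by
  obtain ⟨D, hD, he, hf⟩ := exists_enorm_tfShift_le φ
  obtain ⟨C, r, hC, hr, hkb⟩ := hk.bound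
  obtain ⟨C', r', hC', hr', hlb⟩ := hl.bound
  obtain ⟨A, ρ, hA, hρ, hRb⟩ := (isGaussKernel_tfGram φ φ).bound
  set I := ∫⁻ Z, ex (-(r * ‖Z‖ ^ 2)) ∂(phaseMeasure d) with hI
  set I' := ∫⁻ Z, ex (-(r' * ‖Z‖ ^ 2)) ∂(phaseMeasure d) with hI'
  have hIt : I ≠ ∞ := (lintegral_ex_neg_norm_sq _ hr).ne
  have hIt' : I' ≠ ∞ := (lintegral_ex_neg_norm_sq _ hr').ne
  set L := ∫⁻ t, ‖(φ : Rd d → ℂ) t‖ₑ with hL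
  have hLt : L ≠ ∞ := (gs_integrable φ).hasFiniteIntegral.ne
  have hg1 : ∀ X : Rd d × Rd d, ex (-(r * ‖X‖ ^ 2)) ≤ 1 := fun X => ex_neg_sq_le_one hr _
  have hg1' : ∀ X : Rd d × Rd d, ex (-(r' * ‖X‖ ^ 2)) ≤ 1 := fun X => ex_neg_sq_le_one hr' _
  funext w
  set x := w.fst with hx
  set z := w.snd with hz
  set e : Rd d → Rd d × Rd d → ℂ := fun t X => (tfShift X.1 X.2 φ : Rd d → ℂ) t with hedef
  set f : Rd d → Rd d × Rd d → ℂ := fun t X => (gsConj (tfShift X.1 X.2 φ) : Rd d → ℂ) t with hfdef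
  have hem : ∀ t, StronglyMeasurable (e t) := stronglyMeasurable_tfShift_apply φ
  have hfm : ∀ t, StronglyMeasurable (f t) := stronglyMeasurable_gsConj_tfShift_apply φ
  have hB : StronglyMeasurable (Function.uncurry e) :=
    ((continuous_tfShift_uncurry φ).comp continuous_swap).stronglyMeasurable
  have hAm : StronglyMeasurable (Function.uncurry fun X t => f t X) :=
    Complex.continuous_conj.comp_stronglyMeasurable
      (continuous_tfShift_uncurry φ).stronglyMeasurable
  set p : Rd d × Rd d → ℂ := fun Y => ∫ X, e x X * k X Y ∂(phaseMeasure d) with hp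
  set q : Rd d × Rd d → ℂ := fun X => ∫ Y, l X Y * f z Y ∂(phaseMeasure d) with hq
  have hpm : StronglyMeasurable p :=
    StronglyMeasurable.integral_prod_right'
      (f := fun o : (Rd d × Rd d) × (Rd d × Rd d) => e x o.2 * k o.2 o.1)
      (((hem x).comp_measurable measurable_snd).mul (hk.meas.comp_measurable measurable_swap))
  have hqm : StronglyMeasurable q :=
    StronglyMeasurable.integral_prod_right'
      (f := fun o : (Rd d × Rd d) × (Rd d × Rd d) => l o.1 o.2 * f z o.2)
      (hl.meas.mul ((hfm z).comp_measurable measurable_snd))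
  have hpb : ∀ Y, ‖p Y‖ₑ ≤ D * C * I * ex (-(r * ‖Y‖ ^ 2)) := fun Y => by
    calc _ ≤ ∫⁻ X, (D * C * ex (-(r * ‖Y‖ ^ 2))) * ex (-(r * ‖X‖ ^ 2)) ∂(phaseMeasure d) := by
          refine (enorm_integral_le_lintegral_enorm _).trans (lintegral_mono fun X => ?_)
          rw [enorm_mul]
          calc _ ≤ D * (C * (ex (-(r * ‖X‖ ^ 2)) * ex (-(r * ‖Y‖ ^ 2)))) :=
                mul_le_mul' (he X x) (hkb X Y)
            _ = _ := by ring
      _ = _ := by rw [lintegral_const_mul _ (by fun_prop)]; ring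
  have hqb : ∀ X, ‖q X‖ₑ ≤ D * C' * I' * ex (-(r' * ‖X‖ ^ 2)) := fun X => by
    calc _ ≤ ∫⁻ Y, (D * C' * ex (-(r' * ‖X‖ ^ 2))) * ex (-(r' * ‖Y‖ ^ 2)) ∂(phaseMeasure d) := by
          refine (enorm_integral_le_lintegral_enorm _).trans (lintegral_mono fun Y => ?_)
          rw [enorm_mul]
          calc _ ≤ (C' * (ex (-(r' * ‖X‖ ^ 2)) * ex (-(r' * ‖Y‖ ^ 2)))) * D :=
                mul_le_mul' (hlb X Y) (hf Y z)
            _ = _ := by ring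
      _ = _ := by rw [lintegral_const_mul _ (by fun_prop)]; ring
  have hQ : D * C' * I' ≠ ∞ := ENNReal.mul_ne_top (ENNReal.mul_ne_top hD hC') hIt'
  have hPt : D * C * I ≠ ∞ := ENNReal.mul_ne_top (ENNReal.mul_ne_top hD hC) hIt
  -- The first factor, with the integrations interchanged.
  have h1 : ∀ y, kerFun φ k (pt x y) = ∫ Y, p Y * f y Y ∂(phaseMeasure d) := fun y => by
    refine integral_mul_integral_assoc (hem x).aestronglyMeasurable hk.meas.aestronglyMeasurable
      (hfm y).aestronglyMeasurable ?_
    refine lintegral_lintegral_ne_top_of_le (F := fun X => D * C * D * ex (-(r * ‖X‖ ^ 2)))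
      (G := fun _ Y => ex (-(r * ‖Y‖ ^ 2))) (L := I) (fun X Y => ?_) (fun X => ?_)
      (fun X => le_rfl) hIt ?_
    · calc _ ≤ D * (C * (ex (-(r * ‖X‖ ^ 2)) * ex (-(r * ‖Y‖ ^ 2))) * D) :=
            mul_le_mul' (he X x) (mul_le_mul' (hkb X Y) (hf Y y))
        _ = _ := by ring
    · exact ENNReal.mul_ne_top (ENNReal.mul_ne_top (ENNReal.mul_ne_top hD hC) hD) (ex_ne_top _)
    · rw [lintegral_const_mul _ (by fun_prop)]
      exact ENNReal.mul_ne_top (ENNReal.mul_ne_top (ENNReal.mul_ne_top hD hC) hD) hIt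
  set v : Rd d → ℂ := fun y => ∫ X, e y X * q X ∂(phaseMeasure d) with hv
  have hvm : StronglyMeasurable v :=
    StronglyMeasurable.integral_prod_right'
      (f := fun o : Rd d × (Rd d × Rd d) => e o.1 o.2 * q o.2)
      (hB.mul (hqm.comp_measurable measurable_snd))
  have hvb : ∀ y, ‖v y‖ₑ ≤ D * (D * C' * I') * I' := fun y => by
    calc _ ≤ ∫⁻ X, (D * (D * C' * I')) * ex (-(r' * ‖X‖ ^ 2)) ∂(phaseMeasure d) := by
          refine (enorm_integral_le_lintegral_enorm _).trans (lintegral_mono fun X => ?_)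
          rw [enorm_mul, mul_assoc D]
          exact mul_le_mul' (he X y) (hqb X)
      _ = _ := by rw [lintegral_const_mul _ (by fun_prop)]
  -- Summing over the shifts of the second factor reproduces `q`.
  have h2 : ∀ Y, ∫ y, f y Y * v y = q Y := fun Y => by
    have a1 : ∫ y, f y Y * v y =
        ∫ X, (∫ y, f y Y * e y X) * q X ∂(phaseMeasure d) := by
      refine integral_mul_integral_assoc (f := fun y => f y Y)
        (gs_continuous (gsConj (tfShift Y.1 Y.2 φ))).aestronglyMeasurable
        hB.aestronglyMeasurable hqm.aestronglyMeasurable ?_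
      refine lintegral_lintegral_ne_top_of_le (F := fun y => ‖f y Y‖ₑ)
        (G := fun _ X => (D * (D * C' * I')) * ex (-(r' * ‖X‖ ^ 2)))
        (L := (D * (D * C' * I')) * I') (fun y X => ?_) (fun y => enorm_ne_top)
        (fun y => (lintegral_const_mul _ (by fun_prop)).le) ?_ ?_
      · rw [mul_assoc D]
        exact mul_le_mul_right (mul_le_mul' (he X y) (hqb X)) _
      · exact ENNReal.mul_ne_top (ENNReal.mul_ne_top hD hQ) hIt'
      · exact ((lintegral_enorm_gsConj_tfShift φ Y).trans_ne hLt)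
    have a2 : ∫ X, tfGram φ φ Y X * q X ∂(phaseMeasure d) =
        ∫ W, (∫ X, tfGram φ φ Y X * l X W ∂(phaseMeasure d)) * f z W ∂(phaseMeasure d) := by
      refine integral_mul_integral_assoc
        (stronglyMeasurable_right (isGaussKernel_tfGram φ φ).meas Y).aestronglyMeasurable
        hl.meas.aestronglyMeasurable (hfm z).aestronglyMeasurable ?_
      refine lintegral_lintegral_ne_top_of_le (F := fun X => A * C' * D * ex (-(r' * ‖X‖ ^ 2)))
        (G := fun _ W => ex (-(r' * ‖W‖ ^ 2))) (L := I') (fun X W => ?_) (fun X => ?_)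
        (fun X => le_rfl) hIt' ?_
      · calc _ ≤ (A * 1) * (C' * (ex (-(r' * ‖X‖ ^ 2)) * ex (-(r' * ‖W‖ ^ 2))) * D) :=
              mul_le_mul' ((hRb Y X).trans (mul_le_mul_right (ex_neg_sq_le_one hρ _) _))
                (mul_le_mul' (hlb X W) (hf W z))
          _ = _ := by ring
      · exact ENNReal.mul_ne_top (ENNReal.mul_ne_top (ENNReal.mul_ne_top hA hC') hD) (ex_ne_top _)
      · rw [lintegral_const_mul _ (by fun_prop)]
        exact ENNReal.mul_ne_top (ENNReal.mul_ne_top (ENNReal.mul_ne_top hA hC') hD) hIt'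
    rw [a1]
    refine Eq.trans a2 ?_
    simp only [hφ]
    rfl
  have h3 : ∫ y, (∫ Y, p Y * f y Y ∂(phaseMeasure d)) * v y =
      ∫ Y, p Y * (∫ y, f y Y * v y) ∂(phaseMeasure d) := by
    refine (integral_mul_integral_assoc (b := fun Y y => f y Y) hpm.aestronglyMeasurable
      hAm.aestronglyMeasurable hvm.aestronglyMeasurable ?_).symm
    refine lintegral_lintegral_ne_top_of_le
      (F := fun Y => D * (D * C' * I') * I' * (D * C * I * ex (-(r * ‖Y‖ ^ 2))))
      (G := fun Y y => ‖f y Y‖ₑ) (L := L) (fun Y y => ?_) (fun Y => ?_)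
      (fun Y => (lintegral_enorm_gsConj_tfShift φ Y).le) hLt ?_
    · calc _ ≤ (D * C * I * ex (-(r * ‖Y‖ ^ 2))) * (‖f y Y‖ₑ * (D * (D * C' * I') * I')) :=
            mul_le_mul' (hpb Y) (mul_le_mul_right (hvb y) _)
        _ = _ := by ring
    · exact ENNReal.mul_ne_top (ENNReal.mul_ne_top (ENNReal.mul_ne_top hD hQ) hIt')
        (ENNReal.mul_ne_top hPt (ex_ne_top _))
    · rw [lintegral_const_mul _ (by fun_prop), lintegral_const_mul _ (by fun_prop)]
      exact ENNReal.mul_ne_top (ENNReal.mul_ne_top (ENNReal.mul_ne_top hD hQ) hIt')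
        (ENNReal.mul_ne_top hPt hIt)
  have h4 : ∫ Y, p Y * q Y ∂(phaseMeasure d) =
      ∫ X, e x X * ∫ Y, k X Y * q Y ∂(phaseMeasure d) ∂(phaseMeasure d) := by
    refine (integral_mul_integral_assoc (hem x).aestronglyMeasurable hk.meas.aestronglyMeasurable
      hqm.aestronglyMeasurable ?_).symm
    refine lintegral_lintegral_ne_top_of_le
      (F := fun X => D * C * (D * C' * I') * ex (-(r * ‖X‖ ^ 2)))
      (G := fun _ Y => ex (-(r * ‖Y‖ ^ 2))) (L := I) (fun X Y => ?_) (fun X => ?_)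
      (fun X => le_rfl) hIt ?_
    · calc _ ≤ D * (C * (ex (-(r * ‖X‖ ^ 2)) * ex (-(r * ‖Y‖ ^ 2))) * (D * C' * I' * 1)) :=
            mul_le_mul' (he X x) (mul_le_mul' (hkb X Y)
              ((hqb Y).trans (mul_le_mul_right (hg1' Y) _)))
        _ = _ := by ring
    · exact ENNReal.mul_ne_top (ENNReal.mul_ne_top (ENNReal.mul_ne_top hD hC) hQ) (ex_ne_top _)
    · rw [lintegral_const_mul _ (by fun_prop)]
      exact ENNReal.mul_ne_top (ENNReal.mul_ne_top (ENNReal.mul_ne_top hD hC) hQ) hIt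
  have h5 : ∀ X, ∫ Y, k X Y * q Y ∂(phaseMeasure d) =
      ∫ W, (∫ Y, k X Y * l Y W ∂(phaseMeasure d)) * f z W ∂(phaseMeasure d) := fun X => by
    refine integral_mul_integral_assoc (stronglyMeasurable_right hk.meas X).aestronglyMeasurable
      hl.meas.aestronglyMeasurable (hfm z).aestronglyMeasurable ?_
    refine lintegral_lintegral_ne_top_of_le (F := fun Y => C * C' * D * ex (-(r * ‖Y‖ ^ 2)))
      (G := fun _ W => ex (-(r' * ‖W‖ ^ 2))) (L := I') (fun Y W => ?_) (fun Y => ?_)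
      (fun Y => le_rfl) hIt' ?_
    · calc _ ≤ (C * (1 * ex (-(r * ‖Y‖ ^ 2)))) * (C' * (1 * ex (-(r' * ‖W‖ ^ 2))) * D) :=
            mul_le_mul' ((hkb X Y).trans (mul_le_mul_right (mul_le_mul_left (hg1 X) _) _))
              (mul_le_mul' ((hlb Y W).trans (mul_le_mul_right (mul_le_mul_left (hg1' Y) _) _))
                (hf W z))
        _ = _ := by ring
    · exact ENNReal.mul_ne_top (ENNReal.mul_ne_top (ENNReal.mul_ne_top hC hC') hD) (ex_ne_top _)
    · rw [lintegral_const_mul _ (by fun_prop)]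
      exact ENNReal.mul_ne_top (ENNReal.mul_ne_top (ENNReal.mul_ne_top hC hC') hD) hIt
  have h6 : kernelComp (kerFun φ k) (kerFun φ l) w =
      ∫ y, (∫ Y, p Y * f y Y ∂(phaseMeasure d)) * v y := by
    refine integral_congr_ae (Eventually.of_forall fun y => ?_)
    change kerFun φ k (pt x y) * kerFun φ l (pt y z) = _
    rw [h1 y]
    rfl
  rw [h6, h3]
  simp only [h2]
  rw [h4]
  simp only [h5]
  rfl

end KerFun

section TestKernels

variable {d : ℕ} {φ : GelfandShilov (Rd d)} {k : Rd d × Rd d → Rd d × Rd d → ℂ}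

theorem IsRapid.exists_bound_phaseMapInv (hk : IsRapid k) :
    ∃ C r : ℝ, 0 < r ∧ 0 ≤ C ∧ ∀ z : R2d d × R2d d,
      ‖k (phaseMapInv z).1 (phaseMapInv z).2‖ ≤ C * Real.exp (-(r * ‖z‖ ^ 2)) := by
  obtain ⟨C, r, hC, hr, h⟩ := hk.bound
  refine ⟨C.toReal, r / 2, by positivity, ENNReal.toReal_nonneg, fun z => ?_⟩
  set q := phaseMapInv z with hq
  have hz : ‖z‖ ≤ ‖q.1‖ + ‖q.2‖ := by
    have := norm_phaseMap_le q
    rwa [hq, phaseMap_phaseMapInv] at this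
  have h1 : ‖k q.1 q.2‖ₑ ≤ C * ex (-(r / 2 * ‖z‖ ^ 2)) := by
    refine (h _ _).trans (mul_le_mul_right ?_ _)
    rw [← ex_add]
    refine ex_mono ?_
    have h2 : ‖z‖ ^ 2 ≤ (‖q.1‖ + ‖q.2‖) ^ 2 := by gcongr
    nlinarith [sq_nonneg (‖q.1‖ - ‖q.2‖)]
  have h2 := ENNReal.toReal_mono (ENNReal.mul_ne_top hC (ex_ne_top _)) h1
  rwa [toReal_enorm, ENNReal.toReal_mul, ex, ENNReal.toReal_ofReal (Real.exp_pos _).le] at h2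

theorem IsRapid.stronglyMeasurable_phaseMapInv (hk : IsRapid k) :
    StronglyMeasurable fun z : R2d d × R2d d => k (phaseMapInv z).1 (phaseMapInv z).2 :=
  hk.meas.comp_measurable continuous_phaseMapInv.measurable

theorem integrable_exp_neg_norm_sq' {δ : ℝ} (hδ : 0 < δ) :
    Integrable (fun z : R2d d × R2d d => Real.exp (-(δ * ‖z‖ ^ 2))) :=
  integrable_exp_neg_norm_sq volume hδ

theorem IsRapid.integrable_phaseMapInv (hk : IsRapid k) :
    ∃ δ > 0, Integrable fun z : R2d d × R2d d =>
      ‖k (phaseMapInv z).1 (phaseMapInv z).2‖ * Real.exp (δ * ‖z‖ ^ 2) := by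
  obtain ⟨C, r, hr, hC, h⟩ := hk.exists_bound_phaseMapInv
  refine ⟨r / 2, by positivity, ?_⟩
  refine ((integrable_exp_neg_norm_sq' (d := d) (δ := r / 2) (by positivity)).const_mul C).mono'
    (hk.stronglyMeasurable_phaseMapInv.norm.aestronglyMeasurable.mul
      (by fun_prop : Continuous fun z : R2d d × R2d d =>
        Real.exp (r / 2 * ‖z‖ ^ 2)).aestronglyMeasurable) (Eventually.of_forall fun z => ?_)
  rw [norm_mul, norm_norm, Real.norm_of_nonneg (Real.exp_pos _).le]
  calc _ ≤ (C * Real.exp (-(r * ‖z‖ ^ 2))) * Real.exp (r / 2 * ‖z‖ ^ 2) :=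
        mul_le_mul_of_nonneg_right (h z) (Real.exp_pos _).le
    _ = C * Real.exp (-(r / 2 * ‖z‖ ^ 2)) := by
        rw [mul_assoc, ← Real.exp_add]; congr 2; ring

theorem IsRapid.integrable_mul_tfShift (hk : IsRapid k) (w : R2d d) :
    Integrable fun z : R2d d × R2d d => k (phaseMapInv z).1 (phaseMapInv z).2 *
      (tfShift z.1 z.2 (kerWindow φ) : R2d d → ℂ) w := by
  obtain ⟨δ, hδ, hi⟩ := hk.integrable_phaseMapInv
  obtain ⟨D, hD, hb⟩ := gs_exists_norm_le (kerWindow φ)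
  refine (hi.mul_const D).mono' (hk.stronglyMeasurable_phaseMapInv.aestronglyMeasurable.mul
    ((continuous_tfShift_uncurry (kerWindow φ)).comp
      (Continuous.prodMk_left w)).aestronglyMeasurable) (Eventually.of_forall fun z => ?_)
  rw [norm_mul, norm_tfShift]
  refine mul_le_mul ?_ (hb _) (norm_nonneg _) (by positivity)
  exact le_mul_of_one_le_right (norm_nonneg _) (Real.one_le_exp (by positivity))

theorem kerFun_eq (hk : IsRapid k) (w : R2d d) :
    kerFun φ k w = ((((2 * Real.pi) ^ d)⁻¹) ^ 2 : ℝ) *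
      ∫ z : R2d d × R2d d, k (phaseMapInv z).1 (phaseMapInv z).2 *
        (tfShift z.1 z.2 (kerWindow φ) : R2d d → ℂ) w := by
  rw [← integral_comp_phaseMap fun z : R2d d × R2d d =>
    k (phaseMapInv z).1 (phaseMapInv z).2 * (tfShift z.1 z.2 (kerWindow φ) : R2d d → ℂ) w]
  have hi := integrable_comp_phaseMap.mpr (hk.integrable_mul_tfShift (φ := φ) w)
  rw [integral_prod _ hi]
  refine integral_congr_ae (Eventually.of_forall fun X => ?_)
  simp only
  rw [← integral_const_mul]
  refine integral_congr_ae (Eventually.of_forall fun Y => ?_)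
  simp only [phaseMapInv_phaseMap, tfShift_kerWindow]
  change _ = k X Y * ((tfShift X.1 X.2 φ : Rd d → ℂ) w.fst *
    (gsConj (tfShift Y.1 Y.2 φ) : Rd d → ℂ) w.snd)
  ring

theorem memGS_kerFun (hk : IsRapid k) : MemGS (kerFun φ k) := by
  obtain ⟨δ, hδ, hi⟩ := hk.integrable_phaseMapInv
  obtain ⟨h, C, hh, hC, H⟩ := exists_gsBound_synth (kerWindow φ) hδ
  obtain ⟨h1, h2⟩ := (H _ hk.stronglyMeasurable_phaseMapInv.aestronglyMeasurable hi).1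
  have h3 : MemGS fun w => ∫ z : R2d d × R2d d, k (phaseMapInv z).1 (phaseMapInv z).2 *
        (tfShift z.1 z.2 (kerWindow φ) : R2d d → ℂ) w := ⟨h1, h, _, hh, h2⟩
  have e : kerFun φ k = (((((2 * Real.pi) ^ d)⁻¹) ^ 2 : ℝ) : ℂ) •
      fun w => ∫ z : R2d d × R2d d, k (phaseMapInv z).1 (phaseMapInv z).2 *
        (tfShift z.1 z.2 (kerWindow φ) : R2d d → ℂ) w := funext fun w => kerFun_eq hk w
  rw [e]
  exact h3.const_smul _

/-- For kernels with Gaussian decay, the distribution with this matrix is a test function. -/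
theorem isGivenBy_kerSynth (hk : IsRapid k) : IsGivenBy (kerSynth φ k) (kerFun φ k) := by
  intro G
  refine ⟨gs_integrable_mul ⟨kerFun φ k, memGS_kerFun hk⟩ G, ?_⟩
  obtain ⟨M, hM, hkM⟩ := hk.exists_tame
  obtain ⟨δ, hδ, hi⟩ := hk.integrable_phaseMapInv
  rw [kerSynth_apply hkM hM]
  have e1 := integral_comp_phaseMap fun z : R2d d × R2d d =>
    k (phaseMapInv z).1 (phaseMapInv z).2 * ana (kerWindow φ) G z
  simp only [phaseMapInv_phaseMap] at e1
  refine e1.trans ?_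
  simp only [kerFun_eq hk, mul_assoc]
  rw [integral_const_mul]
  congr 1
  have hcont := continuous_tfShift_uncurry (kerWindow φ)
  rw [← integral_mul_integral_assoc (b := fun (z : R2d d × R2d d) w =>
      (tfShift z.1 z.2 (kerWindow φ) : R2d d → ℂ) w)
      hk.stronglyMeasurable_phaseMapInv.aestronglyMeasurable hcont.aestronglyMeasurable
      (gs_continuous G).aestronglyMeasurable]
  · simp only [ana, mul_comm]
  · obtain ⟨D, hD, hb⟩ := gs_exists_norm_le (kerWindow φ)
    refine lintegral_lintegral_ne_top_of_le
      (F := fun z => ‖k (phaseMapInv z).1 (phaseMapInv z).2‖ₑ * ENNReal.ofReal D)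
      (G := fun _ w => ‖(G : R2d d → ℂ) w‖ₑ) (L := ∫⁻ w, ‖(G : R2d d → ℂ) w‖ₑ) (fun z w => ?_)
      (fun z => ENNReal.mul_ne_top enorm_ne_top ENNReal.ofReal_ne_top) (fun z => le_rfl)
      (gs_integrable G).hasFiniteIntegral.ne ?_
    · rw [mul_assoc]
      refine mul_le_mul_right (mul_le_mul_left ?_ _) _
      rw [← ofReal_norm, norm_tfShift]
      exact ENNReal.ofReal_le_ofReal (hb _)
    · rw [lintegral_mul_const' _ _ ENNReal.ofReal_ne_top]
      refine ENNReal.mul_ne_top ?_ ENNReal.ofReal_ne_top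
      have hle : Integrable fun z : R2d d × R2d d => k (phaseMapInv z).1 (phaseMapInv z).2 := by
        refine hi.mono' hk.stronglyMeasurable_phaseMapInv.aestronglyMeasurable
          (Eventually.of_forall fun z => ?_)
        exact le_mul_of_one_le_right (norm_nonneg _) (Real.one_le_exp (by positivity))
      exact hle.hasFiniteIntegral.ne

theorem tfMatrix_eq_conj {K : GSDist (R2d d)} {F : GelfandShilov (R2d d)}
    (h : IsGivenBy K (F : R2d d → ℂ)) (X Y : Rd d × Rd d) :
    tfMatrix φ K X Y = conj (ana (kerWindow φ) (gsConj F) (phaseMap (X, Y))) := by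
  rw [tfMatrix_eq, (h _).2, ana, ← integral_conj]
  refine integral_congr_ae (Eventually.of_forall fun w => ?_)
  simp only [gsConj_apply, map_mul, Complex.conj_conj]

theorem isRapid_tfMatrix {K : GSDist (R2d d)} {F : GelfandShilov (R2d d)}
    (h : IsGivenBy K (F : R2d d → ℂ)) : IsRapid (tfMatrix φ K) := by
  obtain ⟨C, r, hr, hC, hb⟩ := exists_ana_gauss (kerWindow φ) (gsConj F)
  refine ⟨stronglyMeasurable_tfMatrix φ K, ENNReal.ofReal C, r / 2, ENNReal.ofReal_ne_top,
    by positivity, fun X Y => ?_⟩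
  rw [tfMatrix_eq_conj h, RCLike.enorm_conj, ← ex_add, ex, ← ENNReal.ofReal_mul hC, ← ofReal_norm]
  refine ENNReal.ofReal_le_ofReal ((hb _).trans (mul_le_mul_of_nonneg_left
    (Real.exp_le_exp.mpr ?_) hC))
  obtain ⟨h1, h2⟩ := norm_phaseMapInv_le (phaseMap (X, Y))
  rw [phaseMapInv_phaseMap] at h1 h2
  have h3 : ‖X‖ ^ 2 ≤ ‖phaseMap (X, Y)‖ ^ 2 := by gcongr
  have h4 : ‖Y‖ ^ 2 ≤ ‖phaseMap (X, Y)‖ ^ 2 := by gcongr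
  nlinarith

/-- Test functions are recovered from their matrices. -/
theorem kerFun_tfMatrix (hφ : ∫ t, ‖(φ : Rd d → ℂ) t‖ ^ 2 = 1) {K : GSDist (R2d d)}
    {F : GelfandShilov (R2d d)} (h : IsGivenBy K (F : R2d d → ℂ)) :
    kerFun φ (tfMatrix φ K) = (F : R2d d → ℂ) := by
  funext w
  have h1 := congrArg conj (ana_inversion (kerWindow φ) (gsConj F) w)
  rw [← integral_conj, map_mul, gsConj_apply, Complex.conj_conj, Complex.conj_ofReal,
    windowConst_kerWindow hφ] at h1
  rw [kerFun_eq (isRapid_tfMatrix h)]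
  have e : ∀ z : R2d d × R2d d, tfMatrix φ K (phaseMapInv z).1 (phaseMapInv z).2 *
      (tfShift z.1 z.2 (kerWindow φ) : R2d d → ℂ) w =
      conj (ana (kerWindow φ) (gsConj F) z *
        (gsConj (tfShift z.1 z.2 (kerWindow φ)) : R2d d → ℂ) w) := fun z => by
    rw [tfMatrix_eq_conj h, Prod.mk.eta, phaseMap_phaseMapInv, map_mul, gsConj_apply,
      Complex.conj_conj]
  simp only [e]
  rw [h1, ← mul_assoc, ← Complex.ofReal_mul, ← mul_pow, inv_mul_cancel₀ (by positivity), one_pow,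
    Complex.ofReal_one, one_mul]

theorem kernelCompList_cons {K : R2d d → ℂ} {l : List (R2d d → ℂ)} (hl : l ≠ []) :
    kernelCompList (K :: l) = kernelComp K (kernelCompList l) := by
  cases l with
  | nil => exact absurd rfl hl
  | cons L l => rfl

/-- Composing test functions amounts to composing their matrices. -/
theorem kernelCompList_eq_kerFun {k : ℕ → Rd d × Rd d → Rd d × Rd d → ℂ} {N : ℕ}
    (hk : ∀ j, j ≤ N → IsRapid (k j))
    (hr : ∀ i n, i + n ≤ N →
      ReproducesLeft (phaseMeasure d) (tfGram φ φ) (chain (phaseMeasure d) k i n))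
    {i n : ℕ} (hin : i + n ≤ N) :
    kernelCompList (List.ofFn fun j : Fin (n + 1) => kerFun φ (k (i + j))) =
      kerFun φ (chain (phaseMeasure d) k i n) := by
  induction n generalizing i with
  | zero => simp [kernelCompList, chain_zero]
  | succ n ih =>
    rw [List.ofFn_succ, kernelCompList_cons (by simp)]
    have e : (fun j : Fin (n + 1) => kerFun φ (k (i + (j.succ : Fin (n + 2))))) =
        fun j : Fin (n + 1) => kerFun φ (k (i + 1 + j)) := by
      funext j
      rw [Fin.val_succ]
      congr 2
      omega
    rw [e, ih (by omega), Fin.val_zero, add_zero, kernelComp_kerFun (hr (i + 1) n (by omega))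
      (hk i (by omega)) (IsRapid.chain fun j _ h => hk j (by omega))]
    rfl

theorem MemGS.comp_of_norm_eq {V W : Type*} [NormedAddCommGroup V] [InnerProductSpace ℝ V]
    [NormedAddCommGroup W] [InnerProductSpace ℝ W] {f : W → ℂ} (hf : MemGS f) (L : V →L[ℝ] W)
    (hL : ∀ x, ‖L x‖ = ‖x‖) : MemGS fun x => f (L x) := by
  obtain ⟨hc, h, B, hh, hb⟩ := hf
  refine ⟨hc.comp L.contDiff, h, B, hh, fun m n x => ?_⟩
  have hL1 : ‖L‖ ≤ 1 := L.opNorm_le_bound zero_le_one fun x => by rw [hL, one_mul]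
  calc _ ≤ ‖L x‖ ^ m * ‖iteratedFDeriv ℝ n f (L x)‖ := by
        rw [hL]
        exact mul_le_mul_of_nonneg_left (norm_iteratedFDeriv_comp_le_of_norm_le_one hc L hL1 n x)
          (by positivity)
    _ ≤ _ := hb m n (L x)

/-- Every non-zero test function on `ℝ^{2d}` has a slice which, when normalized, is a window on
`ℝ^d`. -/
theorem exists_window {Φ : GelfandShilov (R2d d)} (hΦ : Φ ≠ 0) :
    ∃ φ : GelfandShilov (Rd d), ∫ t, ‖(φ : Rd d → ℂ) t‖ ^ 2 = 1 := by
  obtain ⟨w, hw⟩ : ∃ w, (Φ : R2d d → ℂ) w ≠ 0 := by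
    by_contra! h
    exact hΦ (Subtype.ext (funext h))
  let L : Rd d →L[ℝ] R2d d := (WithLp.prodContinuousLinearEquiv 2 ℝ (Rd d) (Rd d)).symm.toContinuousLinearMap.comp
    (ContinuousLinearMap.inl ℝ (Rd d) (Rd d))
  have hLapp : ∀ x, L x = pt x 0 := fun x => rfl
  have hL : ∀ x, ‖L x‖ = ‖x‖ := fun x => by
    rw [hLapp, WithLp.prod_norm_eq_of_L2]
    change √(‖x‖ ^ 2 + ‖(0 : Rd d)‖ ^ 2) = _
    rw [norm_zero, zero_pow two_ne_zero, add_zero, Real.sqrt_sq (norm_nonneg x)]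
  let χ : GelfandShilov (Rd d) := ⟨_, (Φ.2.comp_sub (pt 0 (-w.snd))).comp_of_norm_eq L hL⟩
  have hχ : χ ≠ 0 := fun h => hw (by
    have h1 := congrFun (congrArg Subtype.val h) w.fst
    have h2 : L w.fst - pt 0 (-w.snd) = w := by
      rw [hLapp]
      change pt (w.fst - 0) (0 - -w.snd) = w
      rw [sub_zero, zero_sub, neg_neg]
      rfl
    change (Φ : R2d d → ℂ) (L w.fst - pt 0 (-w.snd)) = 0 at h1
    rwa [h2] at h1)
  have hpos : 0 < ∫ t, ‖(χ : Rd d → ℂ) t‖ ^ 2 :=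
    (mul_pos_iff_of_pos_left (by positivity)).mp (windowConst_pos hχ)
  set a := ∫ t, ‖(χ : Rd d → ℂ) t‖ ^ 2 with ha
  refine ⟨(((√a)⁻¹ : ℝ) : ℂ) • χ, ?_⟩
  have e : ∀ t, ‖(((((√a)⁻¹ : ℝ) : ℂ) • χ : GelfandShilov (Rd d)) : Rd d → ℂ) t‖ ^ 2 =
      a⁻¹ * ‖(χ : Rd d → ℂ) t‖ ^ 2 := fun t => by
    change ‖(((√a)⁻¹ : ℝ) : ℂ) * (χ : Rd d → ℂ) t‖ ^ 2 = _
    rw [norm_mul, Complex.norm_real, Real.norm_of_nonneg (by positivity), mul_pow, inv_pow,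
      Real.sq_sqrt hpos.le]
  simp only [e]
  rw [integral_const_mul, ← ha, inv_mul_cancel₀ hpos.ne']

end TestKernels

/-! ### Weighted estimates for iterated integrals -/

section WeightChain

variable {P : Type*} [NormedAddCommGroup P] [NormedSpace ℝ P] [FiniteDimensional ℝ P]
  [MeasurableSpace P] [BorelSpace P] {ν : Measure P} [ν.IsAddHaarMeasure]

/-- Weights `w_0, …, w_{n+1}` on pairs of points, an output weight `w'` and exponents
`q_0, …, q_{n+1}` to which the composition estimate applies: the product of all weights along closed
paths is bounded from below, and `max(1, q_j)` alternates between conjugate exponents. -/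
structure IsWeightChain {P : Type*} [NormedAddCommGroup P] [MeasurableSpace P] (n : ℕ)
    (q : ℕ → ℝ≥0∞) (w : ℕ → P → P → ℝ≥0∞) (w' : P → P → ℝ≥0∞) (c : ℝ) : Prop where
  exp_ne_zero : ∀ j, q j ≠ 0
  holder : ∀ j, j ≤ n → ENNReal.HolderConjugate (max 1 (q j)) (max 1 (q (j + 1)))
  exp_last : q (n + 1) = q 0
  nonneg : 0 ≤ c
  measurable : ∀ j, Measurable (Function.uncurry (w j))
  slow : ∀ j, IsSlowKernel c (w j)
  ne_zero : ∀ j X Y, w j X Y ≠ 0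
  ne_top : ∀ j X Y, w j X Y ≠ ∞
  ne_top' : ∀ X Y, w' X Y ≠ ∞
  path : ∃ a : ℝ≥0∞, a ≠ 0 ∧ ∀ Z : ℕ → P,
    a ≤ w' (Z 0) (Z (n + 2)) * ∏ j ∈ Finset.range (n + 2), w j (Z j) (Z (j + 1))

/-- The weighted norm `‖m w‖_{L^q}` of a kernel. -/
def wNorm {P : Type*} [MeasurableSpace P] (ν : Measure P) (q : ℝ≥0∞) (w m : P → P → ℝ≥0∞) : ℝ≥0∞ :=
  eLpNorm (fun z : P × P => w z.1 z.2 * m z.1 z.2) q (ν.prod ν)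

theorem wNorm_mono {P : Type*} [MeasurableSpace P] {ν : Measure P} {q : ℝ≥0∞}
    {w m m' : P → P → ℝ≥0∞} (h : ∀ X Y, m X Y ≤ m' X Y) : wNorm ν q w m ≤ wNorm ν q w m' :=
  eLpNorm_mono_enorm fun z => by
    simp only [enorm_eq_self]
    exact mul_le_mul_right (h _ _) _

variable {n : ℕ} {q : ℕ → ℝ≥0∞} {w : ℕ → P → P → ℝ≥0∞} {w' : P → P → ℝ≥0∞} {c : ℝ}

theorem IsSlowKernel.mul {P : Type*} [NormedAddCommGroup P] {s t : ℝ} {F G : P → P → ℝ≥0∞}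
    (hF : IsSlowKernel s F) (hG : IsSlowKernel t G) :
    IsSlowKernel (s + t) fun X Y => F X Y * G X Y := fun X X' Y Y' => by
  refine (mul_le_mul' (hF X X' Y Y') (hG X X' Y Y')).trans (le_of_eq ?_)
  rw [add_mul, ex_add]
  ring

theorem IsSlowKernel.add {P : Type*} [NormedAddCommGroup P] {s : ℝ} {F G : P → P → ℝ≥0∞}
    (hF : IsSlowKernel s F) (hG : IsSlowKernel s G) :
    IsSlowKernel s fun X Y => F X Y + G X Y := fun X X' Y Y' => by
  refine (add_le_add (hF X X' Y Y') (hG X X' Y Y')).trans (le_of_eq ?_)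
  rw [add_mul]

theorem IsSlowKernel.mono {P : Type*} [NormedAddCommGroup P] {s t : ℝ} {F : P → P → ℝ≥0∞}
    (hF : IsSlowKernel s F) (h : s ≤ t) : IsSlowKernel t F := fun X X' Y Y' =>
  (hF X X' Y Y').trans (mul_le_mul_right (ex_mono (mul_le_mul_of_nonneg_right h (by positivity))) _)

/-- Composition is bounded in weighted norms: the lower bound for the product of the weights along
closed paths moves the output weight into the iterated integral. -/
theorem IsWeightChain.exists_wNorm_lchain_le (h : IsWeightChain n q w w' c) (ν : Measure P)
    [ν.IsAddHaarMeasure] {s : ℝ} (hs : 0 ≤ s) :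
    ∃ C : ℝ≥0∞, C ≠ ∞ ∧ ∀ m : ℕ → P → P → ℝ≥0∞, (∀ i, Measurable (Function.uncurry (m i))) →
      (∀ i, IsSlowKernel s (m i)) →
      wNorm ν (q 0) (fun X Y => (w' X Y)⁻¹) (lchain ν m 0 (n + 1)) ≤
        C * ∏ j ∈ Finset.range (n + 2), wNorm ν (q j) (w j) (m j) := by
  obtain ⟨C, hC, hb⟩ := exists_eLpNorm_uncurry_lchain_le ν (s := c + s) (add_nonneg h.nonneg hs)
    h.exp_ne_zero n h.holder h.exp_last
  obtain ⟨a, ha, hpath⟩ := h.path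
  have hat : a ≠ ∞ := ne_top_of_le_ne_top (ENNReal.mul_ne_top (h.ne_top' 0 0)
    (ENNReal.prod_ne_top fun j _ => h.ne_top j 0 0)) (hpath fun _ => 0)
  refine ⟨a⁻¹ * C, ENNReal.mul_ne_top (ENNReal.inv_ne_top.mpr ha) hC, fun m hm hms => ?_⟩
  set G : ℕ → P → P → ℝ≥0∞ := fun j X Y => w j X Y * m j X Y with hG
  have hGm : ∀ i, Measurable (Function.uncurry (G i)) := fun i => (h.measurable i).mul (hm i)
  have hpt : ∀ X Y, (w' X Y)⁻¹ * lchain ν m 0 (n + 1) X Y ≤ a⁻¹ * lchain ν G 0 (n + 1) X Y := by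
    intro X Y
    have h1 : a * (w' X Y)⁻¹ * lchain ν m 0 (n + 1) X Y ≤ lchain ν G 0 (n + 1) X Y := by
      refine mul_lchain_le hm h.ne_zero h.ne_top 0 (n + 1) X Y _ fun Z h0 h1 => ?_
      have := hpath Z
      rw [h0, h1] at this
      simp only [zero_add]
      rw [← div_eq_mul_inv]
      exact ENNReal.div_le_of_le_mul' this
    calc _ = a⁻¹ * (a * (w' X Y)⁻¹ * lchain ν m 0 (n + 1) X Y) := by
          rw [mul_assoc a, ← mul_assoc a⁻¹, ENNReal.inv_mul_cancel ha hat, one_mul]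
      _ ≤ _ := mul_le_mul_right h1 _
  calc _ ≤ eLpNorm (fun z : P × P => a⁻¹ * Function.uncurry (lchain ν G 0 (n + 1)) z) (q 0)
        (ν.prod ν) := by
        refine eLpNorm_mono_enorm fun z => ?_
        simp only [enorm_eq_self]
        exact hpt z.1 z.2
    _ = a⁻¹ * eLpNorm (Function.uncurry (lchain ν G 0 (n + 1))) (q 0) (ν.prod ν) :=
        eLpNorm_ennreal_const_mul _ (ENNReal.inv_ne_top.mpr ha) _
    _ ≤ a⁻¹ * (C * ∏ j ∈ Finset.range (n + 2), eLpNorm (Function.uncurry (G j)) (q j)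
        (ν.prod ν)) :=
        mul_le_mul_right (hb G hGm fun i => (h.slow i).mul (hms i)) _
    _ = _ := by rw [mul_assoc]; rfl

theorem eLpNorm_ex_lt_top {E : Type*} [NormedAddCommGroup E] [NormedSpace ℝ E]
    [FiniteDimensional ℝ E] [MeasurableSpace E] [BorelSpace E] (μ : Measure E)
    [μ.IsAddHaarMeasure] (q : ℝ≥0∞) : eLpNorm (fun z : E => ex (-‖z‖)) q μ < ∞ := by
  rcases eq_or_ne q 0 with rfl | hq
  · simp
  rcases eq_or_ne q ∞ with rfl | hqt
  · rw [eLpNorm_exponent_top]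
    refine (eLpNormEssSup_le_of_ae_enorm_bound (C := 1) (Eventually.of_forall fun z => ?_)).trans_lt
      ENNReal.one_lt_top
    rw [enorm_eq_self, ← ex_zero]
    exact ex_mono (by simp)
  · have hp := ENNReal.toReal_pos hq hqt
    rw [eLpNorm_ennreal _ hq hqt]
    refine ENNReal.rpow_lt_top_of_nonneg (by positivity) ?_
    have h := (lintegral_ex_neg_norm μ hp).ne
    simp only [ex_rpow]
    simpa only [mul_neg] using h

/-- Kernels with finite weighted norms have finite iterated integrals. -/
theorem IsWeightChain.isMajorant (h : IsWeightChain n q w w' c) {s : ℝ} (hs : 0 ≤ s)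
    {m : ℕ → P → P → ℝ≥0∞} (hm : ∀ i, Measurable (Function.uncurry (m i)))
    (hms : ∀ i, IsSlowKernel s (m i)) (hfin : ∀ j, j < n + 2 → wNorm ν (q j) (w j) (m j) ≠ ∞) :
    IsMajorant ν s (n + 1) m := by
  refine ⟨hm, hms, ?_⟩
  have hnorm : (ν.prod ν).IsAddHaarMeasure := inferInstance
  set t := max s (c + 1) with ht
  -- A positive, rapidly decaying kernel is added to make all kernels positive.
  set ε : P → P → ℝ≥0∞ := fun X Y => ex (-(t * (‖X‖ + ‖Y‖))) with hε
  have ht0 : 0 ≤ t := hs.trans (le_max_left _ _)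
  have hεm : Measurable (Function.uncurry ε) := by
    change Measurable fun z : P × P => ex (-(t * (‖z.1‖ + ‖z.2‖)))
    fun_prop
  have hεs : IsSlowKernel t ε := fun X X' Y Y' => by
    rw [hε, ← ex_add]
    refine ex_mono ?_
    have h1 := norm_sub_norm_le X' X
    have h2 := norm_sub_norm_le Y' Y
    rw [norm_sub_rev] at h1 h2
    nlinarith
  set m' : ℕ → P → P → ℝ≥0∞ := fun j X Y => m j X Y + ε X Y with hm'
  have hm'm : ∀ i, Measurable (Function.uncurry (m' i)) := fun i => (hm i).add hεm
  have hm's : ∀ i, IsSlowKernel t (m' i) := fun i => ((hms i).mono (le_max_left _ _)).add hεs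
  have hm'0 : ∀ i X Y, m' i X Y ≠ 0 := fun i X Y => by
    simp only [hm', ne_eq, add_eq_zero, not_and]
    exact fun _ => ex_ne_zero _
  have hεfin : ∀ j, wNorm ν (q j) (w j) ε < ∞ := fun j => by
    have hle : wNorm ν (q j) (w j) ε ≤
        eLpNorm (fun z : P × P => w j 0 0 * ex (-‖z‖)) (q j) (ν.prod ν) := by
      refine eLpNorm_mono_enorm fun z => ?_
      simp only [enorm_eq_self]
      have h1 := h.slow j z.1 0 z.2 0
      rw [sub_zero, sub_zero] at h1
      calc w j z.1 z.2 * ε z.1 z.2 ≤ (w j 0 0 * ex (c * (‖z.1‖ + ‖z.2‖))) * ε z.1 z.2 :=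
            mul_le_mul_left h1 _
        _ = w j 0 0 * ex (c * (‖z.1‖ + ‖z.2‖) + -(t * (‖z.1‖ + ‖z.2‖))) := by
            rw [ex_add, mul_assoc]
        _ ≤ w j 0 0 * ex (-‖z‖) := by
            refine mul_le_mul_right (ex_mono ?_) _
            have h2 : c + 1 ≤ t := le_max_right _ _
            have h3 : ‖z‖ ≤ ‖z.1‖ + ‖z.2‖ := by
              rw [Prod.norm_def]
              exact max_le_add_of_nonneg (norm_nonneg _) (norm_nonneg _)
            nlinarith [norm_nonneg z.1, norm_nonneg z.2]
    refine hle.trans_lt ?_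
    rw [eLpNorm_ennreal_const_mul _ (h.ne_top j 0 0)]
    exact ENNReal.mul_lt_top (h.ne_top j 0 0).lt_top (eLpNorm_ex_lt_top _ _)
  have hm'fin : ∀ j, j < n + 2 → wNorm ν (q j) (w j) (m' j) < ∞ := fun j hj => by
    have e : (fun z : P × P => w j z.1 z.2 * m' j z.1 z.2) =
        (fun z : P × P => w j z.1 z.2 * m j z.1 z.2) + fun z => w j z.1 z.2 * ε z.1 z.2 := by
      funext z
      simp only [hm', Pi.add_apply, mul_add]
    rw [wNorm, e]
    refine (eLpNorm_add_le' ?_ ?_ _).trans_lt (ENNReal.mul_lt_top (ENNReal.LpAddConst_lt_top _)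
      (ENNReal.add_lt_top.mpr ⟨(hfin j hj).lt_top, hεfin j⟩))
    · exact ((h.measurable j).mul (hm j)).aestronglyMeasurable
    · exact ((h.measurable j).mul hεm).aestronglyMeasurable
  obtain ⟨C, hC, hb⟩ := h.exists_wNorm_lchain_le ν ht0
  have hfull : wNorm ν (q 0) (fun X Y => (w' X Y)⁻¹) (lchain ν m' 0 (n + 1)) < ∞ :=
    (hb m' hm'm hm's).trans_lt (ENNReal.mul_lt_top hC.lt_top
      (ENNReal.prod_lt_top fun j hj => hm'fin j (Finset.mem_range.mp hj)))
  obtain ⟨X₀, Y₀, hXY⟩ : ∃ X Y, lchain ν m' 0 (n + 1) X Y ≠ ∞ := by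
    by_contra! hall
    refine hfull.ne ?_
    have e : (fun z : P × P => (w' z.1 z.2)⁻¹ * lchain ν m' 0 (n + 1) z.1 z.2) = fun _ => ∞ := by
      funext z
      rw [hall, ENNReal.mul_top (ENNReal.inv_ne_zero.mpr (h.ne_top' _ _))]
    rw [wNorm, e]
    have hν : (ν.prod ν) Set.univ ≠ 0 := (IsOpen.measure_pos _ isOpen_univ ⟨0, trivial⟩).ne'
    rw [eLpNorm_const _ (h.exp_ne_zero 0) fun h0 => hν (by rw [h0]; rfl), enorm_eq_self]
    refine ENNReal.top_mul (ENNReal.rpow_pos_of_nonneg ?_ (by positivity)).ne'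
    exact pos_iff_ne_zero.mpr hν
  intro i k hik X Y
  refine ne_top_of_le_ne_top (lchain_ne_top hm'm hm's (fun i _ => hm'0 i) hXY hik X Y)
    (lchain_mono (fun j _ X Y => le_self_add) X Y)

end WeightChain

/-! ### Modulation norms in terms of time-frequency matrices -/

section MatrixNorms

variable {d : ℕ} {φ : GelfandShilov (Rd d)} {Φ : GelfandShilov (R2d d)}

/-- The least `s`-slowly varying majorant of the time-frequency matrix of `u`. -/
def slowMatrix (φ : GelfandShilov (Rd d)) (s : ℝ) (u : GSDist (R2d d)) (X Y : Rd d × Rd d) : ℝ≥0∞ :=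
  sharp s (absStft (kerWindow φ) u) (phaseMap (X, Y))

theorem enorm_tfMatrix (φ : GelfandShilov (Rd d)) (u : GSDist (R2d d)) (X Y : Rd d × Rd d) :
    ‖tfMatrix φ u X Y‖ₑ = absStft (kerWindow φ) u (phaseMap (X, Y)) := by
  rw [tfMatrix_eq]
  rfl

theorem enorm_tfMatrix_le (φ : GelfandShilov (Rd d)) (s : ℝ) (u : GSDist (R2d d))
    (X Y : Rd d × Rd d) : ‖tfMatrix φ u X Y‖ₑ ≤ slowMatrix φ s u X Y :=
  (enorm_tfMatrix φ u X Y).trans_le (le_sharp _ _ _)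

theorem measurable_slowMatrix (φ : GelfandShilov (Rd d)) (s : ℝ) (u : GSDist (R2d d)) :
    Measurable (Function.uncurry (slowMatrix φ s u)) :=
  (measurable_sharp s (absStft_ne_top _ _)).comp continuous_phaseMap.measurable

theorem isSlowKernel_phaseMap {s : ℝ} (hs : 0 ≤ s) {f : R2d d × R2d d → ℝ≥0∞}
    (hf : ∀ z z', f z ≤ f z' * ex (s * ‖z - z'‖)) :
    IsSlowKernel s fun X Y => f (phaseMap (X, Y)) := fun X X' Y Y' =>
  (hf _ (phaseMap (X', Y'))).trans (mul_le_mul_right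
    (ex_mono (mul_le_mul_of_nonneg_left (norm_phaseMap_sub_le X X' Y Y') hs)) _)

theorem isSlowKernel_slowMatrix (φ : GelfandShilov (Rd d)) {s : ℝ} (hs : 0 ≤ s)
    (u : GSDist (R2d d)) : IsSlowKernel s (slowMatrix φ s u) :=
  isSlowKernel_phaseMap hs fun z z' => (sharp_le hs _ z z').trans (le_of_eq (mul_comm _ _))

theorem isDominatedBy_tfMatrix (φ : GelfandShilov (Rd d)) (s : ℝ) (u : GSDist (R2d d)) :
    IsDominatedBy (slowMatrix φ s u) (tfMatrix φ u) :=
  ⟨stronglyMeasurable_tfMatrix φ u, enorm_tfMatrix_le φ s u⟩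

theorem kerWindow_ne_zero (hφ : ∫ t, ‖(φ : Rd d → ℂ) t‖ ^ 2 = 1) : kerWindow φ ≠ 0 := by
  intro h
  have h1 := windowConst_kerWindow hφ
  have h2 : windowConst (kerWindow φ) = 0 := by
    rw [h]
    simp [windowConst]
  rw [h2] at h1
  exact absurd h1.symm (by positivity)

/-- The factor by which norms over the phase space of `ℝ^{2d}` change when pairs of points of the
phase space of `ℝ^d` are used as coordinates. -/
def normFactor (d : ℕ) (q : ℝ≥0∞) : ℝ≥0∞ :=
  ENNReal.ofReal ((((2 * Real.pi) ^ d)⁻¹) ^ 2) ^ (1 / q).toReal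

theorem normFactor_ne_top (d : ℕ) (q : ℝ≥0∞) : normFactor d q ≠ ∞ :=
  ENNReal.rpow_ne_top_of_nonneg ENNReal.toReal_nonneg ENNReal.ofReal_ne_top

theorem normFactor_ne_zero (d : ℕ) (q : ℝ≥0∞) : normFactor d q ≠ 0 :=
  (ENNReal.rpow_pos (ENNReal.ofReal_pos.mpr (by positivity)) ENNReal.ofReal_ne_top).ne'

/-- Weighted norms of matrices are norms over the phase space of `ℝ^{2d}`, up to a constant factor. -/
theorem wNorm_phaseMap {q : ℝ≥0∞} {f g : R2d d × R2d d → ℝ≥0∞} (hf : Measurable f)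
    (hg : Measurable g) :
    wNorm (phaseMeasure d) q (fun X Y => g (phaseMap (X, Y))) (fun X Y => f (phaseMap (X, Y))) =
      normFactor d q * eLpNorm (fun z => f z * g z) q volume := by
  have e : (fun z : (Rd d × Rd d) × (Rd d × Rd d) =>
      g (phaseMap (z.1, z.2)) * f (phaseMap (z.1, z.2))) = (fun z => f z * g z) ∘ phaseMap := by
    funext z
    exact mul_comm _ _
  have hm : Measurable fun z => f z * g z := hf.mul hg
  rw [wNorm, e, phaseMeasure_prod, eLpNorm_smul_measure_of_ne_zero
    (ENNReal.ofReal_pos.mpr (by positivity)).ne',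
    eLpNorm_comp_measurePreserving hm.aestronglyMeasurable measurePreserving_phaseMap]
  rfl

/-- The modulation norm is at most a constant times the weighted norm of the time-frequency
matrix. -/
theorem exists_modNorm_le (hφ : ∫ t, ‖(φ : Rd d → ℂ) t‖ ^ 2 = 1) (Φ : GelfandShilov (R2d d))
    {ω ω' : R2d d × R2d d → ℝ} {c K : ℝ} (hω : ∀ z, 0 < ω z) (hω' : IsLogLip c ω') (hK : 0 ≤ K)
    (h : ∀ z, ω z ≤ K * ω' z) {q : ℝ≥0∞} (hq : q ≠ 0) :
    ∃ C : ℝ≥0∞, C ≠ ∞ ∧ ∀ u : GSDist (R2d d), modNorm Φ q ω u ≤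
      C * wNorm (phaseMeasure d) q (fun X Y => ENNReal.ofReal (ω' (phaseMap (X, Y))))
        (fun X Y => ‖tfMatrix φ u X Y‖ₑ) := by
  obtain ⟨C, hC, hb⟩ := exists_eLpNorm_sharp_le hω' Φ (kerWindow_ne_zero hφ) hq le_rfl
  set B := ENNReal.ofReal ((2 * Real.pi) ^ (-(Module.finrank ℝ (R2d d) : ℝ) / 2)) with hB
  refine ⟨B * ENNReal.ofReal K * C * (normFactor d q)⁻¹, by
    refine ENNReal.mul_ne_top (ENNReal.mul_ne_top (ENNReal.mul_ne_top ?_ ?_) hC) ?_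
    · exact ENNReal.ofReal_ne_top
    · exact ENNReal.ofReal_ne_top
    · exact ENNReal.inv_ne_top.mpr (normFactor_ne_zero d q), fun u => ?_⟩
  simp only [enorm_tfMatrix]
  rw [modNorm_eq Φ q hω, wNorm_phaseMap (measurable_absStft _ u)
    hω'.continuous.measurable.ennreal_ofReal, mul_assoc _ (normFactor d q)⁻¹, ← mul_assoc
    (normFactor d q)⁻¹, ENNReal.inv_mul_cancel (normFactor_ne_zero d q) (normFactor_ne_top d q),
    one_mul, mul_assoc]
  calc _ ≤ eLpNorm (fun z => B * ENNReal.ofReal K *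
        (sharp (c + 1) (absStft Φ u) z * ENNReal.ofReal (ω' z))) q volume := by
        refine eLpNorm_mono_enorm fun z => ?_
        simp only [enorm_eq_self]
        calc _ ≤ B * (sharp (c + 1) (absStft Φ u) z *
              (ENNReal.ofReal K * ENNReal.ofReal (ω' z))) := by
              rw [← ENNReal.ofReal_mul hK]
              exact mul_le_mul_right (mul_le_mul' (le_sharp _ _ _)
                (ENNReal.ofReal_le_ofReal (h z))) _
          _ = _ := by ring
    _ = B * ENNReal.ofReal K * eLpNorm (fun z => sharp (c + 1) (absStft Φ u) z *
        ENNReal.ofReal (ω' z)) q volume :=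
        eLpNorm_ennreal_const_mul _ (ENNReal.mul_ne_top ENNReal.ofReal_ne_top
          ENNReal.ofReal_ne_top) _
    _ ≤ _ := mul_le_mul_right (hb u) _

/-- The weighted norm of the slowly varying majorant of the time-frequency matrix is at most a
constant times the modulation norm. -/
theorem exists_wNorm_slowMatrix_le (φ : GelfandShilov (Rd d)) (hΦ : Φ ≠ 0)
    {ω ω' : R2d d × R2d d → ℝ} {c K : ℝ} (hω : ∀ z, 0 < ω z) (hω' : IsLogLip c ω') (hK : 0 ≤ K)
    (h : ∀ z, ω' z ≤ K * ω z) {q : ℝ≥0∞} (hq : q ≠ 0) {s : ℝ} (hs : c + 1 ≤ s) :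
    ∃ C : ℝ≥0∞, C ≠ ∞ ∧ ∀ u : GSDist (R2d d),
      wNorm (phaseMeasure d) q (fun X Y => ENNReal.ofReal (ω' (phaseMap (X, Y))))
        (slowMatrix φ s u) ≤ C * modNorm Φ q ω u := by
  obtain ⟨C, hC, hb⟩ := exists_eLpNorm_sharp_le hω' (kerWindow φ) hΦ hq hs
  set B := ENNReal.ofReal ((2 * Real.pi) ^ (-(Module.finrank ℝ (R2d d) : ℝ) / 2)) with hB
  have hB0 : B ≠ 0 := (ENNReal.ofReal_pos.mpr (by positivity)).ne'
  have hBt : B ≠ ∞ := ENNReal.ofReal_ne_top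
  refine ⟨normFactor d q * C * ENNReal.ofReal K * B⁻¹, ENNReal.mul_ne_top (ENNReal.mul_ne_top
    (ENNReal.mul_ne_top (normFactor_ne_top d q) hC) ENNReal.ofReal_ne_top)
    (ENNReal.inv_ne_top.mpr hB0), fun u => ?_⟩
  unfold slowMatrix
  rw [modNorm_eq Φ q hω, wNorm_phaseMap (measurable_sharp s (absStft_ne_top _ u))
    hω'.continuous.measurable.ennreal_ofReal, eLpNorm_ennreal_const_mul _ hBt,
    mul_assoc _ B⁻¹, ← mul_assoc B⁻¹, ENNReal.inv_mul_cancel hB0 hBt, one_mul,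
    mul_assoc _ (ENNReal.ofReal K), ← eLpNorm_ennreal_const_mul _ ENNReal.ofReal_ne_top, mul_assoc]
  refine mul_le_mul_right ((hb u).trans (mul_le_mul_right (eLpNorm_mono_enorm fun z => ?_) _)) _
  simp only [enorm_eq_self]
  rw [mul_left_comm, ← ENNReal.ofReal_mul hK]
  exact mul_le_mul_right (ENNReal.ofReal_le_ofReal (h z)) _

/-- The weight `w` on pairs of points of phase space is slowly varying with constant `c`, and the
modulation norms with weight `ω` and `1/ω` are equivalent to the norms of time-frequency matrices
with weight `w` and `1/w`. -/
structure IsMatrixWeight (φ : GelfandShilov (Rd d)) (Φ : GelfandShilov (R2d d))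
    (ω : R2d d × R2d d → ℝ) (c : ℝ) (w : Rd d × Rd d → Rd d × Rd d → ℝ≥0∞) : Prop where
  nonneg : 0 ≤ c
  measurable : Measurable (Function.uncurry w)
  slow : IsSlowKernel c w
  ne_zero : ∀ X Y, w X Y ≠ 0
  ne_top : ∀ X Y, w X Y ≠ ∞
  le : ∃ K : ℝ≥0∞, K ≠ ∞ ∧ ∀ X Y, ENNReal.ofReal (kernelWeight ω X Y) ≤ K * w X Y
  slowMatrix_le : ∀ (q : ℝ≥0∞), q ≠ 0 → ∀ s, c + 1 ≤ s → ∃ C : ℝ≥0∞, C ≠ ∞ ∧ ∀ u,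
    wNorm (phaseMeasure d) q w (slowMatrix φ s u) ≤ C * modNorm Φ q ω u
  modNorm_le : ∀ (q : ℝ≥0∞), q ≠ 0 → ∃ C : ℝ≥0∞, C ≠ ∞ ∧ ∀ u,
    modNorm Φ q ω u ≤ C * wNorm (phaseMeasure d) q w fun X Y => ‖tfMatrix φ u X Y‖ₑ
  modNorm_inv_le : ∀ (q : ℝ≥0∞), q ≠ 0 → ∃ C : ℝ≥0∞, C ≠ ∞ ∧ ∀ u,
    modNorm Φ q (fun z => (ω z)⁻¹) u ≤
      C * wNorm (phaseMeasure d) q (fun X Y => (w X Y)⁻¹) fun X Y => ‖tfMatrix φ u X Y‖ₑ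
  le_modNorm_inv : ∀ (q : ℝ≥0∞), q ≠ 0 → ∃ C : ℝ≥0∞, C ≠ ∞ ∧ ∀ u,
    wNorm (phaseMeasure d) q (fun X Y => (w X Y)⁻¹) (fun X Y => ‖tfMatrix φ u X Y‖ₑ) ≤
      C * modNorm Φ q (fun z => (ω z)⁻¹) u

theorem IsMatrixWeight.mono {ω : R2d d × R2d d → ℝ} {c c' : ℝ}
    {w : Rd d × Rd d → Rd d × Rd d → ℝ≥0∞} (h : IsMatrixWeight φ Φ ω c w) (hc : c ≤ c') :
    IsMatrixWeight φ Φ ω c' w :=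
  { h with
    nonneg := h.nonneg.trans hc
    slow := h.slow.mono hc
    slowMatrix_le := fun q hq s hs => h.slowMatrix_le q hq s (by linarith) }

/-- Every moderate weight is equivalent to a weight whose logarithm is Lipschitz continuous, and the
latter may be used on time-frequency matrices. -/
theorem IsModerateWeight.exists_isMatrixWeight {ω : R2d d × R2d d → ℝ} (hω : IsModerateWeight ω)
    (hφ : ∫ t, ‖(φ : Rd d → ℂ) t‖ ^ 2 = 1) (hΦ : Φ ≠ 0) :
    ∃ c w, IsMatrixWeight φ Φ ω c w := by
  obtain ⟨ω', c, K, hω', hK, h1, h2⟩ := hω.exists_isLogLip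
  refine ⟨c, fun X Y => ENNReal.ofReal (ω' (phaseMap (X, Y))), hω'.nonneg,
    hω'.continuous.measurable.ennreal_ofReal.comp continuous_phaseMap.measurable,
    isSlowKernel_phaseMap (f := fun z => ENNReal.ofReal (ω' z)) hω'.nonneg hω'.ofReal_le,
    fun X Y => (ENNReal.ofReal_pos.mpr (hω'.pos _)).ne', fun X Y => ENNReal.ofReal_ne_top,
    ⟨ENNReal.ofReal K, ENNReal.ofReal_ne_top, fun X Y => ?_⟩,
    fun q hq s hs => exists_wNorm_slowMatrix_le φ hΦ (K := 1) hω.pos hω' zero_le_one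
      (fun z => (h1 z).trans_eq (one_mul _).symm) hq hs,
    fun q hq => exists_modNorm_le hφ Φ hω.pos hω' (zero_le_one.trans hK) h2 hq, fun q hq => ?_,
    fun q hq => ?_⟩
  · rw [← ENNReal.ofReal_mul (zero_le_one.trans hK)]
    exact ENNReal.ofReal_le_ofReal (h2 _)
  · obtain ⟨C, hC, hb⟩ := exists_modNorm_le hφ Φ (K := 1) (fun z => inv_pos.mpr (hω.pos z)) hω'.inv
      zero_le_one (fun z => by
        rw [one_mul]
        exact inv_anti₀ (hω'.pos z) (h1 z)) hq
    refine ⟨C, hC, fun u => (hb u).trans (le_of_eq ?_)⟩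
    simp only [ENNReal.ofReal_inv_of_pos (hω'.pos _)]
  · obtain ⟨C, hC, hb⟩ := exists_wNorm_slowMatrix_le φ hΦ (fun z => inv_pos.mpr (hω.pos z))
      hω'.inv (zero_le_one.trans hK) (fun z => by
        rw [← div_eq_mul_inv, inv_eq_one_div, div_le_div_iff₀ (hω'.pos z) (hω.pos z), one_mul]
        exact h2 z) hq le_rfl
    refine ⟨C, hC, fun u => (le_trans ?_ (hb u))⟩
    simp only [ENNReal.ofReal_inv_of_pos (hω'.pos _)]
    exact wNorm_mono fun X Y => enorm_tfMatrix_le φ _ u X Y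

end MatrixNorms

section QuasiNorm

variable {P : Type*} [MeasurableSpace P] {ν : Measure P} {q : ℝ≥0∞} {w m m' : P → P → ℝ≥0∞}

theorem wNorm_add_le (hw : Measurable (Function.uncurry w)) (hm : Measurable (Function.uncurry m))
    (hm' : Measurable (Function.uncurry m')) :
    wNorm ν q w (fun X Y => m X Y + m' X Y) ≤
      ENNReal.LpAddConst q * (wNorm ν q w m + wNorm ν q w m') := by
  have e : (fun z : P × P => w z.1 z.2 * (m z.1 z.2 + m' z.1 z.2)) =
      (fun z : P × P => w z.1 z.2 * m z.1 z.2) + fun z => w z.1 z.2 * m' z.1 z.2 := by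
    funext z
    simp only [Pi.add_apply, mul_add]
  rw [wNorm, e]
  exact eLpNorm_add_le' (hw.mul hm).aestronglyMeasurable (hw.mul hm').aestronglyMeasurable _

theorem ae_eq_zero_of_wNorm (hq : q ≠ 0) (hw : Measurable (Function.uncurry w))
    (hm : Measurable (Function.uncurry m)) (hw0 : ∀ X Y, w X Y ≠ 0) (h : wNorm ν q w m = 0) :
    ∀ᵐ z ∂(ν.prod ν), m z.1 z.2 = 0 := by
  have hwm : Measurable fun z : P × P => w z.1 z.2 * m z.1 z.2 := hw.mul hm
  rw [wNorm, eLpNorm_eq_zero_iff hwm.aestronglyMeasurable hq] at h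
  filter_upwards [h] with z hz
  exact (mul_eq_zero.mp hz).resolve_left (hw0 _ _)

end QuasiNorm

section Uniqueness

variable {d : ℕ} {φ : GelfandShilov (Rd d)} {Φ : GelfandShilov (R2d d)}

theorem tfMatrix_linear (φ : GelfandShilov (Rd d)) {u v x : GSDist (R2d d)} {a b : ℂ}
    (h : x = a • u + b • v) (X Y : Rd d × Rd d) :
    tfMatrix φ x X Y = a * tfMatrix φ u X Y + b * tfMatrix φ v X Y := by
  subst h
  rfl

theorem tfMatrix_sub (φ : GelfandShilov (Rd d)) (u v : GSDist (R2d d)) (X Y : Rd d × Rd d) :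
    tfMatrix φ (u - v) X Y = tfMatrix φ u X Y - tfMatrix φ v X Y := rfl

theorem tfMatrix_zero (φ : GelfandShilov (Rd d)) (X Y : Rd d × Rd d) :
    tfMatrix φ 0 X Y = 0 := rfl

theorem measurable_enorm_tfMatrix (φ : GelfandShilov (Rd d)) (u : GSDist (R2d d)) :
    Measurable (Function.uncurry fun X Y => ‖tfMatrix φ u X Y‖ₑ) :=
  (stronglyMeasurable_tfMatrix φ u).enorm

theorem eq_zero_of_ae_tfMatrix (hφ : ∫ t, ‖(φ : Rd d → ℂ) t‖ ^ 2 = 1) {u : GSDist (R2d d)}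
    (h : ∀ᵐ z ∂((phaseMeasure d).prod (phaseMeasure d)), ‖tfMatrix φ u z.1 z.2‖ₑ = 0) : u = 0 := by
  refine Subtype.ext (LinearMap.ext fun F => ?_)
  rw [← (tfMatrix_expansion hφ u F).2]
  refine (integral_eq_zero_of_ae ?_)
  filter_upwards [h] with z hz
  rw [enorm_eq_zero.mp hz, zero_mul]
  rfl

theorem wNorm_tfMatrix_le {w : Rd d × Rd d → Rd d × Rd d → ℝ≥0∞}
    (hw : Measurable (Function.uncurry w)) (q : ℝ≥0∞) {x u v : GSDist (R2d d)}
    (h : ∀ X Y, ‖tfMatrix φ x X Y‖ₑ ≤ ‖tfMatrix φ u X Y‖ₑ + ‖tfMatrix φ v X Y‖ₑ) :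
    wNorm (phaseMeasure d) q w (fun X Y => ‖tfMatrix φ x X Y‖ₑ) ≤
      ENNReal.LpAddConst q * (wNorm (phaseMeasure d) q w (fun X Y => ‖tfMatrix φ u X Y‖ₑ) +
        wNorm (phaseMeasure d) q w (fun X Y => ‖tfMatrix φ v X Y‖ₑ)) :=
  (wNorm_mono h).trans
    (wNorm_add_le hw (measurable_enorm_tfMatrix φ u) (measurable_enorm_tfMatrix φ v))

theorem enorm_tfMatrix_sub_le (φ : GelfandShilov (Rd d)) (u v : GSDist (R2d d))
    (X Y : Rd d × Rd d) :
    ‖tfMatrix φ (u - v) X Y‖ₑ ≤ ‖tfMatrix φ u X Y‖ₑ + ‖tfMatrix φ v X Y‖ₑ :=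
  enorm_sub_le

theorem enorm_tfMatrix_sub_le_sub (φ : GelfandShilov (Rd d)) (a u v : GSDist (R2d d))
    (X Y : Rd d × Rd d) : ‖tfMatrix φ (u - v) X Y‖ₑ ≤
      ‖tfMatrix φ (a - u) X Y‖ₑ + ‖tfMatrix φ (a - v) X Y‖ₑ := by
  have e : u - v = (a - v) - (a - u) := by abel
  rw [e, add_comm]
  exact enorm_tfMatrix_sub_le φ _ _ X Y

/-- Limits with respect to a modulation norm are unique. -/
theorem IsMatrixWeight.eq_of_tendsto {ω : R2d d × R2d d → ℝ} {c : ℝ}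
    {w : Rd d × Rd d → Rd d × Rd d → ℝ≥0∞} (h : IsMatrixWeight φ Φ ω c w)
    (hφ : ∫ t, ‖(φ : Rd d → ℂ) t‖ ^ 2 = 1) {r : ℝ≥0∞} (hr : r ≠ 0) {a : ℕ → GSDist (R2d d)}
    {u v : GSDist (R2d d)}
    (hu : Tendsto (fun k => modNorm Φ r (fun z => (ω z)⁻¹) (a k - u)) atTop (𝓝 0))
    (hv : Tendsto (fun k => modNorm Φ r (fun z => (ω z)⁻¹) (a k - v)) atTop (𝓝 0)) : u = v := by
  obtain ⟨C, hC, hb⟩ := h.le_modNorm_inv r hr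
  have hw : Measurable (Function.uncurry fun X Y => (w X Y)⁻¹) := h.measurable.inv
  have hlim : Tendsto (fun k => ENNReal.LpAddConst r *
      (C * modNorm Φ r (fun z => (ω z)⁻¹) (a k - u) +
        C * modNorm Φ r (fun z => (ω z)⁻¹) (a k - v))) atTop (𝓝 0) := by
    have h1 := ENNReal.Tendsto.const_mul hu (Or.inr hC)
    have h2 := ENNReal.Tendsto.const_mul hv (Or.inr hC)
    have h3 := ENNReal.Tendsto.const_mul (h1.add h2)
      (Or.inr (ENNReal.LpAddConst_lt_top r).ne)
    simpa using h3
  have h0 : wNorm (phaseMeasure d) r (fun X Y => (w X Y)⁻¹)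
      (fun X Y => ‖tfMatrix φ (u - v) X Y‖ₑ) ≤ 0 :=
    ge_of_tendsto' hlim fun k => (wNorm_tfMatrix_le hw r (enorm_tfMatrix_sub_le_sub φ (a k) u v)).trans
      (mul_le_mul_right (add_le_add (hb _) (hb _)) _)
  refine sub_eq_zero.mp (eq_zero_of_ae_tfMatrix hφ (ae_eq_zero_of_wNorm hr hw
    (measurable_enorm_tfMatrix φ _) (fun X Y => ENNReal.inv_ne_zero.mpr (h.ne_top X Y))
    (nonpos_iff_eq_zero.mp h0)))

end Uniqueness

/-! ### The composition map -/

section Product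

variable {d n : ℕ}

/-- The extension of a finite sequence to a sequence indexed by `ℕ`, by a default value. -/
def natExt {α : Type*} {N : ℕ} (a : α) (u : Fin N → α) (j : ℕ) : α :=
  if h : j < N then u ⟨j, h⟩ else a

@[simp] theorem natExt_fin {α : Type*} {N : ℕ} (a : α) (u : Fin N → α) (j : Fin N) :
    natExt a u j = u j := by
  simp [natExt]

theorem natExt_of_lt {α : Type*} {N : ℕ} (a : α) (u : Fin N → α) {j : ℕ} (h : j < N) :
    natExt a u j = u ⟨j, h⟩ := by
  simp [natExt, h]

/-- The time-frequency matrices of a sequence of distributions. -/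
def matrices (φ : GelfandShilov (Rd d)) {N : ℕ} (u : Fin N → GSDist (R2d d)) (j : ℕ) :
    Rd d × Rd d → Rd d × Rd d → ℂ := tfMatrix φ (natExt 0 u j)

/-- The slowly varying majorants of the time-frequency matrices of a sequence of distributions. -/
def majorants (φ : GelfandShilov (Rd d)) (s : ℝ) {N : ℕ} (u : Fin N → GSDist (R2d d)) (j : ℕ) :
    Rd d × Rd d → Rd d × Rd d → ℝ≥0∞ := slowMatrix φ s (natExt 0 u j)

/-- The composition of the distribution kernels `u_i, …, u_{i+k}`: the distribution whose
time-frequency matrix is the product of their time-frequency matrices. -/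
def subProduct (φ : GelfandShilov (Rd d)) {N : ℕ} (u : Fin N → GSDist (R2d d)) (i k : ℕ) :
    GSDist (R2d d) := kerSynth φ (chain (phaseMeasure d) (matrices φ u) i k)

/-- Exponents and weights for which the composition of `n + 2` kernels is continuous, together with
equivalent weights on pairs of points of phase space. The output weight is `1/ω₀`. -/
structure IsCompositionSetup (φ : GelfandShilov (Rd d)) (Φ : GelfandShilov (R2d d))
    (q : Fin (n + 2) → ℝ≥0∞) (ω : Fin (n + 2) → R2d d × R2d d → ℝ) (r : ℝ≥0∞)
    (ω₀ : R2d d × R2d d → ℝ) (c : ℝ) (w : ℕ → Rd d × Rd d → Rd d × Rd d → ℝ≥0∞)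
    (w' : Rd d × Rd d → Rd d × Rd d → ℝ≥0∞) : Prop where
  window : ∫ t, ‖(φ : Rd d → ℂ) t‖ ^ 2 = 1
  weightChain : IsWeightChain n (natExt 1 q) w w' c
  matrixWeight : ∀ j : Fin (n + 2), IsMatrixWeight φ Φ (ω j) c (w j)
  matrixWeight' : IsMatrixWeight φ Φ ω₀ c w'
  exp_zero : q 0 = r

variable {φ : GelfandShilov (Rd d)} {Φ : GelfandShilov (R2d d)} {q : Fin (n + 2) → ℝ≥0∞}
  {ω : Fin (n + 2) → R2d d × R2d d → ℝ} {r : ℝ≥0∞} {ω₀ : R2d d × R2d d → ℝ} {c : ℝ}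
  {w : ℕ → Rd d × Rd d → Rd d × Rd d → ℝ≥0∞} {w' : Rd d × Rd d → Rd d × Rd d → ℝ≥0∞}
  {u : Fin (n + 2) → GSDist (R2d d)}

theorem stronglyMeasurable_matrices (φ : GelfandShilov (Rd d)) {N : ℕ}
    (u : Fin N → GSDist (R2d d)) (j : ℕ) :
    StronglyMeasurable (Function.uncurry (matrices φ u j)) :=
  stronglyMeasurable_tfMatrix φ _

theorem enorm_matrices_le (φ : GelfandShilov (Rd d)) (s : ℝ) {N : ℕ}
    (u : Fin N → GSDist (R2d d)) (j : ℕ) (X Y : Rd d × Rd d) :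
    ‖matrices φ u j X Y‖ₑ ≤ majorants φ s u j X Y :=
  enorm_tfMatrix_le φ s _ X Y

namespace IsCompositionSetup

theorem exp_ne_zero (S : IsCompositionSetup φ Φ q ω r ω₀ c w w') (j : Fin (n + 2)) : q j ≠ 0 := by
  simpa using S.weightChain.exp_ne_zero j

theorem out_ne_zero (S : IsCompositionSetup φ Φ q ω r ω₀ c w w') : r ≠ 0 :=
  S.exp_zero ▸ S.exp_ne_zero 0

theorem exp_natExt_zero (S : IsCompositionSetup φ Φ q ω r ω₀ c w w') : natExt 1 q 0 = r := by
  rw [natExt_of_lt _ _ (Nat.succ_pos _)]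
  exact S.exp_zero

theorem nonneg (S : IsCompositionSetup φ Φ q ω r ω₀ c w w') : 0 ≤ c + 1 := by
  linarith [S.weightChain.nonneg]

theorem wNorm_majorants_ne_top (S : IsCompositionSetup φ Φ q ω r ω₀ c w w')
    {v : GSDist (R2d d)} {j : Fin (n + 2)} (hv : v ∈ modSpace Φ (q j) (ω j)) :
    wNorm (phaseMeasure d) (q j) (w j) (slowMatrix φ (c + 1) v) ≠ ∞ := by
  obtain ⟨C, hC, hb⟩ := (S.matrixWeight j).slowMatrix_le (q j) (S.exp_ne_zero j) (c + 1) le_rfl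
  exact ((hb v).trans_lt (ENNReal.mul_lt_top hC.lt_top hv)).ne

theorem isMajorant (S : IsCompositionSetup φ Φ q ω r ω₀ c w w')
    (hu : ∀ j, u j ∈ modSpace Φ (q j) (ω j)) :
    IsMajorant (phaseMeasure d) (c + 1) (n + 1) (majorants φ (c + 1) u) := by
  refine S.weightChain.isMajorant S.nonneg (fun i => measurable_slowMatrix _ _ _)
    (fun i => isSlowKernel_slowMatrix _ S.nonneg _) fun j hj => ?_
  rw [majorants, natExt_of_lt _ _ hj, natExt_of_lt _ _ hj]
  exact S.wNorm_majorants_ne_top (hu ⟨j, hj⟩)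

theorem isTame (S : IsCompositionSetup φ Φ q ω r ω₀ c w w')
    (hu : ∀ j, u j ∈ modSpace Φ (q j) (ω j)) {i k : ℕ} (h : i + k ≤ n + 1) :
    IsTame (c + 1) (lchain (phaseMeasure d) (majorants φ (c + 1) u) i k) :=
  (S.isMajorant hu).isTame_lchain h

theorem isDominatedBy (φ : GelfandShilov (Rd d)) (s : ℝ) {N : ℕ} (u : Fin N → GSDist (R2d d))
    (i k : ℕ) : IsDominatedBy (lchain (phaseMeasure d) (majorants φ s u) i k)
      (chain (phaseMeasure d) (matrices φ u) i k) :=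
  ⟨stronglyMeasurable_chain (stronglyMeasurable_matrices φ u) i k,
    enorm_chain_le (enorm_matrices_le φ s u) i k⟩

theorem reproducesLeft (S : IsCompositionSetup φ Φ q ω r ω₀ c w w')
    (hu : ∀ j, u j ∈ modSpace Φ (q j) (ω j)) {i k : ℕ} (h : i + k ≤ n + 1) :
    ReproducesLeft (phaseMeasure d) (tfGram φ φ)
      (chain (phaseMeasure d) (matrices φ u) i k) :=
  reproducesLeft_chain (isGaussKernel_tfGram φ φ) (S.isMajorant hu)
    (stronglyMeasurable_matrices φ u) (enorm_matrices_le φ _ u) h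
    (reproducesLeft_tfMatrix S.window (isDominatedBy_tfMatrix φ (c + 1) _)
      (S.isTame hu (i := i) (k := 0) (by omega)))

theorem reproducesRight (S : IsCompositionSetup φ Φ q ω r ω₀ c w w')
    (hu : ∀ j, u j ∈ modSpace Φ (q j) (ω j)) {i k : ℕ} (h : i + k ≤ n + 1) :
    ReproducesRight (phaseMeasure d) (tfGram φ φ)
      (chain (phaseMeasure d) (matrices φ u) i k) :=
  reproducesRight_chain (isGaussKernel_tfGram φ φ) (S.isMajorant hu)
    (stronglyMeasurable_matrices φ u) (enorm_matrices_le φ _ u) h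
    (reproducesRight_tfMatrix S.window (isDominatedBy_tfMatrix φ (c + 1) _)
      (S.isTame hu (i := i + k) (k := 0) (by omega)))

theorem tfMatrix_subProduct (S : IsCompositionSetup φ Φ q ω r ω₀ c w w')
    (hu : ∀ j, u j ∈ modSpace Φ (q j) (ω j)) {i k : ℕ} (h : i + k ≤ n + 1) :
    tfMatrix φ (subProduct φ u i k) = chain (phaseMeasure d) (matrices φ u) i k :=
  tfMatrix_kerSynth (isDominatedBy φ (c + 1) u i k) (S.isTame hu h) (S.reproducesLeft hu h)
    (S.reproducesRight hu h)

theorem subProduct_apply (S : IsCompositionSetup φ Φ q ω r ω₀ c w w')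
    (hu : ∀ j, u j ∈ modSpace Φ (q j) (ω j)) {i k : ℕ} (h : i + k ≤ n + 1)
    (F : GelfandShilov (R2d d)) : (subProduct φ u i k).1 F =
      ∫ z : (Rd d × Rd d) × (Rd d × Rd d), chain (phaseMeasure d) (matrices φ u) i k z.1 z.2 *
        anaKer φ F z.1 z.2 ∂((phaseMeasure d).prod (phaseMeasure d)) :=
  kerSynth_apply (isDominatedBy φ (c + 1) u i k) (S.isTame hu h) F

theorem subProduct_self (S : IsCompositionSetup φ Φ q ω r ω₀ c w w') (j : Fin (n + 2)) :
    subProduct φ u j 0 = u j := by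
  rw [subProduct, chain_zero, matrices, natExt_fin, kerSynth_tfMatrix S.window]

theorem isKernelComp_subProduct (S : IsCompositionSetup φ Φ q ω r ω₀ c w w')
    (hu : ∀ j, u j ∈ modSpace Φ (q j) (ω j)) {i a b : ℕ} (h : i + (a + b + 1) ≤ n + 1) :
    IsKernelComp (subProduct φ u i a) (subProduct φ u (i + a + 1) b)
      (subProduct φ u i (a + b + 1)) :=
  isKernelComp_kerSynth (S.isTame hu (by omega)) (S.isTame hu (by omega)) (S.isTame hu h)
    (fun X Y => (lchain_add (fun i => measurable_slowMatrix _ _ _) i a b X Y).symm)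
    (isDominatedBy φ (c + 1) u _ _) (isDominatedBy φ (c + 1) u _ _)
    (isDominatedBy φ (c + 1) u _ _)
    (fun X Y => chain_add (S.isMajorant hu) (stronglyMeasurable_matrices φ u)
      (enorm_matrices_le φ _ u) h X Y)
    (S.reproducesLeft hu (by omega))

/-- The norm estimate for compositions, in terms of weighted norms of time-frequency matrices. -/
theorem exists_wNorm_le (S : IsCompositionSetup φ Φ q ω r ω₀ c w w') :
    ∃ C : ℝ≥0∞, C ≠ ∞ ∧ ∀ u : Fin (n + 2) → GSDist (R2d d),
      (∀ j, u j ∈ modSpace Φ (q j) (ω j)) →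
      wNorm (phaseMeasure d) r (fun X Y => (w' X Y)⁻¹)
        (fun X Y => ‖tfMatrix φ (subProduct φ u 0 (n + 1)) X Y‖ₑ) ≤
        C * ∏ j, modNorm Φ (q j) (ω j) (u j) := by
  obtain ⟨C, hC, hb⟩ := S.weightChain.exists_wNorm_lchain_le (phaseMeasure d) S.nonneg
  choose D hD hDb using fun j : Fin (n + 2) =>
    (S.matrixWeight j).slowMatrix_le (q j) (S.exp_ne_zero j) (c + 1) le_rfl
  refine ⟨C * ∏ j, D j, ENNReal.mul_ne_top hC (ENNReal.prod_ne_top fun j _ => hD j),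
    fun u hu => ?_⟩
  rw [S.tfMatrix_subProduct hu (by omega)]
  calc _ ≤ wNorm (phaseMeasure d) r (fun X Y => (w' X Y)⁻¹)
        (lchain (phaseMeasure d) (majorants φ (c + 1) u) 0 (n + 1)) :=
        wNorm_mono (isDominatedBy φ (c + 1) u _ _).le
    _ ≤ C * ∏ j ∈ Finset.range (n + 2), wNorm (phaseMeasure d) (natExt 1 q j) (w j)
        (majorants φ (c + 1) u j) := by
        have := hb (majorants φ (c + 1) u) (fun i => measurable_slowMatrix _ _ _)
          (fun i => isSlowKernel_slowMatrix _ S.nonneg _)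
        rwa [S.exp_natExt_zero] at this
    _ = C * ∏ j : Fin (n + 2), wNorm (phaseMeasure d) (q j) (w j) (slowMatrix φ (c + 1) (u j)) := by
        rw [← Fin.prod_univ_eq_prod_range (fun j => wNorm (phaseMeasure d) (natExt 1 q j) (w j)
          (majorants φ (c + 1) u j))]
        simp only [majorants, natExt_fin]
    _ ≤ C * ∏ j, (D j * modNorm Φ (q j) (ω j) (u j)) :=
        mul_le_mul_right (Finset.prod_le_prod' fun j _ => hDb j (u j)) _
    _ = _ := by rw [Finset.prod_mul_distrib, mul_assoc]

theorem exists_modNorm_le (S : IsCompositionSetup φ Φ q ω r ω₀ c w w') :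
    ∃ C : ℝ≥0∞, C ≠ ∞ ∧ ∀ u : Fin (n + 2) → GSDist (R2d d),
      (∀ j, u j ∈ modSpace Φ (q j) (ω j)) →
      modNorm Φ r (fun z => (ω₀ z)⁻¹) (subProduct φ u 0 (n + 1)) ≤
        C * ∏ j, modNorm Φ (q j) (ω j) (u j) := by
  obtain ⟨C, hC, hb⟩ := S.exists_wNorm_le
  obtain ⟨D, hD, hDb⟩ := S.matrixWeight'.modNorm_inv_le r S.out_ne_zero
  refine ⟨D * C, ENNReal.mul_ne_top hD hC, fun u hu => (hDb _).trans ?_⟩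
  rw [mul_assoc]
  exact mul_le_mul_right (hb u hu) _

theorem subProduct_mem (S : IsCompositionSetup φ Φ q ω r ω₀ c w w')
    (hu : ∀ j, u j ∈ modSpace Φ (q j) (ω j)) :
    subProduct φ u 0 (n + 1) ∈ modSpace Φ r fun z => (ω₀ z)⁻¹ := by
  obtain ⟨C, hC, hb⟩ := S.exists_modNorm_le
  exact (hb u hu).trans_lt (ENNReal.mul_lt_top hC.lt_top (ENNReal.prod_lt_top fun j _ => hu j))

theorem subProduct_linear (S : IsCompositionSetup φ Φ q ω r ω₀ c w w') {j : Fin (n + 2)}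
    {u₁ u₂ : Fin (n + 2) → GSDist (R2d d)} (hu : ∀ j, u j ∈ modSpace Φ (q j) (ω j))
    (hu₁ : ∀ j, u₁ j ∈ modSpace Φ (q j) (ω j)) (hu₂ : ∀ j, u₂ j ∈ modSpace Φ (q j) (ω j))
    (h₁ : ∀ l, l ≠ j → u l = u₁ l) (h₂ : ∀ l, l ≠ j → u l = u₂ l) {a b : ℂ}
    (hj : u j = a • u₁ j + b • u₂ j) :
    subProduct φ u 0 (n + 1) =
      a • subProduct φ u₁ 0 (n + 1) + b • subProduct φ u₂ 0 (n + 1) := by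
  have hext : ∀ v : Fin (n + 2) → GSDist (R2d d), (∀ l, l ≠ j → u l = v l) →
      ∀ l : ℕ, l ≠ j → matrices φ u l = matrices φ v l := by
    intro v hv l hl
    unfold matrices natExt
    split_ifs with h
    · rw [hv ⟨l, h⟩ fun e => hl (by rw [← e])]
    · rfl
  refine Subtype.ext (LinearMap.ext fun F => ?_)
  have e : (a • subProduct φ u₁ 0 (n + 1) + b • subProduct φ u₂ 0 (n + 1)).1 F =
      a * (subProduct φ u₁ 0 (n + 1)).1 F + b * (subProduct φ u₂ 0 (n + 1)).1 F := rfl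
  have hint := fun (v : Fin (n + 2) → GSDist (R2d d)) (hv : ∀ j, v j ∈ modSpace Φ (q j) (ω j)) =>
    integrable_mul_anaKer (φ := φ) (isDominatedBy φ (c + 1) v 0 (n + 1))
      (S.isTame hv (i := 0) (k := n + 1) (by omega)) F
  rw [e, S.subProduct_apply hu (by omega), S.subProduct_apply hu₁ (by omega),
    S.subProduct_apply hu₂ (by omega), ← integral_const_mul, ← integral_const_mul,
    ← integral_add ((hint u₁ hu₁).const_mul a) ((hint u₂ hu₂).const_mul b)]
  refine integral_congr_ae (Eventually.of_forall fun z => ?_)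
  simp only
  rw [chain_linear (j := (j : ℕ)) (S.isMajorant hu₁) (S.isMajorant hu₂)
    (stronglyMeasurable_matrices φ u₁) (stronglyMeasurable_matrices φ u₂)
    (enorm_matrices_le φ _ u₁) (enorm_matrices_le φ _ u₂) (hext u₁ h₁) (hext u₂ h₂) (a := a) (b := b)
    (fun X Y => ?_) (by omega) (by omega) (by omega)]
  · ring
  · simp only [matrices, natExt_fin]
    exact tfMatrix_linear φ hj X Y

end IsCompositionSetup

end Product

section Slow

variable {P : Type*} [NormedAddCommGroup P] {s : ℝ} {F : P → P → ℝ≥0∞}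

theorem IsSlowKernel.inv (h : IsSlowKernel s F) : IsSlowKernel s fun X Y => (F X Y)⁻¹ := by
  intro X X' Y Y'
  have h1 := h X' X Y' Y
  rw [norm_sub_rev X', norm_sub_rev Y'] at h1
  have h2 := ENNReal.inv_le_inv.mpr h1
  rw [ENNReal.mul_inv (Or.inr (ex_ne_top _)) (Or.inr (ex_ne_zero _))] at h2
  calc (F X Y)⁻¹ = (F X Y)⁻¹ * (ex (s * (‖X - X'‖ + ‖Y - Y'‖)))⁻¹ *
        ex (s * (‖X - X'‖ + ‖Y - Y'‖)) := by
        rw [mul_assoc, ENNReal.inv_mul_cancel (ex_ne_zero _) (ex_ne_top _), mul_one]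
    _ ≤ _ := mul_le_mul_left h2 _

theorem IsSlowKernel.const_mul (h : IsSlowKernel s F) (C : ℝ≥0∞) :
    IsSlowKernel s fun X Y => C * F X Y := fun X X' Y Y' => by
  rw [mul_assoc]
  exact mul_le_mul_right (h X X' Y Y') _

/-- A slowly varying kernel which is bounded almost everywhere is bounded everywhere. -/
theorem IsSlowKernel.le_of_ae [MeasurableSpace P] {ν : Measure P} [SFinite ν] [ν.IsOpenPosMeasure]
    (h : IsSlowKernel s F) (hs : 0 ≤ s) {D : ℝ≥0∞} (hD : ∀ᵐ z ∂(ν.prod ν), F z.1 z.2 ≤ D)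
    (X Y : P) : F X Y ≤ D * ex (s * 2) := by
  obtain ⟨z, hz, hdist⟩ := (Measure.dense_of_ae hD).exists_dist_lt (X, Y) one_pos
  refine (h X z.1 Y z.2).trans (mul_le_mul' hz (ex_mono (mul_le_mul_of_nonneg_left ?_ hs)))
  rw [Prod.dist_eq, max_lt_iff, dist_eq_norm, dist_eq_norm] at hdist
  linarith [hdist.1, hdist.2]

end Slow

section Product

variable {d n : ℕ} {φ : GelfandShilov (Rd d)} {Φ : GelfandShilov (R2d d)}

/-- The quasi-triangle inequality, in a form which covers sums and differences. -/
theorem IsMatrixWeight.exists_modNorm_le_add {ω : R2d d × R2d d → ℝ} {c : ℝ}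
    {w : Rd d × Rd d → Rd d × Rd d → ℝ≥0∞} (h : IsMatrixWeight φ Φ ω c w) {q : ℝ≥0∞}
    (hq : q ≠ 0) : ∃ A : ℝ≥0∞, A ≠ ∞ ∧ ∀ x u v : GSDist (R2d d),
      (∀ X Y, ‖tfMatrix φ x X Y‖ₑ ≤ ‖tfMatrix φ u X Y‖ₑ + ‖tfMatrix φ v X Y‖ₑ) →
      modNorm Φ q ω x ≤ A * (modNorm Φ q ω u + modNorm Φ q ω v) := by
  obtain ⟨C, hC, hb⟩ := h.modNorm_le q hq
  obtain ⟨D, hD, hDb⟩ := h.slowMatrix_le q hq (c + 1) le_rfl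
  have hle : ∀ u, wNorm (phaseMeasure d) q w (fun X Y => ‖tfMatrix φ u X Y‖ₑ) ≤
      D * modNorm Φ q ω u := fun u => (wNorm_mono (enorm_tfMatrix_le φ (c + 1) u)).trans (hDb u)
  refine ⟨C * (ENNReal.LpAddConst q * D), ENNReal.mul_ne_top hC
    (ENNReal.mul_ne_top (ENNReal.LpAddConst_lt_top q).ne hD), fun x u v hx => (hb x).trans ?_⟩
  rw [mul_assoc, mul_assoc, mul_add]
  exact mul_le_mul_right ((wNorm_tfMatrix_le h.measurable q hx).trans
    (mul_le_mul_right (add_le_add (hle u) (hle v)) _)) _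

theorem IsGivenBy.unique {K L : GSDist (R2d d)} {F : R2d d → ℂ} (hK : IsGivenBy K F)
    (hL : IsGivenBy L F) : K = L :=
  Subtype.ext (LinearMap.ext fun g => (hK g).2.trans (hL g).2.symm)

namespace IsCompositionSetup

variable {q : Fin (n + 2) → ℝ≥0∞}
  {ω : Fin (n + 2) → R2d d × R2d d → ℝ} {r : ℝ≥0∞} {ω₀ : R2d d × R2d d → ℝ} {c : ℝ}
  {w : ℕ → Rd d × Rd d → Rd d × Rd d → ℝ≥0∞} {w' : Rd d × Rd d → Rd d × Rd d → ℝ≥0∞}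
  {u : Fin (n + 2) → GSDist (R2d d)}

/-- The composition map between modulation spaces. -/
def map (S : IsCompositionSetup φ Φ q ω r ω₀ c w w') (u : ∀ j, modSpace Φ (q j) (ω j)) :
    modSpace Φ r (fun z => (ω₀ z)⁻¹) :=
  ⟨subProduct φ (fun j => (u j : GSDist (R2d d))) 0 (n + 1), S.subProduct_mem fun j => (u j).2⟩

theorem isMultilinear_map (S : IsCompositionSetup φ Φ q ω r ω₀ c w w') : IsMultilinear S.map := by
  intro u j a b x s t hx
  refine S.subProduct_linear (j := j) (fun l => Subtype.coe_prop _) (fun l => Subtype.coe_prop _)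
    (fun l => Subtype.coe_prop _) (fun l hl => ?_) (fun l hl => ?_) ?_
  · simp only [Function.update_of_ne hl]
  · simp only [Function.update_of_ne hl]
  · simpa only [Function.update_self] using hx

theorem isAssociative_map (S : IsCompositionSetup φ Φ q ω r ω₀ c w w') : IsAssociative S.map := by
  intro u
  refine ⟨fun k l => subProduct φ (fun j => (u j : GSDist (R2d d))) k (l - k), fun j => ?_, rfl,
    fun k m l hkm hml hl => ?_⟩
  · simp only [Nat.sub_self]
    exact S.subProduct_self j
  · have h := S.isKernelComp_subProduct (fun j => (u j).2) (i := k) (a := m - k)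
      (b := l - (m + 1)) (by omega)
    have e1 : k + (m - k) + 1 = m + 1 := by omega
    have e2 : m - k + (l - (m + 1)) + 1 = l - k := by omega
    rwa [e1, e2] at h

/-- For kernels in `S_{1/2}` the matrices have Gaussian decay, and their product is the matrix of the
composition of the kernel functions. -/
theorem extendsKernelComp_map (S : IsCompositionSetup φ Φ q ω r ω₀ c w w') :
    ExtendsKernelComp S.map := by
  intro u K hK
  set v : Fin (n + 2) → GSDist (R2d d) := fun j => u j with hv
  have hrap : ∀ j, j ≤ n + 1 → IsRapid (matrices φ v j) := fun j hj => by
    rw [matrices, natExt_of_lt _ _ (show j < n + 2 by omega)]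
    exact isRapid_tfMatrix (hK _)
  have e : kernelCompList (List.ofFn fun j => (K j : R2d d → ℂ)) =
      kerFun φ (chain (phaseMeasure d) (matrices φ v) 0 (n + 1)) := by
    rw [← kernelCompList_eq_kerFun hrap
      (fun i k h => S.reproducesLeft (fun j => (u j).2) h) (by omega)]
    congr 2
    funext j
    rw [zero_add, matrices, natExt_fin, kerFun_tfMatrix S.window (hK j)]
  have hch : IsRapid (chain (phaseMeasure d) (matrices φ v) 0 (n + 1)) :=
    IsRapid.chain fun j _ hj => hrap j (by omega)
  rw [e]
  exact ⟨memGS_kerFun hch, isGivenBy_kerSynth hch⟩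

/-- Continuity in the norms follows from multilinearity and the norm estimate, by changing one
factor after the other. -/
theorem isNormContinuous_map (S : IsCompositionSetup φ Φ q ω r ω₀ c w w') :
    IsNormContinuous Φ q ω r (fun z => (ω₀ z)⁻¹) S.map := by
  intro U u hU
  have hw' : Measurable (Function.uncurry fun X Y => (w' X Y)⁻¹) := S.matrixWeight'.measurable.inv
  choose A hA hAb using fun j : Fin (n + 2) =>
    (S.matrixWeight j).exists_modNorm_le_add (S.exp_ne_zero j)
  obtain ⟨C, hC, hCb⟩ := S.exists_wNorm_le
  set H : ℕ → ℕ → Fin (n + 2) → GSDist (R2d d) := fun l k j => if (j : ℕ) < l then U k j else u j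
    with hH
  have hHm : ∀ l k j, H l k j ∈ modSpace Φ (q j) (ω j) := fun l k j => by
    simp only [hH]
    split_ifs
    · exact (U k j).2
    · exact (u j).2
  have hsub : ∀ k j, (U k j : GSDist (R2d d)) - u j ∈ modSpace Φ (q j) (ω j) := fun k j =>
    (hAb j _ _ _ (enorm_tfMatrix_sub_le φ (U k j : GSDist (R2d d)) (u j))).trans_lt
      (ENNReal.mul_lt_top (hA j).lt_top (ENNReal.add_lt_top.mpr ⟨(U k j).2, (u j).2⟩))
  set B : Fin (n + 2) → ℝ≥0∞ := fun j =>
    A j * (1 + modNorm Φ (q j) (ω j) (u j)) + modNorm Φ (q j) (ω j) (u j) with hB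
  have hBt : ∀ j, B j ≠ ∞ := fun j => ENNReal.add_ne_top.mpr ⟨ENNReal.mul_ne_top (hA j)
    (ENNReal.add_ne_top.mpr ⟨ENNReal.one_ne_top, (u j).2.ne⟩), (u j).2.ne⟩
  have hev : ∀ᶠ k in atTop, ∀ l j, modNorm Φ (q j) (ω j) (H l k j) ≤ B j := by
    have h1 : ∀ᶠ k in atTop, ∀ j, modNorm Φ (q j) (ω j) ((U k j : GSDist (R2d d)) - u j) ≤ 1 :=
      eventually_all.mpr fun j => ((tendsto_order.mp (hU j)).2 1 one_pos).mono fun k hk => hk.le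
    filter_upwards [h1] with k hk l j
    simp only [hH]
    split_ifs
    · refine le_trans ?_ le_self_add
      refine (hAb j (U k j) ((U k j : GSDist (R2d d)) - u j) (u j) fun X Y => ?_).trans
        (mul_le_mul_right (add_le_add_left (hk j) _) _)
      have e : tfMatrix φ (U k j) X Y =
          tfMatrix φ ((U k j : GSDist (R2d d)) - u j) X Y + tfMatrix φ (u j) X Y := by
        rw [tfMatrix_sub, sub_add_cancel]
      rw [e]
      exact enorm_add_le _ _
    · exact le_add_self
  have hlim : ∀ l, l ≤ n + 2 → Tendsto (fun k => wNorm (phaseMeasure d) r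
      (fun X Y => (w' X Y)⁻¹) (fun X Y => ‖tfMatrix φ (subProduct φ (H l k) 0 (n + 1) -
        subProduct φ (H 0 k) 0 (n + 1)) X Y‖ₑ)) atTop (𝓝 0) := by
    intro l
    induction l with
    | zero =>
      intro _
      have e : wNorm (phaseMeasure d) r (fun X Y => (w' X Y)⁻¹) (fun X Y => ‖tfMatrix φ 0 X Y‖ₑ)
          = 0 := by
        simp [wNorm, tfMatrix_zero]
      simp only [sub_self, e]
      exact tendsto_const_nhds
    | succ l ih =>
      intro hl
      set j₀ : Fin (n + 2) := ⟨l, by omega⟩ with hj₀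
      -- The difference made by changing the factor with index `l`.
      set E : ℕ → Fin (n + 2) → GSDist (R2d d) := fun k =>
        Function.update (H l k) j₀ ((U k j₀ : GSDist (R2d d)) - u j₀) with hE
      have hEm : ∀ k j, E k j ∈ modSpace Φ (q j) (ω j) := fun k j => by
        rcases eq_or_ne j j₀ with rfl | hj
        · simp only [hE, Function.update_self]
          exact hsub k _
        · simp only [hE, Function.update_of_ne hj]
          exact hHm l k j
      have hlin : ∀ k, subProduct φ (H (l + 1) k) 0 (n + 1) =
          (1 : ℂ) • subProduct φ (E k) 0 (n + 1) + (1 : ℂ) • subProduct φ (H l k) 0 (n + 1) := by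
        intro k
        have hne : ∀ i, i ≠ j₀ → H (l + 1) k i = H l k i := fun i hi => by
          have : (i : ℕ) ≠ l := fun e => hi (Fin.ext e)
          simp only [hH]
          split_ifs <;> first | rfl | omega
        refine S.subProduct_linear (j := j₀) (hHm _ k) (hEm k) (hHm l k) (fun i hi => ?_) hne ?_
        · rw [hne i hi, hE]
          simp only [Function.update_of_ne hi]
        · have e1 : H (l + 1) k j₀ = U k j₀ := if_pos (Nat.lt_succ_self l)
          have e2 : H l k j₀ = u j₀ := if_neg (lt_irrefl l)
          simp only [e1, e2, hE, Function.update_self, one_smul, sub_add_cancel]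
      have hEle : ∀ᶠ k in atTop, wNorm (phaseMeasure d) r (fun X Y => (w' X Y)⁻¹)
          (fun X Y => ‖tfMatrix φ (subProduct φ (E k) 0 (n + 1)) X Y‖ₑ) ≤
          C * (modNorm Φ (q j₀) (ω j₀) ((U k j₀ : GSDist (R2d d)) - u j₀) *
            ∏ j ∈ Finset.univ.erase j₀, B j) := by
        filter_upwards [hev] with k hk
        refine (hCb (E k) (hEm k)).trans (mul_le_mul_right ?_ _)
        rw [← Finset.mul_prod_erase _ _ (Finset.mem_univ j₀)]
        refine mul_le_mul' (by simp [hE]) (Finset.prod_le_prod' fun j hj => ?_)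
        simp only [hE, Function.update_of_ne (Finset.ne_of_mem_erase hj)]
        exact hk l j
      have hElim : Tendsto (fun k => wNorm (phaseMeasure d) r (fun X Y => (w' X Y)⁻¹)
          (fun X Y => ‖tfMatrix φ (subProduct φ (E k) 0 (n + 1)) X Y‖ₑ)) atTop (𝓝 0) := by
        refine tendsto_of_tendsto_of_tendsto_of_le_of_le' tendsto_const_nhds ?_
          (Eventually.of_forall fun _ => zero_le) hEle
        have h1 := ENNReal.Tendsto.mul_const (hU j₀)
          (Or.inr (ENNReal.prod_ne_top (s := Finset.univ.erase j₀) fun j _ => hBt j))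
        simpa using ENNReal.Tendsto.const_mul h1 (Or.inr hC)
      have h2 := ENNReal.Tendsto.const_mul (hElim.add (ih (by omega)))
        (Or.inr (ENNReal.LpAddConst_lt_top r).ne)
      rw [add_zero, mul_zero] at h2
      refine tendsto_of_tendsto_of_tendsto_of_le_of_le tendsto_const_nhds h2
        (fun _ => zero_le) fun k => wNorm_tfMatrix_le hw' r fun X Y => ?_
      rw [hlin k, one_smul, one_smul, add_sub_assoc]
      exact enorm_add_le _ _
  obtain ⟨D, hD, hDb⟩ := S.matrixWeight'.modNorm_inv_le r S.out_ne_zero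
  have h0 : ∀ k, H 0 k = fun j => (u j : GSDist (R2d d)) := fun k => by
    funext j
    simp [hH]
  have h1 : ∀ k, H (n + 2) k = fun j => (U k j : GSDist (R2d d)) := fun k => by
    funext j
    simp [hH]
  have hfin := ENNReal.Tendsto.const_mul (hlim (n + 2) le_rfl) (Or.inr hD)
  rw [mul_zero] at hfin
  refine tendsto_of_tendsto_of_tendsto_of_le_of_le tendsto_const_nhds hfin
    (fun _ => zero_le) fun k => ?_
  rw [h0, h1]
  exact hDb _

/-- Bounded sets in `M^∞_{(ω_j)}` have time-frequency matrices with a common pointwise majorant. -/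
theorem exists_enorm_tfMatrix_le_of_top (S : IsCompositionSetup φ Φ q ω r ω₀ c w w')
    {j : Fin (n + 2)} (hj : q j = ∞) {B : ℝ≥0∞} (hB : B ≠ ∞) :
    ∃ D : ℝ≥0∞, D ≠ ∞ ∧ ∀ v : GSDist (R2d d), modNorm Φ (q j) (ω j) v ≤ B →
      ∀ X Y, ‖tfMatrix φ v X Y‖ₑ ≤ D * (w j X Y)⁻¹ := by
  obtain ⟨C, hC, hb⟩ := (S.matrixWeight j).slowMatrix_le (q j) (S.exp_ne_zero j) (c + 1) le_rfl
  refine ⟨C * B * ex ((c + (c + 1)) * 2), ENNReal.mul_ne_top (ENNReal.mul_ne_top hC hB)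
    (ex_ne_top _), fun v hv X Y => ?_⟩
  have h1 : wNorm (phaseMeasure d) ∞ (w j) (slowMatrix φ (c + 1) v) ≤ C * B := by
    rw [← hj]
    exact (hb v).trans (mul_le_mul_right hv _)
  have h2 := ((S.matrixWeight j).slow.mul (isSlowKernel_slowMatrix φ S.nonneg v)).le_of_ae
    (ν := phaseMeasure d) (D := C * B) (by linarith [S.nonneg, S.weightChain.nonneg])
    ((ae_le_eLpNorm_top _).mono fun z hz => hz.trans h1) X Y
  rw [← div_eq_mul_inv, ENNReal.le_div_iff_mul_le (Or.inl ((S.matrixWeight j).ne_zero X Y))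
    (Or.inl ((S.matrixWeight j).ne_top X Y)), mul_comm]
  exact (mul_le_mul_right (enorm_tfMatrix_le φ _ v X Y) _).trans h2

/-- Convergence in `S_{1/2}'` is pointwise convergence of time-frequency matrices, and boundedness in
`M^∞` provides a majorant, so that dominated convergence applies to the iterated integrals. -/
theorem isWeaklyContinuousAtInfty_map (S : IsCompositionSetup φ Φ q ω r ω₀ c w w') :
    IsWeaklyContinuousAtInfty Φ q ω r (fun z => (ω₀ z)⁻¹) S.map := by
  intro U u hfix htop F
  have hbd : ∀ j : Fin (n + 2), ∃ D : ℝ≥0∞, D ≠ ∞ ∧ (q j = ∞ → ∀ k X Y,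
      ‖tfMatrix φ (U k j) X Y‖ₑ ≤ D * (w j X Y)⁻¹) := fun j => by
    by_cases hj : q j = ∞
    · obtain ⟨⟨B, hB⟩, -⟩ := htop j hj
      obtain ⟨D, hD, hDb⟩ := S.exists_enorm_tfMatrix_le_of_top hj (ENNReal.coe_ne_top (r := B))
      exact ⟨D, hD, fun _ k => hDb _ (hB k)⟩
    · exact ⟨0, ENNReal.zero_ne_top, fun h => absurd h hj⟩
  choose D hD hDb using hbd
  set v : Fin (n + 2) → GSDist (R2d d) := fun j => u j with hv
  set κ : ℕ → ℕ → Rd d × Rd d → Rd d × Rd d → ℂ :=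
    fun k => matrices φ fun j => (U k j : GSDist (R2d d)) with hκ
  set m : ℕ → Rd d × Rd d → Rd d × Rd d → ℝ≥0∞ := fun j =>
    if natExt 1 q j = ∞ then fun X Y => natExt 0 D j * (w j X Y)⁻¹ else majorants φ (c + 1) v j
    with hm
  have hDt : ∀ j, natExt 0 D j ≠ ∞ := fun j => by
    unfold natExt
    split_ifs
    · exact hD _
    · exact ENNReal.zero_ne_top
  have hM : IsMajorant (phaseMeasure d) (c + 1) (n + 1) m := by
    refine S.weightChain.isMajorant S.nonneg (fun i => ?_) (fun i => ?_) fun j hj => ?_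
    · simp only [hm]
      split_ifs
      · exact (S.weightChain.measurable i).inv.const_mul _
      · exact measurable_slowMatrix _ _ _
    · simp only [hm]
      split_ifs
      · exact ((S.weightChain.slow i).inv.const_mul _).mono (by linarith)
      · exact isSlowKernel_slowMatrix _ S.nonneg _
    · simp only [hm]
      split_ifs with hq
      · rw [hq, wNorm, eLpNorm_exponent_top]
        refine ((eLpNormEssSup_le_of_ae_enorm_bound (C := natExt 0 D j)
          (Eventually.of_forall fun z => ?_)).trans_lt (hDt j).lt_top).ne
        rw [enorm_eq_self, mul_left_comm, ENNReal.mul_inv_cancel (S.weightChain.ne_zero j _ _)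
          (S.weightChain.ne_top j _ _), mul_one]
      · rw [majorants, natExt_of_lt _ _ hj, natExt_of_lt _ _ hj]
        exact S.wNorm_majorants_ne_top (u ⟨j, hj⟩).2
  have hκm : ∀ k i X Y, ‖κ k i X Y‖ₑ ≤ m i X Y := by
    intro k i X Y
    rcases lt_or_ge i (n + 2) with hi | hi
    · simp only [hm, hκ, matrices, natExt_of_lt _ _ hi]
      split_ifs with hq
      · exact hDb _ hq k X Y
      · rw [(hfix _ hq).1 k, majorants, natExt_of_lt _ _ hi]
        exact enorm_tfMatrix_le φ _ _ X Y
    · have e : κ k i X Y = 0 := by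
        simp only [hκ, matrices, natExt, not_lt.mpr hi, dite_false]
        rfl
      rw [e, enorm_zero]
      exact zero_le
  have hlim : ∀ i X Y, Tendsto (fun k => κ k i X Y) atTop (𝓝 (matrices φ v i X Y)) := by
    intro i X Y
    rcases lt_or_ge i (n + 2) with hi | hi
    · simp only [hκ, matrices, natExt_of_lt _ _ hi]
      by_cases hq : q ⟨i, hi⟩ = ∞
      · exact (htop _ hq).2 _
      · simp only [(hfix _ hq).1]
        exact tendsto_const_nhds
    · simp only [hκ, matrices, natExt, not_lt.mpr hi, dite_false]
      exact tendsto_const_nhds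
  have htame := hM.isTame_lchain (i := 0) (n := n + 1) (by omega)
  have hcoe : ∀ X Y, ‖((lchain (phaseMeasure d) m 0 (n + 1) X Y).toReal : ℂ)‖ₑ =
      lchain (phaseMeasure d) m 0 (n + 1) X Y := fun X Y => by
    rw [← ofReal_norm, Complex.norm_real, Real.norm_of_nonneg ENNReal.toReal_nonneg,
      ENNReal.ofReal_toReal (htame.ne_top X Y)]
  have hdom : IsDominatedBy (lchain (phaseMeasure d) m 0 (n + 1))
      (fun X Y => ((lchain (phaseMeasure d) m 0 (n + 1) X Y).toReal : ℂ)) :=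
    ⟨(Complex.measurable_ofReal.comp htame.measurable.ennreal_toReal).stronglyMeasurable,
      fun X Y => (hcoe X Y).le⟩
  have hU : ∀ k, ((S.map (U k) : GSDist (R2d d))).1 F = _ := fun k =>
    S.subProduct_apply (fun j => (U k j).2) (by omega) F
  have hu : ((S.map u : GSDist (R2d d))).1 F = _ :=
    S.subProduct_apply (fun j => (u j).2) (by omega) F
  simp only [hU, hu]
  refine tendsto_integral_of_dominated_convergence _
    (fun k => (integrable_mul_anaKer (φ := φ) (isDominatedBy φ (c + 1) _ 0 (n + 1))
      (S.isTame (fun j => (U k j).2) (by omega)) F).aestronglyMeasurable)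
    (integrable_mul_anaKer (φ := φ) hdom htame F).norm
    (fun k => Eventually.of_forall fun z => ?_) (Eventually.of_forall fun z => ?_)
  · rw [norm_mul, norm_mul]
    refine mul_le_mul_of_nonneg_right ?_ (norm_nonneg _)
    rw [← enorm_le_iff_norm_le, hcoe]
    exact enorm_chain_le (hκm k) 0 (n + 1) z.1 z.2
  · exact (tendsto_chain hM (fun k => stronglyMeasurable_matrices φ _) hκm hlim (by omega)
      z.1 z.2).mul_const _

theorem isContinuousExtension_map (S : IsCompositionSetup φ Φ q ω r ω₀ c w w') :
    IsContinuousExtension Φ q ω r (fun z => (ω₀ z)⁻¹) S.map :=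
  ⟨S.extendsKernelComp_map, S.isNormContinuous_map, S.isWeaklyContinuousAtInfty_map⟩

end IsCompositionSetup

end Product

/-! ### Approximation by test functions and uniqueness -/

section Approximation

variable {d : ℕ} {φ : GelfandShilov (Rd d)} {Φ : GelfandShilov (R2d d)}
  {M : Rd d × Rd d → Rd d × Rd d → ℝ≥0∞} {s : ℝ}

/-- Synthesis followed by analysis is integration against Gaussian kernels on both sides, which
respects slowly varying majorants. -/
theorem exists_enorm_tfMatrix_kerSynth_le (φ : GelfandShilov (Rd d)) (s : ℝ) :
    ∃ K : ℝ≥0∞, K ≠ ∞ ∧ ∀ (M : Rd d × Rd d → Rd d × Rd d → ℝ≥0∞)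
      (c : Rd d × Rd d → Rd d × Rd d → ℂ), IsDominatedBy M c → IsTame s M →
      ∀ X Y, ‖tfMatrix φ (kerSynth φ c) X Y‖ₑ ≤ K * M X Y := by
  have hG := isGaussKernel_tfGram φ φ
  obtain ⟨K₁, hK₁, h₁⟩ := hG.exists_lintegral_le (phaseMeasure d) s
  obtain ⟨K₂, hK₂, h₂⟩ := hG.swap.exists_lintegral_le (phaseMeasure d) s
  refine ⟨K₂ * K₁, ENNReal.mul_ne_top hK₂ hK₁, fun M c hc hM X Y => ?_⟩
  rw [tfMatrix_kerSynth_eq hc hM]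
  have hin : ∀ Z, ‖∫ W, c Z W * tfGram φ φ W Y ∂(phaseMeasure d)‖ₑ ≤ K₂ * M Z Y := fun Z => by
    refine (enorm_integral_le_lintegral_enorm _).trans (le_trans (lintegral_mono fun W => ?_)
      (h₂ (M Z) (hM.slow.isSlow_right Z) Y))
    rw [enorm_mul, mul_comm]
    exact mul_le_mul_right (hc.le Z W) _
  calc _ ≤ ∫⁻ Z, ‖tfGram φ φ X Z‖ₑ * (K₂ * M Z Y) ∂(phaseMeasure d) := by
        refine (enorm_integral_le_lintegral_enorm _).trans (lintegral_mono fun Z => ?_)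
        rw [enorm_mul]
        exact mul_le_mul_right (hin Z) _
    _ ≤ K₁ * (K₂ * M X Y) := h₁ _ ((hM.slow.const_mul K₂).isSlow_left Y) X
    _ = _ := by ring

/-- The restriction of a kernel to a bounded set. -/
def truncate (c : Rd d × Rd d → Rd d × Rd d → ℂ) (k : ℕ) (X Y : Rd d × Rd d) : ℂ :=
  if ‖X‖ ≤ k ∧ ‖Y‖ ≤ k then c X Y else 0

theorem IsDominatedBy.truncate {c : Rd d × Rd d → Rd d × Rd d → ℂ} (hc : IsDominatedBy M c)
    (k : ℕ) : IsDominatedBy M (truncate c k) := by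
  refine ⟨StronglyMeasurable.ite (p := fun z : (Rd d × Rd d) × (Rd d × Rd d) =>
    ‖z.1‖ ≤ k ∧ ‖z.2‖ ≤ k) ?_ hc.meas stronglyMeasurable_const, fun X Y => ?_⟩
  · exact (measurableSet_le measurable_fst.norm measurable_const).inter
      (measurableSet_le measurable_snd.norm measurable_const)
  · unfold _root_.truncate
    split_ifs
    · exact hc.le X Y
    · rw [enorm_zero]
      exact zero_le

theorem isRapid_truncate {c : Rd d × Rd d → Rd d × Rd d → ℂ} (hc : IsDominatedBy M c)
    (hM : IsTame s M) (hs : 0 ≤ s) (k : ℕ) : IsRapid (truncate c k) := by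
  refine ⟨(hc.truncate k).meas, M 0 0 * ex (s * k) * ex (s * k) * (ex ((k : ℝ) ^ 2) *
    ex ((k : ℝ) ^ 2)), 1, ?_, one_pos, fun X Y => ?_⟩
  · exact ENNReal.mul_ne_top (ENNReal.mul_ne_top (ENNReal.mul_ne_top (hM.ne_top 0 0)
      (ex_ne_top _)) (ex_ne_top _)) (ENNReal.mul_ne_top (ex_ne_top _) (ex_ne_top _))
  · unfold truncate
    split_ifs with h
    · have hk : ∀ x : ℝ, 0 ≤ x → x ≤ k → 1 ≤ ex ((k : ℝ) ^ 2) * ex (-(1 * x ^ 2)) := by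
        intro x hx hxk
        rw [← ex_add, ← ex_zero]
        refine ex_mono ?_
        nlinarith
      calc ‖c X Y‖ₑ ≤ M 0 0 * ex (s * ‖X‖) * ex (s * ‖Y‖) := (hc.le X Y).trans (hM.le_zero X Y)
        _ ≤ M 0 0 * ex (s * k) * ex (s * k) := by
            refine mul_le_mul' (mul_le_mul' le_rfl (ex_mono ?_)) (ex_mono ?_)
            · exact mul_le_mul_of_nonneg_left h.1 hs
            · exact mul_le_mul_of_nonneg_left h.2 hs
        _ ≤ M 0 0 * ex (s * k) * ex (s * k) * ((ex ((k : ℝ) ^ 2) * ex (-(1 * ‖X‖ ^ 2))) *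
            (ex ((k : ℝ) ^ 2) * ex (-(1 * ‖Y‖ ^ 2)))) := by
            refine le_mul_of_one_le_right' ?_
            exact one_le_mul (hk _ (norm_nonneg _) h.1) (hk _ (norm_nonneg _) h.2)
        _ = _ := by ring
    · rw [enorm_zero]
      exact zero_le

theorem modNorm_zero (Φ : GelfandShilov (R2d d)) (q : ℝ≥0∞) (ω : R2d d × R2d d → ℝ) :
    modNorm Φ q ω 0 = 0 := by
  have e : (fun z => stft Φ 0 z * (ω z : ℂ)) = 0 := by
    funext z
    simp [stft]
  rw [modNorm, e, eLpNorm_zero]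

/-- Truncation of time-frequency matrices approximates elements of modulation spaces by test
functions: in the norm if the exponent is finite, and boundedly in `S_{1/2}'` in all cases. -/
theorem IsMatrixWeight.exists_approx {ω : R2d d × R2d d → ℝ} {c : ℝ}
    {w : Rd d × Rd d → Rd d × Rd d → ℝ≥0∞} (h : IsMatrixWeight φ Φ ω c w)
    (hφ : ∫ t, ‖(φ : Rd d → ℂ) t‖ ^ 2 = 1) {q : ℝ≥0∞} (hq : q ≠ 0) {u : GSDist (R2d d)}
    (hu : modNorm Φ q ω u ≠ ∞) (hM : IsTame (c + 1) (slowMatrix φ (c + 1) u)) :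
    ∃ a : ℕ → GSDist (R2d d),
      (∀ k, ∃ F : GelfandShilov (R2d d), IsGivenBy (a k) (F : R2d d → ℂ)) ∧
      (∃ B : ℝ≥0, ∀ k, modNorm Φ q ω (a k) ≤ B) ∧ GSDistTendsto a u ∧
      (q ≠ ∞ → Tendsto (fun k => modNorm Φ q ω (a k - u)) atTop (𝓝 0)) := by
  have hc0 : 0 ≤ c + 1 := by linarith [h.nonneg]
  have hdom := isDominatedBy_tfMatrix φ (c + 1) u
  obtain ⟨K, hK, hKb⟩ := exists_enorm_tfMatrix_kerSynth_le φ (c + 1)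
  obtain ⟨C, hC, hCb⟩ := h.modNorm_le q hq
  obtain ⟨D, hD, hDb⟩ := h.slowMatrix_le q hq (c + 1) le_rfl
  set a : ℕ → GSDist (R2d d) := fun k => kerSynth φ (truncate (tfMatrix φ u) k) with ha
  have hrap : ∀ k, IsRapid (truncate (tfMatrix φ u) k) := isRapid_truncate hdom hM hc0
  have hale : ∀ k X Y, ‖tfMatrix φ (a k) X Y‖ₑ ≤ K * slowMatrix φ (c + 1) u X Y := fun k =>
    hKb _ _ (hdom.truncate k) hM
  have hWt : wNorm (phaseMeasure d) q w (slowMatrix φ (c + 1) u) ≠ ∞ :=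
    ((hDb u).trans_lt (ENNReal.mul_lt_top hD.lt_top hu.lt_top)).ne
  have hconst : ∀ A : ℝ≥0∞, A ≠ ∞ →
      wNorm (phaseMeasure d) q w (fun X Y => A * slowMatrix φ (c + 1) u X Y) =
        A * wNorm (phaseMeasure d) q w (slowMatrix φ (c + 1) u) := fun A hA => by
    rw [wNorm, wNorm, ← eLpNorm_ennreal_const_mul _ hA]
    simp only [mul_left_comm]
  have hconv : GSDistTendsto a u := by
    intro F
    rw [← (tfMatrix_expansion hφ u F).2]
    simp only [ha, kerSynth_apply (hdom.truncate _) hM]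
    refine tendsto_integral_of_dominated_convergence _
      (fun k => (integrable_mul_anaKer (φ := φ) (hdom.truncate k) hM F).aestronglyMeasurable)
      (tfMatrix_expansion hφ u F).1.norm (fun k => Eventually.of_forall fun z => ?_)
      (Eventually.of_forall fun z => ?_)
    · rw [norm_mul, norm_mul]
      refine mul_le_mul_of_nonneg_right ?_ (norm_nonneg _)
      unfold truncate
      split_ifs
      · exact le_rfl
      · rw [norm_zero]
        exact norm_nonneg _
    · refine Tendsto.mul_const _ (tendsto_const_nhds.congr' ?_)
      filter_upwards [(tendsto_natCast_atTop_atTop (R := ℝ)).eventually_ge_atTop ‖z.1‖,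
        (tendsto_natCast_atTop_atTop (R := ℝ)).eventually_ge_atTop ‖z.2‖] with k h1 h2
      rw [truncate, if_pos ⟨h1, h2⟩]
  refine ⟨a, fun k => ⟨⟨_, memGS_kerFun (hrap k)⟩, isGivenBy_kerSynth (hrap k)⟩, ?_, hconv,
    fun hqt => ?_⟩
  · have hBt : C * (K * wNorm (phaseMeasure d) q w (slowMatrix φ (c + 1) u)) ≠ ∞ :=
      ENNReal.mul_ne_top hC (ENNReal.mul_ne_top hK hWt)
    refine ⟨(C * (K * wNorm (phaseMeasure d) q w (slowMatrix φ (c + 1) u))).toNNReal, fun k => ?_⟩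
    rw [ENNReal.coe_toNNReal hBt, ← hconst K hK]
    exact (hCb (a k)).trans (mul_le_mul_right (wNorm_mono (hale k)) _)
  · have hpos := ENNReal.toReal_pos hq hqt
    have hlim : Tendsto (fun k => wNorm (phaseMeasure d) q w
        (fun X Y => ‖tfMatrix φ (a k - u) X Y‖ₑ)) atTop (𝓝 0) := by
      have hK1 : K + 1 ≠ ∞ := ENNReal.add_ne_top.mpr ⟨hK, ENNReal.one_ne_top⟩
      have hle : ∀ k X Y, ‖tfMatrix φ (a k - u) X Y‖ₑ ≤ (K + 1) * slowMatrix φ (c + 1) u X Y :=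
        fun k X Y => by
          refine (enorm_tfMatrix_sub_le φ (a k) u X Y).trans ?_
          rw [add_mul, one_mul]
          exact add_le_add (hale k X Y) (enorm_tfMatrix_le φ _ u X Y)
      have hfin := hconst (K + 1) hK1
      have hfin' : wNorm (phaseMeasure d) q w
          (fun X Y => (K + 1) * slowMatrix φ (c + 1) u X Y) ≠ ∞ := by
        rw [hfin]
        exact ENNReal.mul_ne_top hK1 hWt
      rw [wNorm, eLpNorm_ennreal _ hq hqt] at hfin'
      have hint := (ENNReal.rpow_lt_top_iff_of_pos (by positivity)).mp hfin'.lt_top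
      have hmeas : ∀ k, Measurable fun z : (Rd d × Rd d) × (Rd d × Rd d) =>
          (w z.1 z.2 * ‖tfMatrix φ (a k - u) z.1 z.2‖ₑ) ^ q.toReal := fun k =>
        (h.measurable.mul (measurable_enorm_tfMatrix φ (a k - u))).pow_const _
      have hdct := tendsto_lintegral_of_dominated_convergence _ hmeas
        (fun k => Eventually.of_forall fun z => ENNReal.rpow_le_rpow
          (mul_le_mul_right (hle k z.1 z.2) (w z.1 z.2)) hpos.le) hint.ne
        (Eventually.of_forall fun z => (?_ : Tendsto _ atTop (𝓝 (0 : ℝ≥0∞))))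
      · simp only [lintegral_zero] at hdct
        have h2 := ((ENNReal.continuous_rpow_const (y := 1 / q.toReal)).tendsto 0).comp hdct
        rw [ENNReal.zero_rpow_of_pos (by positivity)] at h2
        refine h2.congr fun k => ?_
        rw [wNorm, eLpNorm_ennreal _ hq hqt]
        rfl
      · have h1 : Tendsto (fun k => ‖tfMatrix φ (a k - u) z.1 z.2‖ₑ) atTop (𝓝 0) := by
          have h2 : Tendsto (fun k => tfMatrix φ (a k) z.1 z.2) atTop (𝓝 (tfMatrix φ u z.1 z.2)) :=
            hconv _
          have h3 := (h2.sub_const (tfMatrix φ u z.1 z.2)).enorm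
          rw [sub_self, enorm_zero] at h3
          exact h3
        have h4 := ENNReal.Tendsto.const_mul h1 (Or.inr (h.ne_top z.1 z.2))
        rw [mul_zero] at h4
        have h5 := ((ENNReal.continuous_rpow_const (y := q.toReal)).tendsto 0).comp h4
        rw [ENNReal.zero_rpow_of_pos hpos] at h5
        exact h5
    have h6 := ENNReal.Tendsto.const_mul hlim (Or.inr hC)
    rw [mul_zero] at h6
    exact tendsto_of_tendsto_of_tendsto_of_le_of_le tendsto_const_nhds h6
      (fun _ => zero_le) fun k => hCb _

end Approximation

section Uniqueness

variable {d n : ℕ} {φ : GelfandShilov (Rd d)} {Φ : GelfandShilov (R2d d)}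
  {q : Fin (n + 2) → ℝ≥0∞}
  {ω : Fin (n + 2) → R2d d × R2d d → ℝ} {r : ℝ≥0∞} {ω₀ : R2d d × R2d d → ℝ} {c : ℝ}
  {w : ℕ → Rd d × Rd d → Rd d × Rd d → ℝ≥0∞} {w' : Rd d × Rd d → Rd d × Rd d → ℝ≥0∞}

/-- Continuous extensions are unique: they agree on test functions; by weak continuity they agree
when the factors of finite exponent are test functions; by norm continuity they agree everywhere. -/
theorem IsCompositionSetup.eq_of_isContinuousExtension
    (S : IsCompositionSetup φ Φ q ω r ω₀ c w w')
    {T₁ T₂ : (∀ j, modSpace Φ (q j) (ω j)) → modSpace Φ r fun z => (ω₀ z)⁻¹}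
    (h₁ : IsContinuousExtension Φ q ω r (fun z => (ω₀ z)⁻¹) T₁)
    (h₂ : IsContinuousExtension Φ q ω r (fun z => (ω₀ z)⁻¹) T₂) : T₁ = T₂ := by
  have happrox : ∀ (u : ∀ j, modSpace Φ (q j) (ω j)) (j : Fin (n + 2)), _ := fun u j =>
    (S.matrixWeight j).exists_approx S.window (S.exp_ne_zero j) (u j).2.ne (by
      have := S.isTame (fun j => (u j).2) (i := j) (k := 0) (by omega)
      rwa [lchain_zero, majorants, natExt_fin] at this)
  have hgiven : ∀ u : ∀ j, modSpace Φ (q j) (ω j),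
      (∀ j, ∃ F : GelfandShilov (R2d d), IsGivenBy (u j : GSDist (R2d d)) (F : R2d d → ℂ)) →
      T₁ u = T₂ u := by
    intro u hu
    choose F hF using hu
    exact Subtype.ext ((h₁.extend u F hF).2.unique (h₂.extend u F hF).2)
  have hfinite : ∀ u : ∀ j, modSpace Φ (q j) (ω j),
      (∀ j, q j ≠ ∞ →
        ∃ F : GelfandShilov (R2d d), IsGivenBy (u j : GSDist (R2d d)) (F : R2d d → ℂ)) →
      T₁ u = T₂ u := by
    intro u hu
    choose a haF haB haw _ using happrox u
    choose B hB using haB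
    set U : ℕ → ∀ j, modSpace Φ (q j) (ω j) := fun k j =>
      if q j = ∞ then ⟨a j k, (hB j k).trans_lt ENNReal.coe_lt_top⟩ else u j with hU
    have e1 : ∀ k j, q j ≠ ∞ → U k j = u j := fun k j hj => if_neg hj
    have e2 : ∀ k j, q j = ∞ → (U k j : GSDist (R2d d)) = a j k := fun k j hj => by
      simp only [hU, if_pos hj]
    have hUg : ∀ k, T₁ (U k) = T₂ (U k) := fun k => hgiven _ fun j => by
      by_cases hj : q j = ∞
      · rw [e2 k j hj]
        exact haF j k
      · rw [e1 k j hj]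
        exact hu j hj
    have hfix : ∀ j, q j ≠ ∞ → (∀ k, U k j = u j) ∧
        ∃ K : GelfandShilov (R2d d), IsGivenBy (u j : GSDist (R2d d)) (K : R2d d → ℂ) :=
      fun j hj => ⟨fun k => e1 k j hj, hu j hj⟩
    have htop : ∀ j, q j = ∞ → (∃ B : ℝ≥0, ∀ k, modNorm Φ (q j) (ω j) (U k j) ≤ B) ∧
        GSDistTendsto (fun k => (U k j : GSDist (R2d d))) (u j) := fun j hj => by
      simp only [e2 _ j hj]
      exact ⟨⟨B j, hB j⟩, haw j⟩
    refine Subtype.ext (Subtype.ext (LinearMap.ext fun F => ?_))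
    have t1 := h₁.weakly_continuous U u hfix htop F
    simp only [hUg] at t1
    exact tendsto_nhds_unique t1 (h₂.weakly_continuous U u hfix htop F)
  funext u
  choose a haF haB haw han using happrox u
  choose B hB using haB
  set U : ℕ → ∀ j, modSpace Φ (q j) (ω j) := fun k j =>
    if q j = ∞ then u j else ⟨a j k, (hB j k).trans_lt ENNReal.coe_lt_top⟩ with hU
  have e1 : ∀ k j, q j = ∞ → U k j = u j := fun k j hj => if_pos hj
  have e2 : ∀ k j, q j ≠ ∞ → (U k j : GSDist (R2d d)) = a j k := fun k j hj => by
    simp only [hU, if_neg hj]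
  have hUf : ∀ k, T₁ (U k) = T₂ (U k) := fun k => hfinite _ fun j hj => by
    rw [e2 k j hj]
    exact haF j k
  have hlim : ∀ j, Tendsto (fun k => modNorm Φ (q j) (ω j) ((U k j : GSDist (R2d d)) - u j))
      atTop (𝓝 0) := fun j => by
    by_cases hj : q j = ∞
    · simp only [e1 _ j hj, sub_self, modNorm_zero]
      exact tendsto_const_nhds
    · simp only [e2 _ j hj]
      exact han j hj
  have t1 := h₁.norm_continuous U u hlim
  simp only [hUf] at t1
  exact Subtype.ext
    (S.matrixWeight'.eq_of_tendsto S.window S.out_ne_zero t1 (h₂.norm_continuous U u hlim))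

end Uniqueness

/-! ### The choice of weights and exponents -/

section Setup

variable {d n : ℕ}

theorem holderConjugate_conjExp (p : ℝ≥0∞) :
    ENNReal.HolderConjugate (max 1 p) (max 1 (conjExp p)) := by
  unfold conjExp
  split_ifs with h1 ht
  · rw [max_eq_left h1, max_eq_right le_top]
    infer_instance
  · rw [ht, max_eq_right le_top, max_self]
    infer_instance
  · rw [not_le] at h1
    have h0 : p - 1 ≠ 0 := (tsub_pos_of_lt h1).ne'
    have hpt : p - 1 ≠ ∞ := ENNReal.sub_ne_top ht
    have e : p / (p - 1) = 1 + (p - 1)⁻¹ := by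
      conv_lhs => rw [← tsub_add_cancel_of_le h1.le]
      rw [ENNReal.add_div, ENNReal.add_sub_cancel_right ENNReal.one_ne_top,
        ENNReal.div_self h0 hpt, one_div]
    rw [e, max_eq_right h1.le, max_eq_right le_self_add]
    exact ENNReal.HolderConjugate.conjExponent h1.le

theorem conjExp_ne_zero (p : ℝ≥0∞) : conjExp p ≠ 0 := by
  unfold conjExp
  split_ifs with h1 ht
  · exact ENNReal.top_ne_zero
  · exact one_ne_zero
  · exact ENNReal.div_ne_zero.mpr ⟨fun h => h1 (h ▸ zero_le), ENNReal.sub_ne_top ht⟩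

/-- The hypotheses on exponents and weights give a composition setup, with a common rate of variation
for all weights and with a window of norm one obtained from `Φ`. -/
theorem exists_isCompositionSetup {Φ : GelfandShilov (R2d d)} (hΦ : Φ ≠ 0)
    {ω : Fin (n + 2 + 1) → R2d d × R2d d → ℝ} (hω : ∀ j, IsModerateWeight (ω j))
    (hweight : 0 < ⨅ X : Fin (n + 2 + 1) → Rd d × Rd d,
      kernelWeight (ω 0) (X 0) (X (Fin.last (n + 2))) *
        ∏ j : Fin (n + 2), kernelWeight (ω j.succ) (X j.castSucc) (X j.succ))
    {q : Fin (n + 2) → ℝ≥0∞} {r : ℝ≥0∞} (hq0 : ∀ j, q j ≠ 0)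
    (hq : ∀ j (hj : j ≤ n), ENNReal.HolderConjugate (max 1 (q ⟨j, by omega⟩))
      (max 1 (q ⟨j + 1, by omega⟩)))
    (hq1 : q 0 = r) (hq2 : q (Fin.last (n + 1)) = r) :
    ∃ φ c w w', IsCompositionSetup φ Φ q (fun j => ω j.succ) r (ω 0) c w w' := by
  obtain ⟨φ, hφ⟩ := exists_window hΦ
  choose c w hw using fun j => (hω j).exists_isMatrixWeight hφ hΦ
  set c₀ := ∑ j, c j with hc₀
  have hcle : ∀ j, c j ≤ c₀ := fun j =>
    Finset.single_le_sum (fun i _ => (hw i).nonneg) (Finset.mem_univ j)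
  have hw' : ∀ j, IsMatrixWeight φ Φ (ω j) c₀ (w j) := fun j => (hw j).mono (hcle j)
  -- The weights are indexed by `ℕ`; the values beyond `n + 1` play no role.
  set W : ℕ → Rd d × Rd d → Rd d × Rd d → ℝ≥0∞ := natExt (w 0) fun j => w j.succ with hW
  have hWj : ∀ j, ∃ i, W j = w i := fun j => by
    simp only [hW, natExt]
    split_ifs
    · exact ⟨_, rfl⟩
    · exact ⟨0, rfl⟩
  have hforall : ∀ {p : (Rd d × Rd d → Rd d × Rd d → ℝ≥0∞) → Prop}, (∀ i, p (w i)) →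
      ∀ j, p (W j) := fun hp j => by
    obtain ⟨i, hi⟩ := hWj j
    rw [hi]
    exact hp i
  choose K hK hKb using fun j => (hw j).le
  set a := ⨅ X : Fin (n + 2 + 1) → Rd d × Rd d,
    kernelWeight (ω 0) (X 0) (X (Fin.last (n + 2))) *
      ∏ j : Fin (n + 2), kernelWeight (ω j.succ) (X j.castSucc) (X j.succ) with ha
  have hpos : ∀ j X Y, 0 < kernelWeight (ω j) X Y := fun j X Y => (hω j).pos _
  have hpath : ∃ b : ℝ≥0∞, b ≠ 0 ∧ ∀ Z : ℕ → Rd d × Rd d,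
      b ≤ w 0 (Z 0) (Z (n + 2)) * ∏ j ∈ Finset.range (n + 2), W j (Z j) (Z (j + 1)) := by
    have hKt : K 0 * ∏ j : Fin (n + 2), K j.succ ≠ ∞ :=
      ENNReal.mul_ne_top (hK 0) (ENNReal.prod_ne_top fun j _ => hK _)
    refine ⟨ENNReal.ofReal a / (K 0 * ∏ j : Fin (n + 2), K j.succ),
      (ENNReal.div_pos (ENNReal.ofReal_pos.mpr hweight).ne' hKt).ne', fun Z => ?_⟩
    refine ENNReal.div_le_of_le_mul' ?_
    have hbdd : BddBelow (Set.range fun X : Fin (n + 2 + 1) → Rd d × Rd d =>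
        kernelWeight (ω 0) (X 0) (X (Fin.last (n + 2))) *
          ∏ j : Fin (n + 2), kernelWeight (ω j.succ) (X j.castSucc) (X j.succ)) := by
      refine ⟨0, ?_⟩
      rintro _ ⟨X, rfl⟩
      exact mul_nonneg (hpos _ _ _).le (Finset.prod_nonneg fun j _ => (hpos _ _ _).le)
    have h1 := ENNReal.ofReal_le_ofReal
      (ciInf_le hbdd fun i : Fin (n + 2 + 1) => Z (i : ℕ))
    rw [← ha, ENNReal.ofReal_mul (hpos _ _ _).le,
      ENNReal.ofReal_prod_of_nonneg fun j _ => (hpos _ _ _).le] at h1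
    refine h1.trans ?_
    rw [← Fin.prod_univ_eq_prod_range (fun j => W j (Z j) (Z (j + 1)))]
    calc _ ≤ (K 0 * w 0 (Z 0) (Z (n + 2))) *
          ∏ j : Fin (n + 2), K j.succ * w j.succ (Z (j : ℕ)) (Z ((j : ℕ) + 1)) :=
          mul_le_mul' (hKb 0 _ _) (Finset.prod_le_prod' fun j _ => hKb j.succ _ _)
      _ = _ := by
          simp only [hW, natExt_fin, Finset.prod_mul_distrib]
          ring
  refine ⟨φ, c₀, W, w 0, hφ, ?_, fun j => ?_, hw' 0, hq1⟩
  · refine ⟨fun j => ?_, fun j hj => ?_, ?_, (hw' 0).nonneg,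
      hforall (p := fun w => Measurable (Function.uncurry w)) fun i => (hw' i).measurable,
      hforall fun i => (hw' i).slow, hforall (p := fun w => ∀ X Y, w X Y ≠ 0)
        fun i => (hw' i).ne_zero,
      hforall (p := fun w => ∀ X Y, w X Y ≠ ∞) fun i => (hw' i).ne_top,
      (hw' 0).ne_top, hpath⟩
    · unfold natExt
      split_ifs
      · exact hq0 _
      · exact one_ne_zero
    · rw [natExt_of_lt _ _ (show j < n + 2 by omega), natExt_of_lt _ _ (show j + 1 < n + 2 by omega)]
      exact hq j hj
    · rw [natExt_of_lt _ _ (show n + 1 < n + 2 by omega), natExt_of_lt _ _ (Nat.succ_pos _)]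
      exact hq2.trans hq1.symm
  · simp only [hW, natExt_fin]
    exact hw' j.succ

/-- Existence, uniqueness and properties of the composition map for exponents which alternate
between `e₁` and `e₂`, up to replacing `q` by `max(1, q)`, where `max(1, e₁)` and `max(1, e₂)` are
conjugate. -/
theorem exists_composition_map {N : ℕ} (hN : 3 ≤ N) (hodd : Odd N)
    {Φ : GelfandShilov (R2d d)} (hΦ : Φ ≠ 0)
    {ω : Fin (N + 1) → R2d d × R2d d → ℝ} (hω : ∀ j, IsModerateWeight (ω j))
    (hweight : 0 < ⨅ X : Fin (N + 1) → Rd d × Rd d,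
      kernelWeight (ω 0) (X 0) (X (Fin.last N)) *
        ∏ j : Fin N, kernelWeight (ω j.succ) (X j.castSucc) (X j.succ))
    {q : Fin N → ℝ≥0∞} {e₁ e₂ : ℝ≥0∞}
    (he : ENNReal.HolderConjugate (max 1 e₁) (max 1 e₂)) (hq0 : ∀ j, q j ≠ 0)
    (hqo : ∀ j : Fin N, Odd ((j : ℕ) + 1) → max 1 (q j) = max 1 e₁)
    (hqe : ∀ j : Fin N, Even ((j : ℕ) + 1) → max 1 (q j) = max 1 e₂)
    (hqr : ∀ j : Fin N, (j : ℕ) + 1 = 1 ∨ (j : ℕ) + 1 = N → q j = e₁) :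
    ∃ T : (∀ j, modSpace Φ (q j) (ω j.succ)) → modSpace Φ e₁ (fun z => (ω 0 z)⁻¹),
      IsContinuousExtension Φ q (fun j => ω j.succ) e₁ (fun z => (ω 0 z)⁻¹) T ∧
      (∀ T', IsContinuousExtension Φ q (fun j => ω j.succ) e₁ (fun z => (ω 0 z)⁻¹) T' →
        T' = T) ∧
      IsMultilinear T ∧ IsAssociative T ∧
      ∃ C : ℝ≥0, ∀ u, modNorm Φ e₁ (fun z => (ω 0 z)⁻¹) (T u) ≤
        C * ∏ j, modNorm Φ (q j) (ω j.succ) (u j) := by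
  obtain ⟨n, rfl⟩ : ∃ n, N = n + 2 := ⟨N - 2, by omega⟩
  obtain ⟨φ, c, w, w', S⟩ := exists_isCompositionSetup hΦ hω hweight hq0 (fun j hj => by
      rcases Nat.even_or_odd (j + 1) with h | h
      · rw [hqe ⟨j, by omega⟩ h, hqo ⟨j + 1, by omega⟩ h.add_one]
        exact he.symm
      · rw [hqo ⟨j, by omega⟩ h, hqe ⟨j + 1, by omega⟩ h.add_one]
        exact he)
    (hqr 0 (Or.inl rfl)) (hqr (Fin.last (n + 1)) (Or.inr rfl))
  obtain ⟨C, hC, hCb⟩ := S.exists_modNorm_le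
  refine ⟨S.map, S.isContinuousExtension_map, fun T' hT' =>
    S.eq_of_isContinuousExtension hT' S.isContinuousExtension_map, S.isMultilinear_map,
    S.isAssociative_map, C.toNNReal, fun u => ?_⟩
  rw [ENNReal.coe_toNNReal hC]
  exact hCb _ fun j => (u j).2

end Setup

end

theorem proposition2p3 (d N : ℕ) (hN : 3 ≤ N) (hodd : Odd N) (p : ℝ≥0∞) (hp : 0 < p)
    (Φ : GelfandShilov (R2d d)) (hΦ : Φ ≠ 0)
    (ω : Fin (N + 1) → R2d d × R2d d → ℝ) (hω : ∀ j, IsModerateWeight (ω j))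
    (hweight : 0 < ⨅ X : Fin (N + 1) → Rd d × Rd d,
      kernelWeight (ω 0) (X 0) (X (Fin.last N)) *
        ∏ j : Fin N, kernelWeight (ω j.succ) (X j.castSucc) (X j.succ)) :
    (∀ q : Fin N → ℝ≥0∞,
      (∀ j : Fin N, q j = if (j : ℕ) + 1 = 1 ∨ (j : ℕ) + 1 = N then p
        else if Odd ((j : ℕ) + 1) then max 1 p else conjExp p) →
      ∃ T : (∀ j, modSpace Φ (q j) (ω j.succ)) → modSpace Φ p (fun z => (ω 0 z)⁻¹),
        IsContinuousExtension Φ q (fun j => ω j.succ) p (fun z => (ω 0 z)⁻¹) T ∧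
        (∀ T', IsContinuousExtension Φ q (fun j => ω j.succ) p (fun z => (ω 0 z)⁻¹) T' →
          T' = T) ∧
        IsMultilinear T ∧ IsAssociative T ∧
        ∃ C : ℝ≥0, ∀ u, modNorm Φ p (fun z => (ω 0 z)⁻¹) (T u) ≤
          C * ∏ j, modNorm Φ (q j) (ω j.succ) (u j)) ∧
    (∀ q : Fin N → ℝ≥0∞,
      (∀ j : Fin N, q j = if Even ((j : ℕ) + 1) then p else conjExp p) →
      ∃ T : (∀ j, modSpace Φ (q j) (ω j.succ)) → modSpace Φ (conjExp p) (fun z => (ω 0 z)⁻¹),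
        IsContinuousExtension Φ q (fun j => ω j.succ) (conjExp p) (fun z => (ω 0 z)⁻¹) T ∧
        (∀ T', IsContinuousExtension Φ q (fun j => ω j.succ) (conjExp p)
          (fun z => (ω 0 z)⁻¹) T' → T' = T) ∧
        IsMultilinear T ∧ IsAssociative T) := by
  have hconj := holderConjugate_conjExp p
  have hends : ∀ j : Fin N, (j : ℕ) + 1 = 1 ∨ (j : ℕ) + 1 = N → Odd ((j : ℕ) + 1) := by
    rintro j (h | h)
    · rw [h]
      exact odd_one
    · rw [h]
      exact hodd
  refine ⟨fun q hq => ?_, fun q hq => ?_⟩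
  · refine exists_composition_map hN hodd hΦ hω hweight hconj (fun j => ?_) (fun j hj => ?_)
      (fun j hj => ?_) fun j hj => ?_
    · rw [hq]
      split_ifs
      · exact hp.ne'
      · exact (zero_lt_one.trans_le (le_max_left 1 p)).ne'
      · exact conjExp_ne_zero p
    · rw [hq]
      split_ifs
      exacts [rfl, by rw [← max_assoc, max_self]]
    · have hodd' := Nat.not_odd_iff_even.mpr hj
      rw [hq, if_neg (fun h => hodd' (hends j h)), if_neg hodd']
    · rw [hq, if_pos hj]
  · have hq_odd : ∀ j : Fin N, Odd ((j : ℕ) + 1) → q j = conjExp p := fun j hj => by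
      rw [hq, if_neg (Nat.not_even_iff_odd.mpr hj)]
    have hq_even : ∀ j : Fin N, Even ((j : ℕ) + 1) → q j = p := fun j hj => by
      rw [hq, if_pos hj]
    have hq_ne : ∀ j, q j ≠ 0 := fun j => by
      rw [hq]
      split_ifs
      exacts [hp.ne', conjExp_ne_zero p]
    obtain ⟨T, h1, h2, h3, h4, -⟩ := exists_composition_map hN hodd hΦ hω hweight hconj.symm hq_ne
      (fun j hj => by rw [hq_odd j hj]) (fun j hj => by rw [hq_even j hj])
      fun j hj => hq_odd j (hends j hj)
    exact ⟨T, h1, h2, h3, h4⟩
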